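/- **Setting.** Let $I=[0,T]$, $T>0$. Let $U,Z$ be reflexive real Banach spaces, $H$ a real Hilbert space, $U\subset H$ continuously and densely, and $H=H^*\subset U^*$. Let $1<p_1,p_2<\infty$, $p_i'=p_i/(p_i-1)$. Assume: * $\mathscr T:H\to\mathbb R$ is a continuous homogeneous quadratic functional, coercive ($\mathscr T(v)/\|v\|\to\infty$ as $\|v\|\to\infty$); $\mathscr T'$ is its (linear) derivative; * $\Phi:U\times Z\to\mathbb R$ is coercive, i.e. $\Phi(u,z)/(\|u\|+\|z\|)\to\infty$ as $\|u\|+\|z\|\to\infty$; $\Phi(\cdot,z)$ and $\Phi(u,\cdot)$ are (continuous) quadratic, affine terms allowed, and convex for all $z\in Z$ and all $u\in U$; $\Phi$ is weakly lower semicontinuous, and $\partial_u\Phi:U\times Z\to U^*$, $\partial_z\Phi:U\times Z\to Z^*$ are (weak,weak)-continuous (all weak notions being sequential); * $\Psi_1:U\to[0,\infty]$, $\Psi_2:Z\to[0,\infty]$ are convex, (weakly) lower semicontinuous, finite at $0$, $\Psi_i\ge\varepsilon\|\cdot\|^{p_i}$ for some $\varepsilon>0$, and $\|\xi\|_{U^*}\le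 C(1+\|v\|_U^{p_1-1})$ for all $v\in U$, $\xi\in\partial\Psi_1(v)$; * $f\in L^{p_1'}(I;U^*)+L^1(I;H)$, $g\in L^{p_2'}(I;Z^*)$, $u_0\in U$, $v_0\in H$, $z_0\in Z$. **Scheme.** For $N\ge1$ and $\tau=T/N$ find $(u^k,v^k,z^k)\in U\times H\times Z$ with $(u^0,v^0,z^0)=(u_0,v_0,z_0)$ and, for $k=1,\dots,N$, $$\frac{u^k-u^{k-1}}\tau=v^{k-1/2},\qquad \mathscr T'\frac{v^k-v^{k-1}}\tau+\partial\Psi_1(v^{k-1/2})+\partial_u\Phi(u^{k-1/2},z^{k-1})\ni f^k,$$ $$\partial\Psi_2\Big(\frac{z^k-z^{k-1}}\tau\Big)+\partial_z\Phi(u^k,z^{k-1/2})\ni g^k,$$ where $w^{k-1/2}=\frac12(w^k+w^{k-1})$, and $f^k$ is the mean of $f$ over $[(k-1)\tau,k\tau]$ or, if $f\in C(I;U^*)$, alternatively $f(k\tau)$, $f((k-\frac12)\tau)$ or $\frac12(f(k\tau)+f((k-1)\tau))$; likewise (independently) for $g^k$ with $Z^*$. Denote by $u_\tau,v_\tau,z_\tau$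 the piecewise affine interpolants and by $\underline{\overline v}_\tau$ the piecewise constant interpolant with value $v^{k-1/2}$ on $((k-1)\tau,k\tau]$. **Weak solution.** A triple $u\in W^{1,p_1}(I;U)$, $v\in L^{p_1}(I;U)\cap C_{\rm weak}(I;H)$ with $\mathscr T'v\in W^{1,1}(I;U^*)$, $z\in W^{1,p_2}(I;Z)$, such that $u(0)=u_0$, $v(0)=v_0$, $z(0)=z_0$, $\dot u=v$ in the sense of distributions, and, writing $\mathscr T'\dot v:=(\mathscr T'v)^{\textstyle\cdot}$, $$\int_0^T\Psi_1(\tilde v)+\Psi_2(\tilde z)+\langle\mathscr T'\dot v+\partial_u\Phi(u,z)-f,\tilde v\rangle+\langle\partial_z\Phi(u,z)-g,\tilde z\rangle+\langle f,\dot u\rangle+\langle g,\dot z\rangle\,dt+\mathscr T(v_0)+\Phi(u_0,z_0)$$ $$\ge\mathscr T(v(T))+\Phi(u(T),z(T))+\int_0^T\Psi_1(\dot u)+\Psi_2(\dot z)\,dt$$ for all $\tilde v\in L^\infty(I;U)$, $\tilde z\in L^\infty(I;Z)$. **Claim.** 1. The scheme has a solution for every $N\ge1$. 2. (Exact energy balance.)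 If $\xi_1^k\in\partial\Psi_1(v^{k-1/2})$ and $\xi_2^k\in\partial\Psi_2(\frac{z^k-z^{k-1}}\tau)$ realize the two inclusions, then $$\frac{\mathscr T(v^k)-\mathscr T(v^{k-1})}\tau+\langle\xi_1^k,v^{k-1/2}\rangle+\Big\langle\xi_2^k,\frac{z^k-z^{k-1}}\tau\Big\rangle+\frac{\Phi(u^k,z^k)-\Phi(u^{k-1},z^{k-1})}\tau=\langle f^k,v^{k-1/2}\rangle+\Big\langle g^k,\frac{z^k-z^{k-1}}\tau\Big\rangle .$$ 3. (A-priori estimates.) There is $C$ independent of $\tau$ that bounds the norms of $u_\tau$ in $L^\infty(I;U)\cap W^{1,\infty}(I;H)\cap W^{1,p_1}(I;U)$, of $z_\tau$ in $W^{1,p_2}(I;Z)$, of $\underline{\overline v}_\tau$ in $L^\infty(I;H)\cap L^{p_1}(I;U)$, and of $\mathscr T'v_\tau$ in $W^{1,p_1'}(I;U^*)+W^{1,1}(I;H)$; if $\mathscr T'$ restricts to an isomorphism of $U$ (e.g. $\mathscr T=\frac12\|\cdot\|_H^2$), also that of $v_\tau$ in the last space. 4. (Convergence.) There is exactly one weak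 solution $(u,v,z)$, and for $N\to\infty$ one has $u_\tau\to u$ weakly* in $L^\infty(I;U)\cap W^{1,\infty}(I;H)\cap W^{1,p_1}(I;U)$, $z_\tau\to z$ weakly in $W^{1,p_2}(I;Z)$, $\underline{\overline v}_\tau\to v$ weakly* in $L^\infty(I;H)\cap L^{p_1}(I;U)$. 5. (Strong convergence.) Let $p_1\le2$. If the space $U$ and the functional $\Psi_1$ are uniformly convex (the latter at least on bounded sets), then $u_\tau\to u$ strongly in $W^{1,p_1}(I;U)$. If $Z$ and $\Psi_2$ are uniformly convex (in the same sense), then $z_\tau\to z$ strongly in $W^{1,p_2}(I;Z)$. -/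

import Mathlib

open MeasureTheory Filter Topology Set
open scoped ENNReal NNReal InnerProductSpace

noncomputable section

namespace FractionalStep

/-! ### Weak convergence, convex functionals, quadratic functionals -/

section Functionals

variable {X : Type*} [NormedAddCommGroup X] [NormedSpace ℝ X]

/-- `X` is reflexive: the canonical map into the bidual is onto. -/
def Reflexive (X : Type*) [NormedAddCommGroup X] [NormedSpace ℝ X] : Prop :=
  Function.Surjective (NormedSpace.inclusionInDoubleDual ℝ X)

/-- Weak convergence of a sequence in a normed space. -/
def WeaklyTendsto (x : ℕ → X) (a : X) : Prop :=
  ∀ φ : X →L[ℝ] ℝ, Tendsto (fun n => φ (x n)) atTop (𝓝 (φ a))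

/-- Convexity of an extended-valued functional. -/
def IsConvex (Ψ : X → ℝ≥0∞) : Prop :=
  ∀ x y : X, ∀ a b : ℝ, 0 ≤ a → 0 ≤ b → a + b = 1 →
    Ψ (a • x + b • y) ≤ ENNReal.ofReal a * Ψ x + ENNReal.ofReal b * Ψ y

/-- `Ψ ≥ ε ‖·‖ ^ p` for some `ε > 0`. -/
def IsPowerCoercive (p : ℝ) (Ψ : X → ℝ≥0∞) : Prop :=
  ∃ ε : ℝ, 0 < ε ∧ ∀ x, ENNReal.ofReal (ε * ‖x‖ ^ p) ≤ Ψ x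

/-- (Sequential) weak lower semicontinuity. -/
def IsWeaklyLSC (Ψ : X → ℝ≥0∞) : Prop :=
  ∀ (x : ℕ → X) (a : X), WeaklyTendsto x a → Ψ a ≤ liminf (fun n => Ψ (x n)) atTop

/-- The convex subdifferential; it is empty where `Ψ = ∞`. -/
def subdiff (Ψ : X → ℝ≥0∞) (x : X) : Set (X →L[ℝ] ℝ) :=
  {ξ | Ψ x ≠ ∞ ∧ ∀ y, (Ψ x : EReal) + ((ξ (y - x) : ℝ) : EReal) ≤ (Ψ y : EReal)}

/-- Uniform convexity of a functional, required on bounded sets only, so that it also covers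
`‖·‖ ^ p` with `p < 2` on a uniformly convex space. -/
def IsUniformlyConvex (Ψ : X → ℝ≥0∞) : Prop :=
  ∀ R ε : ℝ, 0 < R → 0 < ε → ∃ δ : ℝ, 0 < δ ∧ ∀ x y : X, ‖x‖ ≤ R → ‖y‖ ≤ R → ε ≤ ‖x - y‖ →
    Ψ ((1 / 2 : ℝ) • (x + y)) + ENNReal.ofReal δ ≤ (Ψ x + Ψ y) / 2

/-- A continuous quadratic functional, affine terms being allowed. -/
def IsQuadratic (q : X → ℝ) : Prop :=
  ∃ (B : X →L[ℝ] X →L[ℝ] ℝ) (l : X →L[ℝ] ℝ) (c : ℝ),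
    (∀ x y, B x y = B y x) ∧ ∀ x, q x = (1 / 2) * B x x + l x + c

/-- A continuous homogeneous quadratic functional (its derivative is linear). -/
def IsQuadraticForm (q : X → ℝ) : Prop :=
  ∃ B : X →L[ℝ] X →L[ℝ] ℝ, (∀ x y, B x y = B y x) ∧ ∀ x, q x = (1 / 2) * B x x

end Functionals

/-! ### Bochner and Sobolev spaces on the interval `[0, T]` -/

section Spaces

variable {X : Type*} [NormedAddCommGroup X] [NormedSpace ℝ X]

/-- Lebesgue measure on `I = [0, T]`. -/
def μI (T : ℝ) : Measure ℝ := volume.restrict (Icc 0 T)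

/-- The conjugate exponent `p' = p / (p - 1)`. -/
def conjExp (p : ℝ) : ℝ := p / (p - 1)

/-- `w` is the distributional derivative of `u` on `(0, T)`. -/
def HasWeakDeriv (T : ℝ) (u w : ℝ → X) : Prop :=
  ∀ φ : ℝ → ℝ, ContDiff ℝ (⊤ : ℕ∞) φ → HasCompactSupport φ → tsupport φ ⊆ Ioo 0 T →
    ∫ t, deriv φ t • u t ∂(μI T) = -∫ t, φ t • w t ∂(μI T)

/-- `u ∈ W^{1,p}(I; X)` with time derivative `w`. -/
def IsSobolev (T : ℝ) (p : ℝ≥0∞) (u w : ℝ → X) : Prop :=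
  MemLp u p (μI T) ∧ MemLp w p (μI T) ∧ HasWeakDeriv T u w

/-- `‖u‖ ≤ C` in `L^p(I; X)`. -/
def LpBound (T : ℝ) (p : ℝ≥0∞) (u : ℝ → X) (C : ℝ≥0) : Prop :=
  MemLp u p (μI T) ∧ eLpNorm u p (μI T) ≤ C

/-- `‖u‖ ≤ C` in `W^{1,p}(I; X)`. -/
def SobolevBound (T : ℝ) (p : ℝ≥0∞) (u : ℝ → X) (C : ℝ≥0) : Prop :=
  ∃ w : ℝ → X, IsSobolev T p u w ∧ eLpNorm u p (μI T) + eLpNorm w p (μI T) ≤ C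

/-- Convergence of `x n` to `a` against all test functions in `L^q(I; X*)`. For reflexive `X`
this is weak* convergence in `L^∞(I; X)` if `q = 1`, and weak convergence in `L^p(I; X)` if
`q = p'` with `1 < p < ∞`. -/
def WeakStarTendsto (T : ℝ) (q : ℝ≥0∞) (x : ℕ → ℝ → X) (a : ℝ → X) : Prop :=
  ∀ φ : ℝ → (X →L[ℝ] ℝ), MemLp φ q (μI T) →
    Tendsto (fun n => ∫ t, φ t (x n t) ∂(μI T)) atTop (𝓝 (∫ t, φ t (a t) ∂(μI T)))

/-- Weak (weak* if `p = ∞`) convergence in `W^{1,p}(I; X)`, `q` being conjugate to `p`: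
convergence of the functions and of their time derivatives. -/
def SobolevWeakStarTendsto (T : ℝ) (p q : ℝ≥0∞) (x : ℕ → ℝ → X) (a : ℝ → X) : Prop :=
  ∃ (dx : ℕ → ℝ → X) (da : ℝ → X), (∀ n, IsSobolev T p (x n) (dx n)) ∧ IsSobolev T p a da ∧
    WeakStarTendsto T q x a ∧ WeakStarTendsto T q dx da

/-- Strong convergence in `W^{1,p}(I; X)`. -/
def SobolevTendsto (T : ℝ) (p : ℝ≥0∞) (x : ℕ → ℝ → X) (a : ℝ → X) : Prop :=
  ∃ (dx : ℕ → ℝ → X) (da : ℝ → X), (∀ n, IsSobolev T p (x n) (dx n)) ∧ IsSobolev T p a da ∧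
    Tendsto (fun n => eLpNorm (x n - a) p (μI T)) atTop (𝓝 0) ∧
    Tendsto (fun n => eLpNorm (dx n - da) p (μI T)) atTop (𝓝 0)

/-- The piecewise affine interpolant of `x 0, x 1, …` with time step `τ`: for
`(k - 1) τ < t ≤ k τ` it is `((t - (k-1) τ) / τ) x_k + ((k τ - t) / τ) x_{k-1}`. -/
def affineInterp (τ : ℝ) (x : ℕ → X) (t : ℝ) : X :=
  ((t - ((⌈t / τ⌉₊ : ℝ) - 1) * τ) / τ) • x ⌈t / τ⌉₊
    + (((⌈t / τ⌉₊ : ℝ) * τ - t) / τ) • x (⌈t / τ⌉₊ - 1)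

/-- The piecewise constant interpolant of the midpoints `(x_k + x_{k-1}) / 2`. -/
def midInterp (τ : ℝ) (x : ℕ → X) (t : ℝ) : X :=
  (1 / 2 : ℝ) • (x ⌈t / τ⌉₊ + x (⌈t / τ⌉₊ - 1))

/-- The usual ways of sampling a loading in time. -/
inductive LoadingRule
  | rightEnd
  | midpoint
  | trapezoid
  | mean

/-- The value `h_τ^k` of the sampled loading `h`. -/
def LoadingRule.sample (r : LoadingRule) (τ : ℝ) (h : ℝ → X) (k : ℕ) : X :=
  match r with
  | .rightEnd => h (k * τ)
  | .midpoint => h (((k : ℝ) - 1 / 2) * τ)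
  | .trapezoid => (1 / 2 : ℝ) • (h (k * τ) + h (((k : ℝ) - 1) * τ))
  | .mean => τ⁻¹ • ∫ t in (((k : ℝ) - 1) * τ)..(k * τ), h t

/-- The rule makes sense for `h`: averages of any integrable loading, point values of a
continuous one. -/
def LoadingRule.AppliesTo (r : LoadingRule) (T : ℝ) (h : ℝ → X) : Prop :=
  r = .mean ∨ ContinuousOn h (Icc 0 T)

end Spaces

/-! ### The evolution problem -/

/-- The data: the embedding of `U` into `H`, the time horizon, the kinetic energy `𝒯`, the stored
energy `Φ`, the dissipation potentials (nonnegative, with values in `[0, ∞]`), their growth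
exponents, the loadings and the initial values. -/
structure Problem (U H Z : Type*) [NormedAddCommGroup U] [NormedSpace ℝ U]
    [NormedAddCommGroup H] [InnerProductSpace ℝ H]
    [NormedAddCommGroup Z] [NormedSpace ℝ Z] where
  emb : U →L[ℝ] H
  T : ℝ
  kin : H → ℝ
  Φ : U → Z → ℝ
  Ψ₁ : U → ℝ≥0∞
  Ψ₂ : Z → ℝ≥0∞
  p₁ : ℝ
  p₂ : ℝ
  f : ℝ → (U →L[ℝ] ℝ)
  g : ℝ → (Z →L[ℝ] ℝ)
  u₀ : U
  v₀ : H
  z₀ : Z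

namespace Problem

variable {U H Z : Type*} [NormedAddCommGroup U] [NormedSpace ℝ U]
  [NormedAddCommGroup H] [InnerProductSpace ℝ H]
  [NormedAddCommGroup Z] [NormedSpace ℝ Z]

/-- The embedding `H = H* ⊂ U*` of the Gelfand triple. -/
def toDual (P : Problem U H Z) (h : H) : U →L[ℝ] ℝ := (innerSL ℝ h).comp P.emb

/-- `𝒯' h ∈ H* ⊂ U*`. -/
def kin' (P : Problem U H Z) (h : H) : U →L[ℝ] ℝ := (fderiv ℝ P.kin h).comp P.emb

/-- `∂_u Φ (u, z) ∈ U*`. -/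
def dΦu (P : Problem U H Z) (u : U) (z : Z) : U →L[ℝ] ℝ := fderiv ℝ (fun w => P.Φ w z) u

/-- `∂_z Φ (u, z) ∈ Z*`. -/
def dΦz (P : Problem U H Z) (u : U) (z : Z) : Z →L[ℝ] ℝ := fderiv ℝ (fun w => P.Φ u w) z

/-- The standing assumptions. -/
structure Admissible (P : Problem U H Z) : Prop where
  reflexive_U : Reflexive U
  reflexive_Z : Reflexive Z
  emb_injective : Function.Injective P.emb
  emb_dense : DenseRange P.emb
  T_pos : 0 < P.T
  one_lt_p₁ : 1 < P.p₁
  one_lt_p₂ : 1 < P.p₂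
  kin_quadratic : IsQuadraticForm P.kin
  kin_coercive : Tendsto (fun h : H => P.kin h / ‖h‖) (Bornology.cobounded H) atTop
  Φ_coercive : Tendsto (fun x : U × Z => P.Φ x.1 x.2 / (‖x.1‖ + ‖x.2‖))
    (Bornology.cobounded (U × Z)) atTop
  Φ_quadratic_u : ∀ z, IsQuadratic (fun u => P.Φ u z)
  Φ_convex_u : ∀ z, ConvexOn ℝ univ (fun u => P.Φ u z)
  Φ_quadratic_z : ∀ u, IsQuadratic (fun z => P.Φ u z)
  Φ_convex_z : ∀ u, ConvexOn ℝ univ (fun z => P.Φ u z)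
  Φ_weakly_lsc : ∀ (u : ℕ → U) (a : U) (z : ℕ → Z) (b : Z), WeaklyTendsto u a →
    WeaklyTendsto z b →
      (P.Φ a b : EReal) ≤ liminf (fun n => (P.Φ (u n) (z n) : EReal)) atTop
  dΦu_weakly_cont : ∀ (u : ℕ → U) (a : U) (z : ℕ → Z) (b : Z), WeaklyTendsto u a →
    WeaklyTendsto z b → WeaklyTendsto (fun n => P.dΦu (u n) (z n)) (P.dΦu a b)
  dΦz_weakly_cont : ∀ (u : ℕ → U) (a : U) (z : ℕ → Z) (b : Z), WeaklyTendsto u a →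
    WeaklyTendsto z b → WeaklyTendsto (fun n => P.dΦz (u n) (z n)) (P.dΦz a b)
  Ψ₁_zero : P.Ψ₁ 0 ≠ ∞
  Ψ₁_convex : IsConvex P.Ψ₁
  Ψ₁_lsc : LowerSemicontinuous P.Ψ₁
  Ψ₁_weakly_lsc : IsWeaklyLSC P.Ψ₁
  Ψ₁_coercive : IsPowerCoercive P.p₁ P.Ψ₁
  Ψ₁_growth : ∃ C : ℝ, ∀ v, ∀ ξ ∈ subdiff P.Ψ₁ v, ‖ξ‖ ≤ C * (1 + ‖v‖ ^ (P.p₁ - 1))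
  Ψ₂_zero : P.Ψ₂ 0 ≠ ∞
  Ψ₂_convex : IsConvex P.Ψ₂
  Ψ₂_lsc : LowerSemicontinuous P.Ψ₂
  Ψ₂_weakly_lsc : IsWeaklyLSC P.Ψ₂
  Ψ₂_coercive : IsPowerCoercive P.p₂ P.Ψ₂
  f_mem : ∃ (f₁ : ℝ → (U →L[ℝ] ℝ)) (f₂ : ℝ → H),
    MemLp f₁ (ENNReal.ofReal (conjExp P.p₁)) (μI P.T) ∧ MemLp f₂ 1 (μI P.T) ∧
      ∀ᵐ t ∂(μI P.T), P.f t = f₁ t + P.toDual (f₂ t)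
  g_mem : MemLp P.g (ENNReal.ofReal (conjExp P.p₂)) (μI P.T)

/-- Weak solutions `(u, v, z)` of the initial value problem
`u' = v`, `𝒯' v' + ∂Ψ₁(v) + ∂_uΦ(u, z) ∋ f`, `∂Ψ₂(z') + ∂_zΦ(u, z) ∋ g`.
Here `u` and `z` are the continuous representatives, `v` is the weakly continuous representative
with values in `H`, and `𝒯' v'` is the time derivative of `𝒯' v : I → H* ⊂ U*`. -/
def IsWeakSolution (P : Problem U H Z) (u : ℝ → U) (v : ℝ → H) (z : ℝ → Z) : Prop :=
  ContinuousOn u (Icc 0 P.T) ∧ ContinuousOn z (Icc 0 P.T) ∧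
  (∀ h : H, ContinuousOn (fun t => ⟪h, v t⟫_ℝ) (Icc 0 P.T)) ∧
  u 0 = P.u₀ ∧ v 0 = P.v₀ ∧ z 0 = P.z₀ ∧
  ∃ (du : ℝ → U) (dTv : ℝ → (U →L[ℝ] ℝ)) (dz : ℝ → Z),
    IsSobolev P.T (ENNReal.ofReal P.p₁) u du ∧
    (∀ᵐ t ∂(μI P.T), P.emb (du t) = v t) ∧
    IsSobolev P.T 1 (fun t => P.kin' (v t)) dTv ∧
    IsSobolev P.T (ENNReal.ofReal P.p₂) z dz ∧
    ∀ (v' : ℝ → U) (z' : ℝ → Z), MemLp v' ∞ (μI P.T) → MemLp z' ∞ (μI P.T) →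
      ((P.kin (v P.T) + P.Φ (u P.T) (z P.T) : ℝ) : EReal)
          + ((∫⁻ t, (P.Ψ₁ (du t) + P.Ψ₂ (dz t)) ∂(μI P.T) : ℝ≥0∞) : EReal)
        ≤ ((∫⁻ t, (P.Ψ₁ (v' t) + P.Ψ₂ (z' t)) ∂(μI P.T) : ℝ≥0∞) : EReal)
          + (((∫ t, ((dTv t + P.dΦu (u t) (z t) - P.f t) (v' t)
                + (P.dΦz (u t) (z t) - P.g t) (z' t)
                + P.f t (du t) + P.g t (dz t)) ∂(μI P.T))
              + P.kin P.v₀ + P.Φ P.u₀ P.z₀ : ℝ) : EReal)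

/-- The step `k → k + 1` of the scheme with time step `τ`, where `ξ₁ ∈ ∂Ψ₁` and `ξ₂ ∈ ∂Ψ₂` are the
dissipative forces realizing the two inclusions. The midpoint velocity `(v_{k+1} + v_k) / 2`
is the element `(u_{k+1} - u_k) / τ` of `U`. -/
def IsStep (P : Problem U H Z) (rf rg : LoadingRule) (τ : ℝ) (u : ℕ → U) (v : ℕ → H) (z : ℕ → Z)
    (k : ℕ) (ξ₁ : U →L[ℝ] ℝ) (ξ₂ : Z →L[ℝ] ℝ) : Prop :=
  P.emb (τ⁻¹ • (u (k + 1) - u k)) = (1 / 2 : ℝ) • (v (k + 1) + v k) ∧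
  ξ₁ ∈ subdiff P.Ψ₁ (τ⁻¹ • (u (k + 1) - u k)) ∧
  P.kin' (τ⁻¹ • (v (k + 1) - v k)) + ξ₁ + P.dΦu ((1 / 2 : ℝ) • (u (k + 1) + u k)) (z k)
    = rf.sample τ P.f (k + 1) ∧
  ξ₂ ∈ subdiff P.Ψ₂ (τ⁻¹ • (z (k + 1) - z k)) ∧
  ξ₂ + P.dΦz (u (k + 1)) ((1 / 2 : ℝ) • (z (k + 1) + z k)) = rg.sample τ P.g (k + 1)

/-- `(u_k, v_k, z_k)`, `k = 0, …, N`, solves the scheme with time step `τ = T / N`. -/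
def IsDiscreteSolution (P : Problem U H Z) (rf rg : LoadingRule) (N : ℕ)
    (u : ℕ → U) (v : ℕ → H) (z : ℕ → Z) : Prop :=
  u 0 = P.u₀ ∧ v 0 = P.v₀ ∧ z 0 = P.z₀ ∧
    ∀ k < N, ∃ ξ₁ ξ₂, P.IsStep rf rg (P.T / N) u v z k ξ₁ ξ₂

/-- `‖w‖ ≤ C` in `L^∞(I; H) ∩ L^{p₁}(I; U)` for `w : I → H`. -/
def VelocityBound (P : Problem U H Z) (w : ℝ → H) (C : ℝ≥0) : Prop :=
  LpBound P.T ∞ w C ∧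
    ∃ w' : ℝ → U, (∀ᵐ t ∂(μI P.T), P.emb (w' t) = w t) ∧
      LpBound P.T (ENNReal.ofReal P.p₁) w' C

/-- Weak* convergence in `L^∞(I; H) ∩ L^{p₁}(I; U)`. -/
def VelocityTendsto (P : Problem U H Z) (w : ℕ → ℝ → H) (a : ℝ → H) : Prop :=
  WeakStarTendsto P.T 1 w a ∧
    ∃ (w' : ℕ → ℝ → U) (a' : ℝ → U),
      (∀ n, MemLp (w' n) (ENNReal.ofReal P.p₁) (μI P.T) ∧
        ∀ᵐ t ∂(μI P.T), P.emb (w' n t) = w n t) ∧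
      (MemLp a' (ENNReal.ofReal P.p₁) (μI P.T) ∧ ∀ᵐ t ∂(μI P.T), P.emb (a' t) = a t) ∧
      WeakStarTendsto P.T (ENNReal.ofReal (conjExp P.p₁)) w' a'

/-- `‖ζ‖ ≤ C` in `W^{1,p₁'}(I; U*) + W^{1,1}(I; H)` for `ζ : I → U*`. -/
def SumBound (P : Problem U H Z) (ζ : ℝ → (U →L[ℝ] ℝ)) (C : ℝ≥0) : Prop :=
  ∃ (a : ℝ → (U →L[ℝ] ℝ)) (b : ℝ → H) (Ca Cb : ℝ≥0), Ca + Cb ≤ C ∧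
    (∀ᵐ t ∂(μI P.T), ζ t = a t + P.toDual (b t)) ∧
    SobolevBound P.T (ENNReal.ofReal (conjExp P.p₁)) a Ca ∧ SobolevBound P.T 1 b Cb

/-- `𝒯'`, as an operator on `H = H*`, restricts to an isomorphism of `U` (for example `𝒯` is a
multiple of `‖·‖² / 2`). -/
def KinPreserves (P : Problem U H Z) : Prop :=
  ∃ S : U ≃L[ℝ] U, ∀ x : U, fderiv ℝ P.kin (P.emb x) = innerSL ℝ (P.emb (S x))

end Problem

end FractionalStep

end

open FractionalStep

noncomputable section

set_option linter.unusedSectionVars false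

namespace FractionalStep

open ENNReal (ofReal ofReal_ne_top ofReal_le_ofReal toReal_nonneg toReal_mono add_ne_top
  toReal_ofReal mul_ne_top toReal_add ofReal_toReal HolderTriple ofReal_mul rpow_ne_top_of_nonneg
  ofReal_rpow_of_nonneg ofReal_add toReal_mul toReal_one tendsto_toReal rpow_one zero_ne_top
  rpow_le_rpow div_ne_top rpow_mul one_ne_top ofReal_one)
open Real (norm_of_nonneg rpow_nonneg mul_rpow exp)
open ContinuousLinearMap (compL le_opNorm le_opNorm₂ comp_apply)
open intervalIntegral (integral_of_le integral_interval_sub_left integral_add_adjacent_intervals)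

local notation:max X:max "⋆" => X →L[ℝ] ℝ

variable {X : Type*} [NormedAddCommGroup X] [NormedSpace ℝ X] [CompleteSpace X]
  {Y : Type*} [NormedAddCommGroup Y] [NormedSpace ℝ Y]
  {U H Z : Type*} [NormedAddCommGroup U] [NormedSpace ℝ U] [CompleteSpace U]
  [NormedAddCommGroup H] [InnerProductSpace ℝ H] [CompleteSpace H]
  [NormedAddCommGroup Z] [NormedSpace ℝ Z] [CompleteSpace Z]
  {P : Problem U H Z} {K : H →L[ℝ] H⋆} {f₁ : ℝ → U⋆} {f₂ : ℝ → H} {T t : ℝ} {N : ℕ} (hP : P.Admissible)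
local notation "μT" => μI T
local notation "IT" => Icc 0 T
local notation "μP" => μI P.T
local notation "IP" => Icc 0 P.T
local notation "ℓ₁" => ofReal P.p₁
local notation "ℓ₂" => ofReal P.p₂
local notation "ℓ₁'" => ofReal (conjExp P.p₁)
local notation "ℓ₂'" => ofReal (conjExp P.p₂)
local notation "⟪" x ", " y "⟫" => inner ℝ x y
local notation "δT" => T / (N : ℝ)
local notation "δP" => P.T / (N : ℝ)
local notation "H♯" => LinearIsometryEquiv.symm (InnerProductSpace.toDual ℝ H)
local notation:max "∫Ψ₁" w:max => ∫⁻ t, P.Ψ₁ (w t) ∂(μI P.T)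
local notation:max "∫Ψ₂" w:max => ∫⁻ t, P.Ψ₂ (w t) ∂(μI P.T)
local notation "∫⟨" x ", " w "⟩" => ∫ t, x t (w t) ∂(μI P.T)
local notation:max "∫Γ" u:max z:max w:max => ∫ t, (P.g t - P.dΦz (u t) (z t)) (w t) ∂(μI P.T)

/-! ### Hilbertizable spaces and weak sequential compactness -/

section Hilbertizable

universe u

variable {X : Type u} [NormedAddCommGroup X] [NormedSpace ℝ X]

/-- `X` carries an equivalent Hilbert norm. -/
def Hilbertizable (X : Type u) [NormedAddCommGroup X] [NormedSpace ℝ X] : Prop :=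
  ∃ (E : Type u) (_ : NormedAddCommGroup E) (_ : InnerProductSpace ℝ E) (_ : CompleteSpace E),
    Nonempty (X ≃L[ℝ] E)

/-- A copy of `X`, to be normed by the bilinear form `B`. -/
def BilinCopy (_B : X →L[ℝ] X⋆) : Type u := X

instance (B : X →L[ℝ] X⋆) : AddCommGroup (BilinCopy B) := inferInstanceAs (AddCommGroup X)

instance (B : X →L[ℝ] X⋆) : Module ℝ (BilinCopy B) := inferInstanceAs (Module ℝ X)

lemma Hilbertizable.of_bilin [CompleteSpace X] (B : X →L[ℝ] X⋆) (hs : ∀ x y, B x y = B y x) {c : ℝ} (hc : 0 < c)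
    (hB : ∀ x, c * ‖x‖ ^ 2 ≤ B x x) : Hilbertizable X := by
  let e : X ≃ₗ[ℝ] BilinCopy B := LinearEquiv.refl ℝ X
  let core : InnerProductSpace.Core ℝ (BilinCopy B) :=
    { inner := fun x y => B (e.symm x) (e.symm y)
      conj_inner_symm := fun x y => by simpa using hs _ _
      re_inner_nonneg := fun x => by
        exact le_trans (by positivity) (hB (e.symm x))
      add_left := fun x y z => by simp
      smul_left := fun x y r => by simp
      definite := fun x hx => by
        have h1 := hB (e.symm x)
        rw [show B (e.symm x) (e.symm x) = 0 from hx] at h1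
        by_contra h0
        have : 0 < ‖e.symm x‖ := norm_pos_iff.2 (by simpa using h0)
        exact h1.not_gt (by positivity) }
  let i1 : NormedAddCommGroup (BilinCopy B) := core.toNormedAddCommGroup
  let i2 : InnerProductSpace ℝ (BilinCopy B) := InnerProductSpace.ofCore core.toCore
  have hn : ∀ x : X, ‖e x‖ ^ 2 = B x x := fun x => by
    rw [← real_inner_self_eq_norm_sq]; rfl
  have h1 : ∀ x : X, ‖e x‖ ≤ √‖B‖ * ‖x‖ := fun x => by
    apply le_of_sq_le_sq _ (by positivity)
    rw [hn, mul_pow, Real.sq_sqrt (norm_nonneg B), sq, ← mul_assoc]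
    exact (le_abs_self _).trans (B.le_opNorm₂ x x)
  have h2 : ∀ y : BilinCopy B, ‖e.symm y‖ ≤ (√c)⁻¹ * ‖y‖ := fun y => by
    have h := (hB (e.symm y)).trans_eq (hn _).symm
    rw [LinearEquiv.apply_symm_apply] at h
    apply le_of_sq_le_sq _ (by positivity)
    rwa [mul_pow, inv_pow, Real.sq_sqrt hc.le, le_inv_mul_iff₀ hc]
  let E := LinearEquiv.toContinuousLinearEquivOfBounds e _ _ h1 h2
  exact ⟨BilinCopy B, i1, i2, (completeSpace_congr (e := E.toEquiv) E.isUniformEmbedding).1 inferInstance, ⟨E⟩⟩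

lemma Hilbertizable.of_hilbert (H : Type*) [NormedAddCommGroup H] [InnerProductSpace ℝ H]
    [CompleteSpace H] : Hilbertizable H :=
  ⟨H, inferInstance, inferInstance, inferInstance, ⟨.refl ℝ H⟩⟩

lemma Hilbertizable.dual (h : Hilbertizable X) : Hilbertizable X⋆ := by
  obtain ⟨E, _, _, _, ⟨e⟩⟩ := h
  refine ⟨E, inferInstance, inferInstance, inferInstance, ⟨?_⟩⟩
  exact (e.arrowCongr (ContinuousLinearEquiv.refl ℝ ℝ)).trans
    (InnerProductSpace.toDual ℝ E).symm.toContinuousLinearEquiv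

/-- A coercive symmetric form on a Hilbertizable space. -/
lemma Hilbertizable.exists_form (h : Hilbertizable X) :
    ∃ (B : X →L[ℝ] X⋆) (c : ℝ), 0 < c ∧ (∀ x y, B x y = B y x) ∧
      ∀ x, c * ‖x‖ ^ 2 ≤ B x x := by
  obtain ⟨E, _, _, _, ⟨e⟩⟩ := h
  let e' : X →L[ℝ] E := e
  refine ⟨((innerSL ℝ : E →L[ℝ] E⋆).comp e').flip.comp e', (‖(e.symm : E →L[ℝ] X)‖ ^ 2 + 1)⁻¹,
    by positivity, fun x y => by simp [real_inner_comm], fun x => ?_⟩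
  have h1 : ‖x‖ ≤ ‖(e.symm : E →L[ℝ] X)‖ * ‖e x‖ := by
    simpa using (e.symm : E →L[ℝ] X).le_opNorm (e x)
  have h2 := pow_le_pow_left₀ (norm_nonneg _) h1 2
  rw [inv_mul_le_iff₀ (by positivity)]
  change _ ≤ _ * ⟪e x, e x⟫
  rw [real_inner_self_eq_norm_sq]
  nlinarith [sq_nonneg ‖e x‖]

/-- A norming linear map from the dual space. -/
lemma Hilbertizable.exists_dualMap (h : Hilbertizable X) :
    ∃ (J : X⋆ →L[ℝ] X) (c : ℝ), 0 < c ∧ ∀ ξ : X⋆, c * ‖ξ‖ ^ 2 ≤ ξ (J ξ) := by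
  obtain ⟨E, _, _, _, ⟨e⟩⟩ := h
  let d : X⋆ →L[ℝ] E := (InnerProductSpace.toDual ℝ E).symm.toContinuousLinearEquiv.toContinuousLinearMap.comp
    ((compL ℝ E X ℝ).flip (e.symm : E →L[ℝ] X))
  refine ⟨(e.symm : E →L[ℝ] X).comp d, (‖(e : X →L[ℝ] E)‖ ^ 2 + 1)⁻¹, by positivity, fun ξ => ?_⟩
  have h0 : ∀ y, ⟪d ξ, y⟫ = ξ (e.symm y) := fun y => by simp [d]
  have h1 : ξ (e.symm (d ξ)) = ‖d ξ‖ ^ 2 := by rw [← h0, real_inner_self_eq_norm_sq]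
  have h2 : ‖ξ‖ ≤ ‖d ξ‖ * ‖(e : X →L[ℝ] E)‖ := by
    refine ContinuousLinearMap.opNorm_le_bound _ (by positivity) fun x => ?_
    rw [← e.symm_apply_apply x, ← h0, mul_assoc, e.symm_apply_apply]
    exact (abs_real_inner_le_norm _ _).trans (by gcongr; exact (e : X →L[ℝ] E).le_opNorm x)
  have h3 := pow_le_pow_left₀ (norm_nonneg _) h2 2
  rw [comp_apply, inv_mul_le_iff₀ (by positivity)]
  change ‖ξ‖ ^ 2 ≤ _ * ξ (e.symm (d ξ))
  rw [h1]
  nlinarith [sq_nonneg ‖d ξ‖]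

lemma exists_subseq_tendsto_coord {ι : Type*} [Countable ι] (a : ℕ → ι → ℝ) (C : ι → ℝ)
    (h : ∀ n i, |a n i| ≤ C i) :
    ∃ φ : ℕ → ℕ, StrictMono φ ∧ ∃ l : ι → ℝ, ∀ i, Tendsto (fun n => a (φ n) i) atTop (𝓝 (l i)) := by
  have hK : IsCompact (Set.pi univ fun i => Icc (-C i) (C i)) :=
    isCompact_univ_pi fun i => isCompact_Icc
  obtain ⟨l, -, φ, hφ, hl⟩ := hK.tendsto_subseq (x := a) fun n i _ =>
    abs_le.1 (h n i)
  exact ⟨φ, hφ, l, tendsto_pi_nhds.1 hl⟩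

/-- A bounded sequence in a Hilbert space converges weakly if its inner products with the members
of a set containing the sequence converge. -/
lemma exists_weak_limit_of_tendsto {E : Type*} [NormedAddCommGroup E] [InnerProductSpace ℝ E]
    [CompleteSpace E] (s : ℕ → E) {C : ℝ} (hC : ∀ n, ‖s n‖ ≤ C) (S : Set E) (hS : ∀ n, s n ∈ S)
    (h : ∀ y ∈ S, ∃ l, Tendsto (fun n => ⟪s n, y⟫) atTop (𝓝 l)) :
    ∃ a, ∀ y, Tendsto (fun n => ⟪s n, y⟫) atTop (𝓝 ⟪a, y⟫) := by
  have hC0 : 0 ≤ C := (norm_nonneg _).trans (hC 0)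
  let V : Submodule ℝ E :=
    { carrier := {y | CauchySeq fun n => ⟪s n, y⟫}
      add_mem' := fun hx hy => by
        simp only [mem_ofPred_eq, inner_add_right] at *
        exact hx.add hy
      zero_mem' := by simpa only [mem_ofPred_eq, inner_zero_right] using cauchySeq_const 0
      smul_mem' := fun c x hx => by
        simpa only [mem_ofPred_eq, inner_smul_right] using
          ((cauchySeq_tendsto_of_complete hx).choose_spec.const_mul c).cauchySeq }
  have hVc : IsClosed (V : Set E) := by
    refine isClosed_of_closure_subset fun y hy => ?_
    change CauchySeq fun n => ⟪s n, y⟫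
    rw [Metric.cauchySeq_iff']
    intro ε hε
    obtain ⟨x, hx, hxy⟩ := Metric.mem_closure_iff.1 hy (ε / (3 * (C + 1))) (by positivity)
    obtain ⟨N, hN⟩ := Metric.cauchySeq_iff'.1 (show CauchySeq fun n => ⟪s n, x⟫ from hx) (ε / 3)
      (by positivity)
    have key : ∀ n, |⟪s n, y⟫ - ⟪s n, x⟫| < ε / 3 := fun n => by
      rw [← inner_sub_right]
      refine (abs_real_inner_le_norm _ _).trans_lt ?_
      rw [dist_eq_norm] at hxy
      calc ‖s n‖ * ‖y - x‖ ≤ (C + 1) * ‖y - x‖ := by gcongr; linarith [hC n]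
        _ < (C + 1) * (ε / (3 * (C + 1))) := by gcongr
        _ = ε / 3 := by field_simp
    refine ⟨N, fun n hn => ?_⟩
    have h1 := abs_lt.1 (key n)
    have h2 := abs_lt.1 (key N)
    have h3 := abs_lt.1 (hN n hn)
    rw [Real.dist_eq, abs_lt]
    constructor <;> linarith
  have hSV : ∀ n, s n ∈ V := fun n => (h _ (hS n)).choose_spec.cauchySeq
  have hVt : ∀ y, y ∈ V := by
    intro y
    have : CompleteSpace V := hVc.completeSpace_coe
    obtain ⟨a, ha, b, hb, rfl⟩ := V.exists_add_mem_mem_orthogonal y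
    refine V.add_mem ha ?_
    change CauchySeq fun n => ⟪s n, b⟫
    simpa only [fun n => hb _ (hSV n)] using cauchySeq_const 0
  choose f hf using fun y => cauchySeq_tendsto_of_complete (show CauchySeq fun n => ⟪s n, y⟫ from hVt y)
  let F : E⋆ := continuousLinearMapOfTendsto (fun n => innerSL ℝ (s n)) (f := f)
    (tendsto_pi_nhds.2 fun y => by simpa using hf y)
  refine ⟨(InnerProductSpace.toDual ℝ E).symm F, fun y => ?_⟩
  rw [InnerProductSpace.toDual_symm_apply]
  exact hf y

lemma exists_subseq_weak_hilbert {ι : Type*} [Countable ι] {E : Type*} [NormedAddCommGroup E]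
    [InnerProductSpace ℝ E] [CompleteSpace E] (x : ι → ℕ → E) (C : ι → ℝ)
    (hC : ∀ i n, ‖x i n‖ ≤ C i) :
    ∃ φ : ℕ → ℕ, StrictMono φ ∧ ∃ a : ι → E, ∀ i y,
      Tendsto (fun n => ⟪x i (φ n), y⟫) atTop (𝓝 ⟪a i, y⟫) := by
  obtain ⟨φ, hφ, l, hl⟩ := exists_subseq_tendsto_coord
    (fun n (p : ι × ℕ) => ⟪x p.1 n, x p.1 p.2⟫) (fun p => C p.1 * C p.1) fun n p =>
      (abs_real_inner_le_norm _ _).trans (mul_le_mul (hC _ _) (hC _ _) (norm_nonneg _)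
        ((norm_nonneg _).trans (hC p.1 0)))
  choose a ha using fun i => exists_weak_limit_of_tendsto (fun n => x i (φ n)) (fun n => hC i _)
    (range (x i)) (fun n => mem_range_self _) (forall_mem_range.2 fun m => ⟨_, hl (i, m)⟩)
  exact ⟨φ, hφ, a, ha⟩

/-- Bounded sequences in Hilbertizable spaces have weakly convergent subsequences. -/
lemma Hilbertizable.exists_subseq (h : Hilbertizable X) (x : ℕ → X) {C : ℝ}
    (hC : ∀ n, ‖x n‖ ≤ C) :
    ∃ φ : ℕ → ℕ, StrictMono φ ∧ ∃ a : X, WeaklyTendsto (fun n => x (φ n)) a := by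
  obtain ⟨E, _, _, _, ⟨e⟩⟩ := h
  obtain ⟨φ, hφ, a, ha⟩ := exists_subseq_weak_hilbert (fun (_ : Unit) n => e (x n))
    (fun _ => ‖(e : X →L[ℝ] E)‖ * C) (fun _ n => ((e : X →L[ℝ] E).le_opNorm _).trans
      (by gcongr; exact hC n))
  refine ⟨φ, hφ, e.symm (a ()), fun f => ?_⟩
  let g := (InnerProductSpace.toDual ℝ E).symm (f.comp (e.symm : E →L[ℝ] X))
  simpa [real_inner_comm g, g] using ha () g

end Hilbertizable

lemma WeaklyTendsto.comp {x : ℕ → X} {a : X} (h : WeaklyTendsto x a) {φ : ℕ → ℕ}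
    (hφ : Tendsto φ atTop atTop) : WeaklyTendsto (fun n => x (φ n)) a :=
  fun f => (h f).comp hφ

lemma weaklyTendsto_const (a : X) : WeaklyTendsto (fun _ => a) a := fun _ => tendsto_const_nhds

lemma WeaklyTendsto.map {x : ℕ → X} {a : X} (h : WeaklyTendsto x a) (L : X →L[ℝ] Y) :
    WeaklyTendsto (fun n => L (x n)) (L a) := fun f => h (f.comp L)

lemma WeaklyTendsto.add {x y : ℕ → X} {a b : X} (h : WeaklyTendsto x a)
    (h' : WeaklyTendsto y b) : WeaklyTendsto (fun n => x n + y n) (a + b) := fun f => by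
  simpa using (h f).add (h' f)

lemma WeaklyTendsto.neg {x : ℕ → X} {a : X} (h : WeaklyTendsto x a) :
    WeaklyTendsto (fun n => -x n) (-a) := fun f => by simpa using (h f).neg

lemma WeaklyTendsto.sub {x y : ℕ → X} {a b : X} (h : WeaklyTendsto x a)
    (h' : WeaklyTendsto y b) : WeaklyTendsto (fun n => x n - y n) (a - b) := by
  simpa [sub_eq_add_neg] using h.add h'.neg

lemma WeaklyTendsto.smul {x : ℕ → X} {a : X} (h : WeaklyTendsto x a) (c : ℝ) :
    WeaklyTendsto (fun n => c • x n) (c • a) := fun f => by simpa using (h f).const_mul c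

lemma _root_.Filter.Tendsto.weaklyTendsto {x : ℕ → X} {a : X} (h : Tendsto x atTop (𝓝 a)) :
    WeaklyTendsto x a := fun f => (f.continuous.tendsto a).comp h

lemma WeaklyTendsto.of_sub {x y : ℕ → X} {a : X} (h : WeaklyTendsto x a)
    (h' : Tendsto (fun n => ‖y n - x n‖) atTop (𝓝 0)) : WeaklyTendsto y a := by
  simpa using h.add (tendsto_zero_iff_norm_tendsto_zero.2 h').weaklyTendsto

lemma WeaklyTendsto.unique {x : ℕ → X} {a b : X} (h : WeaklyTendsto x a)
    (h' : WeaklyTendsto x b) : a = b := by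
  refine (SeparatingDual.eq_iff_forall_dual_eq (R := ℝ)).2 fun f => tendsto_nhds_unique (h f) (h' f)

/-- Weakly convergent sequences are bounded. -/
lemma WeaklyTendsto.bounded {x : ℕ → X} {a : X} (h : WeaklyTendsto x a) :
    ∃ C, ∀ n, ‖x n‖ ≤ C := by
  obtain ⟨C, hC⟩ := banach_steinhaus (g := fun n => NormedSpace.inclusionInDoubleDual ℝ X (x n))
    fun f => by
      obtain ⟨C, hC⟩ := (h f).norm.bddAbove_range
      exact ⟨C, fun n => hC ⟨n, rfl⟩⟩
  exact ⟨C, fun n => (NormedSpace.inclusionInDoubleDualLi ℝ (E := X)).norm_map (x n) ▸ hC n⟩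

lemma WeaklyTendsto.norm_le {x : ℕ → X} {a : X} (h : WeaklyTendsto x a) {C : ℝ}
    (hC : ∀ᶠ n in atTop, ‖x n‖ ≤ C) : ‖a‖ ≤ C := by
  by_cases ha : a = 0
  · obtain ⟨n, hn⟩ := hC.exists
    rw [ha, norm_zero]; exact (norm_nonneg _).trans hn
  obtain ⟨f, hf1, hf⟩ := exists_dual_vector ℝ a (by simpa using ha)
  have h1 : f a = ‖a‖ := by exact_mod_cast hf
  exact h1 ▸ le_of_tendsto (h f) (hC.mono fun n hn =>
    (le_abs_self _).trans ((f.le_opNorm _).trans (by rwa [hf1, one_mul])))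

/-! ### Convex functionals -/

lemma lsc_le_liminf {X : Type*} [TopologicalSpace X] {Ψ : X → ℝ≥0∞} (h : LowerSemicontinuous Ψ)
    {x : ℕ → X} {a : X} (hx : Tendsto x atTop (𝓝 a)) : Ψ a ≤ liminf (fun n => Ψ (x n)) atTop :=
  (h.le_liminf a).trans (liminf_le_liminf_of_le hx)

/-- A limit of points with converging upper bounds, for a lower semicontinuous functional. -/
lemma lsc_le_of_tendsto {X : Type*} [TopologicalSpace X] {Ψ : X → ℝ≥0∞}
    (h : LowerSemicontinuous Ψ) {x : ℕ → X} {a : X} (hx : Tendsto x atTop (𝓝 a)) {r : ℕ → ℝ≥0∞}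
    {l : ℝ≥0∞} (hr : Tendsto r atTop (𝓝 l)) (hle : ∀ n, Ψ (x n) ≤ r n) : Ψ a ≤ l :=
  (lsc_le_liminf h hx).trans ((liminf_le_liminf (.of_forall hle)).trans_eq hr.liminf_eq)

section Convex

lemma mem_subdiff_iff {Ψ : X → ℝ≥0∞} {x : X} {ξ : X⋆} :
    ξ ∈ subdiff Ψ x ↔ Ψ x ≠ ∞ ∧ ∀ y, Ψ y ≠ ∞ → (Ψ x).toReal + ξ (y - x) ≤ (Ψ y).toReal := by
  refine and_congr_right fun hx => forall_congr' fun y => ?_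
  have h1 : (Ψ x : EReal) = ((Ψ x).toReal : EReal) := (EReal.coe_ennreal_toReal hx).symm
  by_cases hy : Ψ y = ∞
  · simp [hy]
  · have h2 : (Ψ y : EReal) = ((Ψ y).toReal : EReal) := (EReal.coe_ennreal_toReal hy).symm
    rw [h1, h2, ← EReal.coe_add, EReal.coe_le_coe_iff]
    simp [hy]

lemma IsConvex.ne_top {Ψ : X → ℝ≥0∞} (h : IsConvex Ψ) {x y : X} (hx : Ψ x ≠ ∞) (hy : Ψ y ≠ ∞)
    {a b : ℝ} (ha : 0 ≤ a) (hb : 0 ≤ b) (hab : a + b = 1) : Ψ (a • x + b • y) ≠ ∞ :=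
  ne_top_of_le_ne_top (add_ne_top.2 ⟨mul_ne_top ofReal_ne_top hx,
    mul_ne_top ofReal_ne_top hy⟩) (h x y a b ha hb hab)

lemma IsConvex.toReal_le {Ψ : X → ℝ≥0∞} (h : IsConvex Ψ) {x y : X} (hx : Ψ x ≠ ∞)
    (hy : Ψ y ≠ ∞) {a b : ℝ} (ha : 0 ≤ a) (hb : 0 ≤ b) (hab : a + b = 1) :
    (Ψ (a • x + b • y)).toReal ≤ a * (Ψ x).toReal + b * (Ψ y).toReal := by
  have h1 := mul_ne_top (ofReal_ne_top (r := a)) hx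
  have h2 := mul_ne_top (ofReal_ne_top (r := b)) hy
  have := toReal_mono (add_ne_top.2 ⟨h1, h2⟩) (h x y a b ha hb hab)
  rwa [toReal_add h1 h2, toReal_mul, toReal_mul, toReal_ofReal ha, toReal_ofReal hb] at this

/-- Minimisation of a coercive quadratic plus a convex functional: the inclusion
`l ∈ B x + ∂Ψ(x)` is solvable. -/
lemma exists_sub_mem_subdiff (B : X →L[ℝ] X⋆)
    (hs : ∀ x y, B x y = B y x) {c : ℝ} (hc : 0 < c) (hB : ∀ x, c * ‖x‖ ^ 2 ≤ B x x)
    (l : X⋆) {Ψ : X → ℝ≥0∞} (hconv : IsConvex Ψ) (hlsc : LowerSemicontinuous Ψ)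
    (h0 : Ψ 0 ≠ ∞) : ∃ x, l - B x ∈ subdiff Ψ x := by
  let Q : X → ℝ := fun x => (1 / 2) * B x x - l x
  have hQc : Continuous Q := by fun_prop
  let F : {x // Ψ x ≠ ∞} → ℝ := fun x => Q x + (Ψ x).toReal
  have hbdd : BddBelow (range F) := by
    refine ⟨-(‖l‖ ^ 2 / (2 * c)), ?_⟩
    rintro _ ⟨x, rfl⟩
    have h1 := hB x.1
    have h2 : l x.1 ≤ ‖l‖ * ‖x.1‖ := (le_abs_self _).trans (l.le_opNorm _)
    have h3 : 0 ≤ (Ψ x.1).toReal := toReal_nonneg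
    have h4 : -(‖l‖ ^ 2 / (2 * c)) ≤ (1 / 2) * (c * ‖x.1‖ ^ 2) - ‖l‖ * ‖x.1‖ := by
      have : (1 / 2) * (c * ‖x.1‖ ^ 2) - ‖l‖ * ‖x.1‖ + ‖l‖ ^ 2 / (2 * c)
          = (c * ‖x.1‖ - ‖l‖) ^ 2 / (2 * c) := by field_simp; ring
      have h5 : 0 ≤ (c * ‖x.1‖ - ‖l‖) ^ 2 / (2 * c) := by positivity
      linarith
    simp only [F, Q]
    linarith
  let m := ⨅ x, F x
  have : Nonempty {x // Ψ x ≠ ∞} := ⟨⟨0, h0⟩⟩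
  have hm : ∀ x, Ψ x ≠ ∞ → m ≤ Q x + (Ψ x).toReal := fun x hx => ciInf_le hbdd ⟨x, hx⟩
  choose x hx using fun n : ℕ => exists_lt_of_ciInf_lt (f := F)
    (lt_add_of_pos_right m (by positivity : 0 < 1 / ((n : ℝ) + 1)))
  have hmid : ∀ n k, (c / 8) * ‖(x n : X) - x k‖ ^ 2 ≤ (1 / ((n : ℝ) + 1) + 1 / ((k : ℝ) + 1)) / 2 := by
    intro n k
    have h0 : (0 : ℝ) ≤ 1 / 2 := by norm_num
    have h1 := hm _ (hconv.ne_top (x n).2 (x k).2 h0 h0 (add_halves 1))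
    have h2 := hconv.toReal_le (x n).2 (x k).2 h0 h0 (add_halves 1)
    have h3 := hx n
    have h4 := hx k
    have h5 := hB ((x n : X) - x k)
    have h6 := hs (x n) (x k)
    simp only [F, Q, map_add, map_smul, map_sub, add_apply, sub_apply, smul_apply, smul_eq_mul] at *
    rw [h6] at *
    nlinarith
  have hcau : CauchySeq fun n => (x n : X) := by
    rw [Metric.cauchySeq_iff']
    intro ε hε
    obtain ⟨N, hN⟩ := exists_nat_one_div_lt (show 0 < c / 8 * ε ^ 2 by positivity)
    refine ⟨N, fun n hn => ?_⟩
    have h1 := hmid n N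
    have h2 : 1 / ((n : ℝ) + 1) ≤ 1 / ((N : ℝ) + 1) := by gcongr
    rw [dist_eq_norm]
    have h3 : c / 8 * ‖(x n : X) - x N‖ ^ 2 < c / 8 * ε ^ 2 := by linarith
    exact lt_of_pow_lt_pow_left₀ 2 hε.le (lt_of_mul_lt_mul_left h3 (by positivity))
  obtain ⟨a, ha⟩ := cauchySeq_tendsto_of_complete hcau
  have hlim : Tendsto (fun n : ℕ => m + 1 / ((n : ℝ) + 1) - Q (x n)) atTop (𝓝 (m - Q a)) := by
    simpa using ((tendsto_const_nhds (x := m)).add tendsto_one_div_add_atTop_nhds_zero_nat).sub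
      ((hQc.tendsto a).comp ha)
  have hΨa : Ψ a ≤ ofReal (m - Q a) := by
    refine lsc_le_of_tendsto hlsc ha (ENNReal.tendsto_ofReal hlim) fun n => ?_
    rw [← ofReal_toReal (x n).2]
    exact ofReal_le_ofReal (le_sub_iff_add_le'.2 (hx n).le)
  have hat : Ψ a ≠ ∞ := ne_top_of_le_ne_top ofReal_ne_top hΨa
  have hmQ : 0 ≤ m - Q a := ge_of_tendsto' hlim fun n =>
    toReal_nonneg.trans (le_sub_iff_add_le'.2 (hx n).le)
  have hle : (Ψ a).toReal ≤ m - Q a := by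
    have := toReal_mono ofReal_ne_top hΨa
    rwa [toReal_ofReal hmQ] at this
  refine ⟨a, mem_subdiff_iff.2 ⟨hat, fun y hy => ?_⟩⟩
  by_contra hcon
  push Not at hcon
  let D := (Ψ a).toReal + (l - B a) (y - a) - (Ψ y).toReal
  let b := B (y - a) (y - a)
  have hD : 0 < D := by simp only [D]; linarith
  have hb : 0 ≤ b := le_trans (by positivity) (hB _)
  have hvar : ∀ s : ℝ, 0 < s → s ≤ 1 → D ≤ s / 2 * b := by
    intro s hs0 hs1
    have h1 := hm _ (hconv.ne_top hat hy (a := 1 - s) (b := s) (by linarith) hs0.le (by ring))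
    have h2 := hconv.toReal_le hat hy (a := 1 - s) (b := s) (by linarith) hs0.le (by ring)
    have h3 : (1 - s) • a + s • y = a + s • (y - a) := by module
    have h4 : Q ((1 - s) • a + s • y) = Q a + s * (B a (y - a) - l (y - a)) + s ^ 2 / 2 * b := by
      rw [h3]
      simp only [Q, b, map_add, map_smul, add_apply, smul_apply, smul_eq_mul, hs (y - a) a]
      ring
    rw [h4] at h1
    have h5 : s * D ≤ s * (s / 2 * b) := by
      simp only [D, sub_apply]
      nlinarith
    exact le_of_mul_le_mul_left h5 hs0
  have h1 := hvar (min 1 (D / (b + 1))) (by positivity) (min_le_left _ _)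
  have h2 := min_le_right 1 (D / (b + 1))
  have h3 : D / (b + 1) * b ≤ D := by
    rw [div_mul_eq_mul_div, div_le_iff₀ (by positivity)]
    nlinarith
  have : min 1 (D / (b + 1)) / 2 * b ≤ D / (b + 1) * b / 2 := by nlinarith
  linarith

lemma one_add_rpow_le {p a : ℝ} (hp : 0 ≤ p) (ha : 0 ≤ a) : (1 + a) ^ p ≤ 2 ^ p * (1 + a ^ p) := by
  rcases le_total a 1 with h | h
  · calc (1 + a) ^ p ≤ 2 ^ p := Real.rpow_le_rpow (by positivity) (by linarith) hp
      _ ≤ 2 ^ p * (1 + a ^ p) := le_mul_of_one_le_right (by positivity)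
          (by linarith [rpow_nonneg ha p])
  · calc (1 + a) ^ p ≤ (2 * a) ^ p := Real.rpow_le_rpow (by positivity) (by linarith) hp
      _ = 2 ^ p * a ^ p := mul_rpow (by norm_num) ha
      _ ≤ 2 ^ p * (1 + a ^ p) := by gcongr; linarith

/-- A convex functional whose subgradients have `(p - 1)`-growth is finite and has `p`-growth. -/
lemma exists_growth_of_subdiff_growth (hX : Hilbertizable X)
    {Ψ : X → ℝ≥0∞} (hconv : IsConvex Ψ) (hlsc : LowerSemicontinuous Ψ) (h0 : Ψ 0 ≠ ∞) {p : ℝ}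
    (hp : 1 < p) {C : ℝ} (hC : ∀ v, ∀ ξ ∈ subdiff Ψ v, ‖ξ‖ ≤ C * (1 + ‖v‖ ^ (p - 1))) :
    ∃ K : ℝ, 0 ≤ K ∧ ∀ v, Ψ v ≤ ofReal (K * (1 + ‖v‖ ^ p)) := by
  obtain ⟨B, c, hc, hs, hB⟩ := hX.exists_form
  let P := (Ψ 0).toReal
  have hP : 0 ≤ P := toReal_nonneg
  let K₁ := 1 + ‖B‖ / c + P / c
  have hK₁ : 1 ≤ K₁ := by
    have : 0 ≤ ‖B‖ / c + P / c := by positivity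
    simp only [K₁]; linarith
  refine ⟨P + |C| * 2 * K₁ ^ p * 2 ^ p, by positivity, fun v => ?_⟩
  choose x hx using fun n : ℕ => exists_sub_mem_subdiff (((n : ℝ) + 1) • B)
    (fun x y => by simp [hs x y]) (c := ((n : ℝ) + 1) * c) (by positivity)
    (fun x => by
      have := hB x
      rw [smul_apply, smul_apply, smul_eq_mul, mul_assoc]
      gcongr) (((n : ℝ) + 1) • B v) hconv hlsc h0
  have hξ : ∀ n : ℕ, ((n : ℝ) + 1) • B v - (((n : ℝ) + 1) • B) (x n) = ((n : ℝ) + 1) • B (v - x n) :=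
    fun n => by ext; simp; ring
  simp only [hξ] at hx
  have h1 : ∀ n : ℕ, (Ψ (x n)).toReal ≤ P + (((n : ℝ) + 1) • B (v - x n)) (x n) := fun n => by
    have := (mem_subdiff_iff.1 (hx n)).2 0 h0
    simp only [zero_sub, map_neg] at this
    linarith
  have hxb : ∀ n, ‖x n‖ ≤ K₁ * (1 + ‖v‖) := fun n => by
    have h2 := h1 n
    have h4 : (((n : ℝ) + 1) • B (v - x n)) (x n)
        = ((n : ℝ) + 1) * (B (v - x n) v - B (v - x n) (v - x n)) := by
      rw [← map_sub, sub_sub_cancel]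
      simp
    rw [h4] at h2
    have h5 := hB (v - x n)
    have h6 : B (v - x n) v ≤ ‖B‖ * ‖v - x n‖ * ‖v‖ := (le_abs_self _).trans (B.le_opNorm₂ _ _)
    have h7 : B (v - x n) (v - x n) - B (v - x n) v ≤ P := by
      by_contra! hcon
      nlinarith [toReal_nonneg (a := Ψ (x n)), (Nat.cast_nonneg n : (0 : ℝ) ≤ n)]
    have h8 : ‖v - x n‖ ≤ 1 + (P + ‖B‖ * ‖v‖) / c := by
      rcases le_total ‖v - x n‖ 1 with h | h
      · exact h.trans (le_add_of_nonneg_right (by positivity))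
      · have h9 : ‖v - x n‖ * (‖v - x n‖ * c) ≤ ‖v - x n‖ * (P + ‖B‖ * ‖v‖) := by nlinarith
        have h10 := (le_div_iff₀ hc).2 (le_of_mul_le_mul_left h9 (by linarith))
        linarith
    have h9 : ‖x n‖ ≤ ‖v‖ + ‖v - x n‖ := by simpa using norm_sub_le v (v - x n)
    have h10 : K₁ * (1 + ‖v‖) = ‖v‖ + (1 + (P + ‖B‖ * ‖v‖) / c) + ‖B‖ / c + P / c * ‖v‖ := by
      simp only [K₁]; ring
    have h11 : 0 ≤ ‖B‖ / c + P / c * ‖v‖ := by positivity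
    linarith
  have hv := norm_nonneg v
  let M := K₁ * (1 + ‖v‖)
  have hM1 : 1 ≤ M := by simp only [M]; nlinarith
  have hξb : ∀ n : ℕ, ‖((n : ℝ) + 1) • B (v - x n)‖ ≤ |C| * (2 * M ^ (p - 1)) := fun n => by
    refine (hC _ _ (hx n)).trans ?_
    have h2 : ‖x n‖ ^ (p - 1) ≤ M ^ (p - 1) :=
      Real.rpow_le_rpow (norm_nonneg _) (hxb n) (by linarith)
    have h3 : 1 ≤ M ^ (p - 1) := Real.one_le_rpow hM1 (by linarith)
    calc C * (1 + ‖x n‖ ^ (p - 1)) ≤ |C| * (1 + ‖x n‖ ^ (p - 1)) := by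
          gcongr; exact le_abs_self C
      _ ≤ |C| * (2 * M ^ (p - 1)) := by gcongr; linarith
  have hconvx : Tendsto x atTop (𝓝 v) := by
    rw [tendsto_iff_norm_sub_tendsto_zero]
    have h2 : ∀ n : ℕ, ‖x n - v‖ ≤ (|C| * (2 * M ^ (p - 1)) / c) * (1 / ((n : ℝ) + 1)) := fun n => by
      have h3 := hB (v - x n)
      have h4 : (((n : ℝ) + 1) • B (v - x n)) (v - x n) ≤ |C| * (2 * M ^ (p - 1)) * ‖v - x n‖ :=
        (le_abs_self _).trans ((le_opNorm _ _).trans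
          (mul_le_mul_of_nonneg_right (hξb n) (norm_nonneg _)))
      simp only [smul_apply, smul_eq_mul] at h4
      rw [norm_sub_rev]
      rcases (norm_nonneg (v - x n)).eq_or_lt with h5 | h5
      · rw [← h5]; positivity
      · have h6 : ((n : ℝ) + 1) * (c * ‖v - x n‖ ^ 2) ≤ |C| * (2 * M ^ (p - 1)) * ‖v - x n‖ :=
          le_trans (by gcongr) h4
        have h7 : ((n : ℝ) + 1) * c * ‖v - x n‖ ≤ |C| * (2 * M ^ (p - 1)) := by
          refine le_of_mul_le_mul_right ?_ h5
          linarith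
        rw [div_mul_div_comm, mul_one, le_div_iff₀ (by positivity)]
        linarith
    refine squeeze_zero (fun _ => norm_nonneg _) h2 ?_
    simpa using tendsto_one_div_add_atTop_nhds_zero_nat.const_mul (|C| * (2 * M ^ (p - 1)) / c)
  refine lsc_le_of_tendsto hlsc hconvx tendsto_const_nhds fun n => ?_
  rw [← ofReal_toReal (hx n).1]
  apply ofReal_le_ofReal
  have h2 : (((n : ℝ) + 1) • B (v - x n)) (x n) ≤ |C| * (2 * M ^ (p - 1)) * M :=
    (le_abs_self _).trans ((le_opNorm _ _).trans
      (mul_le_mul (hξb n) (hxb n) (norm_nonneg _) (by positivity)))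
  have h3 : M ^ (p - 1) * M = M ^ p := by
    rw [← Real.rpow_add_one (by positivity)]; congr 1; ring
  have h4 : M ^ p ≤ K₁ ^ p * (2 ^ p * (1 + ‖v‖ ^ p)) := by
    rw [mul_rpow (by positivity) (by positivity)]
    gcongr
    exact one_add_rpow_le (by linarith) hv
  have h5 : 0 ≤ ‖v‖ ^ p := by positivity
  have h6 : |C| * 2 * M ^ p ≤ |C| * 2 * (K₁ ^ p * (2 ^ p * (1 + ‖v‖ ^ p))) := by gcongr
  have h7 := h1 n
  calc (Ψ (x n)).toReal ≤ P + |C| * 2 * (M ^ (p - 1) * M) := by linarith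
    _ ≤ P * (1 + ‖v‖ ^ p) + |C| * 2 * (K₁ ^ p * (2 ^ p * (1 + ‖v‖ ^ p))) := by
        rw [h3]; nlinarith
    _ = _ := by ring

end Convex

/-! ### Quadratic functionals -/

section Quadratic

lemma coercive_of_superlinear {q : X → ℝ} {B : X →L[ℝ] X⋆} {l : X⋆} {c : ℝ}
    (hq : ∀ x, q x = (1 / 2) * B x x + l x + c)
    (h : ∀ M : ℝ, 0 ≤ M → ∃ R : ℝ, ∀ x, R ≤ ‖x‖ → M * ‖x‖ ≤ q x) :
    ∃ c₀ : ℝ, 0 < c₀ ∧ ∀ x, c₀ * ‖x‖ ^ 2 ≤ B x x := by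
  obtain ⟨R, hR⟩ := h (‖l‖ + 1) (by positivity)
  let r := max R (|c| + 1)
  have hr0 : 0 < r := lt_of_lt_of_le (by positivity) (le_max_right _ _)
  refine ⟨2 / r ^ 2, by positivity, fun x => ?_⟩
  rcases (norm_nonneg x).eq_or_lt with hx | hx
  · have : x = 0 := norm_eq_zero.1 hx.symm
    simp [this]
  let y := (r / ‖x‖) • x
  have hy : ‖y‖ = r := by
    rw [norm_smul, norm_of_nonneg (by positivity)]; field_simp
  have h1 := hR y (hy ▸ le_max_left _ _)
  rw [hq, hy] at h1
  have h2 : l y ≤ ‖l‖ * r := (le_abs_self _).trans (hy ▸ l.le_opNorm y)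
  have h3 : |c| + 1 ≤ r := le_max_right _ _
  have h4 := le_abs_self c
  have h5 : B y y = (r / ‖x‖) ^ 2 * B x x := by simp [y]; ring
  have h6 : 2 ≤ (r / ‖x‖) ^ 2 * B x x := by rw [← h5]; linarith
  rw [div_pow, div_mul_eq_mul_div, le_div_iff₀ (by positivity)] at h6
  rw [div_mul_eq_mul_div, div_le_iff₀ (by positivity)]
  linarith

lemma hasFDerivAt_quadratic {q : X → ℝ} {B : X →L[ℝ] X⋆} {l : X⋆} {c : ℝ}
    (hs : ∀ x y, B x y = B y x) (hq : ∀ x, q x = (1 / 2) * B x x + l x + c) (x : X) :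
    HasFDerivAt q (B x + l) x := by
  have h1 : HasFDerivAt (fun x => (1 / 2) * B x x + l x + c)
      ((1 / 2 : ℝ) • ((B x).comp (ContinuousLinearMap.id ℝ X) + B.flip x) + l) x :=
    ((((B.hasFDerivAt).clm_apply (hasFDerivAt_id x)).const_mul (1 / 2)).add l.hasFDerivAt).add_const c
  have h2 : q = fun x => (1 / 2) * B x x + l x + c := funext hq
  rw [h2]
  convert h1 using 1
  ext y
  have := hs x y
  simp only [add_apply, smul_apply, comp_apply, ContinuousLinearMap.id_apply,
    ContinuousLinearMap.flip_apply, smul_eq_mul]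
  rw [← this]; ring

lemma IsQuadratic.add {q r : X → ℝ} (h : IsQuadratic q) (h' : IsQuadratic r) :
    IsQuadratic (fun x => q x + r x) := by
  obtain ⟨B, l, c, hs, hq⟩ := h
  obtain ⟨B', l', c', hs', hq'⟩ := h'
  exact ⟨B + B', l + l', c + c', fun x y => by simp [hs x y, hs' x y], fun x => by
    simp [hq, hq']; ring⟩

lemma IsQuadratic.neg {q : X → ℝ} (h : IsQuadratic q) : IsQuadratic (fun x => -q x) := by
  obtain ⟨B, l, c, hs, hq⟩ := h
  exact ⟨-B, -l, -c, fun x y => by simp [hs x y], fun x => by simp [hq]; ring⟩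

lemma IsQuadratic.sub {q r : X → ℝ} (h : IsQuadratic q) (h' : IsQuadratic r) :
    IsQuadratic (fun x => q x - r x) := by
  simpa [sub_eq_add_neg] using h.add h'.neg

/-- A vector-valued map which is bounded near `0` and quadratic after composition with a
separating family of functionals is a continuous quadratic polynomial. -/
lemma exists_quadratic_of_separating {E : Type*} [NormedAddCommGroup E] [NormedSpace ℝ E]
    (q : X → E) {ι : Type*} (e : ι → E⋆) (sep : ∀ y, (∀ i, e i y = 0) → y = 0)
    (hq : ∀ i, IsQuadratic fun z => e i (q z)) {C : ℝ} (hb : ∀ z, ‖z‖ ≤ 2 → ‖q z‖ ≤ C) :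
    ∃ (A : X →L[ℝ] X →L[ℝ] E) (m : X →L[ℝ] E), ∀ z, q z = (1 / 2 : ℝ) • A z z + m z + q 0 := by
  have sep' : ∀ y y', (∀ i, e i y = e i y') → y = y' := fun y y' h =>
    sub_eq_zero.1 (sep _ fun i => by rw [map_sub, h i, sub_self])
  choose B l c hs hq using hq
  let a : X → X → E := fun x y => q (x + y) - q x - q y + q 0
  have ha : ∀ i x y, e i (a x y) = B i x y := fun i x y => by
    simp only [a, map_add, map_sub, hq, add_apply, map_zero]
    rw [hs i y x]; ring
  let A₀ : X →ₗ[ℝ] X →ₗ[ℝ] E := LinearMap.mk₂ ℝ a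
    (fun x x' y => sep' _ _ fun i => by simp [ha])
    (fun r x y => sep' _ _ fun i => by simp [ha])
    (fun x y y' => sep' _ _ fun i => by simp [ha])
    (fun r x y => sep' _ _ fun i => by simp [ha])
  have hC : 0 ≤ C := (norm_nonneg _).trans (hb 0 (by simp))
  have hunit : ∀ x y : X, ‖x‖ ≤ 1 → ‖y‖ ≤ 1 → ‖a x y‖ ≤ 4 * C := fun x y hx hy => by
    have h1 := hb (x + y) ((norm_add_le _ _).trans (by linarith))
    have h2 := hb x (by linarith)
    have h3 := hb y (by linarith)
    have h4 := hb 0 (by simp)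
    calc ‖a x y‖ ≤ ‖q (x + y)‖ + ‖q x‖ + ‖q y‖ + ‖q 0‖ :=
          (norm_add_le _ _).trans (by gcongr; exact (norm_sub_le _ _).trans (by gcongr; exact norm_sub_le _ _))
      _ ≤ 4 * C := by linarith
  have hbound : ∀ x y, ‖A₀ x y‖ ≤ 4 * C * ‖x‖ * ‖y‖ := fun x y => by
    rcases eq_or_ne x 0 with rfl | hx
    · simp
    rcases eq_or_ne y 0 with rfl | hy
    · simp
    have hx' : 0 < ‖x‖ := norm_pos_iff.2 hx
    have hy' : 0 < ‖y‖ := norm_pos_iff.2 hy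
    have h1 : x = ‖x‖ • (‖x‖⁻¹ • x) := by rw [smul_smul, mul_inv_cancel₀ hx'.ne', one_smul]
    have h2 : y = ‖y‖ • (‖y‖⁻¹ • y) := by rw [smul_smul, mul_inv_cancel₀ hy'.ne', one_smul]
    have h3 : A₀ x y = (‖x‖ * ‖y‖) • A₀ (‖x‖⁻¹ • x) (‖y‖⁻¹ • y) := by
      conv_lhs => rw [h1, h2]
      simp only [map_smul, LinearMap.smul_apply, smul_smul]
      congr 1; field_simp
    rw [h3, norm_smul, norm_of_nonneg (by positivity)]
    have h4 : ‖A₀ (‖x‖⁻¹ • x) (‖y‖⁻¹ • y)‖ ≤ 4 * C := hunit _ _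
      (by rw [norm_smul, norm_inv, norm_norm, inv_mul_cancel₀ hx'.ne'])
      (by rw [norm_smul, norm_inv, norm_norm, inv_mul_cancel₀ hy'.ne'])
    nlinarith [mul_pos hx' hy']
  let A : X →L[ℝ] X →L[ℝ] E := A₀.mkContinuous₂ (4 * C) hbound
  have hA : ∀ x y, A x y = a x y := fun x y => rfl
  let m' : X → E := fun z => q z - q 0 - (1 / 2 : ℝ) • A z z
  have hm' : ∀ i z, e i (m' z) = l i z := fun i z => by
    simp only [m', map_sub, map_smul, hA, ha, hq, smul_eq_mul, map_zero]
    ring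
  let m₀ : X →ₗ[ℝ] E :=
    { toFun := m'
      map_add' := fun x y => sep' _ _ fun i => by rw [map_add]; simp [hm']
      map_smul' := fun r x => sep' _ _ fun i => by simp [hm'] }
  have hm1 : ∀ x, ‖x‖ ≤ 1 → ‖m₀ x‖ ≤ 4 * C := fun x hx => by
    have h2 := hb x (by linarith)
    have h4 := hb 0 (by simp)
    have h5 := hunit x x hx hx
    calc ‖m' x‖ ≤ ‖q x‖ + ‖q 0‖ + ‖(1 / 2 : ℝ) • A x x‖ :=
          (norm_sub_le _ _).trans (by gcongr; exact norm_sub_le _ _)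
      _ ≤ C + C + 1 / 2 * (4 * C) := by
          rw [norm_smul, hA]; norm_num at *; linarith
      _ = 4 * C := by ring
  have hmb : ∀ x, ‖m₀ x‖ ≤ 4 * C * ‖x‖ := fun x => by
    rcases eq_or_ne x 0 with rfl | hx
    · simp
    have hx' : 0 < ‖x‖ := norm_pos_iff.2 hx
    have h1 : x = ‖x‖ • (‖x‖⁻¹ • x) := by rw [smul_smul, mul_inv_cancel₀ hx'.ne', one_smul]
    have h3 : m₀ x = ‖x‖ • m₀ (‖x‖⁻¹ • x) := by
      rw [← map_smul, ← h1]
    rw [h3, norm_smul, norm_norm]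
    have := hm1 (‖x‖⁻¹ • x) (by rw [norm_smul, norm_inv, norm_norm, inv_mul_cancel₀ hx'.ne'])
    nlinarith
  refine ⟨A, m₀.mkContinuous _ hmb, fun z => ?_⟩
  change q z = (1 / 2 : ℝ) • A z z + m' z + q 0
  simp only [m']; abel

end Quadratic

/-! ### The stored energy -/

namespace Problem

/-- The stored energy as a function on `U × Z`. -/
def energy (P : Problem U H Z) (x : U × Z) : ℝ := P.Φ x.1 x.2

namespace Admissible

include hP

lemma superlinear (M : ℝ) :
    ∃ R : ℝ, ∀ u z, R ≤ ‖u‖ + ‖z‖ → M * (‖u‖ + ‖z‖) ≤ P.Φ u z := by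
  have h := hP.Φ_coercive.eventually_ge_atTop M
  rw [← comap_norm_atTop, eventually_comap] at h
  obtain ⟨R, hR⟩ := eventually_atTop.1 h
  refine ⟨2 * max R 1, fun u z huz => ?_⟩
  have h1 : max R 1 ≤ ‖(u, z)‖ := by
    rw [Prod.norm_def]
    by_contra hcon
    push Not at hcon
    have h2 := (max_lt_iff.1 hcon)
    simp only at h2
    linarith [h2.1, h2.2]
  have h2 := hR _ ((le_max_left _ _).trans h1) (u, z) rfl
  have h3 : 0 < ‖u‖ + ‖z‖ := lt_of_lt_of_le (by positivity) huz
  rwa [le_div_iff₀ h3] at h2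

lemma coercive_u (z : Z) {B : U →L[ℝ] U⋆} {l : U⋆} {c : ℝ}
    (hq : ∀ u, P.Φ u z = (1 / 2) * B u u + l u + c) :
    ∃ c₀ : ℝ, 0 < c₀ ∧ ∀ x, c₀ * ‖x‖ ^ 2 ≤ B x x :=
  coercive_of_superlinear (q := fun u => P.Φ u z) hq fun M hM => by
    obtain ⟨R, hR⟩ := hP.superlinear M
    refine ⟨R, fun u hu => le_trans ?_ (hR u z (by linarith [norm_nonneg z]))⟩
    gcongr; linarith [norm_nonneg z]

lemma coercive_z (u : U) {B : Z →L[ℝ] Z⋆} {l : Z⋆} {c : ℝ}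
    (hq : ∀ z, P.Φ u z = (1 / 2) * B z z + l z + c) :
    ∃ c₀ : ℝ, 0 < c₀ ∧ ∀ x, c₀ * ‖x‖ ^ 2 ≤ B x x :=
  coercive_of_superlinear (q := fun z => P.Φ u z) hq fun M hM => by
    obtain ⟨R, hR⟩ := hP.superlinear M
    refine ⟨R, fun z hz => le_trans ?_ (hR u z (by linarith [norm_nonneg u]))⟩
    gcongr; linarith [norm_nonneg u]

lemma exists_form_u (z : Z) :
    ∃ (B : U →L[ℝ] U⋆) (l : U⋆) (c : ℝ), (∀ x y, B x y = B y x) ∧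
      ∀ u, P.Φ u z = (1 / 2) * B u u + l u + c := hP.Φ_quadratic_u z

lemma exists_form_z (u : U) :
    ∃ (B : Z →L[ℝ] Z⋆) (l : Z⋆) (c : ℝ), (∀ x y, B x y = B y x) ∧
      ∀ z, P.Φ u z = (1 / 2) * B z z + l z + c := hP.Φ_quadratic_z u

lemma hilbertizable_U : Hilbertizable U := by
  obtain ⟨B, l, c, hs, hq⟩ := hP.exists_form_u 0
  obtain ⟨c₀, hc₀, hB⟩ := hP.coercive_u 0 hq
  exact Hilbertizable.of_bilin B hs hc₀ hB

lemma hilbertizable_Z : Hilbertizable Z := by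
  obtain ⟨B, l, c, hs, hq⟩ := hP.exists_form_z 0
  obtain ⟨c₀, hc₀, hB⟩ := hP.coercive_z 0 hq
  exact Hilbertizable.of_bilin B hs hc₀ hB

lemma exists_subseq_pair (u : ℕ → U) (z : ℕ → Z) {C : ℝ}
    (hu : ∀ n, ‖u n‖ ≤ C) (hz : ∀ n, ‖z n‖ ≤ C) : ∃ φ : ℕ → ℕ, StrictMono φ ∧ ∃ a b,
      WeaklyTendsto (fun n => u (φ n)) a ∧ WeaklyTendsto (fun n => z (φ n)) b := by
  obtain ⟨φ, hφ, a, ha⟩ := hP.hilbertizable_U.exists_subseq u hu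
  obtain ⟨ψ, hψ, b, hb⟩ := hP.hilbertizable_Z.exists_subseq (fun n => z (φ n)) fun n => hz _
  exact ⟨φ ∘ ψ, hφ.comp hψ, a, b, ha.comp hψ.tendsto_atTop, hb⟩

lemma exists_bound_dΦ (R : ℝ) : ∃ C : ℝ, 0 ≤ C ∧ ∀ u z, ‖u‖ ≤ R → ‖z‖ ≤ R →
    ‖P.dΦu u z‖ ≤ C ∧ ‖P.dΦz u z‖ ≤ C := by
  by_contra hcon
  push Not at hcon
  have h : ∀ n : ℕ, ∃ u z, ‖u‖ ≤ R ∧ ‖z‖ ≤ R ∧ ((n : ℝ) < ‖P.dΦu u z‖ ∨ (n : ℝ) < ‖P.dΦz u z‖) :=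
    fun n => by
      obtain ⟨u, z, hu, hz, h⟩ := hcon n (by positivity)
      refine ⟨u, z, hu, hz, ?_⟩
      by_cases h1 : (n : ℝ) < ‖P.dΦu u z‖
      · exact Or.inl h1
      · exact Or.inr (h (not_lt.1 h1))
  choose u z hu hz h using h
  obtain ⟨φ, hφ, a, b, ha, hb⟩ := hP.exists_subseq_pair u z hu hz
  obtain ⟨C₁, h1⟩ := (hP.dΦu_weakly_cont _ _ _ _ ha hb).bounded
  obtain ⟨C₂, h2⟩ := (hP.dΦz_weakly_cont _ _ _ _ ha hb).bounded
  obtain ⟨n, hn⟩ := exists_nat_ge (max C₁ C₂)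
  have h3 : (n : ℝ) ≤ φ n := by exact_mod_cast hφ.id_le n
  rcases h (φ n) with h4 | h4
  · exact absurd (h1 n) (not_le.2 (lt_of_le_of_lt (((le_max_left _ _).trans hn).trans h3) h4))
  · exact absurd (h2 n) (not_le.2 (lt_of_le_of_lt (((le_max_right _ _).trans hn).trans h3) h4))

/-- The exact midpoint formula for quadratic functionals. -/
lemma sub_eq_dΦu (u u' : U) (z : Z) :
    P.Φ u z - P.Φ u' z = P.dΦu ((1 / 2 : ℝ) • (u + u')) z (u - u') := by
  obtain ⟨B, l, c, hs, hq⟩ := hP.exists_form_u z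
  rw [dΦu, (hasFDerivAt_quadratic hs hq _).fderiv, hq, hq]
  have := hs u u'
  simp only [map_smul, map_add, add_apply, smul_apply, map_sub, smul_eq_mul]
  rw [this]; ring

lemma sub_eq_dΦz (u : U) (z z' : Z) :
    P.Φ u z - P.Φ u z' = P.dΦz u ((1 / 2 : ℝ) • (z + z')) (z - z') := by
  obtain ⟨B, l, c, hs, hq⟩ := hP.exists_form_z u
  rw [dΦz, (hasFDerivAt_quadratic hs hq _).fderiv, hq, hq]
  have := hs z z'
  simp only [map_smul, map_add, add_apply, smul_apply, map_sub, smul_eq_mul]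
  rw [this]; ring

lemma exists_bound_Φ (R : ℝ) : ∃ C : ℝ, 0 ≤ C ∧ ∀ u z, ‖u‖ ≤ R → ‖z‖ ≤ R →
    |P.Φ u z| ≤ C := by
  obtain ⟨C, hC, hb⟩ := hP.exists_bound_dΦ |R|
  refine ⟨|P.Φ 0 0| + 2 * (C * |R|), by positivity, fun u z hu hz => ?_⟩
  have hu' := hu.trans (le_abs_self R)
  have hz' := hz.trans (le_abs_self R)
  have h1 := hP.sub_eq_dΦu u 0 z
  have h2 := hP.sub_eq_dΦz 0 z 0
  have h3 := (hb ((1 / 2 : ℝ) • (u + 0)) z (by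
    rw [add_zero, norm_smul]; norm_num; linarith [norm_nonneg u]) hz').1
  have h4 := (hb 0 ((1 / 2 : ℝ) • (z + 0)) (by simp) (by
    rw [add_zero, norm_smul]; norm_num; linarith [norm_nonneg z])).2
  have h5 : |P.Φ u z - P.Φ 0 z| ≤ C * |R| := by
    rw [h1, sub_zero]
    exact (le_opNorm _ _).trans
      (mul_le_mul h3 hu' (norm_nonneg _) hC)
  have h6 : |P.Φ 0 z - P.Φ 0 0| ≤ C * |R| := by
    rw [h2, sub_zero]
    exact (le_opNorm _ _).trans
      (mul_le_mul h4 hz' (norm_nonneg _) hC)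
  rw [abs_le] at *
  have := neg_abs_le (P.Φ 0 0)
  have := le_abs_self (P.Φ 0 0)
  constructor <;> linarith

set_option maxSynthPendingDepth 3 in
/-- The stored energy is a polynomial with continuous coefficients. -/
lemma exists_polynomial :
    ∃ (B : U →L[ℝ] U⋆) (B₁ : Z →L[ℝ] U →L[ℝ] U⋆)
      (B₂ : Z →L[ℝ] Z →L[ℝ] U →L[ℝ] U⋆) (l : U⋆) (l₁ : Z →L[ℝ] U⋆)
      (l₂ : Z →L[ℝ] Z →L[ℝ] U⋆) (c : ℝ) (c₁ : Z⋆) (c₂ : Z →L[ℝ] Z⋆),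
      ∀ u z, P.Φ u z = (1 / 2) * ((1 / 2) * B₂ z z u u + B₁ z u u + B u u)
        + ((1 / 2) * l₂ z z u + l₁ z u + l u) + ((1 / 2) * c₂ z z + c₁ z + c) := by
  choose B l c hs hq using hP.exists_form_u
  have hd : ∀ u z, P.dΦu u z = B z u + l z := fun u z =>
    (hasFDerivAt_quadratic (hs z) (hq z) u).fderiv
  obtain ⟨C, hC, hb⟩ := hP.exists_bound_dΦ 2
  have hl : ∀ z, ‖z‖ ≤ 2 → ‖l z‖ ≤ C := fun z hz => by
    have := (hb 0 z (by simp) hz).1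
    rwa [hd, map_zero, zero_add] at this
  have hB : ∀ z, ‖z‖ ≤ 2 → ‖B z‖ ≤ 2 * C := fun z hz => by
    refine ContinuousLinearMap.opNorm_le_of_unit_norm (by positivity) fun u hu => ?_
    have h1 := (hb u z (by linarith) hz).1
    rw [hd] at h1
    have h2 : B z u = (B z u + l z) - l z := by abel
    rw [h2]
    exact (norm_sub_le _ _).trans (by linarith [hl z hz])
  obtain ⟨c₂, c₁, c₀, -, hc⟩ := hP.exists_form_z 0
  have hqx : ∀ x, IsQuadratic fun z => l z x := fun x => by
    obtain ⟨Bx, lx, cx, hsx, hx⟩ := hP.exists_form_z x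
    obtain ⟨Bn, ln, cn, hsn, hn⟩ := hP.exists_form_z (-x)
    refine ⟨(1 / 2 : ℝ) • (Bx - Bn), (1 / 2 : ℝ) • (lx - ln), (1 / 2) * (cx - cn),
      fun a b => by simp [hsx a b, hsn a b], fun z => ?_⟩
    have h2 := hx z
    have h3 := hn z
    rw [hq] at h2 h3
    simp only [map_neg, neg_apply, neg_neg, sub_apply, smul_apply, smul_eq_mul] at *
    linarith
  have hqxy : ∀ p : U × U, IsQuadratic fun z => B z p.1 p.2 := fun p => by
    have h1 : (fun z => B z p.1 p.2)
        = fun z => (P.Φ (p.1 + p.2) z - P.Φ p.1 z) - (P.Φ p.2 z - P.Φ 0 z) := by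
      ext z
      simp only [hq, map_add, add_apply, map_zero]
      rw [hs z p.2 p.1]; ring
    rw [h1]
    exact ((hP.Φ_quadratic_z _).sub (hP.Φ_quadratic_z _)).sub
      ((hP.Φ_quadratic_z _).sub (hP.Φ_quadratic_z _))
  obtain ⟨l₂, l₁, hl₂⟩ := exists_quadratic_of_separating l
    (fun x : U => ContinuousLinearMap.apply ℝ ℝ x)
    (fun y hy => by ext x; simpa using hy x) hqx hl
  obtain ⟨B₂, B₁, hB₂⟩ := exists_quadratic_of_separating B
    (fun p : U × U => (ContinuousLinearMap.apply ℝ ℝ p.2).comp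
      (ContinuousLinearMap.apply ℝ U⋆ p.1))
    (fun y hy => by ext x x'; simpa using hy (x, x')) hqxy hB
  refine ⟨B 0, B₁, B₂, l 0, l₁, l₂, c₀, c₁, c₂, fun u z => ?_⟩
  have h1 : P.Φ 0 z = c z := by rw [hq]; simp
  rw [hq, ← h1, hc z, hB₂ z, hl₂ z]
  simp

set_option maxSynthPendingDepth 3 in
lemma contDiff_energy : ContDiff ℝ 3 P.energy := by
  obtain ⟨B, B₁, B₂, l, l₁, l₂, c, c₁, c₂, h⟩ := hP.exists_polynomial
  have h1 : P.energy = fun x : U × Z => (1 / 2) * ((1 / 2) * B₂ x.2 x.2 x.1 x.1 + B₁ x.2 x.1 x.1 + B x.1 x.1)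
        + ((1 / 2) * l₂ x.2 x.2 x.1 + l₁ x.2 x.1 + l x.1) + ((1 / 2) * c₂ x.2 x.2 + c₁ x.2 + c) :=
    funext fun x => h x.1 x.2
  rw [h1]
  fun_prop

end Admissible

end Problem

/-- Second order Taylor estimates, uniformly on a compact set. -/
lemma exists_taylor_bound {E : Type*} [NormedAddCommGroup E] [NormedSpace ℝ E] [CompleteSpace E]
    {f : E → ℝ} (hf : ContDiff ℝ 3 f) {S : Set E} (hS : IsCompact S) :
    ∃ K : ℝ, 0 ≤ K ∧ ∀ x ∈ S, ∀ y ∈ S,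
      ‖fderiv ℝ f y - fderiv ℝ f x - fderiv ℝ (fderiv ℝ f) x (y - x)‖ ≤ K * ‖y - x‖ ^ 2 ∧
      |f y - f x - fderiv ℝ f x (y - x) - (1 / 2) * fderiv ℝ (fderiv ℝ f) x (y - x) (y - x)|
        ≤ K * ‖y - x‖ ^ 3 := by
  have h1 : ContDiff ℝ 2 (fderiv ℝ f) := hf.fderiv_right (by norm_num)
  have h2 : ContDiff ℝ 1 (fderiv ℝ (fderiv ℝ f)) := h1.fderiv_right (by norm_num)
  have hc : Convex ℝ (closure (convexHull ℝ S)) := (convex_convexHull ℝ S).closure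
  have hSc : S ⊆ closure (convexHull ℝ S) := (subset_convexHull ℝ S).trans subset_closure
  obtain ⟨K, hK⟩ := h2.contDiffOn.exists_lipschitzOnWith one_ne_zero hc
    (hS.totallyBounded.convexHull.closure.isCompact_of_isClosed isClosed_closure)
  refine ⟨K, K.2, fun x hx y hy => ?_⟩
  have hseg : ∀ w ∈ segment ℝ x y, ‖w - x‖ ≤ ‖y - x‖ ∧ w ∈ closure (convexHull ℝ S) := fun w hw => by
    refine ⟨?_, hc.segment_subset (hSc hx) (hSc hy) hw⟩
    obtain ⟨s, hs, rfl⟩ := (segment_eq_image' ℝ x y ▸ hw)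
    rw [add_sub_cancel_left, norm_smul, norm_of_nonneg hs.1]
    exact mul_le_of_le_one_left (norm_nonneg _) hs.2
  have hL : ∀ w ∈ segment ℝ x y,
      ‖fderiv ℝ (fderiv ℝ f) w - fderiv ℝ (fderiv ℝ f) x‖ ≤ K * ‖y - x‖ := fun w hw => by
    exact (hK.norm_sub_le (hseg w hw).2 (hSc hx)).trans (by gcongr; exact (hseg w hw).1)
  have hd1 : ∀ w, HasFDerivAt (fderiv ℝ f) (fderiv ℝ (fderiv ℝ f) w) w := fun w =>
    (h1.differentiable (by norm_num) w).hasFDerivAt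
  have hd0 : ∀ w, HasFDerivAt f (fderiv ℝ f w) w := fun w =>
    (hf.differentiable (by norm_num) w).hasFDerivAt
  set A := fderiv ℝ (fderiv ℝ f) x
  have hfirst : ∀ w ∈ segment ℝ x y, ‖fderiv ℝ f w - fderiv ℝ f x - A (w - x)‖ ≤ K * ‖y - x‖ ^ 2 := by
    intro w hw
    have hsub : segment ℝ x w ⊆ segment ℝ x y :=
      (convex_segment x y).segment_subset (left_mem_segment ℝ x y) hw
    have := (convex_segment (𝕜 := ℝ) x w).norm_image_sub_le_of_norm_hasFDerivWithin_le
      (f := fun v => fderiv ℝ f v - A v) (f' := fun v => fderiv ℝ (fderiv ℝ f) v - A)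
      (C := K * ‖y - x‖)
      (fun v _ => ((hd1 v).sub A.hasFDerivAt).hasFDerivWithinAt)
      (fun v hv => hL v (hsub hv)) (left_mem_segment ℝ x w) (right_mem_segment ℝ x w)
    rw [show fderiv ℝ f w - fderiv ℝ f x - A (w - x)
        = (fderiv ℝ f w - A w) - (fderiv ℝ f x - A x) by rw [map_sub]; abel, pow_two, ← mul_assoc]
    exact this.trans (by gcongr; exact (hseg w hw).1)
  refine ⟨hfirst y (right_mem_segment ℝ x y), ?_⟩
  have hsymm : ∀ v w, A v w = A w v := fun v w =>
    (hf.contDiffAt.isSymmSndFDerivAt (by simp; norm_num)).eq v w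
  have := (convex_segment (𝕜 := ℝ) x y).norm_image_sub_le_of_norm_hasFDerivWithin_le
      (f := fun v => f v - fderiv ℝ f x v - (1 / 2) * A (v - x) (v - x))
      (f' := fun v => fderiv ℝ f v - fderiv ℝ f x - A (v - x))
      (C := K * ‖y - x‖ ^ 2)
      (fun v _ => by
        have h3 := hasFDerivAt_quadratic (q := fun v => (1 / 2) * A v v) (B := A) (l := 0) (c := 0)
          hsymm (by simp) (v - x)
        rw [add_zero] at h3
        exact (((hd0 v).sub (fderiv ℝ f x).hasFDerivAt).sub (HasFDerivAt.comp
          (g := fun v => (1 / 2) * A v v) v h3 ((hasFDerivAt_id v).sub_const x))).hasFDerivWithinAt)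
      hfirst (left_mem_segment ℝ x y) (right_mem_segment ℝ x y)
  rw [pow_succ, ← mul_assoc]
  refine le_trans (le_of_eq (congrArg _ ?_)) this
  rw [map_sub, sub_self, map_zero]
  ring

namespace Problem

/-- The derivative of the stored energy. -/
abbrev dE (P : Problem U H Z) (x : U × Z) : (U × Z)⋆ := fderiv ℝ P.energy x

/-- The second derivative of the stored energy. -/
abbrev d2E (P : Problem U H Z) (x : U × Z) : U × Z →L[ℝ] (U × Z)⋆ := fderiv ℝ (fderiv ℝ P.energy) x

/-- The symmetric second difference of the stored energy. -/
def secondDiff (P : Problem U H Z) (x h : U × Z) : ℝ :=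
  P.energy (x + h) + P.energy (x - h) - 2 * P.energy x

namespace Admissible

include hP

lemma hasFDerivAt_energy (x : U × Z) : HasFDerivAt P.energy (P.dE x) x :=
  (hP.contDiff_energy.differentiable (by norm_num) x).hasFDerivAt

lemma dE_apply (x y : U × Z) :
    P.dE x y = P.dΦu x.1 x.2 y.1 + P.dΦz x.1 x.2 y.2 := by
  have h1 : HasFDerivAt (fun w => P.Φ w x.2) ((P.dE x).comp (ContinuousLinearMap.inl ℝ U Z)) x.1 :=
    HasFDerivAt.comp (g := P.energy) x.1 (hP.hasFDerivAt_energy x) (hasFDerivAt_prodMk_left (𝕜 := ℝ) x.1 x.2)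
  have h2 : HasFDerivAt (fun w => P.Φ x.1 w) ((P.dE x).comp (ContinuousLinearMap.inr ℝ U Z)) x.2 :=
    HasFDerivAt.comp (g := P.energy) x.2 (hP.hasFDerivAt_energy x) (hasFDerivAt_prodMk_right (𝕜 := ℝ) x.1 x.2)
  rw [dΦu, dΦz, h1.fderiv, h2.fderiv]
  simp [← map_add]

lemma tendsto_dE {x : ℕ → U × Z} {a : U × Z} (h : WeaklyTendsto x a)
    (y : U × Z) : Tendsto (fun n => P.dE (x n) y) atTop (𝓝 (P.dE a y)) := by
  simp only [hP.dE_apply]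
  have h1 := h.map (ContinuousLinearMap.fst ℝ U Z)
  have h2 := h.map (ContinuousLinearMap.snd ℝ U Z)
  exact (hP.dΦu_weakly_cont _ _ _ _ h1 h2 (ContinuousLinearMap.apply ℝ ℝ y.1)).add
    (hP.dΦz_weakly_cont _ _ _ _ h1 h2 (ContinuousLinearMap.apply ℝ ℝ y.2))

set_option maxSynthPendingDepth 3 in
lemma exists_secondDiff_smul : ∃ (β : U × Z → ℝ) (C : ℝ), 0 ≤ C ∧ (∀ h, |β h| ≤ C * ‖h‖ ^ 4) ∧
    ∀ x h s, P.secondDiff x (s • h) = s ^ 2 * (P.secondDiff x h - β h) + s ^ 4 * β h := by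
  obtain ⟨B, B₁, B₂, l, l₁, l₂, c, c₁, c₂, hΦ⟩ := hP.exists_polynomial
  refine ⟨fun h => (1 / 2) * B₂ h.2 h.2 h.1 h.1, (1 / 2) * ‖B₂‖, by positivity, fun h => ?_, fun x h s => ?_⟩
  · have h1 : |B₂ h.2 h.2 h.1 h.1| ≤ ‖B₂‖ * ‖h.2‖ * ‖h.2‖ * ‖h.1‖ * ‖h.1‖ := by
      refine (le_opNorm₂ (B₂ h.2 h.2) _ _).trans ?_
      gcongr
      exact le_opNorm₂ B₂ _ _
    have h2 : ‖h.1‖ ≤ ‖h‖ := norm_fst_le h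
    have h3 : ‖h.2‖ ≤ ‖h‖ := norm_snd_le h
    rw [abs_mul, abs_of_pos (by norm_num : (0 : ℝ) < 1 / 2), mul_assoc]
    gcongr
    calc _ ≤ _ := h1
      _ ≤ ‖B₂‖ * ‖h‖ * ‖h‖ * ‖h‖ * ‖h‖ := by gcongr
      _ = ‖B₂‖ * ‖h‖ ^ 4 := by ring
  · obtain ⟨u, z⟩ := x
    obtain ⟨a, b⟩ := h
    simp only [secondDiff, energy, hΦ, Prod.fst_add, Prod.snd_add, Prod.fst_sub, Prod.snd_sub,
      Prod.smul_fst, Prod.smul_snd, map_add, map_sub, map_smul, add_apply, sub_apply, smul_apply,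
      smul_eq_mul]
    ring

lemma d2E_apply_self {β : U × Z → ℝ}
    (hβ : ∀ x h s, P.secondDiff x (s • h) = s ^ 2 * (P.secondDiff x h - β h) + s ^ 4 * β h)
    (x h : U × Z) : P.d2E x h h = P.secondDiff x h - β h := by
  let S := (fun s : ℝ => x + s • h) '' Icc (-1) 1
  obtain ⟨K, hK, hT⟩ := exists_taylor_bound hP.contDiff_energy
    (S := S) (isCompact_Icc.image (by fun_prop))
  have hS : ∀ s : ℝ, -1 ≤ s → s ≤ 1 → x + s • h ∈ S := fun s h1 h2 => ⟨s, ⟨h1, h2⟩, rfl⟩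
  have h0 : x ∈ S := by simpa using hS 0 (by norm_num) (by norm_num)
  set D := P.d2E x h h
  have key : ∀ s : ℝ, 0 < s → s ≤ 1 →
      |D - (P.secondDiff x h - β h)| ≤ s * (2 * K * ‖h‖ ^ 3) + s ^ 2 * |β h| := by
    intro s hs hs1
    have h1 := (hT x h0 _ (hS s (by linarith) hs1)).2
    have h2 := (hT x h0 _ (hS (-s) (by linarith) (by linarith))).2
    have h3 := hβ x h s
    rw [add_sub_cancel_left, norm_smul, Real.norm_eq_abs, abs_of_pos hs] at h1
    rw [add_sub_cancel_left, norm_smul, norm_neg, Real.norm_eq_abs, abs_of_pos hs] at h2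
    simp only [secondDiff, map_smul, smul_apply, smul_eq_mul, neg_smul, ← sub_eq_add_neg, map_neg,
      neg_apply, mul_neg, neg_neg] at h1 h2 h3
    refine le_of_mul_le_mul_left ?_ (pow_pos hs 2)
    have h5 := abs_le.1 h1
    have h6 := abs_le.1 h2
    have h7 := mul_le_mul_of_nonneg_left (neg_abs_le (β h)) (pow_pos hs 4).le
    have h8 := mul_le_mul_of_nonneg_left (le_abs_self (β h)) (pow_pos hs 4).le
    rw [← abs_of_pos (pow_pos hs 2), ← abs_mul, abs_of_pos (pow_pos hs 2), abs_le]
    simp only [secondDiff, D] at *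
    constructor <;> linarith
  have hlim : Continuous fun s : ℝ => s * (2 * K * ‖h‖ ^ 3) + s ^ 2 * |β h| := by fun_prop
  refine sub_eq_zero.1 (abs_nonpos_iff.1 (ge_of_tendsto
    (by simpa using (hlim.tendsto 0).mono_left (nhdsWithin_le_nhds (s := Ioi 0))) ?_))
  filter_upwards [Ioc_mem_nhdsGT one_pos] with s hs using key s hs.1 hs.2

/-- Second differences in weakly vanishing directions do not depend on the base point. -/
lemma tendsto_secondDiff_sub {h : ℕ → U × Z} (hh : WeaklyTendsto h 0) (x : U × Z) :
    Tendsto (fun n => P.secondDiff x (h n) - P.secondDiff 0 (h n)) atTop (𝓝 0) := by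
  have hmv : ∀ n, ∃ s ∈ Ioo (0 : ℝ) 1, P.secondDiff x (h n) - P.secondDiff 0 (h n)
      = P.dE (s • x + h n) x + P.dE (s • x - h n) x - 2 * P.dE (s • x) x := fun n => by
    have hd : ∀ s : ℝ, ∀ k : U × Z,
        HasDerivAt (fun s : ℝ => P.energy (s • x + k)) (P.dE (s • x + k) x) s := fun s k =>
      (hP.hasFDerivAt_energy _).comp_hasDerivAt s
        (by simpa using ((hasDerivAt_id s).smul_const x).add_const k)
    have hd' : ∀ s : ℝ, HasDerivAt (fun s : ℝ => P.secondDiff (s • x) (h n))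
        (P.dE (s • x + h n) x + P.dE (s • x - h n) x - 2 * P.dE (s • x) x) s := fun s => by
      have h1 := hd s (h n)
      have h2 := hd s (-h n)
      have h3 := hd s 0
      simp only [← sub_eq_add_neg, add_zero] at h1 h2 h3
      exact (h1.add h2).sub (h3.const_mul 2)
    obtain ⟨s, hs, hs'⟩ := exists_hasDerivAt_eq_slope _ _ one_pos
      (fun s _ => (hd' s).continuousAt.continuousWithinAt) (fun s _ => hd' s)
    exact ⟨s, hs, hs' ▸ by simp⟩
  choose s hs hs' using hmv
  refine tendsto_of_subseq_tendsto fun ns hns => ?_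
  obtain ⟨t, -, ms, hms, ht⟩ := isCompact_Icc.tendsto_subseq (x := fun n => s (ns n))
    (fun n => Ioo_subset_Icc_self (hs _))
  refine ⟨ms, ?_⟩
  have hk : WeaklyTendsto (fun n => h (ns (ms n))) 0 := hh.comp (hns.comp hms.tendsto_atTop)
  have hsx : WeaklyTendsto (fun n => s (ns (ms n)) • x) (t • x) := (ht.smul_const x).weaklyTendsto
  have h1 := hP.tendsto_dE (hsx.add hk) x
  have h2 := hP.tendsto_dE (hsx.add hk.neg) x
  have h3 := hP.tendsto_dE hsx x
  simp only [hs']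
  simp only [neg_zero, add_zero, ← sub_eq_add_neg] at h1 h2
  convert (h1.add h2).sub (h3.const_mul 2) using 2
  ring

lemma tendsto_d2E_sub {h : ℕ → U × Z} (hh : WeaklyTendsto h 0) (x : U × Z) :
    Tendsto (fun n => P.d2E x (h n) (h n) - P.d2E 0 (h n) (h n)) atTop (𝓝 0) := by
  obtain ⟨β, C, -, -, hβ⟩ := hP.exists_secondDiff_smul
  refine (hP.tendsto_secondDiff_sub hh x).congr fun n => ?_
  rw [hP.d2E_apply_self hβ, hP.d2E_apply_self hβ]; ring

lemma exists_form_prod : ∃ (B : U × Z →L[ℝ] (U × Z)⋆) (c : ℝ), 0 < c ∧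
    (∀ x y, B x y = B y x) ∧ ∀ x, c * ‖x‖ ^ 2 ≤ B x x := by
  obtain ⟨B, c, hc, hs, hB⟩ := hP.hilbertizable_U.exists_form
  obtain ⟨A, d, hd, hs', hA⟩ := hP.hilbertizable_Z.exists_form
  let f := ContinuousLinearMap.fst ℝ U Z
  let g := ContinuousLinearMap.snd ℝ U Z
  refine ⟨(B.comp f).flip.comp f + (A.comp g).flip.comp g, min c d, lt_min hc hd, fun x y => by
    simp [f, g, hs x.1 y.1, hs' x.2 y.2], fun x => ?_⟩
  have h3 : ((B.comp f).flip.comp f + (A.comp g).flip.comp g) x x = B x.1 x.1 + A x.2 x.2 := by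
    simp [f, g]
  have h4 := mul_le_mul_of_nonneg_right (min_le_left c d) (sq_nonneg ‖x.1‖)
  have h5 := mul_le_mul_of_nonneg_right (min_le_right c d) (sq_nonneg ‖x.2‖)
  have h6 := mul_nonneg hc.le (sq_nonneg ‖x.1‖)
  have h7 := mul_nonneg hd.le (sq_nonneg ‖x.2‖)
  rw [h3, Prod.norm_def]
  rcases max_cases ‖x.1‖ ‖x.2‖ with h | h <;> rw [h.1] <;> linarith [hB x.1, hA x.2]

/-- Coercivity of the energy makes its second derivative positive along weakly null sequences. -/
lemma not_weakly_null {h : ℕ → U × Z} (hh : WeaklyTendsto h 0)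
    (hle : ∀ ε : ℝ, 0 < ε → ∀ᶠ n in atTop, P.d2E 0 (h n) (h n) ≤ ε) {r : ℝ} (hr : 0 < r)
    (hrn : ∀ n, r ≤ ‖h n‖) : False := by
  obtain ⟨β, Cβ, hCβ, hβb, hβ⟩ := hP.exists_secondDiff_smul
  obtain ⟨N, c, hc, hNs, hN⟩ := hP.exists_form_prod
  obtain ⟨Ch, hCh⟩ := hh.bounded
  obtain ⟨R₀, hR₀⟩ := hP.superlinear 1
  let R := max R₀ (|P.energy 0| + 1)
  have hR : 0 < R := lt_of_lt_of_le (by positivity) (le_max_right _ _)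
  let ρ := (‖N‖ + 1) * R ^ 2
  have hρ : 0 < ρ := by positivity
  have hNub : ∀ x, N x x ≤ ‖N‖ * ‖x‖ ^ 2 := fun x => by
    rw [pow_two, ← mul_assoc]; exact (le_abs_self _).trans (N.le_opNorm₂ x x)
  have hN0 : ∀ x, 0 ≤ N x x := fun x => le_trans (by positivity) (hN x)
  have hfar : ∀ x, ρ ≤ N x x → P.energy 0 + 1 ≤ P.energy x := fun x hx => by
    have h1 : R ≤ ‖x‖ := not_lt.1 fun hlt => by
      have h1 := mul_le_mul_of_nonneg_left (pow_le_pow_left₀ (norm_nonneg _) hlt.le 2) (norm_nonneg N)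
      have h2 := pow_pos hR 2
      linarith [hNub x]
    have h2 := h1.trans (max_le_add_of_nonneg (norm_nonneg x.1) (norm_nonneg x.2))
    have h3 := hR₀ x.1 x.2 ((le_max_left _ _).trans h2)
    have h4 : |P.energy 0| + 1 ≤ R := le_max_right _ _
    change _ ≤ P.Φ x.1 x.2
    linarith [le_abs_self (P.energy 0)]
  let ε := 1 / (8 * ρ)
  have hε : 0 < ε := by positivity
  have hερ : ε * (4 * ρ) = 1 / 2 := by simp only [ε]; field_simp; norm_num
  let J : {x : U × Z // N x x ≤ 4 * ρ} → ℝ := fun x => P.energy x - ε * N x x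
  have hbdd : BddBelow (range J) := by
    obtain ⟨C, hC, hb⟩ := hP.exists_bound_Φ √(4 * ρ / c)
    refine ⟨-C - 1 / 2, ?_⟩
    rintro _ ⟨x, rfl⟩
    have h1 : ‖x.1‖ ≤ √(4 * ρ / c) := Real.le_sqrt_of_sq_le (by
      rw [le_div_iff₀ hc]; linarith [hN x.1, x.2])
    have h2 := hb x.1.1 x.1.2 ((norm_fst_le _).trans h1) ((norm_snd_le _).trans h1)
    have h3 : ε * N x.1 x.1 ≤ ε * (4 * ρ) := by gcongr; exact x.2
    change _ ≤ P.Φ x.1.1 x.1.2 - _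
    linarith [(abs_le.1 h2).1]
  have : Nonempty {x : U × Z // N x x ≤ 4 * ρ} := ⟨⟨0, by simp; positivity⟩⟩
  let m := ⨅ x, J x
  have hm : ∀ x, N x x ≤ 4 * ρ → m ≤ P.energy x - ε * N x x := fun x hx => ciInf_le hbdd ⟨x, hx⟩
  have hChn : 0 < Ch := hr.trans_le ((hrn 0).trans (hCh 0))
  have hlim (a : ℝ) {b : ℝ} (hb : 0 < b) : ∀ᶠ δ in 𝓝[>] (0 : ℝ), δ ^ 2 * a < b :=
    nhdsWithin_le_nhds ((Continuous.tendsto' (by fun_prop) 0 0 (by simp)).eventually_lt_const hb)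
  obtain ⟨δ, hδ1, hδ2, hδ⟩ := ((hlim (‖N‖ * Ch ^ 2) hρ).and ((hlim (Cβ * Ch ^ 4)
    (show 0 < ε * c * r ^ 2 / 2 by positivity)).and self_mem_nhdsWithin)).exists
  replace hδ : 0 < δ := hδ
  let η := min (1 / 2) (δ ^ 2 * (ε * c * r ^ 2) / 8)
  have hη : 0 < η := by positivity
  obtain ⟨⟨x, hxD⟩, hx⟩ := exists_lt_of_ciInf_lt (lt_add_of_pos_right (⨅ x, J x) hη)
  simp only [J] at hx
  have hm0 := hm 0 (by simp; positivity)
  have hxρ : N x x < ρ := by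
    by_contra hcon
    push Not at hcon
    have h1 := hfar x hcon
    have h2 : ε * N x x ≤ ε * (4 * ρ) := by gcongr
    have h3 : η ≤ 1 / 2 := min_le_left _ _
    simp only [map_zero, mul_zero, sub_zero] at hm0
    change P.energy x - ε * N x x < m + η at hx
    linarith
  have hpert : ∀ n, -2 * η ≤ P.secondDiff x (δ • h n) - 2 * ε * (δ ^ 2 * N (h n) (h n)) := fun n => by
    have hNh : δ ^ 2 * N (h n) (h n) ≤ ρ := by
      refine le_trans ?_ hδ1.le
      gcongr
      exact (hNub _).trans (by gcongr; exact hCh n)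
    have e1 : N (x + δ • h n) (x + δ • h n) = N x x + 2 * (δ * N x (h n)) + δ ^ 2 * N (h n) (h n) := by
      simp [hNs (h n) x]; ring
    have e2 : N (x - δ • h n) (x - δ • h n) = N x x - 2 * (δ * N x (h n)) + δ ^ 2 * N (h n) (h n) := by
      simp [hNs (h n) x]; ring
    have p1 := hN0 (x + δ • h n)
    have p2 := hN0 (x - δ • h n)
    have h1 := hm (x + δ • h n) (by rw [e2] at p2; rw [e1]; linarith)
    have h2 := hm (x - δ • h n) (by rw [e1] at p1; rw [e2]; linarith)
    rw [e1] at h1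
    rw [e2] at h2
    change P.energy x - ε * N x x < m + η at hx
    simp only [secondDiff]
    linarith
  have hev1 := (hP.tendsto_secondDiff_sub (by simpa using hh.smul δ) x).eventually_lt_const
    (show (0 : ℝ) < δ ^ 2 * (ε * c * r ^ 2) / 4 by positivity)
  obtain ⟨n, h1, h2⟩ := (hev1.and (hle (ε * c * r ^ 2 / 4) (by positivity))).exists
  have h3 := hpert n
  have h4 := hβ 0 (h n) δ
  rw [← hP.d2E_apply_self hβ] at h4
  have h5 : c * r ^ 2 ≤ N (h n) (h n) := le_trans (by gcongr; exact hrn n) (hN (h n))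
  have h6 : δ ^ 4 * β (h n) ≤ δ ^ 2 * (δ ^ 2 * (Cβ * Ch ^ 4)) := by
    have : β (h n) ≤ Cβ * Ch ^ 4 := (le_abs_self _).trans ((hβb _).trans (by gcongr; exact hCh n))
    calc δ ^ 4 * β (h n) ≤ δ ^ 4 * (Cβ * Ch ^ 4) := by gcongr
      _ = _ := by ring
  have h7 : δ ^ 2 * (δ ^ 2 * (Cβ * Ch ^ 4)) ≤ δ ^ 2 * (ε * c * r ^ 2 / 2) := by gcongr
  have h8 : η ≤ δ ^ 2 * (ε * c * r ^ 2) / 8 := min_le_right _ _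
  have h9 : 2 * ε * (δ ^ 2 * (c * r ^ 2)) ≤ 2 * ε * (δ ^ 2 * N (h n) (h n)) := by gcongr
  have h10 : δ ^ 2 * P.d2E 0 (h n) (h n) ≤ δ ^ 2 * (ε * c * r ^ 2 / 4) := by gcongr
  have h11 : 0 < δ ^ 2 * (ε * c * r ^ 2) := by positivity
  nlinarith

end Admissible

end Problem

lemma WeaklyTendsto.prodMk {Y : Type*} [NormedAddCommGroup Y] [NormedSpace ℝ Y] [CompleteSpace Y]
    {x : ℕ → X} {y : ℕ → Y} {a : X} {b : Y}
    (hx : WeaklyTendsto x a) (hy : WeaklyTendsto y b) :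
    WeaklyTendsto (fun n => (x n, y n)) (a, b) := by
  simpa using (hx.map (ContinuousLinearMap.inl ℝ X Y)).add (hy.map (ContinuousLinearMap.inr ℝ X Y))

namespace Problem

namespace Admissible

include hP

lemma exists_d2E_pos (x : U × Z) :
    ∃ c : ℝ, 0 < c ∧ ∀ b, c * ‖b‖ ^ 2 ≤ P.d2E x (0, b) (0, b) := by
  obtain ⟨B, l, c, hs, hq⟩ := hP.exists_form_z x.1
  obtain ⟨c₀, hc₀, hB⟩ := hP.coercive_z x.1 hq
  refine ⟨c₀, hc₀, fun b => (hB b).trans (le_of_eq ?_)⟩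
  obtain ⟨β, C, -, -, hβ⟩ := hP.exists_secondDiff_smul
  have h1 : ∀ s : ℝ, P.secondDiff x (s • (0, b)) = s ^ 2 * B b b := fun s => by
    simp only [secondDiff, energy, Prod.fst_add, Prod.snd_add, Prod.fst_sub, Prod.snd_sub,
      Prod.smul_fst, Prod.smul_snd, smul_zero, add_zero, sub_zero, hq, map_add, map_sub, map_smul,
      add_apply, sub_apply, smul_apply, smul_eq_mul]
    rw [hs b x.2]; ring
  rw [hP.d2E_apply_self hβ]
  have h3 := hβ x (0, b) 2
  have h4 := h1 1
  rw [one_smul] at h4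
  rw [h1, h4] at h3
  linarith

set_option maxSynthPendingDepth 3 in
set_option maxHeartbeats 400000 in
/-- Relative energy estimate on compact sets: the Bregman distance of the stored energy controls
the norm, up to a lower order term in `u`. -/
lemma exists_bregman_bound {S : Set ((U × Z) × (U × Z))} (hS : IsCompact S) :
    ∃ c C : ℝ, 0 < c ∧ 0 ≤ C ∧ ∀ p ∈ S, c * ‖p.1 - p.2‖ ^ 2
      ≤ P.energy p.1 - P.energy p.2 - P.dE p.2 (p.1 - p.2) + C * ‖P.emb (p.1.1 - p.2.1)‖ ^ 2 := by
  by_contra hcon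
  push Not at hcon
  obtain ⟨x, y, s, q, a, b, hxS, hx, hy, hw, hs, hs0, hxy⟩ : ∃ (x y : ℕ → U × Z) (s : ℕ → ℝ)
      (q : (U × Z) × (U × Z)) (a : U) (b : Z), (∀ n, (x n, y n) ∈ S) ∧ Tendsto x atTop (𝓝 q.1) ∧ Tendsto y atTop (𝓝 q.2) ∧
      WeaklyTendsto (fun n => ‖x n - y n‖⁻¹ • (x n - y n)) (a, b) ∧ Tendsto s atTop atTop ∧
      (∀ n, 0 < s n) ∧ ∀ n, P.energy (x n) - P.energy (y n) - P.dE (y n) (x n - y n)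
        + s n * ‖P.emb ((x n).1 - (y n).1)‖ ^ 2 < (s n)⁻¹ * ‖x n - y n‖ ^ 2 := by
    choose p hpS hp using fun n : ℕ => hcon ((n : ℝ) + 1)⁻¹ (n + 1) (by positivity) (by positivity)
    obtain ⟨q, -, φ, hφ, hq⟩ := hS.tendsto_subseq hpS
    let h (n : ℕ) := ‖(p n).1 - (p n).2‖⁻¹ • ((p n).1 - (p n).2)
    have hh (n) : ‖h n‖ ≤ 1 := by rw [norm_smul, norm_inv, norm_norm]; exact inv_mul_le_one
    obtain ⟨ψ, hψ, a, b, ha, hb⟩ := hP.exists_subseq_pair (fun n => (h (φ n)).1)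
      (fun n => (h (φ n)).2) (fun n => (norm_fst_le _).trans (hh _))
      (fun n => (norm_snd_le _).trans (hh _))
    replace hq := hq.comp hψ.tendsto_atTop
    exact ⟨fun n => (p (φ (ψ n))).1, fun n => (p (φ (ψ n))).2, fun n => φ (ψ n) + 1, q, a, b,
      fun n => hpS _, (continuous_fst.tendsto q).comp hq, (continuous_snd.tendsto q).comp hq, ha.prodMk hb,
      tendsto_atTop_add_const_right _ _
        (tendsto_natCast_atTop_atTop.comp (hφ.comp hψ).tendsto_atTop), fun n => by positivity,
      fun n => hp _⟩
  obtain ⟨r, hrdef⟩ : ∃ r : ℕ → ℝ, ∀ n, ‖x n - y n‖ = r n := ⟨_, fun _ => rfl⟩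
  have hrq : Tendsto r atTop (𝓝 ‖q.1 - q.2‖) := ((hx.sub hy).norm).congr hrdef
  have hsi : Tendsto (fun n => (s n)⁻¹) atTop (𝓝 0) := hs.inv_tendsto_atTop
  simp only [hrdef] at hw hxy
  have hcE := hP.contDiff_energy.continuous
  have hcD : Continuous (fderiv ℝ P.energy) := hP.contDiff_energy.continuous_fderiv (by norm_num)
  by_cases hqq : q.1 = q.2
  · have hr (n) : 0 < r n := by
      rw [← hrdef]
      refine norm_pos_iff.2 fun h0 => ?_
      have h1 := hxy n
      rw [← hrdef, sub_eq_zero.1 h0] at h1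
      simp at h1
    obtain ⟨h, hh⟩ : ∃ h : ℕ → U × Z, ∀ n, (r n)⁻¹ • (x n - y n) = h n := ⟨_, fun _ => rfl⟩
    have hhr (n) : x n - y n = r n • h n := by
      rw [← hh, smul_smul, mul_inv_cancel₀ (hr n).ne', one_smul]
    have hh1 (n) : ‖h n‖ = 1 := by
      rw [← hh, norm_smul, norm_inv, norm_of_nonneg (hr n).le, hrdef, inv_mul_cancel₀ (hr n).ne']
    simp only [hh] at hw
    obtain ⟨K, hK, hT⟩ := exists_taylor_bound hP.contDiff_energy
      ((hS.image continuous_fst).union (hS.image continuous_snd))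
    rw [hqq] at hx
    rw [hqq, sub_self, norm_zero] at hrq
    set D := P.d2E q.2
    obtain ⟨D', hD'⟩ : ∃ D' : ℕ → U × Z →L[ℝ] (U × Z)⋆, ∀ n, P.d2E (y n) = D' n := ⟨_, fun _ => rfl⟩
    have hA : Tendsto D' atTop (𝓝 D) :=
      ((((hP.contDiff_energy.fderiv_right (m := 2) (by norm_num)).continuous_fderiv
        (by norm_num)).tendsto q.2).comp hy).congr hD'
    have hop (B : U × Z →L[ℝ] (U × Z)⋆) (n) : |B (h n) (h n)| ≤ ‖B‖ := by
      simpa [hh1] using le_opNorm₂ B (h n) (h n)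
    have hquad (n) : (1 / 2) * D' n (h n) (h n) + s n * ‖P.emb (h n).1‖ ^ 2
        ≤ K * r n + (s n)⁻¹ := by
      have h3 := (abs_le.1 (hT _ (.inr ⟨_, hxS n, rfl⟩) _ (.inl ⟨_, hxS n, rfl⟩)).2).1
      have h4 := hxy n
      have hr' := hr n
      rw [← Prod.fst_sub, hhr, Prod.smul_fst, map_smul P.emb, norm_smul, norm_of_nonneg hr'.le] at h4
      rw [hhr, norm_smul, hh1, norm_of_nonneg hr'.le, mul_one] at h3
      simp only [map_smul, smul_apply, smul_eq_mul, hD'] at h3 h4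
      have h7 : r n ^ 2 * ((1 / 2) * D' n (h n) (h n) + s n * ‖P.emb (h n).1‖ ^ 2)
          ≤ r n ^ 2 * (K * r n + (s n)⁻¹) := by nlinarith
      exact le_of_mul_le_mul_left h7 (by positivity)
    have hLn : Tendsto (fun n => ‖P.emb (h n).1‖) atTop (𝓝 0) := by
      have h2 : Tendsto (fun n => ‖P.emb (h n).1‖ ^ 2) atTop (𝓝 0) := by
        refine squeeze_zero (fun n => by positivity) (fun n => ?_)
          ((((hrq.const_mul K).add hsi).add hA.norm).div_atTop hs)
        rw [le_div_iff₀ (hs0 n)]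
        linarith [hquad n, (abs_le.1 (hop (D' n) n)).1, norm_nonneg (D' n)]
      simpa [Real.sqrt_sq] using h2.sqrt
    obtain rfl : a = 0 := by
      have h1 : WeaklyTendsto (fun n => P.emb (h n).1) 0 :=
        (tendsto_zero_iff_norm_tendsto_zero.2 hLn).weaklyTendsto
      have h2 := ((hw.map (ContinuousLinearMap.fst ℝ U Z)).map P.emb).unique h1
      exact hP.emb_injective (h2.trans (map_zero _).symm)
    have hle : ∀ ε : ℝ, 0 < ε → ∀ᶠ n in atTop, D (h n) (h n) ≤ ε := by
      intro ε hε
      have h0 := (((hrq.const_mul K).add hsi).const_mul 2).add ((tendsto_const_nhds (x := D)).sub hA).norm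
      simp only [sub_self, norm_zero, mul_zero, add_zero] at h0
      filter_upwards [h0.eventually_lt_const hε] with n h2
      have h4 := (le_abs_self _).trans (hop (D - D' n) n)
      simp only [sub_apply] at h4
      linarith [hquad n, mul_nonneg (hs0 n).le (sq_nonneg ‖P.emb (h n).1‖)]
    obtain ⟨c, hc, hcb⟩ := hP.exists_d2E_pos q.2
    have hkw : WeaklyTendsto (fun n => h n - (0, b)) 0 := by
      have := hw.add (weaklyTendsto_const (-((0, b) : U × Z)))
      rw [add_neg_cancel] at this
      simpa only [sub_eq_add_neg] using this
    have hkle : ∀ ε : ℝ, 0 < ε → ∀ᶠ n in atTop,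
        D (h n - (0, b)) (h n - (0, b)) ≤ ε - c * ‖b‖ ^ 2 := by
      intro ε hε
      have h0 : 0 < ε / 3 := by positivity
      filter_upwards [hle (ε / 3) h0, (hw (D.flip (0, b))).eventually_const_lt (sub_lt_self _ h0),
        (hw (D (0, b))).eventually_const_lt (sub_lt_self _ h0)] with n h3 h4 h5
      have h6 := hcb b
      simp only [map_sub, sub_apply, ContinuousLinearMap.flip_apply] at h4 ⊢
      linarith
    have hsmall : ∀ ρ : ℝ, 0 < ρ → ∃ᶠ n in atTop, ‖h n - (0, b)‖ < ρ := by
      intro ρ hρ hcon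
      obtain ⟨N, hN⟩ := eventually_atTop.1 hcon
      refine hP.not_weakly_null (h := fun n => h (n + N) - (0, b)) (hkw.comp
        (tendsto_add_atTop_nat N)) (fun ε hε => ?_) hρ fun n => not_lt.1 (hN (n + N) (by omega))
      suffices h0 : ∀ᶠ n in atTop, P.d2E 0 (h n - (0, b)) (h n - (0, b)) ≤ ε from
        (tendsto_add_atTop_nat N).eventually h0
      filter_upwards [hkle (ε / 2) (by positivity),
        (hP.tendsto_d2E_sub hkw q.2).eventually_const_lt (show -(ε / 2) < 0 by linarith)] with n h1 h2
      linarith [mul_nonneg hc.le (sq_nonneg ‖b‖)]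
    have hb2 : c * ‖b‖ ^ 2 ≤ 0 := le_of_forall_pos_le_add fun ε hε => by
      obtain ⟨n, h1, h2⟩ := ((hsmall √(ε / 2 / (‖D‖ + 1)) (by positivity)).and_eventually
        (hkle _ (half_pos hε))).exists
      rw [Real.lt_sqrt (norm_nonneg _), lt_div_iff₀ (by positivity)] at h1
      have h3 := (abs_le.1 (le_opNorm₂ D (h n - (0, b)) (h n - (0, b)))).1
      nlinarith
    obtain rfl : b = 0 := by
      by_contra hb0
      have := norm_pos_iff.2 hb0
      exact hb2.not_gt (by positivity)
    obtain ⟨n, hn⟩ := (hsmall 1 one_pos).exists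
    rw [Prod.mk_zero_zero, sub_zero, hh1] at hn
    exact lt_irrefl _ hn
  · have hq : Tendsto (fun n => (x n, y n)) atTop (𝓝 q) := hx.prodMk_nhds hy
    have hG : Tendsto (fun n => P.energy (x n) - P.energy (y n) - P.dE (y n) (x n - y n)) atTop
        (𝓝 (P.energy q.1 - P.energy q.2 - P.dE q.2 (q.1 - q.2))) := by
      have : Continuous fun p : (U × Z) × (U × Z) =>
          P.energy p.1 - P.energy p.2 - P.dE p.2 (p.1 - p.2) := by
        unfold dE
        fun_prop
      simpa only [Function.comp_def] using (this.tendsto q).comp hq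
    have hrhs := hsi.mul (hrq.pow 2)
    rw [zero_mul] at hrhs
    have hL : Tendsto (fun n => ‖P.emb ((x n).1 - (y n).1)‖ ^ 2) atTop
        (𝓝 (‖P.emb (q.1.1 - q.2.1)‖ ^ 2)) := by
      have : Continuous fun p : (U × Z) × (U × Z) => ‖P.emb (p.1.1 - p.2.1)‖ ^ 2 := by fun_prop
      simpa only [Function.comp_def] using (this.tendsto q).comp hq
    have hL0 : ‖P.emb (q.1.1 - q.2.1)‖ ^ 2 ≤ 0 := by
      refine le_of_tendsto_of_tendsto hL ((hrhs.sub hG).div_atTop hs) (.of_forall fun n => ?_)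
      rw [le_div_iff₀ (hs0 n)]
      linarith [hxy n]
    have hu : q.1.1 = q.2.1 := by
      have h1 : ‖P.emb (q.1.1 - q.2.1)‖ = 0 := by
        nlinarith [norm_nonneg (P.emb (q.1.1 - q.2.1))]
      exact sub_eq_zero.1 (hP.emb_injective (by rw [norm_eq_zero.1 h1, map_zero]))
    have hG0 : P.energy q.1 - P.energy q.2 - P.dE q.2 (q.1 - q.2) ≤ 0 :=
      le_of_tendsto_of_tendsto hG hrhs (.of_forall fun n => by
        linarith [hxy n, mul_nonneg (hs0 n).le (sq_nonneg ‖P.emb ((x n).1 - (y n).1)‖)])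
    obtain ⟨B, l, c, hs, hqz⟩ := hP.exists_form_z q.2.1
    obtain ⟨c₀, hc₀, hB⟩ := hP.coercive_z q.2.1 hqz
    have hz := norm_pos_iff.2 fun h0 => hqq (Prod.ext hu (sub_eq_zero.1 h0))
    have h1 := hB (q.1.2 - q.2.2)
    have h2 : 0 < c₀ * ‖q.1.2 - q.2.2‖ ^ 2 := by positivity
    rw [hP.dE_apply] at hG0
    have h3 : P.dΦz q.2.1 q.2.2 = B q.2.2 + l := (hasFDerivAt_quadratic hs hqz _).fderiv
    have h4 := hs q.1.2 q.2.2
    simp only [energy, hu, Prod.fst_sub, Prod.snd_sub, sub_self, map_zero, hqz, h3, map_sub,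
      add_apply, sub_apply] at hG0 h1
    linarith

end Admissible

end Problem

section Averages

lemma IsConvex.apply_integral_le {Ψ : X → ℝ≥0∞} (hc : IsConvex Ψ)
    (hl : LowerSemicontinuous Ψ) {α : Type*} [MeasurableSpace α] {ν : Measure α}
    [IsProbabilityMeasure ν] {f : α → X} (hf : Integrable f ν) :
    Ψ (∫ x, f x ∂ν) ≤ ∫⁻ x, Ψ (f x) ∂ν := by
  borelize X
  have hm : AEMeasurable (fun x => Ψ (f x)) ν := hl.measurable.comp_aemeasurable hf.1.aemeasurable
  by_cases htop : ∫⁻ x, Ψ (f x) ∂ν = ∞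
  · rw [htop]; exact le_top
  have hfin := ae_lt_top' hm htop
  have hgi : Integrable (fun x => (Ψ (f x)).toReal) ν := integrable_toReal_of_lintegral_ne_top hm htop
  let s : Set (X × ℝ) := {p | Ψ p.1 ≤ ofReal p.2 ∧ 0 ≤ p.2}
  have hsc : IsClosed s := by
    refine IsClosed.inter ?_ (isClosed_le continuous_const continuous_snd)
    exact hl.isClosed_epigraph.preimage (f := fun p : X × ℝ => (p.1, ofReal p.2))
      (continuous_fst.prodMk (ENNReal.continuous_ofReal.comp continuous_snd))
  have hs : Convex ℝ s := by
    rintro ⟨x, r⟩ ⟨hx, hr⟩ ⟨y, q⟩ ⟨hy, hq⟩ a b ha hb hab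
    refine ⟨?_, by simpa using add_nonneg (mul_nonneg ha hr) (mul_nonneg hb hq)⟩
    simp only [Prod.smul_mk, Prod.mk_add_mk, smul_eq_mul]
    rw [ofReal_add (mul_nonneg ha hr) (mul_nonneg hb hq), ofReal_mul ha, ofReal_mul hb]
    refine (hc x y a b ha hb hab).trans ?_
    gcongr
  have := hs.integral_mem hsc (μ := ν) (f := fun x => (f x, (Ψ (f x)).toReal)) (by
    filter_upwards [hfin] with x hx
    exact ⟨by simp [ofReal_toReal hx.ne], toReal_nonneg⟩) (hf.prodMk hgi)
  rw [integral_pair hf hgi] at this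
  refine this.1.trans_eq ?_
  simp only
  rw [integral_toReal hm hfin, ofReal_toReal htop]

/-- The averages over `(α t, α t + h]` are admissible: the windows contain `t` and overlap
boundedly. -/
structure IsWindow (h : ℝ) (α : ℝ → ℝ) : Prop where
  pos : 0 < h
  meas : Measurable α
  le : ∀ t, α t ≤ t
  le_add : ∀ t, t ≤ α t + h
  overlap : ∀ s, volume {t | α t < s ∧ s ≤ α t + h} ≤ ofReal h

/-- Averages of `f` over windows of length `h`. -/
def avg (h : ℝ) (α : ℝ → ℝ) (f : ℝ → X) (t : ℝ) : X := h⁻¹ • ∫ s in (α t)..(α t + h), f s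

lemma isWindow_forward {h : ℝ} (hh : 0 < h) : IsWindow h (fun t => t) where
  pos := hh
  meas := measurable_id
  le _ := le_rfl
  le_add _ := by linarith
  overlap s := by
    refine (measure_mono (t := Icc (s - h) s) ?_).trans (by simp)
    rintro t ⟨h1, h2⟩
    constructor <;> linarith

lemma isWindow_backward {h : ℝ} (hh : 0 < h) : IsWindow h (fun t => t - h) where
  pos := hh
  meas := measurable_id.sub_const h
  le _ := by linarith
  le_add _ := by linarith
  overlap s := by
    refine (measure_mono (t := Icc s (s + h)) ?_).trans (by simp)
    rintro t ⟨h1, h2⟩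
    constructor <;> linarith

/-- Left end of the cell of length `τ` containing `t`. -/
def cellLeft (τ t : ℝ) : ℝ := ((⌈t / τ⌉ : ℝ) - 1) * τ

lemma cellLeft_bounds {τ : ℝ} (hτ : 0 < τ) (t : ℝ) : cellLeft τ t ≤ t ∧ t ≤ cellLeft τ t + τ := by
  have h1 := mul_le_mul_of_nonneg_right (Int.ceil_lt_add_one (t / τ)).le hτ.le
  have h2 := mul_le_mul_of_nonneg_right (Int.le_ceil (t / τ)) hτ.le
  rw [add_mul, div_mul_cancel₀ _ hτ.ne'] at h1
  rw [div_mul_cancel₀ _ hτ.ne'] at h2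
  unfold cellLeft
  constructor <;> linarith

lemma isWindow_cell {τ : ℝ} (hτ : 0 < τ) : IsWindow τ (cellLeft τ) where
  pos := hτ
  meas := by
    have : Measurable fun t : ℝ => (⌈t / τ⌉ : ℝ) :=
      (measurable_from_top (f := fun n : ℤ => (n : ℝ))).comp
        (Int.measurable_ceil.comp (measurable_id.div_const τ))
    exact (this.sub_const 1).mul_const τ
  le t := (cellLeft_bounds hτ t).1
  le_add t := (cellLeft_bounds hτ t).2
  overlap s := by
    refine (measure_mono (t := Icc (cellLeft τ s) (cellLeft τ s + τ)) ?_).trans (by simp)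
    rintro t ⟨h1, h2⟩
    have h3 : ⌈s / τ⌉ = ⌈t / τ⌉ := by
      unfold cellLeft at h1 h2
      rw [Int.ceil_eq_iff, lt_div_iff₀ hτ, div_le_iff₀ hτ]
      exact ⟨h1, by linarith⟩
    unfold cellLeft
    rw [h3]
    exact cellLeft_bounds hτ t

lemma _root_.MeasureTheory.LocallyIntegrable.intervalIntegrable' {f : ℝ → X} (hf : LocallyIntegrable f) (a b : ℝ) :
    IntervalIntegrable f volume a b :=
  (hf.integrableOn_isCompact isCompact_uIcc).intervalIntegrable

lemma stronglyMeasurable_avg {h : ℝ} {α : ℝ → ℝ} (hw : IsWindow h α) {f : ℝ → X}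
    (hf : LocallyIntegrable f) : StronglyMeasurable (avg h α f) := by
  have hi := hf.intervalIntegrable'
  have hc : Continuous fun x => ∫ s in 0..x, f s :=
    intervalIntegral.continuous_primitive (fun a b => hi a b) 0
  have : avg h α f = fun t => h⁻¹ • ((∫ s in 0..(α t + h), f s) - ∫ s in 0..(α t), f s) := by
    funext t
    rw [avg, integral_interval_sub_left (hi _ _) (hi _ _)]
  rw [this]
  exact ((hc.stronglyMeasurable.comp_measurable (hw.meas.add_const h)).sub
    (hc.stronglyMeasurable.comp_measurable hw.meas)).const_smul _

lemma lintegral_window_le {h : ℝ} {α : ℝ → ℝ} (hw : IsWindow h α) {S S' : Set ℝ}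
    (hS : MeasurableSet S) (hS' : MeasurableSet S')
    (hsub : ∀ t ∈ S, Ioc (α t) (α t + h) ⊆ S') {G : ℝ → ℝ≥0∞}
    (hG : AEMeasurable G (volume.restrict S')) :
    ∫⁻ t in S, (ofReal h)⁻¹ * ∫⁻ s in Ioc (α t) (α t + h), G s ≤ ∫⁻ s in S', G s := by
  have hh := hw.pos
  have h0 : ofReal h ≠ 0 := by simpa using hh
  -- replace `G` by a measurable function vanishing outside `S'`
  let G' : ℝ → ℝ≥0∞ := S'.indicator (hG.mk G)
  have hG' : Measurable G' := hG.measurable_mk.indicator hS'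
  have e1 : ∫⁻ s in S', G s = ∫⁻ s, G' s := by
    rw [lintegral_indicator hS']
    exact lintegral_congr_ae hG.ae_eq_mk
  have e2 : ∀ t ∈ S, ∫⁻ s in Ioc (α t) (α t + h), G s
      = ∫⁻ s, (Ioc (α t) (α t + h)).indicator G' s := by
    intro t ht
    rw [lintegral_indicator measurableSet_Ioc]
    apply lintegral_congr_ae
    have := ae_restrict_of_ae_restrict_of_subset (hsub t ht) hG.ae_eq_mk
    filter_upwards [this, ae_restrict_mem measurableSet_Ioc] with s hs hs'
    simp [G', hs, indicator_of_mem (hsub t ht hs')]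
  rw [e1]
  calc ∫⁻ t in S, (ofReal h)⁻¹ * ∫⁻ s in Ioc (α t) (α t + h), G s
      = ∫⁻ t in S, (ofReal h)⁻¹ * ∫⁻ s, (Ioc (α t) (α t + h)).indicator G' s :=
        setLIntegral_congr_fun hS (fun t ht => by simp only [e2 t ht])
    _ ≤ ∫⁻ t, (ofReal h)⁻¹ * ∫⁻ s, (Ioc (α t) (α t + h)).indicator G' s :=
        setLIntegral_le_lintegral _ _
    _ = (ofReal h)⁻¹ * ∫⁻ t, ∫⁻ s, (Ioc (α t) (α t + h)).indicator G' s :=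
        lintegral_const_mul' _ _ (by simpa using hh)
    _ = (ofReal h)⁻¹ * ∫⁻ s, ∫⁻ t, (Ioc (α t) (α t + h)).indicator G' s := by
        rw [lintegral_lintegral_swap]
        have hm : MeasurableSet {p : ℝ × ℝ | α p.1 < p.2 ∧ p.2 ≤ α p.1 + h} :=
          (measurableSet_lt (hw.meas.comp measurable_fst) measurable_snd).inter
            (measurableSet_le measurable_snd ((hw.meas.comp measurable_fst).add_const h))
        exact ((hG'.comp measurable_snd).indicator hm).aemeasurable
    _ ≤ (ofReal h)⁻¹ * ∫⁻ s, ofReal h * G' s := by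
        gcongr with s
        have hm : MeasurableSet {t | α t < s ∧ s ≤ α t + h} :=
          (measurableSet_lt hw.meas measurable_const).inter
            (measurableSet_le measurable_const (hw.meas.add_const h))
        have : (fun t => (Ioc (α t) (α t + h)).indicator G' s)
            = {t | α t < s ∧ s ≤ α t + h}.indicator fun _ => G' s := by
          funext t; simp [indicator, mem_Ioc]
        rw [this, lintegral_indicator hm, setLIntegral_const, mul_comm]
        gcongr
        exact hw.overlap s
    _ = ∫⁻ s, G' s := by
        rw [lintegral_const_mul _ hG', ← mul_assoc, ENNReal.inv_mul_cancel h0 (by simp), one_mul]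

/-- Averaging does not increase convex integral functionals. -/
lemma lintegral_comp_avg_le {Ψ : X → ℝ≥0∞} (hc : IsConvex Ψ)
    (hl : LowerSemicontinuous Ψ) {h : ℝ} {α : ℝ → ℝ} (hw : IsWindow h α) {S S' : Set ℝ}
    (hS : MeasurableSet S) (hS' : MeasurableSet S')
    (hsub : ∀ t ∈ S, Ioc (α t) (α t + h) ⊆ S') {f : ℝ → X}
    (hfi : ∀ t ∈ S, IntegrableOn f (Ioc (α t) (α t + h)))
    (hfm : AEStronglyMeasurable f (volume.restrict S')) :
    ∫⁻ t in S, Ψ (avg h α f t) ≤ ∫⁻ s in S', Ψ (f s) := by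
  borelize X
  refine le_trans ?_ (lintegral_window_le hw hS hS' hsub
    (hl.measurable.comp_aemeasurable hfm.aemeasurable))
  refine lintegral_mono_ae ?_
  filter_upwards [ae_restrict_mem hS] with t ht
  have hh := hw.pos
  have h0 : ofReal h ≠ 0 := by simpa using hh
  let ν : Measure ℝ := (ofReal h)⁻¹ • volume.restrict (Ioc (α t) (α t + h))
  have : IsProbabilityMeasure ν := ⟨by
    simp only [ν, Measure.smul_apply, smul_eq_mul]
    rw [Measure.restrict_apply_univ, Real.volume_Ioc, add_sub_cancel_left,
      ENNReal.inv_mul_cancel h0 (by simp)]⟩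
  have hi : Integrable f ν := (hfi t ht).smul_measure (by simpa using hh)
  have := hc.apply_integral_le hl hi
  simp only [ν] at this
  rw [integral_smul_measure, lintegral_smul_measure, smul_eq_mul] at this
  convert this using 2
  rw [avg, integral_of_le (by linarith)]
  simp [ENNReal.toReal_inv, hh.le]

lemma isConvex_enorm_rpow {q : ℝ} (hq : 1 ≤ q) : IsConvex (fun x : X => ‖x‖ₑ ^ q) := by
  intro x y a b ha hb hab
  have h1 : ‖a • x + b • y‖ₑ ≤ ofReal a * ‖x‖ₑ + ofReal b * ‖y‖ₑ := by
    refine (enorm_add_le _ _).trans_eq ?_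
    rw [enorm_smul, enorm_smul, Real.enorm_of_nonneg ha, Real.enorm_of_nonneg hb]
  have hab' : ofReal a + ofReal b = 1 := by
    rw [← ofReal_add ha hb, hab, ofReal_one]
  refine (rpow_le_rpow h1 (by linarith)).trans ?_
  exact ENNReal.rpow_arith_mean_le_arith_mean2_rpow _ _ _ _ hab' hq

lemma lowerSemicontinuous_enorm_rpow {X : Type*} [NormedAddCommGroup X] {q : ℝ} :
    LowerSemicontinuous (fun x : X => ‖x‖ₑ ^ q) :=
  (ENNReal.continuous_rpow_const.comp continuous_enorm).lowerSemicontinuous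

lemma eLpNorm_avg_le {h : ℝ} {α : ℝ → ℝ} (hw : IsWindow h α) {q : ℝ≥0∞}
    (hq : 1 ≤ q) (hq' : q ≠ ∞) {f : ℝ → X} (hf : MemLp f q) :
    eLpNorm (avg h α f) q ≤ eLpNorm f q := by
  have hq0 : q ≠ 0 := (zero_lt_one.trans_le hq).ne'
  have hfl : LocallyIntegrable f := hf.locallyIntegrable hq
  rw [eLpNorm_eq_lintegral_rpow_enorm_toReal hq0 hq', eLpNorm_eq_lintegral_rpow_enorm_toReal hq0 hq']
  refine rpow_le_rpow ?_ (by positivity)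
  have hq1 : 1 ≤ q.toReal := by
    have := toReal_mono hq' hq
    simpa using this
  have := lintegral_comp_avg_le (S := univ) (S' := univ) (isConvex_enorm_rpow (X := X) hq1)
    lowerSemicontinuous_enorm_rpow hw MeasurableSet.univ MeasurableSet.univ
    (fun t _ => subset_univ _) (f := f) (fun t _ => (hfl.integrableOn_isCompact isCompact_Icc).mono_set Ioc_subset_Icc_self)
    (by simpa using hf.1)
  simpa only [Measure.restrict_univ] using this

lemma memLp_avg {h : ℝ} {α : ℝ → ℝ} (hw : IsWindow h α) {q : ℝ≥0∞}
    (hq : 1 ≤ q) (hq' : q ≠ ∞) {f : ℝ → X} (hf : MemLp f q) : MemLp (avg h α f) q :=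
  ⟨(stronglyMeasurable_avg hw (hf.locallyIntegrable hq)).aestronglyMeasurable,
    (eLpNorm_avg_le hw hq hq' hf).trans_lt hf.2⟩

lemma avg_sub {h : ℝ} {α : ℝ → ℝ} {f g : ℝ → X}
    (hf : LocallyIntegrable f) (hg : LocallyIntegrable g) :
    avg h α (f - g) = avg h α f - avg h α g := by
  funext t
  simp only [avg, Pi.sub_apply]
  rw [intervalIntegral.integral_sub (hf.intervalIntegrable' _ _)
    (hg.intervalIntegrable' _ _), smul_sub]

instance isFiniteMeasure_μI : IsFiniteMeasure μT := by
  unfold μI; infer_instance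

/-- Averages over shrinking windows converge in `L^q`. -/
lemma tendsto_eLpNorm_avg_sub {h : ℕ → ℝ} {α : ℕ → ℝ → ℝ}
    (hw : ∀ n, IsWindow (h n) (α n)) (hh : Tendsto h atTop (𝓝 0)) {q : ℝ≥0∞}
    (hq : 1 ≤ q) (hq' : q ≠ ∞) {f : ℝ → X} (hf : MemLp f q) :
    Tendsto (fun n => eLpNorm (avg (h n) (α n) f - f) q μT) atTop (𝓝 0) := by
  have hfl : LocallyIntegrable f := hf.locallyIntegrable hq
  have hle : μT ≤ volume := Measure.restrict_le_self
  set D : ℝ≥0∞ := μT univ ^ q.toReal⁻¹ with hD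
  have hDt : D ≠ ∞ := rpow_ne_top_of_nonneg (by simp) (measure_ne_top _ _)
  have key : ∀ ε : ℝ, 0 < ε → ∀ᶠ n in atTop,
      eLpNorm (avg (h n) (α n) f - f) q μT ≤ (2 + D) * ofReal ε := by
    intro ε hε
    obtain ⟨g, hgs, hg1, hg2, hg3⟩ := hf.exists_hasCompactSupport_eLpNorm_sub_le hq'
      (ε := ofReal ε) (by simpa using hε)
    have hgl : LocallyIntegrable g := hg2.locallyIntegrable
    have hu := hgs.uniformContinuous_of_continuous hg2
    obtain ⟨δ, hδ, hδ'⟩ := Metric.uniformContinuous_iff.1 hu ε hε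
    filter_upwards [hh.eventually (gt_mem_nhds hδ)] with n hn
    have hp := (hw n).pos
    have e : avg (h n) (α n) f - f
        = avg (h n) (α n) (f - g) + ((avg (h n) (α n) g - g) - (f - g)) := by
      rw [avg_sub hfl hgl]; abel
    have m1 := (memLp_avg (hw n) hq hq' (hf.sub hg3)).1.mono_measure hle
    have m2 := ((stronglyMeasurable_avg (hw n) hgl).aestronglyMeasurable
      (μ := volume)).mono_measure hle
    have m3 := hg3.1.mono_measure hle
    have m4 := (hf.sub hg3).1.mono_measure hle
    have b1 : eLpNorm (avg (h n) (α n) (f - g)) q μT ≤ ofReal ε :=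
      (eLpNorm_mono_measure _ hle).trans ((eLpNorm_avg_le (hw n) hq hq' (hf.sub hg3)).trans hg1)
    have b2 : eLpNorm (avg (h n) (α n) g - g) q μT ≤ D * ofReal ε := by
      refine eLpNorm_le_of_ae_bound (.of_forall fun t => ?_)
      have : (avg (h n) (α n) g - g) t = (h n)⁻¹ • ∫ s in (α n t)..(α n t + h n), (g s - g t) := by
        rw [intervalIntegral.integral_sub (hgl.intervalIntegrable' _ _)
          intervalIntegrable_const, intervalIntegral.integral_const, smul_sub,
          add_sub_cancel_left, inv_smul_smul₀ hp.ne']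
        rfl
      rw [this, norm_smul, norm_inv, norm_of_nonneg hp.le, inv_mul_le_iff₀ hp]
      have := intervalIntegral.norm_integral_le_of_norm_le_const (a := α n t) (b := α n t + h n)
        (f := fun s => g s - g t) (C := ε) (fun s hs => ?_)
      · rw [add_sub_cancel_left, abs_of_pos hp] at this
        linarith
      · rw [uIoc_of_le (by linarith)] at hs
        have h1 := (hw n).le t
        have h2 := (hw n).le_add t
        rw [← dist_eq_norm]
        refine (hδ' ?_).le
        rw [Real.dist_eq, abs_lt]
        constructor <;> linarith [hs.1, hs.2]
    have b3 : eLpNorm (f - g) q μT ≤ ofReal ε := (eLpNorm_mono_measure _ hle).trans hg1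
    rw [e]
    calc _ ≤ _ := eLpNorm_add_le m1 ((m2.sub m3).sub m4) hq
      _ ≤ ofReal ε + (D * ofReal ε + ofReal ε) := by
        gcongr
        exact (eLpNorm_sub_le (m2.sub m3) m4 hq).trans (by gcongr)
      _ = _ := by ring
  rw [ENNReal.tendsto_nhds_zero]
  intro ε hε
  obtain ⟨ε', h1, h2⟩ := ENNReal.exists_nnreal_pos_mul_lt (a := 2 + D) (by simp [hDt]) hε.ne'
  filter_upwards [key ε' h1] with n hn
  rw [ENNReal.ofReal_coe_nnreal, mul_comm] at hn
  exact hn.trans h2.le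

lemma cellLeft_mem (hT : 0 < T) (hN : 0 < N) (ht : t ∈ Ioc 0 T) :
    0 ≤ cellLeft (T / N) t ∧ cellLeft (T / N) t + T / N ≤ T := by
  have hN' : (0 : ℝ) < N := by exact_mod_cast hN
  have hτ : 0 < T / N := by positivity
  have h1 : 1 ≤ ⌈t / (T / N)⌉ := Int.one_le_ceil_iff.2 (div_pos ht.1 hτ)
  have h2 : ⌈t / (T / N)⌉ ≤ N := by
    rw [Int.ceil_le, div_le_iff₀ hτ]
    have : ((N : ℤ) : ℝ) * (T / N) = T := by push_cast; field_simp
    rw [this]; exact ht.2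
  have h1' : (1 : ℝ) ≤ ⌈t / (T / N)⌉ := by exact_mod_cast h1
  have h2' : (⌈t / (T / N)⌉ : ℝ) ≤ N := by exact_mod_cast h2
  unfold cellLeft
  refine ⟨mul_nonneg (by linarith) hτ.le, ?_⟩
  calc _ = (⌈t / (T / N)⌉ : ℝ) * (T / N) := by ring
    _ ≤ N * (T / N) := by gcongr
    _ = T := by field_simp

lemma μI_eq_Ioc : μT = volume.restrict (Ioc 0 T) := Measure.restrict_congr_set Ioc_ae_eq_Icc.symm

lemma integrable_indicator_μI {f : ℝ → X} (hf : Integrable f μT) :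
    Integrable ((Ioc 0 T).indicator f) volume := by
  rw [μI_eq_Ioc] at hf
  rwa [integrable_indicator_iff measurableSet_Ioc]

lemma intervalIntegrable_of_μI {f : ℝ → X} (hf : Integrable f μT) {a b : ℝ}
    (ha : a ∈ IT) (hb : b ∈ IT) : IntervalIntegrable f volume a b := by
  have : IntegrableOn f IT := hf
  exact (this.mono_set (uIcc_subset_Icc ha hb)).intervalIntegrable

lemma integral_indicator_μI {f : ℝ → X} {a b : ℝ} (ha : a ∈ IT) (hb : b ∈ IT) (hab : a ≤ b) :
    ∫ s in a..b, (Ioc 0 T).indicator f s = ∫ s in a..b, f s := by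
  apply intervalIntegral.integral_congr_uIoo
  intro s hs
  rw [uIoo_of_le hab] at hs
  exact indicator_of_mem (show s ∈ Ioc 0 T from ⟨ha.1.trans_lt hs.1, hs.2.le.trans hb.2⟩) _

/-- Weak lower semicontinuity of convex integral functionals: weak convergence of the primitives
suffices. -/
lemma lintegral_le_liminf_of_weak_primitives {Ψ : X → ℝ≥0∞} (hc : IsConvex Ψ)
    (hl : LowerSemicontinuous Ψ) (hwl : IsWeaklyLSC Ψ) (hT : 0 < T)
    {w : ℕ → ℝ → X} {w₀ : ℝ → X} (hw : ∀ n, Integrable (w n) μT)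
    (hw₀ : Integrable w₀ μT)
    (hconv : ∀ s ∈ IT, WeaklyTendsto (fun n => ∫ t in 0..s, w n t) (∫ t in 0..s, w₀ t)) :
    ∫⁻ t, Ψ (w₀ t) ∂μT ≤ liminf (fun n => ∫⁻ t, Ψ (w n t) ∂μT) atTop := by
  borelize X
  let h : ℕ → ℝ := fun m => T / (m + 1 : ℕ)
  let A : ℕ → (ℝ → X) → ℝ → X := fun m f => avg (h m) (cellLeft (h m)) ((Ioc 0 T).indicator f)
  have hh : ∀ m, IsWindow (h m) (cellLeft (h m)) := fun m => isWindow_cell (by positivity)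
  have hmem : ∀ m, ∀ t ∈ Ioc 0 T, cellLeft (h m) t ∈ IT ∧ cellLeft (h m) t + h m ∈ IT :=
    fun m t ht => by
      obtain ⟨h1, h2⟩ := cellLeft_mem hT (Nat.succ_pos m) ht
      have hp := (hh m).pos
      exact ⟨⟨h1, by linarith⟩, by linarith, h2⟩
  have h0 : (0 : ℝ) ∈ IT := ⟨le_rfl, hT.le⟩
  have hA : ∀ m, ∀ t ∈ Ioc 0 T, ∀ f : ℝ → X, Integrable f μT →
      A m f t = (h m)⁻¹ • ((∫ s in 0..(cellLeft (h m) t + h m), f s)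
        - ∫ s in 0..(cellLeft (h m) t), f s) := by
    intro m t ht f hf
    obtain ⟨ma, mb⟩ := hmem m t ht
    simp only [A, avg]
    rw [integral_indicator_μI ma mb (by linarith [(hh m).pos]), integral_interval_sub_left
      (intervalIntegrable_of_μI hf h0 mb) (intervalIntegrable_of_μI hf h0 ma)]
  have step : ∀ m, ∫⁻ t in Ioc 0 T, Ψ (A m w₀ t) ≤ liminf (fun n => ∫⁻ t, Ψ (w n t) ∂μT) atTop := by
    intro m
    calc ∫⁻ t in Ioc 0 T, Ψ (A m w₀ t)
        ≤ ∫⁻ t in Ioc 0 T, liminf (fun n => Ψ (A m (w n) t)) atTop := by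
          refine setLIntegral_mono_ae' measurableSet_Ioc (.of_forall fun t ht => ?_)
          refine hwl _ _ ?_
          obtain ⟨ma, mb⟩ := hmem m t ht
          rw [hA m t ht w₀ hw₀]
          have : (fun n => A m (w n) t) = fun n => (h m)⁻¹ •
              ((∫ s in 0..(cellLeft (h m) t + h m), w n s) - ∫ s in 0..(cellLeft (h m) t), w n s) :=
            funext fun n => hA m t ht _ (hw n)
          rw [this]
          exact ((hconv _ mb).sub (hconv _ ma)).smul _
      _ ≤ liminf (fun n => ∫⁻ t in Ioc 0 T, Ψ (A m (w n) t)) atTop := by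
          refine lintegral_liminf_le' fun n => ?_
          exact (hl.measurable.comp (stronglyMeasurable_avg (hh m)
            (integrable_indicator_μI (hw n)).locallyIntegrable).measurable).aemeasurable
      _ ≤ liminf (fun n => ∫⁻ t, Ψ (w n t) ∂μT) atTop := by
          refine liminf_le_liminf (.of_forall fun n => ?_)
          have hi := integrable_indicator_μI (hw n)
          rw [μI_eq_Ioc]
          have := lintegral_comp_avg_le hc hl (hh m) (S := Ioc 0 T) (S' := Ioc 0 T)
            measurableSet_Ioc measurableSet_Ioc (fun t ht => by
              exact Ioc_subset_Ioc (hmem m t ht).1.1 (hmem m t ht).2.2) (f := (Ioc 0 T).indicator (w n))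
            (fun t _ => hi.integrableOn) hi.1.restrict
          refine this.trans_eq (setLIntegral_congr_fun measurableSet_Ioc fun t ht => ?_)
          simp only [indicator_of_mem ht]
  have hh0 : Tendsto h atTop (𝓝 0) :=
    (tendsto_const_div_atTop_nhds_zero_nat T).comp (tendsto_add_atTop_nat 1)
  have hi₀ := integrable_indicator_μI hw₀
  have hL := tendsto_eLpNorm_avg_sub (T := T) hh hh0 le_rfl (by simp) (memLp_one_iff_integrable.2 hi₀)
  have hM := tendstoInMeasure_of_tendsto_eLpNorm_of_ne_top (p := 1) (by simp) (by simp)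
    (fun m => ((stronglyMeasurable_avg (hh m) hi₀.locallyIntegrable).aestronglyMeasurable
      (μ := μT))) (hi₀.1.mono_measure Measure.restrict_le_self) hL
  obtain ⟨ns, hns, hae⟩ := hM.exists_seq_tendsto_ae
  rw [μI_eq_Ioc] at hae ⊢
  calc ∫⁻ t in Ioc 0 T, Ψ (w₀ t)
      ≤ ∫⁻ t in Ioc 0 T, liminf (fun k => Ψ (A (ns k) w₀ t)) atTop := by
        refine lintegral_mono_ae ?_
        filter_upwards [hae, ae_restrict_mem measurableSet_Ioc] with t ht ht'
        rw [indicator_of_mem ht'] at ht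
        exact lsc_le_liminf hl ht
    _ ≤ liminf (fun k => ∫⁻ t in Ioc 0 T, Ψ (A (ns k) w₀ t)) atTop := by
        refine lintegral_liminf_le' fun n => ?_
        exact (hl.measurable.comp (stronglyMeasurable_avg (hh _)
            hi₀.locallyIntegrable).measurable).aemeasurable
    _ ≤ _ := by
        have := fun k => step (ns k)
        rw [μI_eq_Ioc] at this
        exact liminf_le_of_frequently_le' (Frequently.of_forall this)

end Averages

section Pairing

variable {α : Type*} [MeasurableSpace α] {μ : Measure α}

lemma holderConjugate_conjExp {p : ℝ} (hp : 1 < p) : p.HolderConjugate (conjExp p) :=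
  Real.HolderConjugate.conjExponent hp

lemma one_lt_conjExp {p : ℝ} (hp : 1 < p) : 1 < conjExp p := (holderConjugate_conjExp hp).symm.lt

lemma holderTriple_conjExp {p : ℝ} (hp : 1 < p) :
    HolderTriple (ofReal (conjExp p)) (ofReal p) 1 := by
  have := (holderConjugate_conjExp hp).symm.ennrealOfReal
  simpa using this

lemma integrable_pairing {p q : ℝ≥0∞} [HolderTriple q p 1] {φ : α → X⋆} {w : α → X}
    (hφ : MemLp φ q μ) (hw : MemLp w p μ) : Integrable (fun t => φ t (w t)) μ := by
  have := (ContinuousLinearMap.id ℝ X⋆).memLp_of_bilin 1 hφ hw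
  exact memLp_one_iff_integrable.1 this

lemma abs_integral_pairing_le {p q : ℝ≥0∞} [HolderTriple q p 1] {φ : α → X⋆}
    {w : α → X} (hφ : MemLp φ q μ) (hw : MemLp w p μ) :
    |∫ t, φ t (w t) ∂μ| ≤ (eLpNorm φ q μ).toReal * (eLpNorm w p μ).toReal := by
  have h1 := eLpNorm_le_eLpNorm_mul_eLpNorm'_of_norm (p := q) (q := p) (r := 1) hφ.1 hw.1
    (fun (f : X⋆) (x : X) => f x) 1 (.of_forall fun t => by
      simpa using (φ t).le_opNorm (w t))
  rw [← toReal_mul, ← Real.norm_eq_abs, ← toReal_enorm]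
  refine toReal_mono (mul_ne_top hφ.2.ne hw.2.ne) ((enorm_integral_le_lintegral_enorm _).trans ?_)
  rw [← eLpNorm_one_eq_lintegral_enorm]
  simpa using h1

lemma tendsto_of_approx {x : ℕ → ℝ} {a : ℝ}
    (h : ∀ ε : ℝ, 0 < ε → ∃ (y : ℕ → ℝ) (b : ℝ), Tendsto y atTop (𝓝 b) ∧
      (∀ n, |x n - y n| ≤ ε) ∧ |a - b| ≤ ε) : Tendsto x atTop (𝓝 a) := by
  rw [Metric.tendsto_atTop]
  intro ε hε
  obtain ⟨y, b, hy, h1, h2⟩ := h (ε / 4) (by positivity)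
  obtain ⟨N, hN⟩ := Metric.tendsto_atTop.1 hy (ε / 4) (by positivity)
  refine ⟨N, fun n hn => ?_⟩
  have h3 := hN n hn
  have h4 := h1 n
  rw [Real.dist_eq] at h3 ⊢
  rw [abs_le] at h2 h4
  rw [abs_lt] at h3 ⊢
  constructor <;> linarith [h2.1, h2.2, h4.1, h4.2, h3.1, h3.2]

lemma conjExp_ofReal_ne_zero {p : ℝ} (hp : 1 < p) : ofReal p ≠ 0 := by
  simpa using by linarith

lemma one_le_ofReal {p : ℝ} (hp : 1 < p) : 1 ≤ ofReal p := by
  rw [← ofReal_one]; exact ofReal_le_ofReal hp.le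

/-- Weak convergence against bounded test functions extends by density. -/
lemma WeakStarTendsto.of_bounded {p q : ℝ≥0∞} [HolderTriple q p 1] (hq : q ≠ ∞)
    {w : ℕ → ℝ → X} {a : ℝ → X} {C : ℝ≥0}
    (hw : ∀ n, MemLp (w n) p μT) (hC : ∀ n, eLpNorm (w n) p μT ≤ C)
    (ha : MemLp a p μT) (h : WeakStarTendsto T ∞ w a) : WeakStarTendsto T q w a := by
  intro φ hφ
  refine tendsto_of_approx fun ε hε => ?_
  let K : ℝ := C + (eLpNorm a p μT).toReal + 1
  have hK : 0 < K := by positivity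
  obtain ⟨ψ, hψ1, hψ2⟩ := hφ.exists_simpleFunc_eLpNorm_sub_lt hq
    (ε := ofReal (ε / K)) (by simpa using div_pos hε hK)
  have hψb : MemLp (ψ : ℝ → X⋆) ∞ μT := ψ.memLp_top _
  have hd : MemLp (φ - (ψ : ℝ → X⋆)) q μT := hφ.sub hψ2
  have hdr : (eLpNorm (φ - (ψ : ℝ → X⋆)) q μT).toReal ≤ ε / K := by
    have := toReal_mono (by simp) hψ1.le
    rwa [toReal_ofReal (by positivity)] at this
  have key : ∀ b : ℝ → X, MemLp b p μT → (eLpNorm b p μT).toReal ≤ K →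
      |∫ t, φ t (b t) ∂μT - ∫ t, ψ t (b t) ∂μT| ≤ ε := by
    intro b hb hbK
    rw [← integral_sub (integrable_pairing hφ hb) (integrable_pairing hψ2 hb)]
    have := abs_integral_pairing_le hd hb
    simp only [Pi.sub_apply, sub_apply] at this
    refine this.trans ?_
    calc _ ≤ ε / K * K := by gcongr
      _ = ε := by field_simp
  refine ⟨_, _, h ψ hψb, fun n => key _ (hw n) ?_, key _ ha ?_⟩
  · have := toReal_mono (by simp) (hC n)
    simp only [ENNReal.coe_toReal] at this
    have := toReal_nonneg (a := eLpNorm a p μT)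
    simp only [K]; linarith
  · have : (0 : ℝ) ≤ C := C.2
    simp only [K]; linarith

lemma WeakStarTendsto.mono {q q' : ℝ≥0∞} (hqq : q ≤ q') {w : ℕ → ℝ → X} {a : ℝ → X}
    (h : WeakStarTendsto T q w a) : WeakStarTendsto T q' w a :=
  fun φ hφ => h φ (hφ.mono_exponent hqq)

lemma WeakStarTendsto.comp {q : ℝ≥0∞} {w : ℕ → ℝ → X} {a : ℝ → X}
    (h : WeakStarTendsto T q w a) {φ : ℕ → ℕ} (hφ : Tendsto φ atTop atTop) :
    WeakStarTendsto T q (fun n => w (φ n)) a := fun ψ hψ => (h ψ hψ).comp hφ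

lemma WeakStarTendsto.weakly_primitive {w : ℕ → ℝ → X} {a : ℝ → X}
    (h : WeakStarTendsto T ∞ w a) (hw : ∀ n, Integrable (w n) μT) (ha : Integrable a μT)
    {s : ℝ} (hs : s ∈ IT) :
    WeaklyTendsto (fun n => ∫ t in 0..s, w n t) (∫ t in 0..s, a t) := by
  intro ξ
  have hφ : MemLp ((Ioc 0 s).indicator fun _ => ξ) ∞ μT :=
    (memLp_top_const ξ).indicator measurableSet_Ioc
  have key : ∀ b : ℝ → X, Integrable b μT →
      ∫ t, ((Ioc 0 s).indicator (fun _ => ξ) t) (b t) ∂μT = ξ (∫ t in 0..s, b t) := by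
    intro b hb
    have hb' : IntegrableOn b (Ioc 0 s) := IntegrableOn.mono_set (s := Ioc 0 s) (t := IT) hb
        (Ioc_subset_Icc_self.trans (Icc_subset_Icc_right hs.2))
    have : (fun t => ((Ioc 0 s).indicator (fun _ => ξ) t) (b t))
        = (Ioc 0 s).indicator fun t => ξ (b t) := by
      funext t
      by_cases ht : t ∈ Ioc 0 s <;> simp [ht]
    rw [this, integral_indicator measurableSet_Ioc, integral_of_le hs.1,
      ← ContinuousLinearMap.integral_comp_comm ξ hb']
    rw [μI, Measure.restrict_restrict measurableSet_Ioc, inter_eq_self_of_subset_left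
      (Ioc_subset_Icc_self.trans (Icc_subset_Icc_right hs.2))]
  have := h _ hφ
  simp only [key _ ha] at this
  refine this.congr fun n => key _ (hw n)

lemma isWeaklyLSC_enorm_rpow {q : ℝ} (hq : 0 ≤ q) : IsWeaklyLSC (fun x : X => ‖x‖ₑ ^ q) := by
  intro x a h
  obtain ⟨f, hf1, hf⟩ := exists_dual_vector'' ℝ a
  have h1 : Tendsto (fun n => ‖f (x n)‖ₑ ^ q) atTop (𝓝 (‖f a‖ₑ ^ q)) :=
    ((ENNReal.continuous_rpow_const.comp continuous_enorm).tendsto _).comp (h f)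
  have h2 : ‖f a‖ₑ = ‖a‖ₑ := by
    rw [hf, ← ofReal_norm, ← ofReal_norm]; simp
  simp only
  rw [← h2, ← h1.liminf_eq]
  refine liminf_le_liminf (.of_forall fun n => ?_)
  refine rpow_le_rpow ?_ hq
  rw [← ofReal_norm, ← ofReal_norm]
  refine ofReal_le_ofReal ((f.le_opNorm _).trans ?_)
  exact mul_le_of_le_one_left (norm_nonneg _) hf1

/-- Radial truncation. -/
def trunc (M : ℝ) (x : X) : X := (M / max M ‖x‖) • x

lemma continuous_trunc {M : ℝ} (hM : 0 < M) : Continuous (trunc M : X → X) := by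
  unfold trunc
  refine Continuous.smul (continuous_const.div (continuous_const.max continuous_norm) fun x => ?_)
    continuous_id
  exact (lt_max_of_lt_left hM).ne'

lemma norm_trunc_le {M : ℝ} (hM : 0 < M) (x : X) : ‖trunc M x‖ ≤ M := by
  have h1 : 0 < max M ‖x‖ := lt_max_of_lt_left hM
  rw [trunc, norm_smul, norm_of_nonneg (by positivity), div_mul_eq_mul_div, div_le_iff₀ h1]
  gcongr; exact le_max_right _ _

lemma norm_trunc_le_norm {M : ℝ} (hM : 0 < M) (x : X) : ‖trunc M x‖ ≤ ‖x‖ := by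
  have h1 : 0 < max M ‖x‖ := lt_max_of_lt_left hM
  rw [trunc, norm_smul, norm_of_nonneg (by positivity)]
  refine mul_le_of_le_one_left (norm_nonneg _) ?_
  rw [div_le_one h1]; exact le_max_left _ _

lemma trunc_of_norm_le {M : ℝ} (hM : 0 < M) {x : X} (hx : ‖x‖ ≤ M) : trunc M x = x := by
  rw [trunc, max_eq_left hx, div_self hM.ne', one_smul]

lemma norm_sub_trunc_le {M p : ℝ} (hM : 0 < M) (hp : 1 ≤ p) (x : X) :
    ‖x - trunc M x‖ ≤ ‖x‖ ^ p * M ^ (1 - p) := by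
  rcases le_total ‖x‖ M with h | h
  · rw [trunc_of_norm_le hM h, sub_self, norm_zero]; positivity
  · have hx : 0 < ‖x‖ := hM.trans_le h
    have e : x - trunc M x = (1 - M / ‖x‖) • x := by
      rw [trunc, max_eq_right h, sub_smul, one_smul]
    have h1 : M / ‖x‖ ≤ 1 := by rw [div_le_one hx]; exact h
    have h0 : 0 ≤ M / ‖x‖ := by positivity
    rw [e, norm_smul, norm_of_nonneg (by linarith)]
    calc (1 - M / ‖x‖) * ‖x‖ ≤ 1 * ‖x‖ := by gcongr; linarith
      _ = ‖x‖ ^ p * ‖x‖ ^ (1 - p) := by rw [← Real.rpow_add hx]; simp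
      _ ≤ _ := by
        gcongr ?_ * ?_
        exact Real.rpow_le_rpow_of_nonpos hM h (by linarith)

lemma memLp_trunc [IsFiniteMeasure μ] {M : ℝ} (hM : 0 < M) {w : α → X}
    (hw : AEStronglyMeasurable w μ) (p : ℝ≥0∞) : MemLp (fun t => trunc M (w t)) p μ :=
  MemLp.of_bound ((continuous_trunc hM).comp_aestronglyMeasurable hw) M
    (.of_forall fun _ => norm_trunc_le hM _)

lemma lintegral_enorm_rpow_eq {p : ℝ} (hp : 1 < p) (w : α → X) :
    ∫⁻ t, ‖w t‖ₑ ^ p ∂μ = eLpNorm w (ofReal p) μ ^ p := by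
  have hp0 : 0 < p := by linarith
  have e := eLpNorm_eq_lintegral_rpow_enorm_toReal (f := w) (μ := μ) (conjExp_ofReal_ne_zero hp)
    ofReal_ne_top
  rw [toReal_ofReal hp0.le] at e
  rw [e, ← rpow_mul, one_div_mul_cancel hp0.ne', rpow_one]

lemma eLpNorm_sub_trunc_le {M p : ℝ} (hM : 0 < M) (hp : 1 < p) {w : α → X} {C : ℝ≥0}
    (hC : eLpNorm w (ofReal p) μ ≤ C) :
    eLpNorm (fun t => w t - trunc M (w t)) 1 μ ≤ ofReal (C ^ p * M ^ (1 - p)) := by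
  rw [eLpNorm_one_eq_lintegral_enorm]
  have hp0 : 0 < p := by linarith
  calc ∫⁻ t, ‖w t - trunc M (w t)‖ₑ ∂μ ≤ ∫⁻ t, ‖w t‖ₑ ^ p * ofReal (M ^ (1 - p)) ∂μ := by
        refine lintegral_mono fun t => ?_
        rw [← ofReal_norm, ← ofReal_norm,
          ofReal_rpow_of_nonneg (norm_nonneg _) hp0.le, ← ofReal_mul (by positivity)]
        exact ofReal_le_ofReal (norm_sub_trunc_le hM hp.le _)
    _ = (∫⁻ t, ‖w t‖ₑ ^ p ∂μ) * ofReal (M ^ (1 - p)) := lintegral_mul_const' _ _ ofReal_ne_top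
    _ ≤ (C : ℝ≥0∞) ^ p * ofReal (M ^ (1 - p)) := by
        rw [lintegral_enorm_rpow_eq hp]; gcongr
    _ = _ := by
        rw [ofReal_mul (by positivity), ← ofReal_rpow_of_nonneg (NNReal.coe_nonneg C)
          hp0.le, ENNReal.ofReal_coe_nnreal]

lemma liminf_le_const {u : ℕ → ℝ≥0∞} {c : ℝ≥0∞} (h : ∀ n, u n ≤ c) : liminf u atTop ≤ c :=
  liminf_le_of_frequently_le' (Frequently.of_forall h)

/-- `L^p` bounds pass to weak limits. -/
lemma eLpNorm_le_of_weak_primitives {p : ℝ} (hp : 1 < p) (hT : 0 < T)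
    {w : ℕ → ℝ → X} {a : ℝ → X} (hw : ∀ n, Integrable (w n) μT) (ha : Integrable a μT)
    {C : ℝ≥0} (hC : ∀ n, eLpNorm (w n) (ofReal p) μT ≤ C)
    (h : ∀ s ∈ IT, WeaklyTendsto (fun n => ∫ t in 0..s, w n t)
      (∫ t in 0..s, a t)) : eLpNorm a (ofReal p) μT ≤ C := by
  have hp0 : 0 < p := by linarith
  have := lintegral_le_liminf_of_weak_primitives (isConvex_enorm_rpow (X := X) hp.le)
    lowerSemicontinuous_enorm_rpow (isWeaklyLSC_enorm_rpow hp0.le) hT hw ha h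
  simp only [lintegral_enorm_rpow_eq hp] at this
  have h2 : liminf (fun n => eLpNorm (w n) (ofReal p) μT ^ p) atTop ≤ (C : ℝ≥0∞) ^ p :=
    liminf_le_const fun n => rpow_le_rpow (hC n) hp0.le
  exact (ENNReal.rpow_le_rpow_iff hp0).1 (this.trans h2)

lemma exists_subseq_weakStar_hilbert {E : Type*} [NormedAddCommGroup E] [InnerProductSpace ℝ E]
    [CompleteSpace E] {p : ℝ} (hp : 1 < p) (hT : 0 < T) {w : ℕ → ℝ → E}
    (hw : ∀ n, MemLp (w n) (ofReal p) μT) {C : ℝ≥0}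
    (hC : ∀ n, eLpNorm (w n) (ofReal p) μT ≤ C) :
    ∃ φ : ℕ → ℕ, StrictMono φ ∧ ∃ a : ℝ → E, MemLp a (ofReal p) μT ∧ eLpNorm a (ofReal p) μT ≤ C ∧
      WeakStarTendsto T (ofReal (conjExp p)) (fun n => w (φ n)) a := by
  have hp0 : 0 < p := by linarith
  have hp1 := one_le_ofReal hp
  have hwi : ∀ n, Integrable (w n) μT := fun n => (hw n).integrable hp1
  obtain ⟨M, hM, hr⟩ : ∃ M : ℕ → ℝ, (∀ k, 0 < M k) ∧
      ∀ k, (C : ℝ) ^ p * M k ^ (1 - p) ≤ (1 / 4) ^ (k + 2) := by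
    have ht : Tendsto (fun M : ℝ => (C : ℝ) ^ p * M ^ (1 - p)) atTop (𝓝 0) := by
      have := tendsto_rpow_neg_atTop (y := p - 1) (by linarith)
      simp only [neg_sub] at this
      simpa using this.const_mul ((C : ℝ) ^ p)
    have : ∀ k : ℕ, ∃ M : ℝ, 0 < M ∧ (C : ℝ) ^ p * M ^ (1 - p) ≤ (1 / 4) ^ (k + 2) := fun k => by
      obtain ⟨M, h1, h2⟩ := ((ht.eventually (ge_mem_nhds (show (0 : ℝ) < (1 / 4) ^ (k + 2) by
        positivity))).and (eventually_gt_atTop 0)).exists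
      exact ⟨M, h2, h1⟩
    choose M h1 h2 using this
    exact ⟨M, h1, h2⟩
  let x : ℕ → ℕ → ℝ → E := fun k n t => trunc (M k) (w n t)
  have hx : ∀ k n q, MemLp (x k n) q μT := fun k n q => memLp_trunc (hM k) (hw n).1 q
  have hd : ∀ k n, eLpNorm (fun t => w n t - x k n t) 1 μT
      ≤ ofReal ((1 / 4) ^ (k + 2)) := fun k n =>
    (eLpNorm_sub_trunc_le (hM k) hp (hC n)).trans (ofReal_le_ofReal (hr k))
  have hb : ∀ k n, ‖(hx k n 2).toLp (x k n)‖
      ≤ (μT univ ^ (2 : ℝ≥0∞).toReal⁻¹ * ofReal (M k)).toReal := by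
    intro k n
    rw [Lp.norm_toLp]
    refine toReal_mono ?_ (eLpNorm_le_of_ae_bound (.of_forall fun t => norm_trunc_le (hM k) _))
    exact mul_ne_top (rpow_ne_top_of_nonneg (by simp) (measure_ne_top _ _))
      ofReal_ne_top
  obtain ⟨φ, hφ, a', ha'⟩ := exists_subseq_weak_hilbert (fun k n => (hx k n 2).toLp (x k n)) _ hb
  let a : ℕ → ℝ → E := fun k => a' k
  have ham : ∀ k, MemLp (a k) 2 μT := fun k => Lp.memLp (a' k)
  have ha : ∀ k, WeakStarTendsto T ∞ (fun n => x k (φ n)) (a k) := by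
    intro k ψ hψ
    have hy : MemLp (fun t => (InnerProductSpace.toDual ℝ E).symm (ψ t)) 2 μT :=
      (InnerProductSpace.toDual ℝ E).symm.toContinuousLinearEquiv.toContinuousLinearMap.comp_memLp'
        (hψ.mono_exponent le_top)
    have := ha' k (hy.toLp _)
    simp only [L2.inner_def] at this
    have e : ∀ b : Lp E 2 μT, ∀ b' : ℝ → E, b =ᵐ[μT] b' →
        ∫ t, ⟪b t, (hy.toLp _ : Lp E 2 μT) t⟫ ∂μT = ∫ t, ψ t (b' t) ∂μT := by
      intro b b' hbb
      refine integral_congr_ae ?_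
      filter_upwards [hbb, hy.coeFn_toLp] with t h1 h2
      rw [h1, h2, real_inner_comm, InnerProductSpace.toDual_symm_apply]
    rw [e (a' k) (a k) (EventuallyEq.refl _ _)] at this
    exact this.congr fun n => e _ _ (hx k (φ n) 2).coeFn_toLp
  have hai : ∀ k, Integrable (a k) μT := fun k => (ham k).integrable (by norm_num)
  have hxi : ∀ k n, Integrable (x k n) μT := fun k n => (hx k n 2).integrable (by norm_num)
  have hcau : ∀ N n m : ℕ, N ≤ n → N ≤ m →
      eLpNorm (a n - a m) 1 μT < ofReal ((1 / 4) ^ (N + 1)) := by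
    intro N n m hn hm
    have hl := lintegral_le_liminf_of_weak_primitives (isConvex_enorm_rpow (X := E) le_rfl)
      lowerSemicontinuous_enorm_rpow (isWeaklyLSC_enorm_rpow zero_le_one) hT
      (w := fun k => x n (φ k) - x m (φ k)) (w₀ := a n - a m)
      (fun k => (hxi _ _).sub (hxi _ _)) ((hai _).sub (hai _)) (fun s hs => by
        have h1 := (ha n).weakly_primitive (fun k => hxi _ _) (hai n) hs
        have h2 := (ha m).weakly_primitive (fun k => hxi _ _) (hai m) hs
        have h0 : (0 : ℝ) ∈ IT := ⟨le_rfl, hT.le⟩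
        simp only [Pi.sub_apply]
        rw [intervalIntegral.integral_sub (intervalIntegrable_of_μI (hai n) h0 hs)
          (intervalIntegrable_of_μI (hai m) h0 hs)]
        convert h1.sub h2 using 2 with k
        exact intervalIntegral.integral_sub (intervalIntegrable_of_μI (hxi _ _) h0 hs)
          (intervalIntegrable_of_μI (hxi _ _) h0 hs))
    simp only [rpow_one, ← eLpNorm_one_eq_lintegral_enorm] at hl
    refine (hl.trans (liminf_le_const (c := ofReal (2 * (1 / 4) ^ (N + 2))) fun k => ?_)).trans_lt ?_
    · have e : x n (φ k) - x m (φ k)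
          = (fun t => w (φ k) t - x m (φ k) t) - fun t => w (φ k) t - x n (φ k) t := by
        funext t; simp
      rw [e]
      refine (eLpNorm_sub_le ((hw _).1.sub (hx _ _ 2).1) ((hw _).1.sub (hx _ _ 2).1) le_rfl).trans ?_
      rw [two_mul, ofReal_add (by positivity) (by positivity)]
      refine add_le_add ((hd _ _).trans ?_) ((hd _ _).trans ?_) <;>
        refine ofReal_le_ofReal (pow_le_pow_of_le_one (by norm_num) (by norm_num) (by omega))
    · rw [ENNReal.ofReal_lt_ofReal_iff (by positivity)]
      have : (0 : ℝ) < (1 / 4) ^ N := by positivity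
      rw [pow_add, pow_add]; linarith
  obtain ⟨b, hb1, hb2⟩ := Lp.cauchy_complete_eLpNorm (p := 1) le_rfl
    (fun k => memLp_one_iff_integrable.2 (hai k)) (B := fun N => ofReal ((1 / 4) ^ (N + 1)))
    (by
      rw [← ENNReal.ofReal_tsum_of_nonneg (fun n => by positivity)]
      · exact ofReal_ne_top
      · exact (summable_nat_add_iff 1).2 (summable_geometric_of_lt_one (by norm_num) (by norm_num)))
    hcau
  have hbi := memLp_one_iff_integrable.1 hb1
  have hconv : WeakStarTendsto T ∞ (fun n => w (φ n)) b := by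
    intro ψ hψ
    refine tendsto_of_approx fun ε hε => ?_
    let K : ℝ := (eLpNorm ψ ∞ μT).toReal + 1
    have hK : 0 < K := by positivity
    have hpos : 0 < ε / K := by positivity
    have t1 : Tendsto (fun k : ℕ => (1 / 4 : ℝ) ^ (k + 2)) atTop (𝓝 0) :=
      (tendsto_pow_atTop_nhds_zero_of_lt_one (by norm_num) (by norm_num)).comp
        (tendsto_add_atTop_nat 2)
    have t2 := hb2.eventually (ge_mem_nhds (show 0 < ofReal (ε / K) by simpa using hpos))
    obtain ⟨k, hk1, hk2⟩ := ((t1.eventually (ge_mem_nhds hpos)).and t2).exists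
    have key : ∀ f g : ℝ → E, Integrable f μT → Integrable g μT →
        eLpNorm (f - g) 1 μT ≤ ofReal (ε / K) →
        |∫ t, ψ t (f t) ∂μT - ∫ t, ψ t (g t) ∂μT| ≤ ε := by
      intro f g hf hg hfg
      have hf' := memLp_one_iff_integrable.2 hf
      have hg' := memLp_one_iff_integrable.2 hg
      rw [← integral_sub (integrable_pairing hψ hf') (integrable_pairing hψ hg')]
      have := abs_integral_pairing_le hψ (hf'.sub hg')
      simp only [Pi.sub_apply, map_sub] at this
      refine this.trans ?_
      have h3 := toReal_mono ofReal_ne_top hfg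
      rw [toReal_ofReal hpos.le] at h3
      calc _ ≤ K * (ε / K) := by
            gcongr
            simp [K]
        _ = ε := by field_simp
    refine ⟨_, _, ha k ψ hψ, fun n => key _ _ (hwi _) (hxi _ _) ((hd k (φ n)).trans
      (ofReal_le_ofReal hk1)), key _ _ hbi (hai k) ?_⟩
    rwa [eLpNorm_sub_comm]
  have hbC := eLpNorm_le_of_weak_primitives hp hT (fun n => hwi (φ n)) hbi (fun n => hC (φ n))
    fun s hs => hconv.weakly_primitive (fun n => hwi _) hbi hs
  have hbp : MemLp b (ofReal p) μT := ⟨hbi.1, hbC.trans_lt (by simp)⟩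
  have := holderTriple_conjExp hp
  exact ⟨φ, hφ, b, hbp, hbC, hconv.of_bounded ofReal_ne_top (fun n => hw _) (fun n => hC _) hbp⟩

lemma WeakStarTendsto.clm {q : ℝ≥0∞}
    {w : ℕ → ℝ → X} {a : ℝ → X} (h : WeakStarTendsto T q w a) (L : X →L[ℝ] Y) :
    WeakStarTendsto T q (fun n t => L (w n t)) (fun t => L (a t)) := fun φ hφ =>
  h (fun t => (φ t).comp L) (((compL ℝ X Y ℝ).flip L).comp_memLp' hφ)

end Pairing

universe u

/-- Bounded sequences in `L^p(I; X)` have weakly convergent subsequences. -/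
lemma Hilbertizable.exists_subseq_weakStar {X : Type u} [NormedAddCommGroup X] [NormedSpace ℝ X]
    (hX : Hilbertizable X) {p : ℝ} (hp : 1 < p) (hT : 0 < T) {w : ℕ → ℝ → X}
    (hw : ∀ n, MemLp (w n) (ofReal p) μT) {C : ℝ≥0}
    (hC : ∀ n, eLpNorm (w n) (ofReal p) μT ≤ C) :
    ∃ φ : ℕ → ℕ, StrictMono φ ∧ ∃ a : ℝ → X, MemLp a (ofReal p) μT ∧
      WeakStarTendsto T (ofReal (conjExp p)) (fun n => w (φ n)) a := by
  obtain ⟨E, _, _, _, ⟨e⟩⟩ := hX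
  obtain ⟨φ, hφ, a, ha, -, hc⟩ := exists_subseq_weakStar_hilbert hp hT
    (w := fun n t => (e : X →L[ℝ] E) (w n t)) (C := ‖(e : X →L[ℝ] E)‖₊ * C)
    (fun n => (e : X →L[ℝ] E).comp_memLp' (hw n)) fun n => by
      refine (eLpNorm_le_nnreal_smul_eLpNorm_of_ae_le_mul (g := w n) (c := ‖(e : X →L[ℝ] E)‖₊)
        (.of_forall fun t => (e : X →L[ℝ] E).le_opNNNorm _) _).trans ?_
      rw [ENNReal.smul_def, smul_eq_mul, ENNReal.coe_mul]
      gcongr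
      exact hC n
  refine ⟨φ, hφ, _, (e.symm : E →L[ℝ] X).comp_memLp' ha, ?_⟩
  have := hc.clm (e.symm : E →L[ℝ] X)
  simp only [ContinuousLinearEquiv.coe_coe, ContinuousLinearEquiv.symm_apply_apply] at this
  exact this

section StrongConvergence

lemma tendsto_zero_of_le_liminf {A B S : ℕ → ℝ≥0∞} {s : ℝ≥0∞} (hs : s ≠ ∞)
    (h : ∀ n, A n + B n ≤ S n) (hS : Tendsto S atTop (𝓝 s)) (hA : s ≤ liminf A atTop) :
    Tendsto B atTop (𝓝 0) := by
  rw [ENNReal.tendsto_nhds_zero]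
  intro ε hε
  rcases eq_or_ne ε ∞ with rfl | hε'
  · simp
  have hε2 : ε / 2 ≠ 0 := by simp [hε.ne']
  have hε2' : ε / 2 ≠ ∞ := div_ne_top hε' (by simp)
  have h1 : ∀ᶠ n in atTop, S n < s + ε / 2 :=
    hS.eventually (gt_mem_nhds (ENNReal.lt_add_right hs hε2))
  have h2 : ∀ᶠ n in atTop, s - ε / 2 ≤ A n := by
    rcases eq_or_ne s 0 with h0 | h0
    · simp [h0]
    · have : s - ε / 2 < liminf A atTop := (ENNReal.sub_lt_self hs h0 hε2).trans_le hA
      exact (eventually_lt_of_lt_liminf this).mono fun n hn => hn.le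
  filter_upwards [h1, h2] with n hn1 hn2
  have hfin : s - ε / 2 ≠ ∞ := ENNReal.sub_ne_top hs
  have : (s - ε / 2) + B n ≤ (s - ε / 2) + ε := by
    calc (s - ε / 2) + B n ≤ A n + B n := by gcongr
      _ ≤ s + ε / 2 := (h n).trans hn1.le
      _ ≤ (s - ε / 2 + ε / 2) + ε / 2 := by gcongr; exact le_tsub_add
      _ = _ := by rw [add_assoc, ENNReal.add_halves]
  exact (ENNReal.add_le_add_iff_left hfin).1 this

lemma le_liminf_tsub {H N : ℕ → ℝ≥0∞} {L : ℝ≥0∞} (hH : L ≤ liminf H atTop)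
    (hN : Tendsto N atTop (𝓝 0)) : L ≤ liminf (fun n => H n - N n) atTop := by
  rw [← ENNReal.liminf_add_of_right_tendsto_zero hN]
  exact hH.trans (liminf_le_liminf (.of_forall fun n => le_tsub_add))

variable {Ψ : X → ℝ≥0∞} (hc : IsConvex Ψ)
  (hl : LowerSemicontinuous Ψ) (hwl : IsWeaklyLSC Ψ) (hu : IsUniformlyConvex Ψ) {p : ℝ}
  (hp : 1 < p) (hpc : IsPowerCoercive p Ψ) (hT : 0 < T)
  {w : ℕ → ℝ → X} {a : ℝ → X} (hw : ∀ n, Integrable (w n) (μI T)) (ha : Integrable a (μI T))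
  (hconv : ∀ s ∈ Icc 0 T, WeaklyTendsto (fun n => ∫ t in 0..s, w n t) (∫ t in 0..s, a t))
  (hfin : ∫⁻ t, Ψ (a t) ∂(μI T) ≠ ∞)
  (hlim : Tendsto (fun n => ∫⁻ t, Ψ (w n t) ∂(μI T)) atTop (𝓝 (∫⁻ t, Ψ (a t) ∂(μI T))))

include hc hl hwl hu hp hpc hT hw ha hconv hfin hlim

/-- Weak convergence and convergence of a uniformly convex energy imply convergence in measure. -/
lemma tendstoInMeasure_of_uniformlyConvex : TendstoInMeasure μT w atTop a := by
  borelize X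
  set S := ∫⁻ t, Ψ (a t) ∂μT with hSdef
  have hp0 : 0 < p := by linarith
  have hΨw : ∀ n, AEMeasurable (fun t => Ψ (w n t)) μT := fun n =>
    hl.measurable.comp_aemeasurable (hw n).1.aemeasurable
  have hΨa : AEMeasurable (fun t => Ψ (a t)) μT := hl.measurable.comp_aemeasurable ha.1.aemeasurable
  let m : ℕ → ℝ → X := fun n t => (1 / 2 : ℝ) • (w n t + a t)
  have hm : ∀ n, Integrable (m n) μT := fun n => ((hw n).add ha).smul _
  have hΨm : ∀ n, AEMeasurable (fun t => Ψ (m n t)) μT := fun n =>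
    hl.measurable.comp_aemeasurable (hm n).1.aemeasurable
  have h0 : (0 : ℝ) ∈ IT := ⟨le_rfl, hT.le⟩
  have hmconv : ∀ s ∈ IT, WeaklyTendsto (fun n => ∫ t in 0..s, m n t) (∫ t in 0..s, a t) := by
    intro s hs
    have h1 := ((hconv s hs).add (weaklyTendsto_const (∫ t in 0..s, a t))).smul (1 / 2)
    convert h1 using 2 with n
    · simp only [m]
      rw [intervalIntegral.integral_smul, intervalIntegral.integral_add
        (intervalIntegrable_of_μI (hw n) h0 hs) (intervalIntegrable_of_μI ha h0 hs)]
    · rw [← two_smul ℝ, smul_smul]; norm_num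
  have hlow := lintegral_le_liminf_of_weak_primitives hc hl hwl hT hm ha hmconv
  let D : ℕ → ℝ → ℝ≥0∞ := fun n t => (Ψ (w n t) + Ψ (a t)) / 2 - Ψ (m n t)
  have hmid : ∀ x y : X, Ψ ((1 / 2 : ℝ) • (x + y)) ≤ (Ψ x + Ψ y) / 2 := by
    intro x y
    have := hc x y (1 / 2) (1 / 2) (by norm_num) (by norm_num) (by norm_num)
    rw [← smul_add] at this
    refine this.trans_eq ?_
    rw [← mul_add, one_div, ENNReal.ofReal_inv_of_pos (by norm_num), ENNReal.ofReal_ofNat, mul_comm,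
      ENNReal.div_eq_inv_mul, mul_comm]
  have hD : Tendsto (fun n => ∫⁻ t, D n t ∂μT) atTop (𝓝 0) := by
    refine tendsto_zero_of_le_liminf hfin (A := fun n => ∫⁻ t, Ψ (m n t) ∂μT)
      (S := fun n => (∫⁻ t, Ψ (w n t) ∂μT + S) / 2) (fun n => ?_) ?_ hlow
    · rw [← lintegral_add_left' (hΨm n)]
      refine le_of_eq ?_
      rw [hSdef, ← lintegral_add_left' (hΨw n), ENNReal.div_eq_inv_mul,
        ← lintegral_const_mul' _ _ (by simp)]
      refine lintegral_congr fun t => ?_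
      rw [← ENNReal.div_eq_inv_mul]
      exact add_tsub_cancel_of_le (hmid _ _)
    · have h1 : Tendsto (fun n => (∫⁻ t, Ψ (w n t) ∂μT + S) / 2) atTop (𝓝 ((S + S) / 2)) :=
        ENNReal.Tendsto.div_const (hlim.add tendsto_const_nhds) (by simp)
      rwa [ENNReal.add_div, ENNReal.add_halves] at h1
  obtain ⟨ε₀, hε₀, hcoer⟩ := hpc
  rw [tendstoInMeasure_iff_norm]
  intro η hη
  rw [ENNReal.tendsto_nhds_zero]
  intro θ' hθ'
  obtain ⟨θ, hθ, hθθ⟩ : ∃ θ : ℝ≥0∞, 0 < θ ∧ θ ≠ ∞ ∧ θ ≤ θ' :=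
    ⟨min θ' 1, lt_min hθ' one_pos, by simp, min_le_left _ _⟩
  let K := S + 1
  have hK : K ≠ ∞ := by simp [K, hfin]
  have hKev : ∀ᶠ n in atTop, ∫⁻ t, Ψ (w n t) ∂μT < K :=
    hlim.eventually (gt_mem_nhds (ENNReal.lt_add_right hfin one_ne_zero))
  let c : ℝ := (K / (θ / 3)).toReal + 1
  have hc0 : 0 < c := by positivity
  have hKθ : K / (θ / 3) ≠ ∞ := div_ne_top hK (by simp [hθ.ne'])
  have hcK : K ≤ ofReal c * (θ / 3) := by
    rw [← ENNReal.div_le_iff (by simp [hθ.ne']) (div_ne_top hθθ.1 (by simp))]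
    rw [← ofReal_toReal hKθ]
    exact ofReal_le_ofReal (by simp [c])
  let R : ℝ := (c / ε₀) ^ (1 / p)
  have hR : 0 < R := by positivity
  have hRc : ε₀ * R ^ p = c := by
    simp only [R]
    rw [← Real.rpow_mul (by positivity), one_div_mul_cancel hp0.ne', Real.rpow_one]
    field_simp
  have hmark : ∀ b : ℝ → X, AEMeasurable (fun t => Ψ (b t)) μT →
      ∫⁻ t, Ψ (b t) ∂μT ≤ K → μT {t | R < ‖b t‖} ≤ θ / 3 := by
    intro b hb hbK
    have h1 := mul_meas_ge_le_lintegral₀ hb (ofReal c)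
    have h2 : μT {t | R < ‖b t‖} ≤ μT {t | ofReal c ≤ Ψ (b t)} := by
      refine measure_mono fun t ht => ?_
      refine le_trans (ofReal_le_ofReal ?_) (hcoer (b t))
      rw [← hRc]
      have : R ≤ ‖b t‖ := (show R < ‖b t‖ from ht).le
      gcongr
    have h3 := (mul_le_mul_right h2 (ofReal c)).trans (h1.trans (hbK.trans hcK))
    exact (ENNReal.mul_le_mul_iff_right (by simpa using hc0) ofReal_ne_top).1 h3
  obtain ⟨δ, hδ, hδ'⟩ := hu R η hR hη
  have hDθ : ∀ᶠ n in atTop, ∫⁻ t, D n t ∂μT ≤ ofReal δ * (θ / 3) :=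
    (ENNReal.tendsto_nhds_zero.1 hD) _ (ENNReal.mul_pos (by simpa using hδ) (by simp [hθ.ne']))
  filter_upwards [hKev, hDθ] with n hn1 hn2
  have hDm : AEMeasurable (D n) μT := (((hΨw n).add hΨa).div_const 2).sub (hΨm n)
  have h1 := mul_meas_ge_le_lintegral₀ hDm (ofReal δ)
  have h2 : μT {t | ofReal δ ≤ D n t} ≤ θ / 3 :=
    (ENNReal.mul_le_mul_iff_right (by simpa using hδ) ofReal_ne_top).1 (h1.trans hn2)
  have h3 := hmark _ (hΨw n) hn1.le
  have h4 := hmark _ hΨa (le_self_add : S ≤ K)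
  have hae : ∀ᵐ t ∂μT, Ψ (a t) < ∞ := ae_lt_top' hΨa hfin
  have hsub : {t | η ≤ ‖w n t - a t‖} ≤ᵐ[μT] (({t | ofReal δ ≤ D n t} ∪ {t | R < ‖w n t‖})
      ∪ {t | R < ‖a t‖} : Set ℝ) := by
    filter_upwards [hae, ae_lt_top' (hΨw n) (hn1.trans_le le_top).ne] with t hat hwt
    intro ht
    have ht' : η ≤ ‖w n t - a t‖ := ht
    by_contra hcon
    have hcon' : ¬ ((ofReal δ ≤ D n t ∨ R < ‖w n t‖) ∨ R < ‖a t‖) := hcon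
    push Not at hcon'
    obtain ⟨⟨hh1, hh2⟩, hh3⟩ := hcon'
    have := hδ' (w n t) (a t) hh2 hh3 ht'
    refine hh1.not_ge ?_
    have hfm : Ψ (m n t) ≠ ∞ := ((hmid (w n t) (a t)).trans_lt
      (ENNReal.div_lt_top (ENNReal.add_lt_top.2 ⟨hwt, hat⟩).ne (by simp))).ne
    exact ENNReal.le_sub_of_add_le_left hfm this
  refine ((measure_mono_ae hsub).trans ?_).trans hθθ.2
  calc _ ≤ θ / 3 + θ / 3 + θ / 3 :=
        (measure_union_le _ _).trans (add_le_add ((measure_union_le _ _).trans (add_le_add h2 h3)) h4)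
    _ = θ := ENNReal.add_thirds θ

lemma exists_subseq_tendsto_eLpNorm : ∃ φ : ℕ → ℕ, StrictMono φ ∧
      Tendsto (fun n => eLpNorm (w (φ n) - a) (ofReal p) μT) atTop (𝓝 0) := by
  borelize X
  have hp0 : 0 < p := by linarith
  have hΨw : ∀ n, AEMeasurable (fun t => Ψ (w n t)) μT := fun n =>
    hl.measurable.comp_aemeasurable (hw n).1.aemeasurable
  have hΨa : AEMeasurable (fun t => Ψ (a t)) μT := hl.measurable.comp_aemeasurable ha.1.aemeasurable
  obtain ⟨φ, hφ, hae⟩ := (tendstoInMeasure_of_uniformlyConvex hc hl hwl hu hp hpc hT hw ha hconv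
    hfin hlim).exists_seq_tendsto_ae
  obtain ⟨ε₀, hε₀, hcoer⟩ := hpc
  refine ⟨φ, hφ, ?_⟩
  let κ : ℝ≥0∞ := ofReal (2 ^ p / ε₀)
  have hκ : κ ≠ ∞ := ofReal_ne_top
  let N : ℕ → ℝ → ℝ≥0∞ := fun n t => ‖w (φ n) t - a t‖ₑ ^ p
  let Hh : ℕ → ℝ → ℝ≥0∞ := fun n t => κ * (Ψ (w (φ n) t) + Ψ (a t))
  have hNm : ∀ n, AEMeasurable (N n) μT := fun n => (((hw (φ n)).1.sub ha.1).enorm).pow_const p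
  have hNH : ∀ n t, N n t ≤ Hh n t := by
    intro n t
    have hx : ∀ x : X, ofReal (‖x‖ ^ p) ≤ ofReal ε₀⁻¹ * Ψ x := by
      intro x
      have := mul_le_mul_right (hcoer x) (ofReal ε₀⁻¹)
      rwa [← ofReal_mul (by positivity), ← mul_assoc, inv_mul_cancel₀ hε₀.ne', one_mul] at this
    have h1 : ‖w (φ n) t - a t‖ ^ p ≤ 2 ^ p * (‖w (φ n) t‖ ^ p + ‖a t‖ ^ p) := by
      have h2 : ‖w (φ n) t - a t‖ ≤ 2 * max ‖w (φ n) t‖ ‖a t‖ := by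
        have := norm_sub_le (w (φ n) t) (a t)
        have := le_max_left ‖w (φ n) t‖ ‖a t‖
        have := le_max_right ‖w (φ n) t‖ ‖a t‖
        linarith
      calc _ ≤ (2 * max ‖w (φ n) t‖ ‖a t‖) ^ p := by gcongr
        _ = 2 ^ p * (max ‖w (φ n) t‖ ‖a t‖) ^ p := mul_rpow (by norm_num) (by positivity)
        _ ≤ _ := by
          gcongr
          rcases le_total ‖w (φ n) t‖ ‖a t‖ with h | h
          · rw [max_eq_right h]; linarith [rpow_nonneg (norm_nonneg (w (φ n) t)) p]
          · rw [max_eq_left h]; linarith [rpow_nonneg (norm_nonneg (a t)) p]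
    simp only [N, Hh, κ]
    rw [← ofReal_norm, ofReal_rpow_of_nonneg (norm_nonneg _) hp0.le]
    refine (ofReal_le_ofReal h1).trans ?_
    rw [ofReal_mul (by positivity), ofReal_add (by positivity) (by positivity),
      div_eq_mul_inv, ofReal_mul (by positivity), mul_assoc]
    gcongr
    rw [mul_add]
    exact add_le_add (hx _) (hx _)
  have hHm : ∀ n, AEMeasurable (Hh n) μT := fun n => ((hΨw _).add hΨa).const_mul κ
  have hHint : ∀ n, ∫⁻ t, Hh n t ∂μT
      = κ * (∫⁻ t, Ψ (w (φ n) t) ∂μT + ∫⁻ t, Ψ (a t) ∂μT) := fun n => by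
    simp only [Hh]
    rw [lintegral_const_mul' _ _ hκ, lintegral_add_right' _ hΨa]
  have hN : Tendsto (fun n => ∫⁻ t, N n t ∂μT) atTop (𝓝 0) := by
    refine tendsto_zero_of_le_liminf (s := κ * (∫⁻ t, Ψ (a t) ∂μT + ∫⁻ t, Ψ (a t) ∂μT))
      (A := fun n => ∫⁻ t, (Hh n t - N n t) ∂μT) (S := fun n => ∫⁻ t, Hh n t ∂μT)
      (mul_ne_top hκ (by simp [hfin])) (fun n => ?_) ?_ ?_
    · rw [← lintegral_add_right' _ (hNm n)]
      exact (lintegral_congr fun t => tsub_add_cancel_of_le (hNH n t)).le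
    · simp only [hHint]
      exact ENNReal.Tendsto.const_mul ((hlim.comp hφ.tendsto_atTop).add tendsto_const_nhds)
        (Or.inr hκ)
    · rw [← lintegral_add_right' _ hΨa, ← lintegral_const_mul' _ _ hκ]
      refine le_trans (lintegral_mono_ae ?_) (lintegral_liminf_le' fun n => (hHm n).sub (hNm n))
      filter_upwards [hae] with t ht
      refine le_liminf_tsub ?_ ?_
      · have hlsc : LowerSemicontinuous fun x : X => κ * (Ψ x + Ψ (a t)) :=
          Continuous.comp_lowerSemicontinuous (g := fun r : ℝ≥0∞ => κ * (r + Ψ (a t)))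
            ((ENNReal.continuous_const_mul hκ).comp (continuous_add_const _)) hl
            (fun r s hrs => by dsimp only; gcongr)
        exact lsc_le_liminf hlsc ht
      · have h1 : Tendsto (fun n => w (φ n) t - a t) atTop (𝓝 0) := by
          simpa using ht.sub_const (a t)
        have h2 := ((ENNReal.continuous_rpow_const (y := p)).comp continuous_enorm).tendsto (0 : X)
        simp only [Function.comp_apply, enorm_zero, ENNReal.zero_rpow_of_pos hp0] at h2
        exact h2.comp h1
  simp only [N, lintegral_enorm_rpow_eq hp (fun t => w (φ _) t - a t)] at hN
  have h3 := ((ENNReal.continuous_rpow_const (y := 1 / p)).tendsto 0).comp hN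
  rw [ENNReal.zero_rpow_of_pos (by positivity)] at h3
  refine h3.congr fun n => ?_
  simp only [Function.comp_apply]
  rw [← rpow_mul, mul_one_div_cancel hp0.ne', rpow_one]
  rfl

omit hlim in
/-- Weak convergence and convergence of a uniformly convex energy imply strong convergence. -/
lemma tendsto_eLpNorm_of_uniformlyConvex
    (hlim : limsup (fun n => ∫⁻ t, Ψ (w n t) ∂μT) atTop ≤ ∫⁻ t, Ψ (a t) ∂μT) :
    Tendsto (fun n => eLpNorm (w n - a) (ofReal p) μT) atTop (𝓝 0) := by
  have hlim' : Tendsto (fun n => ∫⁻ t, Ψ (w n t) ∂μT) atTop (𝓝 (∫⁻ t, Ψ (a t) ∂μT)) :=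
    tendsto_of_le_liminf_of_limsup_le
      (lintegral_le_liminf_of_weak_primitives hc hl hwl hT hw ha hconv) hlim
  refine tendsto_of_subseq_tendsto fun ns hns => ?_
  obtain ⟨φ, hφ, h⟩ := exists_subseq_tendsto_eLpNorm hc hl hwl hu hp hpc hT
    (w := fun n => w (ns n)) (fun n => hw _) ha (fun s hs => (hconv s hs).comp hns) hfin
    (hlim'.comp hns)
  exact ⟨φ, h⟩

end StrongConvergence

section Primitives

lemma absolutelyContinuousOnInterval_of_dist_le {Y Y' : Type*} [PseudoMetricSpace Y]
    [PseudoMetricSpace Y'] {f : ℝ → Y} {g : ℝ → Y'}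
    {a b K : ℝ} (hg : AbsolutelyContinuousOnInterval g a b)
    (h : ∀ x ∈ uIcc a b, ∀ y ∈ uIcc a b, dist (f x) (f y) ≤ K * dist (g x) (g y)) :
    AbsolutelyContinuousOnInterval f a b := by
  unfold AbsolutelyContinuousOnInterval at hg ⊢
  refine squeeze_zero' (.of_forall fun _ => Finset.sum_nonneg fun _ _ => dist_nonneg) ?_
    (by simpa using hg.const_mul K)
  rw [eventually_inf_principal]
  filter_upwards with E hE
  rw [Finset.mul_sum]
  refine Finset.sum_le_sum fun i hi => ?_
  exact h _ (hE.1 i hi).1 _ (hE.1 i hi).2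

lemma absolutelyContinuous_primitive {w : ℝ → X} {a b : ℝ}
    (hw : IntervalIntegrable w volume a b) (c : X) :
    AbsolutelyContinuousOnInterval (fun t => c + ∫ s in a..t, w s) a b := by
  refine absolutelyContinuousOnInterval_of_dist_le (K := 1)
    (hw.norm.absolutelyContinuousOnInterval_intervalIntegral (c := a) (by simp)) fun x hx y hy => ?_
  have hi : ∀ z ∈ uIcc a b, IntervalIntegrable w volume a z := fun z hz =>
    hw.mono_set (uIcc_subset_uIcc_left hz)
  rw [one_mul, dist_add_left, dist_eq_norm, Real.dist_eq,
    integral_interval_sub_left (hi x hx) (hi y hy),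
    integral_interval_sub_left (hi x hx).norm (hi y hy).norm]
  exact intervalIntegral.norm_integral_le_abs_integral_norm

lemma integral_eq_sub_of_ae_hasDerivAt {f f' : ℝ → X} {a b : ℝ}
    (hf : AbsolutelyContinuousOnInterval f a b)
    (h : ∀ᵐ x, x ∈ uIcc a b → HasDerivAt f (f' x) x) (hf' : IntervalIntegrable f' volume a b) :
    ∫ t in a..b, f' t = f b - f a := by
  have hg := hf.sub (absolutelyContinuous_primitive hf' 0)
  obtain ⟨C, hC⟩ := hg.const_of_ae_hasDerivAt_zero (by
    filter_upwards [h, hf'.ae_hasDerivAt_integral] with x h1 h2 h3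
    have h4 := (h1 h3).sub ((h2 h3 a (by simp)).const_add 0)
    rw [sub_self] at h4
    exact h4)
  have h1 := hC a (by simp)
  have h2 := hC b (by simp)
  simp only [Pi.sub_apply, intervalIntegral.integral_same, zero_add, sub_zero] at h1 h2
  rw [h1, ← h2]; abel

/-- Primitive with initial value `c`. -/
def prim (c : X) (w : ℝ → X) (t : ℝ) : X := c + ∫ s in 0..t, w s

lemma intervalIntegrable_left {w : ℝ → X} (hw : Integrable w μT)
    (ht : t ∈ IT) : IntervalIntegrable w volume 0 t :=
  intervalIntegrable_of_μI hw ⟨le_rfl, ht.1.trans ht.2⟩ ht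

lemma continuousOn_prim {w : ℝ → X} (hw : Integrable w μT) (c : X) :
    ContinuousOn (prim c w) IT := by
  rcases le_or_gt 0 T with hT | hT
  · have := (absolutelyContinuous_primitive (intervalIntegrable_left hw ⟨hT, le_rfl⟩) c).continuousOn
    rwa [uIcc_of_le hT] at this
  · rw [Icc_eq_empty (not_le.2 hT)]; exact continuousOn_empty _

lemma prim_sub_prim {w : ℝ → X} (hw : Integrable w μT) (c : X) {s t : ℝ}
    (hs : s ∈ IT) (ht : t ∈ IT) : prim c w t - prim c w s = ∫ r in s..t, w r := by
  simp only [prim, add_sub_add_left_eq_sub]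
  exact integral_interval_sub_left (intervalIntegrable_left hw ht) (intervalIntegrable_left hw hs)

lemma prim_prodMk [CompleteSpace Y] {w : ℝ → X} {w' : ℝ → Y} (hw : Integrable w μT)
    (hw' : Integrable w' μT) (c : X) (c' : Y) {s : ℝ} (hs : s ∈ IT) :
    prim (c, c') (fun t => (w t, w' t)) s = (prim c w s, prim c' w' s) := by
  rw [prim, prim, prim, integral_of_le hs.1, integral_of_le hs.1, integral_of_le hs.1,
    integral_pair ((intervalIntegrable_iff_integrableOn_Ioc_of_le hs.1).1 (intervalIntegrable_left hw hs))
      ((intervalIntegrable_iff_integrableOn_Ioc_of_le hs.1).1 (intervalIntegrable_left hw' hs))]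
  rfl

lemma integrable_of_continuousOn {u : ℝ → X} (hu : ContinuousOn u IT) :
    Integrable u μT := hu.integrableOn_Icc

lemma memLp_of_continuousOn {u : ℝ → X} (hu : ContinuousOn u IT) (p : ℝ≥0∞) :
    MemLp u p μT := by
  obtain ⟨C, hC⟩ := isCompact_Icc.exists_bound_of_continuousOn hu
  exact MemLp.of_bound (integrable_of_continuousOn hu).1 C
    (ae_restrict_of_forall_mem measurableSet_Icc hC)

/-- The chain rule along an absolutely continuous curve. -/
lemma chain_rule_prim [CompleteSpace Y] {F : X → Y} (hF : ContDiff ℝ 1 F) {w : ℝ → X}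
    (hw : Integrable w μT) (c : X) (ht : t ∈ IT) :
    IntervalIntegrable (fun s => fderiv ℝ F (prim c w s) (w s)) volume 0 t ∧
      F (prim c w t) - F c = ∫ s in 0..t, fderiv ℝ F (prim c w s) (w s) := by
  have hwi := intervalIntegrable_left hw ht
  have hsub : Icc 0 t ⊆ IT := Icc_subset_Icc_right ht.2
  have hcont : ContinuousOn (prim c w) (Icc 0 t) := (continuousOn_prim hw c).mono hsub
  have hD : ContinuousOn (fun s => fderiv ℝ F (prim c w s)) (Icc 0 t) :=
    (hF.continuous_fderiv one_ne_zero).comp_continuousOn hcont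
  have hint : IntervalIntegrable (fun s => fderiv ℝ F (prim c w s) (w s)) volume 0 t := by
    rw [intervalIntegrable_iff_integrableOn_Icc_of_le ht.1] at hwi ⊢
    have h1 : MemLp (fun s => fderiv ℝ F (prim c w s)) ∞ (μI t) := memLp_of_continuousOn hD ∞
    have h2 := (ContinuousLinearMap.id ℝ (X →L[ℝ] Y)).memLp_of_bilin 1 h1
      (memLp_one_iff_integrable.2 (hwi : Integrable w (μI t)))
    exact memLp_one_iff_integrable.1 h2
  refine ⟨hint, ?_⟩
  have hK : IsCompact (prim c w '' Icc 0 t) := isCompact_Icc.image_of_continuousOn hcont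
  obtain ⟨L, hL⟩ := LocallyLipschitzOn.exists_lipschitzOnWith_of_compact hK
    hF.locallyLipschitz.locallyLipschitzOn
  have hac : AbsolutelyContinuousOnInterval (fun s => F (prim c w s)) 0 t := by
    refine absolutelyContinuousOnInterval_of_dist_le (K := L)
      (absolutelyContinuous_primitive hwi c) fun x hx y hy => ?_
    rw [uIcc_of_le ht.1] at hx hy
    exact hL.dist_le_mul _ (mem_image_of_mem _ hx) _ (mem_image_of_mem _ hy)
  rw [integral_eq_sub_of_ae_hasDerivAt hac ?_ hint]
  · simp [prim]
  · filter_upwards [hwi.ae_hasDerivAt_integral] with x hx hx'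
    have h1 : HasDerivAt (prim c w) (w x) x := (hx hx' 0 (by simp)).const_add c
    exact ((hF.differentiable one_ne_zero (prim c w x)).hasFDerivAt.comp_hasDerivAt x h1)

lemma integral_μI (hT : 0 ≤ T) (f : ℝ → X) :
    ∫ t, f t ∂μT = ∫ t in 0..T, f t := by
  rw [μI_eq_Ioc, integral_of_le hT]

lemma hasWeakDeriv_prim (hT : 0 < T) {w : ℝ → X}
    (hw : Integrable w μT) (c : X) : HasWeakDeriv T (prim c w) w := by
  intro φ hφ hφc hφs
  have hTm : T ∈ IT := ⟨hT.le, le_rfl⟩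
  have hwi := intervalIntegrable_left hw hTm
  have hφ1 : ContDiff ℝ 1 φ := hφ.of_le (by exact_mod_cast le_top)
  have hac := (hφ1.contDiffOn (s := uIcc 0 T)).absolutelyContinuousOnInterval.smul
    (absolutelyContinuous_primitive hwi c)
  have hi1 : IntervalIntegrable (fun t => deriv φ t • prim c w t) volume 0 T := by
    apply ContinuousOn.intervalIntegrable
    rw [uIcc_of_le hT.le]
    exact (hφ1.continuous_deriv le_rfl).continuousOn.smul (continuousOn_prim hw c)
  have hi2 : IntervalIntegrable (fun t => φ t • w t) volume 0 T :=
    hwi.continuousOn_smul hφ.continuous.continuousOn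
  have h := integral_eq_sub_of_ae_hasDerivAt
    (f' := fun t => φ t • w t + deriv φ t • prim c w t) hac (by
      filter_upwards [hwi.ae_hasDerivAt_integral] with x hx hx'
      have h1 : HasDerivAt (prim c w) (w x) x := (hx hx' 0 (by simp)).const_add c
      exact ((hφ1.differentiable one_ne_zero x).hasDerivAt.smul h1)) (hi2.add hi1)
  have h0 : φ 0 = 0 := image_eq_zero_of_notMem_tsupport fun h => lt_irrefl _ (hφs h).1
  have h1 : φ T = 0 := image_eq_zero_of_notMem_tsupport fun h => lt_irrefl _ (hφs h).2
  rw [intervalIntegral.integral_add hi2 hi1] at h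
  simp only [Pi.smul_apply', h0, h1, zero_smul, sub_zero] at h
  rw [integral_μI hT.le, integral_μI hT.le, eq_neg_iff_add_eq_zero, add_comm]
  exact h

lemma integrable_smul_of_continuous {g : ℝ → ℝ} (hg : Continuous g) {f : ℝ → X}
    (hf : Integrable f μT) : Integrable (fun t => g t • f t) μT :=
  IntegrableOn.continuousOn_smul hf hg.continuousOn isCompact_Icc

lemma HasWeakDeriv.sub {u w u' w' : ℝ → X} (h : HasWeakDeriv T u w)
    (h' : HasWeakDeriv T u' w') (hu : Integrable u μT) (hw : Integrable w μT)
    (hu' : Integrable u' μT) (hw' : Integrable w' μT) :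
    HasWeakDeriv T (fun t => u t - u' t) (fun t => w t - w' t) := by
  intro φ hφ hφc hφs
  have hd : Continuous (deriv φ) :=
    (hφ.of_le (by exact_mod_cast le_top) : ContDiff ℝ 1 φ).continuous_deriv le_rfl
  simp only [smul_sub]
  rw [integral_sub (integrable_smul_of_continuous hd hu) (integrable_smul_of_continuous hd hu'),
    integral_sub (integrable_smul_of_continuous hφ.continuous hw)
      (integrable_smul_of_continuous hφ.continuous hw'), h φ hφ hφc hφs, h' φ hφ hφc hφs]
  abel

lemma HasWeakDeriv.congr {u w u' w' : ℝ → X} (h : HasWeakDeriv T u w)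
    (hu : u =ᵐ[μT] u') (hw : w =ᵐ[μT] w') : HasWeakDeriv T u' w' := by
  intro φ hφ hφc hφs
  have h1 : (fun t => deriv φ t • u t) =ᵐ[μT] fun t => deriv φ t • u' t :=
    hu.mono fun t ht => by simp only [ht]
  have h2 : (fun t => φ t • w t) =ᵐ[μT] fun t => φ t • w' t := hw.mono fun t ht => by simp only [ht]
  rw [← integral_congr_ae h1, ← integral_congr_ae h2]
  exact h φ hφ hφc hφs

lemma locallyIntegrableOn_of_μI {f : ℝ → X} (hf : Integrable f μT) :
    LocallyIntegrableOn f (Ioo 0 T) volume :=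
  (IntegrableOn.mono_set (t := IT) hf Ioo_subset_Icc_self).locallyIntegrableOn

lemma ae_μI_iff {p : ℝ → Prop} : (∀ᵐ t ∂μT, p t) ↔ ∀ᵐ t, t ∈ Ioo 0 T → p t := by
  rw [μI, Measure.restrict_congr_set Ioo_ae_eq_Icc.symm, ae_restrict_iff' measurableSet_Ioo]

lemma integral_μI_of_tsupport {φ : ℝ → ℝ} (hφ : tsupport φ ⊆ Ioo 0 T) (f : ℝ → X) :
    ∫ t, φ t • f t ∂μT = ∫ t, φ t • f t := by
  refine setIntegral_eq_integral_of_forall_compl_eq_zero fun t ht => ?_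
  rw [image_eq_zero_of_notMem_tsupport fun h => ht (Ioo_subset_Icc_self (hφ h)), zero_smul]

lemma ae_eq_zero_of_test {f : ℝ → X} (hf : Integrable f μT)
    (h : ∀ φ : ℝ → ℝ, ContDiff ℝ (⊤ : ℕ∞) φ → HasCompactSupport φ → tsupport φ ⊆ Ioo 0 T →
      ∫ t, φ t • f t ∂μT = 0) : ∀ᵐ t ∂μT, f t = 0 := by
  rw [ae_μI_iff]
  refine isOpen_Ioo.ae_eq_zero_of_integral_contDiff_smul_eq_zero (locallyIntegrableOn_of_μI hf) ?_
  intro φ hφ hφc hφs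
  rw [← integral_μI_of_tsupport hφs]
  exact h φ hφ hφc hφs

lemma HasWeakDeriv.unique {u w w' : ℝ → X} (h : HasWeakDeriv T u w)
    (h' : HasWeakDeriv T u w') (hw : Integrable w μT) (hw' : Integrable w' μT) :
    w =ᵐ[μT] w' := by
  have := ae_eq_zero_of_test (hw.sub hw') fun φ hφ hφc hφs => by
    have h1 := h φ hφ hφc hφs
    rw [h' φ hφ hφc hφs, neg_inj] at h1
    simp only [Pi.sub_apply, smul_sub]
    rw [integral_sub (integrable_smul_of_continuous hφ.continuous hw)
      (integrable_smul_of_continuous hφ.continuous hw'), h1, sub_self]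
  filter_upwards [this] with t ht
  exact sub_eq_zero.1 ht

/-- A function with vanishing weak derivative is constant. -/
lemma ae_eq_const_of_hasWeakDeriv_zero (hT : 0 < T) {u : ℝ → X}
    (hu : Integrable u μT) (h : HasWeakDeriv T u fun _ => 0) :
    ∃ c, ∀ᵐ t ∂μT, u t = c := by
  let η₀ : ContDiffBump (T / 2) := ⟨T / 8, T / 4, by linarith, by linarith⟩
  let η : ℝ → ℝ := η₀.normed volume
  have hη : ContDiff ℝ (⊤ : ℕ∞) η := η₀.contDiff_normed
  have hηc : HasCompactSupport η := η₀.hasCompactSupport_normed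
  have hηs : tsupport η ⊆ Ioo 0 T := by
    simp only [η]
    rw [η₀.tsupport_normed_eq, Real.closedBall_eq_Icc]
    intro x hx
    have h1 : T / 2 - T / 4 ≤ x := hx.1
    have h2 : x ≤ T / 2 + T / 4 := hx.2
    constructor <;> linarith
  have hηi : ∫ t, η t = 1 := η₀.integral_normed
  refine ⟨∫ t, η t • u t ∂μT, ?_⟩
  set c := ∫ t, η t • u t ∂μT with hc
  have key := ae_eq_zero_of_test (hu.sub (integrable_const c)) fun ψ hψ hψc hψs => by
    set m := ∫ t, ψ t with hm
    let g : ℝ → ℝ := fun t => ψ t - m * η t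
    have hg : ContDiff ℝ (⊤ : ℕ∞) g := hψ.sub (contDiff_const.mul hη)
    have hgc : Continuous g := hg.continuous
    have hψi : Integrable ψ := hψ.continuous.integrable_of_hasCompactSupport hψc
    have hηint : Integrable η := hη.continuous.integrable_of_hasCompactSupport hηc
    have hgi : Integrable g := hψi.sub (hηint.const_mul m)
    have hg0 : ∫ t, g t = 0 := by
      simp only [g]
      rw [integral_sub hψi (hηint.const_mul m), integral_const_mul, hηi, mul_one, sub_self]
    let S := tsupport ψ ∪ tsupport η ∪ {T / 2}
    have hK : IsCompact S :=
      (hψc.isCompact.union hηc.isCompact).union isCompact_singleton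
    have hKs : S ⊆ Ioo 0 T :=
      union_subset (union_subset hψs hηs) (by
        rintro x rfl; constructor <;> linarith)
    have hKn : S.Nonempty := ⟨T / 2, Or.inr rfl⟩
    obtain ⟨a, haK, ha⟩ := hK.exists_isLeast hKn
    obtain ⟨b, hbK, hb⟩ := hK.exists_isGreatest hKn
    have ha0 := (hKs haK).1
    have hbT := (hKs hbK).2
    have hgz : ∀ t, t ∉ Icc a b → g t = 0 := by
      intro t ht
      have h1 : t ∉ tsupport ψ := fun h => ht ⟨ha (Or.inl (Or.inl h)), hb (Or.inl (Or.inl h))⟩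
      have h2 : t ∉ tsupport η := fun h => ht ⟨ha (Or.inl (Or.inr h)), hb (Or.inl (Or.inr h))⟩
      simp [g, image_eq_zero_of_notMem_tsupport h1, image_eq_zero_of_notMem_tsupport h2]
    let φ : ℝ → ℝ := fun t => ∫ s in 0..t, g s
    have hφd : ∀ t, HasDerivAt φ (g t) t := fun t =>
      intervalIntegral.integral_hasDerivAt_right (hgc.intervalIntegrable _ _)
        (hgc.stronglyMeasurableAtFilter _ _) hgc.continuousAt
    have hφderiv : deriv φ = g := funext fun t => (hφd t).deriv
    have hφ : ContDiff ℝ (⊤ : ℕ∞) φ := by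
      rw [contDiff_infty_iff_deriv]
      exact ⟨fun t => (hφd t).differentiableAt, by rw [hφderiv]; exact hg⟩
    have hφz : ∀ t, t ∉ Icc a b → φ t = 0 := by
      intro t ht
      rw [mem_Icc, not_and_or, not_le, not_le] at ht
      rcases ht with ht | ht
      · refine (intervalIntegral.integral_congr (g := fun _ => (0 : ℝ)) fun s hs => ?_).trans (by simp)
        refine hgz s fun h => ?_
        rcases mem_uIcc.1 hs with h' | h' <;> linarith [h.1, h'.1, h'.2]
      · have h1 : φ t = ∫ s, g s := by
          simp only [φ]
          rw [integral_of_le (by linarith [hb haK])]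
          refine setIntegral_eq_integral_of_forall_compl_eq_zero fun s hs => hgz s fun h => hs ?_
          exact ⟨by linarith [h.1], by linarith [h.2]⟩
        rw [h1, hg0]
    have hφs : tsupport φ ⊆ Icc a b :=
      closure_minimal (fun t ht => by by_contra h; exact ht (hφz t h)) isClosed_Icc
    have hφs' : tsupport φ ⊆ Ioo 0 T := hφs.trans fun t ht => ⟨ha0.trans_le ht.1, ht.2.trans_lt hbT⟩
    have hφc : HasCompactSupport φ := isCompact_Icc.of_isClosed_subset (isClosed_tsupport _) hφs
    have h1 := h φ hφ hφc hφs'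
    simp only [smul_zero, integral_zero, neg_zero, hφderiv] at h1
    have hψu := integrable_smul_of_continuous hψ.continuous hu
    simp only [g, sub_smul, mul_smul] at h1
    rw [integral_sub (g := fun t => m • η t • u t) hψu
      ((integrable_smul_of_continuous hη.continuous hu).smul m), integral_smul, ← hc, sub_eq_zero] at h1
    simp only [Pi.sub_apply, smul_sub]
    rw [integral_sub hψu (integrable_smul_of_continuous hψ.continuous (integrable_const c)), h1,
      integral_μI_of_tsupport hψs, integral_smul_const, sub_self]
  filter_upwards [key] with t ht
  exact sub_eq_zero.1 ht

lemma HasWeakDeriv.exists_ae_eq_prim (hT : 0 < T) {u w : ℝ → X}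
    (hu : Integrable u μT) (hw : Integrable w μT) (h : HasWeakDeriv T u w) :
    ∃ c, ∀ᵐ t ∂μT, u t = prim c w t := by
  have hp : Integrable (prim 0 w) μT := integrable_of_continuousOn (continuousOn_prim hw 0)
  have h1 := h.sub (hasWeakDeriv_prim hT hw 0) hu hw hp hw
  simp only [sub_self] at h1
  obtain ⟨c, hc⟩ := ae_eq_const_of_hasWeakDeriv_zero hT (hu.sub hp) h1
  refine ⟨c, ?_⟩
  filter_upwards [hc] with t ht
  have ht' : u t - prim 0 w t = c := ht
  rw [← ht']
  simp [prim]

lemma eqOn_of_ae_eq (hT : 0 < T) {u u' : ℝ → X} (hu : ContinuousOn u IT)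
    (hu' : ContinuousOn u' IT) (h : ∀ᵐ t ∂μT, u t = u' t) : EqOn u u' IT :=
  Measure.eqOn_Icc_of_ae_eq volume hT.ne h hu hu'

lemma HasWeakDeriv.eq_prim (hT : 0 < T) {u w : ℝ → X}
    (hu : ContinuousOn u IT) (hw : Integrable w μT) (h : HasWeakDeriv T u w) :
    ∀ t ∈ IT, u t = prim (u 0) w t := by
  obtain ⟨c, hc⟩ := h.exists_ae_eq_prim hT (integrable_of_continuousOn hu) hw
  have he := eqOn_of_ae_eq hT hu (continuousOn_prim hw c) hc
  have h0 : u 0 = c := by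
    rw [he ⟨le_rfl, hT.le⟩]; simp [prim]
  rw [h0]; exact he

end Primitives

/-- Gronwall's inequality with an integrable kernel and vanishing data. -/
lemma eq_zero_of_le_integral {y k : ℝ → ℝ} (hk : Integrable k μT)
    (hk0 : ∀ t, 0 ≤ k t) (hy0 : ∀ t ∈ IT, 0 ≤ y t) {M : ℝ} (hM : ∀ t ∈ IT, y t ≤ M)
    (hi : Integrable (fun t => k t * y t) μT)
    (h : ∀ t ∈ IT, y t ≤ ∫ s in 0..t, k s * y s) : ∀ t ∈ IT, y t = 0 := by
  rcases lt_or_ge T 0 with hT | hT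
  · intro t ht; exact absurd (ht.1.trans ht.2) (not_le.2 hT)
  let κ := prim (0 : ℝ) k
  have hκ0 : ∀ t ∈ IT, 0 ≤ κ t := fun t ht => by
    simp only [κ, prim, zero_add]
    exact intervalIntegral.integral_nonneg ht.1 fun s _ => hk0 s
  let S := (fun t => exp (-(2 * κ t)) * y t) '' IT
  have h0T : (0 : ℝ) ∈ IT := ⟨le_rfl, hT⟩
  have hM0 : 0 ≤ M := (hy0 0 h0T).trans (hM 0 h0T)
  have hne : S.Nonempty := ⟨_, mem_image_of_mem _ h0T⟩
  have hbdd : BddAbove S := by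
    refine ⟨M, ?_⟩
    rintro _ ⟨t, ht, rfl⟩
    have : exp (-(2 * κ t)) ≤ 1 := Real.exp_le_one_iff.2 (by linarith [hκ0 t ht])
    calc exp (-(2 * κ t)) * y t ≤ 1 * M :=
          mul_le_mul this (hM t ht) (hy0 t ht) zero_le_one
      _ = M := one_mul M
  set m := sSup S with hm
  have hm0 : 0 ≤ m := le_csSup_of_le hbdd (mem_image_of_mem _ h0T)
    (mul_nonneg (Real.exp_pos _).le (hy0 0 h0T))
  have hle : ∀ t ∈ IT, y t ≤ m * exp (2 * κ t) := by
    intro t ht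
    have := le_csSup hbdd (mem_image_of_mem (fun t => exp (-(2 * κ t)) * y t) ht)
    simp only [Real.exp_neg] at this
    rwa [inv_mul_le_iff₀ (Real.exp_pos _), mul_comm] at this
  have hF : ContDiff ℝ 1 fun x : ℝ => exp (2 * x) / 2 :=
    (Real.contDiff_exp.comp (contDiff_const.mul contDiff_id)).div_const 2
  have hF' : ∀ x r : ℝ, fderiv ℝ (fun x : ℝ => exp (2 * x) / 2) x r = exp (2 * x) * r := by
    intro x r
    have h1 : HasDerivAt (fun x : ℝ => exp (2 * x) / 2) (exp (2 * x)) x := by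
      have := (((hasDerivAt_id x).const_mul 2).exp).div_const 2
      simpa using this
    rw [h1.hasFDerivAt.fderiv]; simp [mul_comm]
  have hhalf : m ≤ m / 2 := by
    refine csSup_le hne ?_
    rintro _ ⟨t, ht, rfl⟩
    obtain ⟨hint, hval⟩ := chain_rule_prim hF hk 0 ht
    simp only [hF'] at hint hval
    have h1 : ∫ s in 0..t, k s * y s ≤ ∫ s in 0..t, m * (exp (2 * κ s) * k s) := by
      refine intervalIntegral.integral_mono_on ht.1 (intervalIntegrable_left hi ht)
        (hint.const_mul m) fun s hs => ?_
      have := mul_le_mul_of_nonneg_left (hle s ⟨hs.1, hs.2.trans ht.2⟩) (hk0 s)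
      linarith
    rw [intervalIntegral.integral_const_mul, ← hval] at h1
    have h2 := (h t ht).trans h1
    simp only [mul_zero, Real.exp_zero] at h2
    have h3 : y t ≤ m / 2 * exp (2 * κ t) := by
      have : prim 0 k t = κ t := rfl
      rw [this] at h2
      linarith
    simp only [Real.exp_neg]
    rw [inv_mul_le_iff₀ (Real.exp_pos _)]
    linarith
  have hmz : m = 0 := by linarith
  intro t ht
  have := hle t ht
  rw [hmz, zero_mul] at this
  exact le_antisymm this (hy0 t ht)

section Gelfand

lemma tendsto_integral_pairing {p q : ℝ≥0∞} [HolderTriple q p 1]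
    {a : ℝ → X⋆} {d : ℝ → X} (ha : MemLp a q μT) (hd : MemLp d p μT)
    {f : ℕ → ℝ → X⋆} (hf : ∀ n, MemLp (f n) q μT)
    (hfa : Tendsto (fun n => eLpNorm (f n - a) q μT) atTop (𝓝 0)) (hT : 0 < T)
    {l r : ℕ → ℝ} (hl : ∀ n, l n ∈ IT) (hr : ∀ n, r n ∈ IT) (hlr : ∀ n, l n ≤ r n)
    (hl0 : Tendsto l atTop (𝓝 0)) (hr0 : Tendsto r atTop (𝓝 T)) :
    Tendsto (fun n => ∫ s in (l n)..(r n), f n s (d s)) atTop (𝓝 (∫ s in 0..T, a s (d s))) := by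
  have hi : Integrable (fun s => a s (d s)) μT := integrable_pairing ha hd
  have h0 : (0 : ℝ) ∈ IT := ⟨le_rfl, hT.le⟩
  have hTT : T ∈ IT := ⟨hT.le, le_rfl⟩
  have h1 : Tendsto (fun n => ∫ s in (l n)..(r n), a s (d s)) atTop
      (𝓝 (∫ s in 0..T, a s (d s))) := by
    have hc := continuousOn_prim hi 0
    have e : ∀ n, ∫ s in (l n)..(r n), a s (d s)
        = prim 0 (fun s => a s (d s)) (r n) - prim 0 (fun s => a s (d s)) (l n) := fun n =>
      (prim_sub_prim hi 0 (hl n) (hr n)).symm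
    simp only [e]
    rw [← prim_sub_prim hi 0 h0 hTT]
    have tr : Tendsto r atTop (𝓝[IT] T) := tendsto_nhdsWithin_iff.2 ⟨hr0, .of_forall hr⟩
    have tl : Tendsto l atTop (𝓝[IT] 0) := tendsto_nhdsWithin_iff.2 ⟨hl0, .of_forall hl⟩
    exact ((hc T hTT).tendsto.comp tr).sub ((hc 0 h0).tendsto.comp tl)
  have h2 : Tendsto (fun n => (eLpNorm (f n - a) q μT).toReal * (eLpNorm d p μT).toReal)
      atTop (𝓝 0) := by
    have := ((tendsto_toReal zero_ne_top).comp hfa).mul_const (eLpNorm d p μT).toReal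
    simpa using this
  have h3 : Tendsto (fun n => (∫ s in (l n)..(r n), f n s (d s)) - ∫ s in (l n)..(r n), a s (d s)) atTop
      (𝓝 0) := by
    refine squeeze_zero_norm (fun n => ?_) h2
    have hin : Integrable (fun s => f n s (d s)) μT := integrable_pairing (hf n) hd
    rw [← intervalIntegral.integral_sub (intervalIntegrable_of_μI hin (hl n) (hr n))
      (intervalIntegrable_of_μI hi (hl n) (hr n)), integral_of_le (hlr n)]
    have hle : volume.restrict (Ioc (l n) (r n)) ≤ μT :=
      Measure.restrict_mono (Ioc_subset_Icc_self.trans (Icc_subset_Icc (hl n).1 (hr n).2)) le_rfl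
    have hsub : MemLp (f n - a) q μT := (hf n).sub ha
    have := abs_integral_pairing_le (hsub.mono_measure hle) (hd.mono_measure hle)
    simp only [Pi.sub_apply, sub_apply] at this
    rw [Real.norm_eq_abs]
    refine this.trans ?_
    gcongr
    · exact hsub.2.ne
    · exact hd.2.ne
  have := h1.add h3
  simpa using this

lemma memLp_indicator_Ioc {q : ℝ≥0∞} {a : ℝ → X} (ha : MemLp a q μT) :
    MemLp ((Ioc 0 T).indicator a) q := by
  rw [μI_eq_Ioc] at ha
  rwa [memLp_indicator_iff_restrict measurableSet_Ioc]

lemma indicator_ae_eq_μI {a : ℝ → X} : (Ioc 0 T).indicator a =ᵐ[μT] a := by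
  rw [μI_eq_Ioc]; exact indicator_ae_eq_restrict measurableSet_Ioc

lemma tendsto_avg_sub_μI {q : ℝ≥0∞} (hq : 1 ≤ q) (hq' : q ≠ ∞)
    {a : ℝ → X} (ha : MemLp a q μT) {h : ℕ → ℝ} {α : ℕ → ℝ → ℝ}
    (hw : ∀ n, IsWindow (h n) (α n)) (hh : Tendsto h atTop (𝓝 0)) :
    Tendsto (fun n => eLpNorm (avg (h n) (α n) ((Ioc 0 T).indicator a) - a) q μT) atTop (𝓝 0) := by
  refine (tendsto_eLpNorm_avg_sub (T := T) hw hh hq hq' (memLp_indicator_Ioc ha)).congr fun n => ?_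
  refine eLpNorm_congr_ae ?_
  filter_upwards [indicator_ae_eq_μI (T := T) (a := a)] with t ht
  simp only [Pi.sub_apply, ht]

/-- Limit of the shifted difference quotients in the chain rule. -/
lemma tendsto_shift_pairing {p q : ℝ≥0∞} [HolderTriple q p 1] (hq : 1 ≤ q) (hq' : q ≠ ∞)
    (hT : 0 < T) {a : ℝ → X⋆} {d : ℝ → X} (ha : MemLp a q μT)
    (hd : MemLp d p μT) {h : ℕ → ℝ} (hpos : ∀ n, 0 < h n) (hT' : ∀ n, h n ≤ T)
    (hh : Tendsto h atTop (𝓝 0)) :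
    Tendsto (fun n => (∫ s in 0..(T - h n), ((h n)⁻¹ • ∫ r in s..(s + h n), a r) (d s))
        + ∫ s in 0..(T - h n), ((h n)⁻¹ • ∫ r in s..(s + h n), a r) (d (s + h n))) atTop
      (𝓝 (2 * ∫ s in 0..T, a s (d s))) := by
  let A := (Ioc 0 T).indicator a
  have hA : MemLp A q := memLp_indicator_Ioc ha
  have hle : μT ≤ volume := Measure.restrict_le_self
  have h0 : (0 : ℝ) ∈ IT := ⟨le_rfl, hT.le⟩
  have hTT : T ∈ IT := ⟨hT.le, le_rfl⟩
  have hmem : ∀ n, T - h n ∈ IT := fun n => ⟨by linarith [hT' n], by linarith [hpos n]⟩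
  have hhm : ∀ n, h n ∈ IT := fun n => ⟨(hpos n).le, hT' n⟩
  have hlim : Tendsto (fun n => T - h n) atTop (𝓝 T) := by simpa using hh.const_sub T
  have e : ∀ n, ∀ s ∈ Icc 0 (T - h n), ∫ r in s..(s + h n), a r = ∫ r in s..(s + h n), A r := by
    intro n s hs
    exact (integral_indicator_μI ⟨hs.1, by linarith [hs.2, hpos n]⟩
      ⟨by linarith [hs.1, hpos n], by linarith [hs.2]⟩ (by linarith [hpos n])).symm
  have t1 := tendsto_integral_pairing ha hd
    (fun n => ((memLp_avg (isWindow_forward (hpos n)) hq hq' hA).mono_measure hle))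
    (tendsto_avg_sub_μI hq hq' ha (fun n => isWindow_forward (hpos n)) hh) hT
    (fun n => h0) hmem (fun n => (hmem n).1) tendsto_const_nhds hlim
  have t2 := tendsto_integral_pairing ha hd
    (fun n => ((memLp_avg (isWindow_backward (hpos n)) hq hq' hA).mono_measure hle))
    (tendsto_avg_sub_μI hq hq' ha (fun n => isWindow_backward (hpos n)) hh) hT
    hhm (fun n => hTT) hT' hh tendsto_const_nhds
  rw [two_mul]
  refine (t1.add t2).congr fun n => ?_
  congr 1
  · refine intervalIntegral.integral_congr fun s hs => ?_
    rw [uIcc_of_le (hmem n).1] at hs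
    simp only [avg, e n s hs, A]
  · have := intervalIntegral.integral_comp_add_right (a := 0) (b := T - h n)
      (fun s => avg (h n) (fun t => t - h n) A s (d s)) (h n)
    rw [zero_add, sub_add_cancel] at this
    rw [← this]
    refine intervalIntegral.integral_congr fun s hs => ?_
    rw [uIcc_of_le (hmem n).1] at hs
    simp only [avg, e n s hs, add_sub_cancel_right]

/-- Products of averages over shrinking intervals are negligible. -/
lemma tendsto_mul_integral_norm 
    {p q : ℝ≥0∞} [HolderTriple q p 1] (hq : 1 ≤ q) (hq' : q ≠ ∞) (hp : 1 ≤ p)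
    {a : ℝ → Y} {d : ℝ → X} (ha : MemLp a q μT)
    (hd : MemLp d p μT) {c h : ℕ → ℝ} (hpos : ∀ n, 0 < h n) (hc0 : ∀ n, 0 ≤ c n)
    (hcT : ∀ n, c n + h n ≤ T) (hh : Tendsto h atTop (𝓝 0)) :
    Tendsto (fun n => (h n)⁻¹ * ((∫ s in (c n)..(c n + h n), ‖a s‖)
      * ∫ s in (c n)..(c n + h n), ‖d s‖)) atTop (𝓝 0) := by
  have hq0 : q ≠ 0 := (zero_lt_one.trans_le hq).ne'
  let ν : ℕ → Measure ℝ := fun n => volume.restrict (Ioc (c n) (c n + h n))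
  have hν : ∀ n, ν n ≤ μT := fun n =>
    Measure.restrict_mono (Ioc_subset_Icc_self.trans (Icc_subset_Icc (hc0 n) (hcT n))) le_rfl
  have hνu : ∀ n, ν n univ = ofReal (h n) := fun n => by
    simp [ν]
  have hexp : (1 - 1 / q.toReal) + (1 - 1 / p.toReal) = 1 := by
    have h1 := ENNReal.HolderTriple.inv_add_inv_eq_inv q p 1
    have hqi : q⁻¹ ≠ ∞ := by simp [hq0]
    have hpi : p⁻¹ ≠ ∞ := by simp [(zero_lt_one.trans_le hp).ne']
    have h2 := congrArg ENNReal.toReal h1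
    rw [toReal_add hqi hpi, ENNReal.toReal_inv, ENNReal.toReal_inv] at h2
    simp only [inv_one, toReal_one] at h2
    rw [one_div, one_div]; linarith
  have hbound : ∀ n, (∫ s in (c n)..(c n + h n), ‖a s‖) * ∫ s in (c n)..(c n + h n), ‖d s‖
      ≤ h n * ((eLpNorm a q (ν n)).toReal * (eLpNorm d p μT).toReal) := by
    intro n
    have hp0 := hpos n
    have han := ha.mono_measure (hν n)
    have hdn := hd.mono_measure (hν n)
    have e1 : ∫ s in (c n)..(c n + h n), ‖a s‖ = (eLpNorm a 1 (ν n)).toReal := by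
      rw [integral_of_le (by linarith), eLpNorm_one_eq_lintegral_enorm,
        ← integral_norm_eq_lintegral_enorm han.1]
    have e2 : ∫ s in (c n)..(c n + h n), ‖d s‖ = (eLpNorm d 1 (ν n)).toReal := by
      rw [integral_of_le (by linarith), eLpNorm_one_eq_lintegral_enorm,
        ← integral_norm_eq_lintegral_enorm hdn.1]
    rw [e1, e2, ← toReal_mul]
    have b1 := eLpNorm_le_eLpNorm_mul_rpow_measure_univ hq han.1
    have b2 := eLpNorm_le_eLpNorm_mul_rpow_measure_univ hp hdn.1
    have b3 : eLpNorm a 1 (ν n) * eLpNorm d 1 (ν n)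
        ≤ ofReal (h n) * (eLpNorm a q (ν n) * eLpNorm d p μT) := by
      refine (mul_le_mul' b1 b2).trans ?_
      rw [hνu]
      simp only [toReal_one, div_one]
      calc _ = (ofReal (h n) ^ (1 - 1 / q.toReal) * ofReal (h n) ^ (1 - 1 / p.toReal))
            * (eLpNorm a q (ν n) * eLpNorm d p (ν n)) := by ring
        _ = ofReal (h n) * (eLpNorm a q (ν n) * eLpNorm d p (ν n)) := by
            rw [← ENNReal.rpow_add _ _ (by simpa using hp0) ofReal_ne_top, hexp, rpow_one]
        _ ≤ _ := by gcongr; exact hν n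
    have := toReal_mono (by
      exact mul_ne_top ofReal_ne_top (mul_ne_top han.2.ne hd.2.ne)) b3
    rwa [toReal_mul (a := ofReal (h n)), toReal_ofReal hp0.le,
      toReal_mul (a := eLpNorm a q (ν n))] at this
  have hz : Tendsto (fun n => eLpNorm a q (ν n)) atTop (𝓝 0) := by
    have hqr : 0 < q.toReal := ENNReal.toReal_pos hq0 hq'
    have hfin : ∫⁻ s, ‖a s‖ₑ ^ q.toReal ∂μT ≠ ∞ :=
      (lintegral_rpow_enorm_lt_top_of_eLpNorm_lt_top hq0 hq' ha.2).ne
    have h1 := tendsto_setLIntegral_zero hfin (s := fun n => Ioc (c n) (c n + h n)) (l := atTop) (by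
      refine tendsto_of_tendsto_of_tendsto_of_le_of_le tendsto_const_nhds
        (h := fun n => ofReal (h n)) ?_ (fun n => zero_le) (fun n => ?_)
      · simpa using ENNReal.tendsto_ofReal hh
      · refine (Measure.restrict_le_self (s := IT) _).trans ?_
        simp)
    have h2 := ((ENNReal.continuous_rpow_const (y := 1 / q.toReal)).tendsto 0).comp h1
    rw [ENNReal.zero_rpow_of_pos (by positivity)] at h2
    refine h2.congr fun n => ?_
    rw [eLpNorm_eq_lintegral_rpow_enorm_toReal hq0 hq', Function.comp_apply, μI,
      Measure.restrict_restrict measurableSet_Ioc, inter_eq_self_of_subset_left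
      (Ioc_subset_Icc_self.trans (Icc_subset_Icc (hc0 n) (hcT n)))]
  have hz' : Tendsto (fun n => (eLpNorm a q (ν n)).toReal * (eLpNorm d p μT).toReal) atTop
      (𝓝 0) := by
    have := ((tendsto_toReal zero_ne_top).comp hz).mul_const (eLpNorm d p μT).toReal
    simpa using this
  refine squeeze_zero (fun n => ?_) (fun n => ?_) hz'
  · have := hpos n
    refine mul_nonneg (by positivity) (mul_nonneg ?_ ?_) <;>
      exact intervalIntegral.integral_nonneg (by linarith) fun s _ => norm_nonneg _
  · rw [inv_mul_le_iff₀ (hpos n)]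
    exact hbound n

end Gelfand

section Gelfand

lemma intervalIntegrable_shift_pairing {p q : ℝ≥0∞} [HolderTriple q p 1] (hq : 1 ≤ q) (hq' : q ≠ ∞)
    {a : ℝ → X⋆} {d : ℝ → X} (ha : MemLp a q μT)
    (hd : MemLp d p μT) {h : ℝ} (hpos : 0 < h) (hT' : h ≤ T) :
    IntervalIntegrable (fun s => (h⁻¹ • ∫ r in s..(s + h), a r) (d s)) volume 0 (T - h) ∧
    IntervalIntegrable (fun s => (h⁻¹ • ∫ r in s..(s + h), a r) (d (s + h))) volume 0 (T - h) := by
  let A := (Ioc 0 T).indicator a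
  have hA : MemLp A q := memLp_indicator_Ioc ha
  have hle : μT ≤ volume := Measure.restrict_le_self
  have e : ∀ s ∈ Icc 0 (T - h), ∫ r in s..(s + h), a r = ∫ r in s..(s + h), A r := by
    intro s hs
    exact (integral_indicator_μI ⟨hs.1, by linarith [hs.2]⟩
      ⟨by linarith [hs.1], by linarith [hs.2]⟩ (by linarith)).symm
  have i1 := integrable_pairing ((memLp_avg (isWindow_forward hpos) hq hq' hA).mono_measure hle) hd
  have i2 := integrable_pairing ((memLp_avg (isWindow_backward hpos) hq hq' hA).mono_measure hle) hd
  have hTh : 0 ≤ T - h := by linarith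
  constructor
  · refine (intervalIntegrable_left i1 ⟨hTh, by linarith⟩).congr fun s hs => ?_
    rw [uIoc_of_le hTh] at hs
    simp only [avg, e s ⟨hs.1.le, hs.2⟩, A]
  · have i3 := (intervalIntegrable_of_μI i2 (a := h) (b := T) ⟨hpos.le, hT'⟩
      ⟨by linarith, le_rfl⟩).comp_add_right h
    rw [sub_self] at i3
    refine i3.congr fun s hs => ?_
    rw [uIoc_of_le hTh] at hs
    simp only [avg, e s ⟨hs.1.le, hs.2⟩, add_sub_cancel_right, A]

lemma norm_integral_le_of_subset {f : ℝ → Y}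
    {a b c d : ℝ} (hcd : c ≤ d) (hsub : uIoc a b ⊆ Ioc c d) (hf : IntervalIntegrable f volume c d) :
    ‖∫ r in a..b, f r‖ ≤ ∫ r in c..d, ‖f r‖ := by
  refine intervalIntegral.norm_integral_le_integral_norm_uIoc.trans ?_
  rw [integral_of_le hcd]
  exact setIntegral_mono_set ((intervalIntegrable_iff_integrableOn_Ioc_of_le hcd).1 hf).norm
    (.of_forall fun _ => norm_nonneg _) hsub.eventuallyLE

lemma tendsto_average_of_continuousOn {g : ℝ → ℝ} (hg : ContinuousOn g IT) {t₀ : ℝ}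
    {c h : ℕ → ℝ} (hpos : ∀ n, 0 < h n) (hc0 : ∀ n, 0 ≤ c n) (hcT : ∀ n, c n + h n ≤ T)
    (h1 : ∀ n, c n ≤ t₀) (h2 : ∀ n, t₀ ≤ c n + h n) (hh : Tendsto h atTop (𝓝 0)) :
    Tendsto (fun n => (h n)⁻¹ * ∫ s in (c n)..(c n + h n), g s) atTop (𝓝 (g t₀)) := by
  rw [Metric.tendsto_atTop]
  intro ε hε
  have ht₀ : t₀ ∈ IT := ⟨(hc0 0).trans (h1 0), (h2 0).trans (hcT 0)⟩
  obtain ⟨δ, hδ, hδ'⟩ := Metric.continuousOn_iff.1 hg t₀ ht₀ (ε / 2) (by positivity)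
  obtain ⟨N, hN⟩ := Metric.tendsto_atTop.1 hh δ hδ
  refine ⟨N, fun n hn => ?_⟩
  have hp := hpos n
  have hhn : h n < δ := by
    have := hN n hn
    rw [Real.dist_eq, sub_zero, abs_of_pos hp] at this
    exact this
  have hgi : IntervalIntegrable g volume (c n) (c n + h n) := by
    refine (hg.mono ?_).intervalIntegrable
    rw [uIcc_of_le (by linarith)]
    exact Icc_subset_Icc (hc0 n) (hcT n)
  have e : (h n)⁻¹ * (∫ s in (c n)..(c n + h n), g s) - g t₀
      = (h n)⁻¹ * ∫ s in (c n)..(c n + h n), (g s - g t₀) := by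
    rw [intervalIntegral.integral_sub hgi intervalIntegrable_const, intervalIntegral.integral_const,
      add_sub_cancel_left, smul_eq_mul]
    field_simp
  rw [Real.dist_eq, e, abs_mul, abs_of_pos (inv_pos.2 hp), inv_mul_lt_iff₀ hp]
  have := intervalIntegral.norm_integral_le_of_norm_le_const (a := c n) (b := c n + h n)
    (f := fun s => g s - g t₀) (C := ε / 2) fun s hs => by
      rw [uIoc_of_le (by linarith)] at hs
      have := hδ' s ⟨by linarith [hs.1, hc0 n], by linarith [hs.2, hcT n]⟩ (by
        rw [Real.dist_eq, abs_lt]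
        constructor <;> linarith [hs.1, hs.2, h1 n, h2 n])
      rw [Real.dist_eq] at this
      exact this.le
  rw [add_sub_cancel_left, abs_of_pos hp, Real.norm_eq_abs] at this
  nlinarith

lemma exists_bound_of_weakly_continuous {v : ℝ → H}
    (hv : ∀ h : H, ContinuousOn (fun t => ⟪h, v t⟫) IT) :
    ∃ M, 0 ≤ M ∧ ∀ t ∈ IT, ‖v t‖ ≤ M := by
  obtain ⟨C, hC⟩ := banach_steinhaus (g := fun t : IT => innerSL ℝ (v t)) fun x => by
    obtain ⟨C, hC⟩ := isCompact_Icc.exists_bound_of_continuousOn (hv x)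
    refine ⟨C, fun t => ?_⟩
    rw [innerSL_apply_apply, real_inner_comm]
    exact hC t t.2
  refine ⟨max C 0, le_max_right _ _, fun t ht => ?_⟩
  have := hC ⟨t, ht⟩
  rw [innerSL_apply_norm] at this
  exact this.trans (le_max_left _ _)

lemma continuousOn_functional {v : ℝ → H}
    (hv : ∀ h : H, ContinuousOn (fun t => ⟪h, v t⟫) IT) (L : H⋆) :
    ContinuousOn (fun t => L (v t)) IT := by
  have := hv ((InnerProductSpace.toDual ℝ H).symm L)
  simpa only [InnerProductSpace.toDual_symm_apply] using this

/-- The energy identity for `K v' = a + β` in a Gelfand triple. -/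
lemma gelfand_chain_rule {emb : U →L[ℝ] H} (hsym : ∀ x y, K x y = K y x)
    {p : ℝ} (hp : 1 < p) (hT : 0 < T) {v : ℝ → H} {du : ℝ → U} {a : ℝ → U⋆}
    {β : ℝ → H⋆} (hv : ∀ h : H, ContinuousOn (fun t => ⟪h, v t⟫) IT)
    (hdu : MemLp du (ofReal p) μT) (hemb : ∀ᵐ t ∂μT, emb (du t) = v t)
    (ha : MemLp a (ofReal (conjExp p)) μT) (hβ : MemLp β 1 μT)
    (hY : ∀ t ∈ IT, ∀ x : U, K (v t) (emb x) = K (v 0) (emb x)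
      + (∫ s in 0..t, a s) x + (∫ s in 0..t, β s) (emb x)) :
    K (v T) (v T) - K (v 0) (v 0) = 2 * ∫ s in 0..T, (a s (du s) + β s (v s)) := by
  have := holderTriple_conjExp hp
  have hq1 := one_le_ofReal (one_lt_conjExp hp)
  have hp1 := one_le_ofReal hp
  obtain ⟨M, hM0, hM⟩ := exists_bound_of_weakly_continuous hv
  have hai : Integrable a μT := ha.integrable hq1
  have hβi : Integrable β μT := hβ.integrable le_rfl
  have h0 : (0 : ℝ) ∈ IT := ⟨le_rfl, hT.le⟩
  have hTT : T ∈ IT := ⟨hT.le, le_rfl⟩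
  have hvm : AEStronglyMeasurable v μT :=
    (emb.continuous.comp_aestronglyMeasurable hdu.1).congr hemb
  have hMae : ∀ᵐ t ∂μT, ‖v t‖ ≤ M := ae_restrict_of_forall_mem measurableSet_Icc hM
  have hvL : MemLp v ∞ μT := memLp_top_of_bound hvm M hMae
  have hemb' : ∀ᵐ t, t ∈ IT → emb (du t) = v t := by
    rwa [μI, ae_restrict_iff' measurableSet_Icc] at hemb
  let κ : ℝ → ℝ := fun t => K (v t) (v t)
  have hκ : Integrable κ μT := by
    refine memLp_one_iff_integrable.1 (MemLp.of_bound (K.aestronglyMeasurable_comp₂ hvm hvm)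
      (‖K‖ * M * M) ?_)
    filter_upwards [hMae] with t ht
    refine (K.le_opNorm₂ _ _).trans ?_
    gcongr
  have hinc : ∀ s ∈ IT, ∀ t ∈ IT, ∀ x : U, K (v t) (emb x) - K (v s) (emb x)
      = (∫ r in s..t, a r) x + (∫ r in s..t, β r) (emb x) := by
    intro s hs t ht x
    rw [hY t ht, hY s hs, ← integral_interval_sub_left
      (intervalIntegrable_left hai ht) (intervalIntegrable_left hai hs),
      ← integral_interval_sub_left
      (intervalIntegrable_left hβi ht) (intervalIntegrable_left hβi hs), sub_apply, sub_apply]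
    ring
  have hbd : ∀ (t₀ : ℝ) (c h : ℕ → ℝ), (∀ n, 0 < h n) → (∀ n, 0 ≤ c n) → (∀ n, c n + h n ≤ T) →
      (∀ n, c n ≤ t₀) → (∀ n, t₀ ≤ c n + h n) → Tendsto h atTop (𝓝 0) →
      Tendsto (fun n => (h n)⁻¹ * ∫ s in (c n)..(c n + h n), κ s) atTop (𝓝 (κ t₀)) := by
    intro t₀ c h hpos hc0 hcT h1 h2 hh
    have ht₀ : t₀ ∈ IT := ⟨(hc0 0).trans (h1 0), (h2 0).trans (hcT 0)⟩
    have hcm (n) : c n ∈ IT := ⟨hc0 n, by linarith [hcT n, hpos n]⟩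
    have hdm (n) : c n + h n ∈ IT := ⟨by linarith [hc0 n, hpos n], hcT n⟩
    have hg := continuousOn_functional hv (K (v t₀))
    have A := tendsto_average_of_continuousOn hg hpos hc0 hcT h1 h2 hh
    have B := (tendsto_mul_integral_norm hq1 ofReal_ne_top hp1 ha hdu hpos hc0 hcT hh).add
      (tendsto_mul_integral_norm (p := ∞) le_rfl one_ne_top le_top hβ hvL hpos hc0 hcT hh)
    have C : Tendsto (fun n => (h n)⁻¹ * ∫ s in (c n)..(c n + h n), (κ s - K (v t₀) (v s))) atTop
        (𝓝 0) := by
      rw [add_zero] at B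
      refine squeeze_zero_norm (fun n => ?_) B
      have hpn := hpos n
      have hcd : c n ≤ c n + h n := by linarith
      rw [norm_mul, norm_of_nonneg (inv_pos.2 hpn).le, ← mul_add]
      refine mul_le_mul_of_nonneg_left ?_ (inv_pos.2 hpn).le
      rw [← intervalIntegral.integral_const_mul, ← intervalIntegral.integral_const_mul,
        ← intervalIntegral.integral_add
          ((intervalIntegrable_of_μI (hdu.integrable hp1) (hcm n) (hdm n)).norm.const_mul _)
          ((intervalIntegrable_of_μI (hvL.integrable le_top) (hcm n) (hdm n)).norm.const_mul _)]
      refine intervalIntegral.norm_integral_le_of_norm_le hcd ?_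
        (((intervalIntegrable_of_μI (hdu.integrable hp1) (hcm n) (hdm n)).norm.const_mul _).add
          ((intervalIntegrable_of_μI (hvL.integrable le_top) (hcm n) (hdm n)).norm.const_mul _))
      filter_upwards [hemb'] with s hs hs'
      have hsm : s ∈ IT := ⟨by linarith [hs'.1, hc0 n], by linarith [hs'.2, hcT n]⟩
      have e : κ s - K (v t₀) (v s) = (∫ r in t₀..s, a r) (du s) + (∫ r in t₀..s, β r) (v s) := by
        have := hinc t₀ ht₀ s hsm (du s)
        rwa [hs hsm] at this
      rw [e]
      have hsub : uIoc t₀ s ⊆ Ioc (c n) (c n + h n) := by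
        intro r hr
        rcases le_total t₀ s with hts | hts
        · rw [uIoc_of_le hts] at hr
          exact ⟨by linarith [hr.1, h1 n], by linarith [hr.2, hs'.2]⟩
        · rw [uIoc_of_ge hts] at hr
          exact ⟨by linarith [hr.1, hs'.1], by linarith [hr.2, h2 n]⟩
      refine (norm_add_le _ _).trans (add_le_add ?_ ?_)
      · refine (le_opNorm _ _).trans ?_
        gcongr
        exact norm_integral_le_of_subset hcd hsub (intervalIntegrable_of_μI hai (hcm n) (hdm n))
      · refine (le_opNorm _ _).trans ?_
        gcongr
        exact norm_integral_le_of_subset hcd hsub (intervalIntegrable_of_μI hβi (hcm n) (hdm n))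
    have D := A.add C
    rw [add_zero] at D
    refine D.congr fun n => ?_
    rw [intervalIntegral.integral_sub (intervalIntegrable_of_μI hκ (hcm n) (hdm n))
      (intervalIntegrable_of_μI (integrable_of_continuousOn hg) (hcm n) (hdm n))]
    ring
  let h : ℕ → ℝ := fun n => T / (n + 2 : ℕ)
  have hpos : ∀ n, 0 < h n := fun n => by positivity
  have hhT : ∀ n, h n ≤ T := fun n => div_le_self hT.le (by push_cast; linarith [(n.cast_nonneg : (0:ℝ) ≤ n)])
  have hh : Tendsto h atTop (𝓝 0) :=
    (tendsto_const_div_atTop_nhds_zero_nat T).comp (tendsto_add_atTop_nat 2)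
  have L1 := hbd T (fun n => T - h n) h hpos (fun n => by linarith [hhT n]) (fun n => by linarith)
    (fun n => by linarith [hpos n]) (fun n => by linarith) hh
  have L2 := hbd 0 (fun n => 0) h hpos (fun n => le_rfl) (fun n => by linarith [hhT n])
    (fun n => le_rfl) (fun n => by linarith [hpos n]) hh
  have L := L1.sub L2
  have R := (tendsto_shift_pairing hq1 ofReal_ne_top hT ha hdu hpos hhT hh).add
    (tendsto_shift_pairing (p := ∞) le_rfl one_ne_top hT hβ hvL hpos hhT hh)
  rw [intervalIntegral.integral_add (intervalIntegrable_left (integrable_pairing ha hdu) hTT)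
    (intervalIntegrable_left (integrable_pairing (p := ∞) hβ hvL) hTT), mul_add]
  refine tendsto_nhds_unique L (R.congr fun n => ?_)
  have hpn := hpos n
  have hTh : T - h n ∈ IT := ⟨by linarith [hhT n], by linarith⟩
  have hhm : h n ∈ IT := ⟨hpn.le, hhT n⟩
  obtain ⟨i1, i2⟩ := intervalIntegrable_shift_pairing hq1 ofReal_ne_top ha hdu hpn (hhT n)
  obtain ⟨i3, i4⟩ := intervalIntegrable_shift_pairing (p := ∞) le_rfl one_ne_top hβ hvL hpn (hhT n)
  have k1 : IntervalIntegrable (fun s => κ (s + h n)) volume 0 (T - h n) := by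
    have := (intervalIntegrable_of_μI hκ hhm hTT).comp_add_right (h n)
    rwa [sub_self] at this
  have k2 : IntervalIntegrable κ volume 0 (T - h n) := intervalIntegrable_left hκ hTh
  have eκ : ∫ s in 0..(T - h n), (κ (s + h n) - κ s)
      = (∫ s in (T - h n)..(T - h n + h n), κ s) - ∫ s in 0..(0 + h n), κ s := by
    rw [intervalIntegral.integral_sub k1 k2, intervalIntegral.integral_comp_add_right, sub_add_cancel,
      zero_add]
    have e1 := integral_add_adjacent_intervals (intervalIntegrable_left hκ hhm)
      (intervalIntegrable_of_μI hκ hhm hTT)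
    have e2 := integral_add_adjacent_intervals (intervalIntegrable_left hκ hTh)
      (intervalIntegrable_of_μI hκ hTh hTT)
    linarith
  rw [← mul_sub, ← eκ, ← intervalIntegral.integral_const_mul, ← intervalIntegral.integral_add i1 i2,
    ← intervalIntegral.integral_add i3 i4, ← intervalIntegral.integral_add (i1.add i2) (i3.add i4)]
  refine intervalIntegral.integral_congr_ae ?_
  have hemb2 := (measurePreserving_add_right volume (h n)).quasiMeasurePreserving.ae hemb'
  filter_upwards [hemb', hemb2] with s hs1 hs2 hs
  rw [uIoc_of_le hTh.1] at hs
  have m1 : s ∈ IT := ⟨hs.1.le, by linarith [hs.2]⟩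
  have m2 : s + h n ∈ IT := ⟨by linarith [hs.1], by linarith [hs.2]⟩
  have e1 := hinc s m1 (s + h n) m2 (du s)
  have e2 := hinc s m1 (s + h n) m2 (du (s + h n))
  rw [hs1 m1] at e1
  rw [hs2 m2] at e2
  simp only [smul_apply, smul_eq_mul, κ]
  have e3 : K (v (s + h n)) (v (s + h n)) - K (v s) (v s) = (K (v (s + h n)) (v s) - K (v s) (v s))
        + (K (v (s + h n)) (v (s + h n)) - K (v s) (v (s + h n))) := by
    rw [hsym (v (s + h n)) (v s)]; ring
  rw [e3, e1, e2]
  ring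

end Gelfand

section Tests

/-- Integrability by duality. -/
lemma memLp_conjExp_of_test (hX : Hilbertizable X) {p : ℝ} (hp : 1 < p) (hT : 0 < T)
    {ξ : ℝ → X⋆} (hξ : Integrable ξ μT) {K C₀ : ℝ} (hK : 0 ≤ K)
    (h : ∀ w : ℝ → X, MemLp w ∞ μT → ∫ t, ξ t (w t) ∂μT ≤ C₀ + K * ∫ t, (1 + ‖w t‖ ^ p) ∂μT) :
    MemLp ξ (ofReal (conjExp p)) μT := by
  obtain ⟨J, c, hc, hJ⟩ := hX.exists_dualMap
  set q := conjExp p with hq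
  have hpq := holderConjugate_conjExp hp
  have hq1 : 1 < q := one_lt_conjExp hp
  have hqp : (q - 1) * p = q := by
    have := hpq.mul_eq_add
    linarith
  let j := ‖J‖ + 1
  have hj : 0 < j := by positivity
  let b := c / (2 * (K + 1) * j ^ p)
  have hb : 0 < b := by positivity
  let l := b ^ (1 / (p - 1))
  have hl : 0 < l := by positivity
  have hlp : l ^ (p - 1) = b := by
    simp only [l]
    rw [← Real.rpow_mul hb.le, one_div_mul_cancel (by linarith), Real.rpow_one]
  have hlp' : K * (l * j) ^ p ≤ l * c / 2 := by
    have e : l ^ p = l * b := by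
      rw [← hlp, ← Real.rpow_one_add' hl.le (by linarith)]; congr 1; ring
    rw [mul_rpow hl.le hj.le, e]
    have : K * (l * b * j ^ p) = (K / (K + 1)) * (l * c / 2) := by
      simp only [b]; field_simp
    rw [this]
    have h1 : K / (K + 1) ≤ 1 := by rw [div_le_one (by positivity)]; linarith
    have h2 : 0 ≤ l * c / 2 := by positivity
    exact mul_le_of_le_one_left h2 h1
  let D := 2 * (|C₀| + K * T) / (l * c)
  have hVT : (μT).real univ = T := by
    simp [μI, hT.le]
  have hnm : AEMeasurable (fun t => ‖ξ t‖) μT := hξ.1.norm.aemeasurable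
  have key : ∀ M : ℝ, 0 < M → ∫ t, (min ‖ξ t‖ M) ^ q ∂μT ≤ D := by
    intro M hM
    let m : ℝ → ℝ := fun t => min ‖ξ t‖ M
    have hm0 : ∀ t, 0 ≤ m t := fun t => le_min (norm_nonneg _) hM.le
    have hmm : AEMeasurable m μT := hnm.min aemeasurable_const
    let w : ℝ → X := fun t => (l * m t ^ (q - 1) / ‖ξ t‖) • J (ξ t)
    have hwm : AEStronglyMeasurable w μT :=
      ((((hmm.pow_const (q - 1)).const_mul l).div hnm).aestronglyMeasurable).smul
        (J.continuous.comp_aestronglyMeasurable hξ.1)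
    have hwn : ∀ t, ‖w t‖ ≤ l * j * m t ^ (q - 1) := by
      intro t
      have hn := rpow_nonneg (hm0 t) (q - 1)
      simp only [w]
      rw [norm_smul, norm_of_nonneg (by positivity)]
      have h1 : ‖J (ξ t)‖ ≤ j * ‖ξ t‖ := (J.le_opNorm _).trans (by gcongr; simp [j])
      rcases eq_or_ne ‖ξ t‖ 0 with h0 | h0
      · rw [h0]; simp; positivity
      · have : 0 < ‖ξ t‖ := lt_of_le_of_ne (norm_nonneg _) h0.symm
        calc l * m t ^ (q - 1) / ‖ξ t‖ * ‖J (ξ t)‖ ≤ l * m t ^ (q - 1) / ‖ξ t‖ * (j * ‖ξ t‖) := by gcongr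
          _ = _ := by field_simp
    have hwb : MemLp w ∞ μT := memLp_top_of_bound hwm (l * j * M ^ (q - 1))
      (.of_forall fun t => (hwn t).trans (by
        have := hm0 t
        have : m t ≤ M := min_le_right _ _
        gcongr))
    have hmq : Integrable (fun t => m t ^ q) μT :=
      memLp_one_iff_integrable.1 (MemLp.of_bound (hmm.pow_const q).aestronglyMeasurable (M ^ q)
        (.of_forall fun t => by
          have := hm0 t
          have : m t ≤ M := min_le_right _ _
          rw [norm_of_nonneg (by positivity)]; gcongr))
    have hwp : ∀ t, ‖w t‖ ^ p ≤ (l * j) ^ p * m t ^ q := by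
      intro t
      have hn := rpow_nonneg (hm0 t) (q - 1)
      calc ‖w t‖ ^ p ≤ (l * j * m t ^ (q - 1)) ^ p := by gcongr; exact hwn t
        _ = (l * j) ^ p * m t ^ q := by
          rw [mul_rpow (by positivity) hn, ← Real.rpow_mul (hm0 t), hqp]
    have hwpi : Integrable (fun t => 1 + ‖w t‖ ^ p) μT := by
      refine (integrable_const 1).add ((hmq.const_mul ((l * j) ^ p)).mono'
        (hwm.norm.aemeasurable.pow_const p).aestronglyMeasurable (.of_forall fun t => ?_))
      rw [norm_of_nonneg (by positivity)]
      exact hwp t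
    have hlow : ∀ t, l * c * m t ^ q ≤ ξ t (w t) := by
      intro t
      have hn := rpow_nonneg (hm0 t) (q - 1)
      simp only [w, map_smul, smul_eq_mul]
      rcases eq_or_ne ‖ξ t‖ 0 with h0 | h0
      · have : m t = 0 := by simp only [m, h0]; exact min_eq_left hM.le
        rw [this, h0, Real.zero_rpow (by linarith)]; simp
      · have hpos : 0 < ‖ξ t‖ := lt_of_le_of_ne (norm_nonneg _) h0.symm
        have hmξ : m t ≤ ‖ξ t‖ := min_le_left _ _
        have e : m t ^ q = m t ^ (q - 1) * m t := by
          rw [← Real.rpow_add_one' (hm0 t) (by linarith)]; congr 1; ring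
        calc l * c * m t ^ q = l * c * (m t ^ (q - 1) * m t) := by rw [e]
          _ ≤ l * c * (m t ^ (q - 1) * ‖ξ t‖) := by gcongr
          _ = l * m t ^ (q - 1) / ‖ξ t‖ * (c * ‖ξ t‖ ^ 2) := by field_simp
          _ ≤ _ := mul_le_mul_of_nonneg_left (hJ (ξ t)) (by positivity)
    have hξw : Integrable (fun t => ξ t (w t)) μT :=
      integrable_pairing (p := ∞) (q := 1) (memLp_one_iff_integrable.2 hξ) hwb
    have h1 : l * c * ∫ t, m t ^ q ∂μT ≤ ∫ t, ξ t (w t) ∂μT := by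
      rw [← integral_const_mul]
      exact integral_mono (hmq.const_mul _) hξw hlow
    have h2 : ∫ t, (1 + ‖w t‖ ^ p) ∂μT ≤ T + (l * j) ^ p * ∫ t, m t ^ q ∂μT := by
      calc ∫ t, (1 + ‖w t‖ ^ p) ∂μT ≤ ∫ t, (1 + (l * j) ^ p * m t ^ q) ∂μT := by
            refine integral_mono hwpi ((integrable_const 1).add (hmq.const_mul _)) fun t => ?_
            simp only
            linarith [hwp t]
        _ = _ := by
            rw [integral_add (integrable_const 1) (hmq.const_mul _), integral_const_mul,
              integral_const, hVT, smul_eq_mul, mul_one]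
    have h3 : 0 ≤ ∫ t, m t ^ q ∂μT := integral_nonneg fun t => rpow_nonneg (hm0 t) q
    have h4 := (h1.trans (h w hwb)).trans (add_le_add_right (mul_le_mul_of_nonneg_left h2 hK) C₀)
    have h5 := mul_le_mul_of_nonneg_right hlp' h3
    have h6 := le_abs_self C₀
    simp only [D]
    rw [le_div_iff₀ (by positivity)]
    simp only [m] at h4 h5 ⊢
    nlinarith
  refine ⟨hξ.1, ?_⟩
  rw [eLpNorm_lt_top_iff_lintegral_rpow_enorm_lt_top (conjExp_ofReal_ne_zero hq1)
    ofReal_ne_top, toReal_ofReal (by linarith)]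
  have hfat : ∫⁻ t, ‖ξ t‖ₑ ^ q ∂μT
      ≤ liminf (fun n : ℕ => ∫⁻ t, ofReal ((min ‖ξ t‖ (n + 1)) ^ q) ∂μT) atTop := by
    refine le_trans (lintegral_mono fun t => ?_) (lintegral_liminf_le' fun n =>
      (((hnm.min aemeasurable_const).pow_const q).ennreal_ofReal))
    refine le_liminf_of_le (by isBoundedDefault) ?_
    obtain ⟨N, hN⟩ := exists_nat_ge ‖ξ t‖
    filter_upwards [eventually_ge_atTop N] with n hn
    have : (N : ℝ) ≤ n := by exact_mod_cast hn
    rw [min_eq_left (by linarith), ← ofReal_norm, ofReal_rpow_of_nonneg (norm_nonneg _)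
      (by linarith)]
  refine hfat.trans_lt ((liminf_le_const (c := ofReal D) fun n => ?_).trans_lt
    ENNReal.ofReal_lt_top)
  have hM : (0 : ℝ) < n + 1 := by positivity
  have hint : Integrable (fun t => (min ‖ξ t‖ ((n : ℝ) + 1)) ^ q) μT :=
    memLp_one_iff_integrable.1 (MemLp.of_bound
      ((hnm.min aemeasurable_const).pow_const q).aestronglyMeasurable (((n : ℝ) + 1) ^ q)
      (.of_forall fun t => by
        have h0 : 0 ≤ min ‖ξ t‖ ((n : ℝ) + 1) := le_min (norm_nonneg _) hM.le
        rw [norm_of_nonneg (by positivity)]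
        exact Real.rpow_le_rpow h0 (min_le_right _ _) (by linarith)))
  rw [← ofReal_integral_eq_lintegral_ofReal hint (.of_forall fun t =>
    rpow_nonneg (le_min (norm_nonneg _) hM.le) q)]
  exact ofReal_le_ofReal (key _ hM)

lemma tendsto_trunc (x : X) : Tendsto (fun k : ℕ => trunc (k + 1 : ℝ) x) atTop (𝓝 x) := by
  refine tendsto_const_nhds.congr' ?_
  obtain ⟨N, hN⟩ := exists_nat_ge ‖x‖
  filter_upwards [eventually_ge_atTop N] with n hn
  have : (N : ℝ) ≤ n := by exact_mod_cast hn
  exact (trunc_of_norm_le (by positivity) (by linarith)).symm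

/-- Truncation changes convex integral functionals only slightly. -/
lemma exists_trunc_bound {Ψ : X → ℝ≥0∞} (hc : IsConvex Ψ) (h0 : Ψ 0 ≠ ∞)
    (hl : LowerSemicontinuous Ψ) {w : ℝ → X} (hw : AEStronglyMeasurable w μT) :
    ∃ r : ℕ → ℝ≥0∞, Tendsto r atTop (𝓝 0) ∧
      ∀ k : ℕ, ∫⁻ t, Ψ (trunc (k + 1 : ℝ) (w t)) ∂μT ≤ ∫⁻ t, Ψ (w t) ∂μT + r k := by
  borelize X
  let θ : ℕ → ℝ → ℝ := fun k t => ((k : ℝ) + 1) / max ((k : ℝ) + 1) ‖w t‖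
  have hθm : ∀ k, AEMeasurable (θ k) μT := fun k =>
    (aemeasurable_const (b := (k : ℝ) + 1)).div (aemeasurable_const.max hw.norm.aemeasurable)
  have hθ0 : ∀ k t, 0 ≤ θ k t := fun k t => by
    have : 0 < max ((k : ℝ) + 1) ‖w t‖ := lt_max_of_lt_left (by positivity)
    positivity
  have hθ1 : ∀ k t, θ k t ≤ 1 := fun k t => by
    have : 0 < max ((k : ℝ) + 1) ‖w t‖ := lt_max_of_lt_left (by positivity)
    rw [div_le_one this]; exact le_max_left _ _
  refine ⟨fun k => (∫⁻ t, ofReal (1 - θ k t) ∂μT) * Ψ 0, ?_, fun k => ?_⟩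
  · have : Tendsto (fun k => ∫⁻ t, ofReal (1 - θ k t) ∂μT) atTop (𝓝 (∫⁻ _, 0 ∂μT)) := by
      refine tendsto_lintegral_of_dominated_convergence' (fun _ => 1)
        (fun k => ((hθm k).const_sub 1).ennreal_ofReal)
        (fun k => .of_forall fun t => ?_) (by simp) (.of_forall fun t => ?_)
      · rw [← ofReal_one]
        exact ofReal_le_ofReal (by linarith [hθ0 k t])
      · refine tendsto_const_nhds.congr' ?_
        obtain ⟨N, hN⟩ := exists_nat_ge ‖w t‖
        filter_upwards [eventually_ge_atTop N] with n hn
        have : (N : ℝ) ≤ n := by exact_mod_cast hn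
        have : θ n t = 1 := by
          simp only [θ]; rw [max_eq_left (by linarith), div_self (by positivity)]
        simp [this]
    rw [lintegral_zero] at this
    have h2 := ENNReal.Tendsto.mul_const this (Or.inr h0)
    rwa [zero_mul] at h2
  · beta_reduce
    have hm : AEMeasurable (fun t => Ψ (w t)) μT := hl.measurable.comp_aemeasurable hw.aemeasurable
    rw [← lintegral_mul_const'' _ ((hθm k).const_sub 1).ennreal_ofReal, ← lintegral_add_left' hm]
    refine lintegral_mono fun t => ?_
    have h1 := hc (w t) 0 (θ k t) (1 - θ k t) (hθ0 k t) (by linarith [hθ1 k t]) (by ring)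
    rw [smul_zero, add_zero] at h1
    refine h1.trans (add_le_add_left ?_ _)
    refine mul_le_of_le_one_left' ?_
    rw [← ofReal_one]
    exact ofReal_le_ofReal (hθ1 k t)

lemma tendsto_integral_trunc {p q : ℝ≥0∞} [HolderTriple q p 1]
    {φ : ℝ → X⋆} {w : ℝ → X} (hφ : MemLp φ q μT) (hw : MemLp w p μT) :
    Tendsto (fun k : ℕ => ∫ t, φ t (trunc (k + 1 : ℝ) (w t)) ∂μT) atTop
      (𝓝 (∫ t, φ t (w t) ∂μT)) := by
  have h1 : ∀ k : ℕ, MemLp (fun t => trunc (k + 1 : ℝ) (w t)) p μT := fun k =>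
    hw.of_le ((continuous_trunc (by positivity)).comp_aestronglyMeasurable hw.1)
      (.of_forall fun t => norm_trunc_le_norm (by positivity) _)
  have hb : Integrable (fun t => ‖φ t‖ * ‖w t‖) μT :=
    memLp_one_iff_integrable.1 (MemLp.smul (r := 1) hw.norm hφ.norm)
  refine tendsto_integral_of_dominated_convergence _ (fun k => (integrable_pairing hφ (h1 k)).1)
    hb (fun k => .of_forall fun t => ?_) (.of_forall fun t => ?_)
  · refine ((φ t).le_opNorm _).trans ?_
    gcongr
    exact norm_trunc_le_norm (by positivity) _
  · exact ((φ t).continuous.tendsto _).comp (tendsto_trunc _)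

lemma toReal_le_of_ereal_le {A B : ℝ} {a b : ℝ≥0∞} (hb : b ≠ ∞)
    (h : (A : EReal) + (a : EReal) ≤ (b : EReal) + (B : EReal)) :
    a ≠ ∞ ∧ A + a.toReal ≤ b.toReal + B := by
  rw [← EReal.coe_ennreal_toReal hb, ← EReal.coe_add] at h
  have ha : a ≠ ∞ := by
    rintro rfl
    rw [EReal.coe_ennreal_top, EReal.coe_add_top] at h
    exact absurd (top_le_iff.1 h) (EReal.coe_ne_top _)
  rw [← EReal.coe_ennreal_toReal ha, ← EReal.coe_add] at h
  exact ⟨ha, by exact_mod_cast h⟩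

lemma ereal_le_of_toReal_le {A B : ℝ} {a b : ℝ≥0∞} (ha : a ≠ ∞)
    (h : b ≠ ∞ → A + a.toReal ≤ b.toReal + B) :
    (A : EReal) + (a : EReal) ≤ (b : EReal) + (B : EReal) := by
  by_cases hb : b = ∞
  · subst hb; simp
  · rw [← EReal.coe_ennreal_toReal hb, ← EReal.coe_add, ← EReal.coe_ennreal_toReal ha,
      ← EReal.coe_add]
    exact_mod_cast h hb

end Tests

namespace Problem

variable (P) in
/-- `K` is the bilinear form of the kinetic energy. -/
structure IsKinForm (K : H →L[ℝ] H⋆) : Prop where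
  symm : ∀ x y, K x y = K y x
  kin_eq : ∀ x, P.kin x = (1 / 2) * K x x
  fderiv_eq : ∀ x, fderiv ℝ P.kin x = K x
  coercive : ∃ c : ℝ, 0 < c ∧ ∀ x, c * ‖x‖ ^ 2 ≤ K x x

lemma IsKinForm.kin'_eq (hK : P.IsKinForm K) (h : H) :
    P.kin' h = (K h).comp P.emb := by rw [kin', hK.fderiv_eq]

include hP in
lemma Admissible.exists_kinForm : ∃ K, P.IsKinForm K := by
  obtain ⟨K, hs, hq⟩ := hP.kin_quadratic
  have hq' : ∀ x, P.kin x = (1 / 2) * K x x + (0 : H⋆) x + 0 := fun x => by simp [hq x]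
  refine ⟨K, hs, hq, fun x => ?_, coercive_of_superlinear hq' fun M hM => ?_⟩
  · have := (hasFDerivAt_quadratic hs hq' x).fderiv
    rwa [add_zero] at this
  · have h := hP.kin_coercive.eventually_ge_atTop M
    rw [← comap_norm_atTop, eventually_comap] at h
    obtain ⟨R, hR⟩ := eventually_atTop.1 h
    refine ⟨max R 1, fun x hx => ?_⟩
    have := hR ‖x‖ ((le_max_left _ _).trans hx) x rfl
    have hx0 : 0 < ‖x‖ := lt_of_lt_of_le (by positivity) ((le_max_right _ _).trans hx)
    rwa [le_div_iff₀ hx0] at this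

variable (P) in
/-- A decomposition of the loading. -/
structure IsLoad (f₁ : ℝ → U⋆) (f₂ : ℝ → H) : Prop where
  mem₁ : MemLp f₁ ℓ₁' μP
  mem₂ : MemLp f₂ 1 μP
  eq : ∀ᵐ t ∂μP, P.f t = f₁ t + P.toDual (f₂ t)

namespace Admissible

include hP

lemma dΦu_eq_comp (u : U) (z : Z) :
    P.dΦu u z = (P.dE (u, z)).comp (ContinuousLinearMap.inl ℝ U Z) := by
  ext x
  simp [hP.dE_apply]

lemma dΦz_eq_comp (u : U) (z : Z) :
    P.dΦz u z = (P.dE (u, z)).comp (ContinuousLinearMap.inr ℝ U Z) := by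
  ext x
  simp [hP.dE_apply]

lemma continuous_dE : Continuous P.dE := hP.contDiff_energy.continuous_fderiv (by norm_num)

lemma continuousOn_dΦu {u : ℝ → U} {z : ℝ → Z} {S : Set ℝ}
    (hu : ContinuousOn u S) (hz : ContinuousOn z S) : ContinuousOn (fun t => P.dΦu (u t) (z t)) S := by
  simp only [hP.dΦu_eq_comp]
  exact (hP.continuous_dE.comp_continuousOn (hu.prodMk hz)).clm_comp continuousOn_const

lemma continuousOn_dΦz {u : ℝ → U} {z : ℝ → Z} {S : Set ℝ}
    (hu : ContinuousOn u S) (hz : ContinuousOn z S) : ContinuousOn (fun t => P.dΦz (u t) (z t)) S := by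
  simp only [hP.dΦz_eq_comp]
  exact (hP.continuous_dE.comp_continuousOn (hu.prodMk hz)).clm_comp continuousOn_const

lemma one_le_p₁ : 1 ≤ ℓ₁ := one_le_ofReal hP.one_lt_p₁
lemma one_le_p₂ : 1 ≤ ℓ₂ := one_le_ofReal hP.one_lt_p₂
lemma one_le_p₁' : 1 ≤ ℓ₁' := one_le_ofReal (one_lt_conjExp hP.one_lt_p₁)
lemma one_le_p₂' : 1 ≤ ℓ₂' := one_le_ofReal (one_lt_conjExp hP.one_lt_p₂)

end Admissible

variable (P) in
/-- The data of a solution in resolved form: `ξ ∈ ∂Ψ₁(u')` is the dissipative force, and the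
inclusions are expressed by a variational inequality. -/
structure IsFlow (K : H →L[ℝ] H⋆) (f₁ : ℝ → U⋆) (f₂ : ℝ → H)
    (u : ℝ → U) (v : ℝ → H) (z : ℝ → Z) (du : ℝ → U) (dz : ℝ → Z) (ξ : ℝ → U⋆) : Prop where
  v_cont : ∀ h : H, ContinuousOn (fun t => ⟪h, v t⟫) IP
  v_zero : v 0 = P.v₀
  du_mem : MemLp du ℓ₁ μP
  dz_mem : MemLp dz ℓ₂ μP
  ξ_mem : MemLp ξ ℓ₁' μP
  emb_du : ∀ᵐ t ∂μP, P.emb (du t) = v t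
  u_eq : ∀ t ∈ IP, u t = prim P.u₀ du t
  z_eq : ∀ t ∈ IP, z t = prim P.z₀ dz t
  momentum : ∀ t ∈ IP, ∀ x : U, K (v t) (P.emb x) = K P.v₀ (P.emb x)
    + (∫ s in 0..t, (f₁ s - P.dΦu (u s) (z s) - ξ s)) x
    + (∫ s in 0..t, innerSL ℝ (f₂ s)) (P.emb x)

variable (P) in
/-- The variational inequality for the dissipative forces. -/
structure IsDissipative (u : ℝ → U) (z : ℝ → Z) (du : ℝ → U) (dz : ℝ → Z) (ξ : ℝ → U⋆) : Prop where
  fin₁ : ∫Ψ₁ du ≠ ∞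
  fin₂ : ∫Ψ₂ dz ≠ ∞
  vi : ∀ (v' : ℝ → U) (z' : ℝ → Z), MemLp v' ∞ μP → MemLp z' ∞ μP → ∫Ψ₁ v' ≠ ∞ → ∫Ψ₂ z' ≠ ∞ →
    (∫Ψ₁ du).toReal + (∫Ψ₂ dz).toReal + (∫⟨ξ, v'⟩ - ∫⟨ξ, du⟩) + (∫Γ u z z' - ∫Γ u z dz)
      ≤ (∫Ψ₁ v').toReal + (∫Ψ₂ z').toReal

section Flow

variable {u : ℝ → U} {v : ℝ → H} {z : ℝ → Z} {du : ℝ → U} {dz : ℝ → Z} {ξ : ℝ → U⋆}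

variable (h : P.IsFlow K f₁ f₂ u v z du dz ξ)

include hP h

namespace IsFlow

lemma continuousOn_u :
    ContinuousOn u IP :=
  (continuousOn_prim (h.du_mem.integrable hP.one_le_p₁) P.u₀).congr h.u_eq

lemma continuousOn_z :
    ContinuousOn z IP :=
  (continuousOn_prim (h.dz_mem.integrable hP.one_le_p₂) P.z₀).congr h.z_eq

lemma u_zero : u 0 = P.u₀ := by
  rw [h.u_eq 0 ⟨le_rfl, hP.T_pos.le⟩]; simp [prim]

lemma z_zero : z 0 = P.z₀ := by
  rw [h.z_eq 0 ⟨le_rfl, hP.T_pos.le⟩]; simp [prim]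

lemma memLp_dΦu (p : ℝ≥0∞) :
    MemLp (fun t => P.dΦu (u t) (z t)) p μP :=
  memLp_of_continuousOn (hP.continuousOn_dΦu (h.continuousOn_u hP) (h.continuousOn_z hP)) p

lemma memLp_dΦz (p : ℝ≥0∞) :
    MemLp (fun t => P.dΦz (u t) (z t)) p μP :=
  memLp_of_continuousOn (hP.continuousOn_dΦz (h.continuousOn_u hP) (h.continuousOn_z hP)) p

lemma memLp_force (hf : P.IsLoad f₁ f₂) :
    MemLp (fun t => f₁ t - P.dΦu (u t) (z t) - ξ t) ℓ₁' μP :=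
  (hf.mem₁.sub (h.memLp_dΦu hP _)).sub h.ξ_mem

lemma memLp_η :
    MemLp (fun t => P.g t - P.dΦz (u t) (z t)) ℓ₂' μP :=
  hP.g_mem.sub (h.memLp_dΦz hP _)

omit hP in
lemma memLp_v : MemLp v ∞ μP := by
  obtain ⟨M, hM0, hM⟩ := exists_bound_of_weakly_continuous h.v_cont
  exact memLp_top_of_bound ((P.emb.continuous.comp_aestronglyMeasurable h.du_mem.1).congr h.emb_du) M
    (ae_restrict_of_forall_mem measurableSet_Icc hM)

end IsFlow

omit hP h in
lemma memLp_innerSL {p : ℝ≥0∞} (hf : MemLp f₂ p μT) :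
    MemLp (fun s => (innerSL ℝ (f₂ s) : H⋆)) p μT :=
  (innerSL ℝ : H →L[ℝ] H⋆).comp_memLp' hf

omit hP h in
lemma μI_mono (h : t ≤ T) : μI t ≤ μT := Measure.restrict_mono (Icc_subset_Icc_right h) le_rfl

lemma IsFlow.kin_balance (hK : P.IsKinForm K) (hf : P.IsLoad f₁ f₂) (ht : t ∈ IP) :
    P.kin (v t) - P.kin P.v₀ = ∫ s in 0..t,
      ((f₁ s - P.dΦu (u s) (z s) - ξ s) (du s) + innerSL ℝ (f₂ s) (v s)) := by
  rcases ht.1.eq_or_lt with h0 | h0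
  · rw [← h0, h.v_zero]; simp
  have hle := μI_mono ht.2
  have hsub : Icc 0 t ⊆ IP := Icc_subset_Icc_right ht.2
  have := gelfand_chain_rule (emb := P.emb) hK.symm hP.one_lt_p₁ h0
    (fun x => (h.v_cont x).mono hsub) (h.du_mem.mono_measure hle) (ae_mono hle h.emb_du)
    ((h.memLp_force hP hf).mono_measure hle) ((memLp_innerSL hf.mem₂).mono_measure hle)
    (fun s hs x => by rw [h.v_zero]; exact h.momentum s (hsub hs) x)
  rw [h.v_zero] at this
  rw [hK.kin_eq, hK.kin_eq]
  linarith

omit h in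
lemma chain_rule_energy {du : ℝ → U} {dz : ℝ → Z} (hdu : Integrable du μP) (hdz : Integrable dz μP)
    (hu : ∀ t ∈ IP, u t = prim P.u₀ du t) (hz : ∀ t ∈ IP, z t = prim P.z₀ dz t)
    (ht : t ∈ IP) :
    IntervalIntegrable (fun s => P.dΦu (u s) (z s) (du s) + P.dΦz (u s) (z s) (dz s)) volume 0 t ∧
    P.Φ (u t) (z t) - P.Φ P.u₀ P.z₀
      = ∫ s in 0..t, (P.dΦu (u s) (z s) (du s) + P.dΦz (u s) (z s) (dz s)) := by
  have hpair : ∀ s ∈ IP, prim ((P.u₀, P.z₀) : U × Z) (fun s => (du s, dz s)) s = (u s, z s) := by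
    intro s hs
    rw [prim_prodMk hdu hdz _ _ hs, ← hu s hs, ← hz s hs]
  obtain ⟨h1, h2⟩ := chain_rule_prim (F := P.energy) (hP.contDiff_energy.of_le (by norm_num))
    (hdu.prodMk hdz) (P.u₀, P.z₀) ht
  have hcongr : ∀ s ∈ Icc 0 t, fderiv ℝ P.energy (prim ((P.u₀, P.z₀) : U × Z) (fun s => (du s, dz s)) s)
      (du s, dz s) = P.dΦu (u s) (z s) (du s) + P.dΦz (u s) (z s) (dz s) := by
    intro s hs
    rw [hpair s ⟨hs.1, hs.2.trans ht.2⟩]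
    exact hP.dE_apply _ _
  refine ⟨h1.congr fun s hs => ?_, ?_⟩
  · rw [uIoc_of_le ht.1] at hs
    exact hcongr s ⟨hs.1.le, hs.2⟩
  · rw [hpair t ht] at h2
    refine Eq.trans h2 (intervalIntegral.integral_congr fun s hs => ?_)
    rw [uIcc_of_le ht.1] at hs
    exact hcongr s hs

/-- The energy balance of a flow. -/
lemma IsFlow.energy_balance (hK : P.IsKinForm K) (hf : P.IsLoad f₁ f₂) :
    P.kin (v P.T) + P.Φ (u P.T) (z P.T) = P.kin P.v₀ + P.Φ P.u₀ P.z₀ + ∫⟨P.f, du⟩ + ∫⟨P.g, dz⟩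
      - ∫⟨ξ, du⟩ - ∫Γ u z dz := by
  have := holderTriple_conjExp hP.one_lt_p₁
  have := holderTriple_conjExp hP.one_lt_p₂
  have hT : P.T ∈ IP := ⟨hP.T_pos.le, le_rfl⟩
  have e1 := h.kin_balance hP hK hf hT
  have e2 := (chain_rule_energy hP (h.du_mem.integrable hP.one_le_p₁)
    (h.dz_mem.integrable hP.one_le_p₂) h.u_eq h.z_eq hT).2
  rw [← integral_μI hP.T_pos.le] at e1 e2
  have i1 := integrable_pairing hf.mem₁ h.du_mem
  have i2 : Integrable (fun t => innerSL ℝ (f₂ t) (v t)) μP :=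
    integrable_pairing (p := ∞) (memLp_innerSL hf.mem₂) h.memLp_v
  have i3 := integrable_pairing h.ξ_mem h.du_mem
  have i4 := integrable_pairing (h.memLp_dΦu hP ℓ₁') h.du_mem
  have i5 := integrable_pairing (h.memLp_dΦz hP ℓ₂') h.dz_mem
  have i6 := integrable_pairing hP.g_mem h.dz_mem
  have hfd : (fun t => P.f t (du t)) =ᵐ[μP] fun t => f₁ t (du t) + innerSL ℝ (f₂ t) (v t) := by
    filter_upwards [hf.eq, h.emb_du] with t h1 h2
    rw [h1, add_apply, ← h2]; rfl
  simp only [sub_apply] at e1 ⊢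
  rw [integral_congr_ae hfd, integral_add i1 i2, integral_sub i6 i5]
  rw [integral_add i4 i5] at e2
  have i7 : Integrable (fun t => f₁ t (du t) - P.dΦu (u t) (z t) (du t)) μP := i1.sub i4
  have i8 : Integrable (fun t => f₁ t (du t) - P.dΦu (u t) (z t) (du t) - ξ t (du t)) μP :=
    i7.sub i3
  rw [integral_add i8 i2, integral_sub i7 i3, integral_sub i1 i4] at e1
  linarith

end Flow

end Problem

lemma aemeasurable_comp_lsc {X : Type*} [NormedAddCommGroup X] {Ψ : X → ℝ≥0∞}
    (hl : LowerSemicontinuous Ψ) {α : Type*} [MeasurableSpace α] {μ : Measure α} {w : α → X}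
    (hw : AEStronglyMeasurable w μ) : AEMeasurable (fun t => Ψ (w t)) μ := by
  borelize X
  exact hl.measurable.comp_aemeasurable hw.aemeasurable

lemma lintegral_le_of_growth {X : Type*} [NormedAddCommGroup X] {Ψ : X → ℝ≥0∞} {k p : ℝ}
    (hk : 0 ≤ k) (h : ∀ v, Ψ v ≤ ofReal (k * (1 + ‖v‖ ^ p))) (hp : 1 < p)
    {w : ℝ → X} (hw : MemLp w (ofReal p) μT) :
    Integrable (fun t => 1 + ‖w t‖ ^ p) μT ∧
    ∫⁻ t, Ψ (w t) ∂μT ≤ ofReal (k * ∫ t, (1 + ‖w t‖ ^ p) ∂μT) := by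
  have hi : Integrable (fun t => 1 + ‖w t‖ ^ p) μT := by
    refine (integrable_const _).add ?_
    have := hw.integrable_norm_rpow (conjExp_ofReal_ne_zero hp) ofReal_ne_top
    rwa [toReal_ofReal (by linarith)] at this
  refine ⟨hi, ?_⟩
  rw [← integral_const_mul, ofReal_integral_eq_lintegral_ofReal (hi.const_mul k)
    (.of_forall fun t => by positivity)]
  exact lintegral_mono fun t => h _

lemma ae_μI_of_forall {X : Type*} {a b : ℝ → X} (h : ∀ t ∈ IT, a t = b t) :
    b =ᵐ[μT] a :=
  ae_restrict_of_forall_mem measurableSet_Icc fun t ht => (h t ht).symm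

lemma integrable_add {X : Type*} [NormedAddCommGroup X] {α : Type*} [MeasurableSpace α]
    {μ : Measure α} {f g : α → X} (hf : Integrable f μ) (hg : Integrable g μ) :
    Integrable (fun t => f t + g t) μ := hf.add hg

namespace Problem

/-- The embedding of `H` into `U*` as a continuous linear map. -/
def toDualL (P : Problem U H Z) : H →L[ℝ] U⋆ := ((compL ℝ U H ℝ).flip P.emb).comp (innerSL ℝ)

lemma toDualL_apply (P : Problem U H Z) (h : H) : P.toDualL h = P.toDual h := rfl

lemma IsLoad.integral_toDual (hf : P.IsLoad f₁ f₂) (ht : t ∈ IP) : ∫ s in 0..t, P.toDual (f₂ s)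
    = ((compL ℝ U H ℝ).flip P.emb) (∫ s in 0..t, (innerSL ℝ (f₂ s) : H⋆)) :=
  ((compL ℝ U H ℝ).flip P.emb).intervalIntegral_comp_comm
    (intervalIntegrable_left ((memLp_innerSL hf.mem₂).integrable le_rfl) ht)

include hP

lemma Admissible.exists_growth :
    ∃ k : ℝ, 0 ≤ k ∧ ∀ v, P.Ψ₁ v ≤ ofReal (k * (1 + ‖v‖ ^ P.p₁)) := by
  obtain ⟨C, hC⟩ := hP.Ψ₁_growth
  exact exists_growth_of_subdiff_growth hP.hilbertizable_U hP.Ψ₁_convex hP.Ψ₁_lsc hP.Ψ₁_zero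
    hP.one_lt_p₁ hC

lemma IsLoad.integrable (hf : P.IsLoad f₁ f₂) : Integrable P.f μP := by
  have h2 : Integrable (fun t => P.toDual (f₂ t)) μP :=
    P.toDualL.integrable_comp (hf.mem₂.integrable le_rfl)
  refine (integrable_add (hf.mem₁.integrable hP.one_le_p₁') h2).congr ?_
  filter_upwards [hf.eq] with t ht
  rw [ht]

lemma IsLoad.integrable_pairing (hf : P.IsLoad f₁ f₂) {du : ℝ → U} {v : ℝ → H}
    (hdu : MemLp du ℓ₁ μP) (hv : MemLp v ∞ μP)
    (he : ∀ᵐ t ∂μP, P.emb (du t) = v t) :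
    Integrable (fun t => P.f t (du t)) μP ∧ ∫⟨P.f, du⟩ = ∫⟨f₁, du⟩ + ∫ t, ⟪f₂ t, v t⟫ ∂μP := by
  have := holderTriple_conjExp hP.one_lt_p₁
  have i1 := FractionalStep.integrable_pairing hf.mem₁ hdu
  have i2 : Integrable (fun t => ⟪f₂ t, v t⟫) μP :=
    FractionalStep.integrable_pairing (p := ∞) (memLp_innerSL hf.mem₂) hv
  have hfd : (fun t => f₁ t (du t) + ⟪f₂ t, v t⟫) =ᵐ[μP] fun t => P.f t (du t) := by
    filter_upwards [hf.eq, he] with t h1 h2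
    rw [h1, add_apply, ← h2]; rfl
  exact ⟨(i1.add i2).congr hfd, by rw [← integral_congr_ae hfd, integral_add i1 i2]⟩

/-- The terms of the variational inequality of a weak solution, separated. -/
lemma integral_weak_eq
    (hf : P.IsLoad f₁ f₂) {u : ℝ → U} {z : ℝ → Z} {v : ℝ → H} {du : ℝ → U} {dz : ℝ → Z}
    {dTv ξ : ℝ → U⋆} (hz : Integrable (fun t => P.g t - P.dΦz (u t) (z t)) μP)
    (hdu : MemLp du ℓ₁ μP) (hdz : MemLp dz ℓ₂ μP)
    (hv : MemLp v ∞ μP) (he : ∀ᵐ t ∂μP, P.emb (du t) = v t)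
    (hξ : Integrable ξ μP)
    (heq : ∀ᵐ t ∂μP, dTv t + P.dΦu (u t) (z t) - P.f t = -ξ t)
    {v' : ℝ → U} {z' : ℝ → Z} (hv' : MemLp v' ∞ μP) (hz' : MemLp z' ∞ μP) :
    ∫ t, ((dTv t + P.dΦu (u t) (z t) - P.f t) (v' t) + (P.dΦz (u t) (z t) - P.g t) (z' t)
      + P.f t (du t) + P.g t (dz t)) ∂μP
    = -∫⟨ξ, v'⟩ - ∫Γ u z z' + ∫⟨P.f, du⟩ + ∫⟨P.g, dz⟩ := by
  have := holderTriple_conjExp hP.one_lt_p₂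
  have i1 : Integrable (fun t => ξ t (v' t)) μP :=
    FractionalStep.integrable_pairing (p := ∞) (memLp_one_iff_integrable.2 hξ) hv'
  have i2 : Integrable (fun t => (P.g t - P.dΦz (u t) (z t)) (z' t)) μP :=
    FractionalStep.integrable_pairing (p := ∞) (memLp_one_iff_integrable.2 hz) hz'
  have i3 := (hf.integrable_pairing hP hdu hv he).1
  have i4 := FractionalStep.integrable_pairing hP.g_mem hdz
  have i5 : Integrable (fun t => -ξ t (v' t) - (P.g t - P.dΦz (u t) (z t)) (z' t)) μP :=
    i1.neg.sub i2
  have i6 : Integrable (fun t => -ξ t (v' t) - (P.g t - P.dΦz (u t) (z t)) (z' t) + P.f t (du t))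
    μP := i5.add i3
  have i7 : Integrable (fun t => -ξ t (v' t)) μP := i1.neg
  rw [← integral_neg, ← integral_sub i7 i2, ← integral_add i5 i3, ← integral_add i6 i4]
  refine integral_congr_ae ?_
  filter_upwards [heq] with t ht
  rw [ht, neg_apply, sub_apply, sub_apply]
  ring

section

variable {u : ℝ → U} {v : ℝ → H} {z : ℝ → Z}

/-- A weak solution, in resolved form. -/
lemma IsWeakSolution.exists_flow (hK : P.IsKinForm K) (hf : P.IsLoad f₁ f₂)
    (h : P.IsWeakSolution u v z) : ∃ du dz ξ, P.IsFlow K f₁ f₂ u v z du dz ξ ∧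
      P.IsDissipative u z du dz ξ := by
  obtain ⟨hu, hz, hv, hu0, hv0, hz0, du, dTv, dz, ⟨-, hdu, hdu'⟩, he, ⟨-, hdT, hdT'⟩,
    ⟨-, hdz, hdz'⟩, hvi⟩ := h
  have hT := hP.T_pos
  have hTm : P.T ∈ IP := ⟨hT.le, le_rfl⟩
  have iT := hdT.integrable le_rfl
  let ξ : ℝ → U⋆ := fun t => P.f t - P.dΦu (u t) (z t) - dTv t
  have idu : MemLp (fun t => P.dΦu (u t) (z t)) ℓ₁' μP :=
    memLp_of_continuousOn (hP.continuousOn_dΦu hu hz) _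
  have hξ : Integrable ξ μP := ((hf.integrable hP).sub (idu.integrable hP.one_le_p₁')).sub iT
  have hηL : MemLp (fun t => P.g t - P.dΦz (u t) (z t)) ℓ₂' μP :=
    hP.g_mem.sub (memLp_of_continuousOn (hP.continuousOn_dΦz hu hz) _)
  have hη := hηL.integrable hP.one_le_p₂'
  have hvL : MemLp v ∞ μP := by
    obtain ⟨M, hM0, hM⟩ := exists_bound_of_weakly_continuous hv
    exact memLp_top_of_bound ((P.emb.continuous.comp_aestronglyMeasurable hdu.1).congr he) M
      (ae_restrict_of_forall_mem measurableSet_Icc hM)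
  have key := fun (v' : ℝ → U) (z' : ℝ → Z) (hv' : MemLp v' ∞ μP)
    (hz' : MemLp z' ∞ μP) => integral_weak_eq hP hf (dTv := dTv) hη hdu hdz hvL he hξ
      (.of_forall fun t => by simp only [ξ]; abel) hv' hz'
  have hvi' : ∀ (v' : ℝ → U) (z' : ℝ → Z), MemLp v' ∞ μP → MemLp z' ∞ μP → ∫Ψ₁ v' ≠ ∞ → ∫Ψ₂ z' ≠ ∞ →
      ∫Ψ₁ du ≠ ∞ ∧ ∫Ψ₂ dz ≠ ∞ ∧
      P.kin (v P.T) + P.Φ (u P.T) (z P.T) + ((∫Ψ₁ du).toReal + (∫Ψ₂ dz).toReal) ≤ (∫Ψ₁ v').toReal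
        + (∫Ψ₂ z').toReal + (-∫⟨ξ, v'⟩
        - ∫Γ u z z' + ∫⟨P.f, du⟩
        + ∫⟨P.g, dz⟩ + P.kin P.v₀ + P.Φ P.u₀ P.z₀) := by
    intro v' z' hv' hz' h1 h2
    have := hvi v' z' hv' hz'
    rw [key v' z' hv' hz', lintegral_add_left' (aemeasurable_comp_lsc hP.Ψ₁_lsc hdu.1),
      lintegral_add_left' (aemeasurable_comp_lsc hP.Ψ₁_lsc hv'.1)] at this
    obtain ⟨h3, h4⟩ := toReal_le_of_ereal_le (add_ne_top.2 ⟨h1, h2⟩) this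
    have h5 := add_ne_top.1 h3
    rw [toReal_add h5.1 h5.2, toReal_add h1 h2] at h4
    exact ⟨h5.1, h5.2, h4⟩
  have hz0L : MemLp (fun _ : ℝ => (0 : Z)) ∞ μP := MemLp.zero
  have hu0L : MemLp (fun _ : ℝ => (0 : U)) ∞ μP := MemLp.zero
  have hΨ10 : ∫⁻ _, P.Ψ₁ 0 ∂μP ≠ ∞ := by
    simp [ENNReal.mul_eq_top, hP.Ψ₁_zero]
  have hΨ20 : ∫⁻ _, P.Ψ₂ 0 ∂μP ≠ ∞ := by
    simp [ENNReal.mul_eq_top, hP.Ψ₂_zero]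
  obtain ⟨fin₁, fin₂, -⟩ := hvi' _ _ hu0L hz0L hΨ10 hΨ20
  have hξL : MemLp ξ ℓ₁' μP := by
    obtain ⟨k, hk, hΨ⟩ := hP.exists_growth
    refine memLp_conjExp_of_test hP.hilbertizable_U hP.one_lt_p₁ hT hξ hk (C₀ :=
      (∫⁻ _, P.Ψ₂ 0 ∂μP).toReal + (∫⟨P.f, du⟩ + ∫⟨P.g, dz⟩ + P.kin P.v₀ + P.Φ P.u₀ P.z₀)
        - (P.kin (v P.T) + P.Φ (u P.T) (z P.T))) fun w hw => ?_
    obtain ⟨i1, i2⟩ := lintegral_le_of_growth hk hΨ hP.one_lt_p₁ (hw.mono_exponent le_top)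
    obtain ⟨-, -, h3⟩ := hvi' w _ hw hz0L (ne_top_of_le_ne_top ofReal_ne_top i2) hΨ20
    have h4 : (∫Ψ₁ w).toReal ≤ k * ∫ t, (1 + ‖w t‖ ^ P.p₁) ∂μP :=
      ENNReal.toReal_le_of_le_ofReal (mul_nonneg hk (integral_nonneg fun t => by positivity)) i2
    simp only [map_zero, integral_zero] at h3
    have h5 := toReal_nonneg (a := ∫Ψ₁ du)
    have h6 := toReal_nonneg (a := ∫Ψ₂ dz)
    linarith
  have hmom : ∀ t ∈ IP, ∀ x : U, K (v t) (P.emb x) = K P.v₀ (P.emb x)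
      + (∫ s in 0..t, (f₁ s - P.dΦu (u s) (z s) - ξ s)) x
      + (∫ s in 0..t, innerSL ℝ (f₂ s)) (P.emb x) := by
    have hkin : Integrable (fun t => P.kin' (v t)) μP := by
      have h1 : Integrable (fun t => K (v t)) μP := K.integrable_comp (hvL.integrable le_top)
      have := ((compL ℝ U H ℝ).flip P.emb).integrable_comp h1
      refine this.congr (.of_forall fun t => ?_)
      exact (hK.kin'_eq (v t)).symm
    obtain ⟨c, hc⟩ := hdT'.exists_ae_eq_prim hT hkin iT
    intro t ht x
    have hcont : ContinuousOn (fun t => K (v t) (P.emb x)) IP :=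
      continuousOn_functional hv (K.flip (P.emb x))
    have hcont' : ContinuousOn (fun t => prim c dTv t x) IP :=
      (continuousOn_prim iT c).clm_apply continuousOn_const
    have heq := eqOn_of_ae_eq hT hcont hcont' (by
      filter_upwards [hc] with t ht
      rw [← ht, hK.kin'_eq]; rfl)
    have h0 := heq ⟨le_rfl, hT.le⟩
    have ht' := heq ht
    simp only [prim, intervalIntegral.integral_same, add_zero, hv0] at h0 ht'
    rw [ht', add_apply, ← h0, add_assoc]
    congr 1
    have i1 : IntervalIntegrable (fun s => f₁ s - P.dΦu (u s) (z s) - ξ s) volume 0 t :=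
      intervalIntegrable_left (((hf.mem₁.sub idu).sub hξL).integrable hP.one_le_p₁') ht
    have i2' : Integrable (fun s => P.toDual (f₂ s)) μP :=
      P.toDualL.integrable_comp (hf.mem₂.integrable le_rfl)
    have i2 := intervalIntegrable_left i2' ht
    have e1 : ∫ s in 0..t, dTv s = (∫ s in 0..t, (f₁ s - P.dΦu (u s) (z s) - ξ s))
        + ∫ s in 0..t, P.toDual (f₂ s) := by
      rw [← intervalIntegral.integral_add i1 i2]
      rw [integral_of_le ht.1, integral_of_le ht.1]
      refine integral_congr_ae ?_
      have := hf.eq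
      rw [μI_eq_Ioc] at this
      filter_upwards [ae_restrict_of_ae_restrict_of_subset (Ioc_subset_Ioc_right ht.2) this] with s hs
      simp only [ξ, hs]
      abel
    rw [e1, add_apply]
    congr 1
    rw [hf.integral_toDual ht]; rfl
  have hflow : P.IsFlow K f₁ f₂ u v z du dz ξ := ⟨hv, hv0, hdu, hdz, hξL, he,
    fun t ht => hu0 ▸ hdu'.eq_prim hT hu (hdu.integrable hP.one_le_p₁) t ht,
    fun t ht => hz0 ▸ hdz'.eq_prim hT hz (hdz.integrable hP.one_le_p₂) t ht, hmom⟩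
  refine ⟨du, dz, ξ, hflow, fin₁, fin₂, fun v' z' hv' hz' h1 h2 => ?_⟩
  obtain ⟨-, -, h3⟩ := hvi' v' z' hv' hz' h1 h2
  rw [hflow.energy_balance hP hK hf] at h3
  linarith

/-- A dissipative flow is a weak solution. -/
lemma IsFlow.isWeakSolution (hK : P.IsKinForm K) (hf : P.IsLoad f₁ f₂)
    {du : ℝ → U} {dz : ℝ → Z} {ξ : ℝ → U⋆} (h : P.IsFlow K f₁ f₂ u v z du dz ξ)
    (hd : P.IsDissipative u z du dz ξ) : P.IsWeakSolution u v z := by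
  have hT := hP.T_pos
  have hu := h.continuousOn_u hP
  have hz := h.continuousOn_z hP
  have iu := h.du_mem.integrable hP.one_le_p₁
  have iz := h.dz_mem.integrable hP.one_le_p₂
  let dTv : ℝ → U⋆ := fun t => (f₁ t - P.dΦu (u t) (z t) - ξ t) + P.toDual (f₂ t)
  have i1 := (h.memLp_force hP hf).integrable hP.one_le_p₁'
  have i2 : Integrable (fun s => P.toDual (f₂ s)) μP :=
    P.toDualL.integrable_comp (hf.mem₂.integrable le_rfl)
  have iT : Integrable dTv μP := integrable_add i1 i2
  have hkin : ∀ t ∈ IP, P.kin' (v t) = prim (P.kin' P.v₀) dTv t := by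
    intro t ht
    ext x
    rw [hK.kin'_eq, hK.kin'_eq, prim,
      intervalIntegral.integral_add (intervalIntegrable_left i1 ht) (intervalIntegrable_left i2 ht)]
    rw [hf.integral_toDual ht]
    refine (h.momentum t ht x).trans ?_
    simp [add_assoc]
  refine ⟨hu, hz, h.v_cont, h.u_zero hP, h.v_zero, h.z_zero hP, du, dTv, dz,
    ⟨memLp_of_continuousOn hu _, h.du_mem, (hasWeakDeriv_prim hT iu P.u₀).congr (ae_μI_of_forall h.u_eq) ae_eq_rfl⟩,
    h.emb_du, ⟨?_, memLp_one_iff_integrable.2 iT,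
      (hasWeakDeriv_prim hT iT (P.kin' P.v₀)).congr (ae_μI_of_forall hkin) ae_eq_rfl⟩,
    ⟨memLp_of_continuousOn hz _, h.dz_mem, (hasWeakDeriv_prim hT iz P.z₀).congr (ae_μI_of_forall h.z_eq) ae_eq_rfl⟩,
    fun v' z' hv' hz' => ?_⟩
  · exact (memLp_of_continuousOn (continuousOn_prim iT _) 1).ae_eq (ae_μI_of_forall hkin)
  · have hξ := h.ξ_mem.integrable hP.one_le_p₁'
    have hη := (h.memLp_η hP).integrable hP.one_le_p₂'
    have heq : ∀ᵐ t ∂μP, dTv t + P.dΦu (u t) (z t) - P.f t = -ξ t := by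
      filter_upwards [hf.eq] with t ht
      rw [ht]; simp only [dTv]; abel
    rw [integral_weak_eq hP hf (dTv := dTv) hη h.du_mem h.dz_mem h.memLp_v h.emb_du hξ heq hv' hz',
      lintegral_add_left' (aemeasurable_comp_lsc hP.Ψ₁_lsc h.du_mem.1),
      lintegral_add_left' (aemeasurable_comp_lsc hP.Ψ₁_lsc hv'.1)]
    refine ereal_le_of_toReal_le (add_ne_top.2 ⟨hd.fin₁, hd.fin₂⟩) fun hb => ?_
    obtain ⟨h1, h2⟩ := add_ne_top.1 hb
    rw [toReal_add hd.fin₁ hd.fin₂, toReal_add h1 h2, h.energy_balance hP hK hf]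
    have := hd.vi v' z' hv' hz' h1 h2
    linarith

/-- The variational inequality holds for all test functions with finite dissipation. -/
lemma IsDissipative.vi_of_memLp {du : ℝ → U} {dz : ℝ → Z}
    {ξ : ℝ → U⋆} (h : P.IsFlow K f₁ f₂ u v z du dz ξ) (hd : P.IsDissipative u z du dz ξ)
    {v' : ℝ → U} {z' : ℝ → Z} (hv' : MemLp v' ℓ₁ μP)
    (hz' : MemLp z' ℓ₂ μP) (h1 : ∫Ψ₁ v' ≠ ∞)
    (h2 : ∫Ψ₂ z' ≠ ∞) :
    (∫Ψ₁ du).toReal + (∫Ψ₂ dz).toReal + (∫⟨ξ, v'⟩ - ∫⟨ξ, du⟩) + (∫Γ u z z' - ∫Γ u z dz)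
      ≤ (∫Ψ₁ v').toReal + (∫Ψ₂ z').toReal := by
  have := holderTriple_conjExp hP.one_lt_p₁
  have := holderTriple_conjExp hP.one_lt_p₂
  obtain ⟨r, hr, hr'⟩ := exists_trunc_bound hP.Ψ₁_convex hP.Ψ₁_zero hP.Ψ₁_lsc hv'.1
  obtain ⟨s, hs, hs'⟩ := exists_trunc_bound hP.Ψ₂_convex hP.Ψ₂_zero hP.Ψ₂_lsc hz'.1
  have lim : ∀ {r : ℕ → ℝ≥0∞} {A : ℝ≥0∞}, A ≠ ∞ → Tendsto r atTop (𝓝 0) →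
      (∀ᶠ k in atTop, A + r k ≠ ∞) ∧ Tendsto (fun k => (A + r k).toReal) atTop (𝓝 A.toReal) := by
    intro r A hA hr
    refine ⟨?_, ?_⟩
    · filter_upwards [hr.eventually_lt_const (u := 1) (by simp)] with k hk
      exact add_ne_top.2 ⟨hA, (hk.trans (by simp)).ne⟩
    · have : Tendsto (fun k => A + r k) atTop (𝓝 A) := by simpa using hr.const_add A
      exact (tendsto_toReal hA).comp this
  obtain ⟨e1, l1⟩ := lim h1 hr
  obtain ⟨e2, l2⟩ := lim h2 hs
  have l3 := tendsto_integral_trunc h.ξ_mem hv'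
  have l4 := tendsto_integral_trunc (h.memLp_η hP) hz'
  refine le_of_tendsto_of_tendsto ((tendsto_const_nhds.add (l3.sub tendsto_const_nhds)).add
    (l4.sub tendsto_const_nhds)) (l1.add l2) ?_
  filter_upwards [e1, e2] with k hk1 hk2
  have hk : (0 : ℝ) < k + 1 := by positivity
  refine (hd.vi _ _ (memLp_trunc hk hv'.1 ∞) (memLp_trunc hk hz'.1 ∞)
    (ne_top_of_le_ne_top hk1 (hr' k)) (ne_top_of_le_ne_top hk2 (hs' k))).trans ?_
  exact add_le_add (toReal_mono hk1 (hr' k)) (toReal_mono hk2 (hs' k))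

end

end Problem

section Swap

variable {α : Type*} [MeasurableSpace α] {μ : Measure α}

open Classical in
lemma lintegral_swap_add {Ψ : X → ℝ≥0∞} (hl : LowerSemicontinuous Ψ) {S : Set α}
    (hS : MeasurableSet S) {a b : α → X} (ha : AEStronglyMeasurable a μ)
    (hb : AEStronglyMeasurable b μ) :
    ∫⁻ t, Ψ (S.piecewise b a t) ∂μ + ∫⁻ t, Ψ (S.piecewise a b t) ∂μ
      = ∫⁻ t, Ψ (a t) ∂μ + ∫⁻ t, Ψ (b t) ∂μ := by
  have hm : AEStronglyMeasurable (S.piecewise b a) μ :=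
    AEStronglyMeasurable.piecewise hS hb.restrict ha.restrict
  rw [← lintegral_add_left' (aemeasurable_comp_lsc hl hm),
    ← lintegral_add_left' (aemeasurable_comp_lsc hl ha)]
  refine lintegral_congr fun t => ?_
  by_cases ht : t ∈ S
  · simp [ht, add_comm]
  · simp [ht]

open Classical in
lemma integral_swap_add {p q : ℝ≥0∞} [HolderTriple q p 1] {S : Set α}
    (hS : MeasurableSet S) {ξ ζ : α → X⋆} {a b : α → X} (hξ : MemLp ξ q μ)
    (hζ : MemLp ζ q μ) (ha : MemLp a p μ) (hb : MemLp b p μ) :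
    (∫ t, ξ t (S.piecewise b a t) ∂μ - ∫ t, ξ t (a t) ∂μ)
      + (∫ t, ζ t (S.piecewise a b t) ∂μ - ∫ t, ζ t (b t) ∂μ)
      = -∫ t in S, (ξ t - ζ t) (a t - b t) ∂μ := by
  have h1 : MemLp (S.piecewise b a) p μ := MemLp.piecewise hS (hb.restrict S) (ha.restrict Sᶜ)
  have h2 : MemLp (S.piecewise a b) p μ := MemLp.piecewise hS (ha.restrict S) (hb.restrict Sᶜ)
  have i1 := integrable_pairing hξ h1
  have i2 := integrable_pairing hξ ha
  have i3 := integrable_pairing hζ h2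
  have i4 := integrable_pairing hζ hb
  have i5 : Integrable (fun t => ξ t (S.piecewise b a t) - ξ t (a t)) μ := i1.sub i2
  have i6 : Integrable (fun t => ζ t (S.piecewise a b t) - ζ t (b t)) μ := i3.sub i4
  rw [← integral_sub i1 i2, ← integral_sub i3 i4, ← integral_add i5 i6, ← integral_indicator hS,
    ← integral_neg]
  refine integral_congr_ae (.of_forall fun t => ?_)
  by_cases ht : t ∈ S
  · simp [ht]; ring
  · simp [ht]

end Swap

/-- The derivative of the Bregman distance of two absolutely continuous curves. -/
lemma bregman_chain_rule {E : Type*} [NormedAddCommGroup E] [NormedSpace ℝ E] [CompleteSpace E]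
    {f : E → ℝ} (hf : ContDiff ℝ 3 f) {w₁ w₂ : ℝ → E} (h₁ : Integrable w₁ μT)
    (h₂ : Integrable w₂ μT) (c : E) (ht : t ∈ IT) :
    f (prim c w₁ t) - f (prim c w₂ t) - fderiv ℝ f (prim c w₂ t) (prim c w₁ t - prim c w₂ t)
      = (∫ s in 0..t, (fderiv ℝ f (prim c w₁ s) - fderiv ℝ f (prim c w₂ s)) (w₁ s - w₂ s))
        + ∫ s in 0..t, (fderiv ℝ f (prim c w₁ s) - fderiv ℝ f (prim c w₂ s)
          - fderiv ℝ (fderiv ℝ f) (prim c w₂ s) (prim c w₁ s - prim c w₂ s)) (w₂ s) := by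
  have hf' : ContDiff ℝ 2 (fderiv ℝ f) := hf.fderiv_right (by norm_num)
  have hf'' : ContDiff ℝ 1 (fderiv ℝ (fderiv ℝ f)) := hf'.fderiv_right (by norm_num)
  let F : E × E → ℝ := fun x => f x.1 - f x.2 - fderiv ℝ f x.2 (x.1 - x.2)
  have hF : ContDiff ℝ 1 F :=
    (((hf.comp contDiff_fst).sub (hf.comp contDiff_snd)).of_le (by norm_num)).sub
      (((hf'.comp contDiff_snd).of_le (by norm_num)).clm_apply (contDiff_fst.sub contDiff_snd))
  have hd : ∀ x a : E × E, fderiv ℝ F x a = fderiv ℝ f x.1 a.1 - fderiv ℝ f x.2 a.2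
      - (fderiv ℝ (fderiv ℝ f) x.2 a.2 (x.1 - x.2) + fderiv ℝ f x.2 (a.1 - a.2)) := by
    intro x a
    have d1 : HasFDerivAt (fun x : E × E => f x.1)
        ((fderiv ℝ f x.1).comp (ContinuousLinearMap.fst ℝ E E)) x :=
      ((hf.differentiable (by norm_num) x.1).hasFDerivAt).comp x hasFDerivAt_fst
    have d2 : HasFDerivAt (fun x : E × E => f x.2)
        ((fderiv ℝ f x.2).comp (ContinuousLinearMap.snd ℝ E E)) x :=
      ((hf.differentiable (by norm_num) x.2).hasFDerivAt).comp x hasFDerivAt_snd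
    have d3 : HasFDerivAt (fun x : E × E => fderiv ℝ f x.2)
        ((fderiv ℝ (fderiv ℝ f) x.2).comp (ContinuousLinearMap.snd ℝ E E)) x :=
      HasFDerivAt.comp (g := fderiv ℝ f) x
        ((hf'.differentiable (by norm_num) x.2).hasFDerivAt) hasFDerivAt_snd
    have d4 : HasFDerivAt (fun x : E × E => x.1 - x.2)
        (ContinuousLinearMap.fst ℝ E E - ContinuousLinearMap.snd ℝ E E) x :=
      hasFDerivAt_fst.sub hasFDerivAt_snd
    have := ((d1.sub d2).sub (d3.clm_apply d4)).fderiv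
    rw [show fderiv ℝ F x = _ from this]
    simp
    abel
  have hpair : ∀ s ∈ IT, prim ((c, c) : E × E) (fun s => (w₁ s, w₂ s)) s
      = (prim c w₁ s, prim c w₂ s) := fun s hs => prim_prodMk h₁ h₂ c c hs
  obtain ⟨-, h⟩ := chain_rule_prim hF (h₁.prodMk h₂) (c, c) ht
  rw [hpair t ht] at h
  have hsymm : ∀ x a b, fderiv ℝ (fderiv ℝ f) x a b = fderiv ℝ (fderiv ℝ f) x b a := fun x a b =>
    (hf.contDiffAt.isSymmSndFDerivAt (by simp; norm_num)).eq a b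
  have c1 := continuousOn_prim h₁ c
  have c2 := continuousOn_prim h₂ c
  have k1 := (hf'.continuous.comp_continuousOn c1).sub (hf'.continuous.comp_continuousOn c2)
  have k2 := k1.sub ((hf''.continuous.comp_continuousOn c2).clm_apply (c1.sub c2))
  have i1 := integrable_pairing (p := 1) (memLp_of_continuousOn k1 ∞)
    (memLp_one_iff_integrable.2 (h₁.sub h₂))
  have i2 := integrable_pairing (p := 1) (memLp_of_continuousOn k2 ∞)
    (memLp_one_iff_integrable.2 h₂)
  have j1 : IntervalIntegrable (fun s => (fderiv ℝ f (prim c w₁ s) - fderiv ℝ f (prim c w₂ s))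
    (w₁ s - w₂ s)) volume 0 t := intervalIntegrable_left i1 ht
  have j2 : IntervalIntegrable (fun s => (fderiv ℝ f (prim c w₁ s) - fderiv ℝ f (prim c w₂ s)
    - fderiv ℝ (fderiv ℝ f) (prim c w₂ s) (prim c w₁ s - prim c w₂ s)) (w₂ s)) volume 0 t :=
    intervalIntegrable_left i2 ht
  rw [← intervalIntegral.integral_add j1 j2]
  have h0 : F (c, c) = 0 := by simp [F]
  rw [h0, sub_zero] at h
  refine h.trans (intervalIntegral.integral_congr fun s hs => ?_)
  rw [uIcc_of_le ht.1] at hs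
  rw [hpair s ⟨hs.1, hs.2.trans ht.2⟩, hd]
  simp only [sub_apply, map_sub, hsymm _ (w₂ s)]
  ring

lemma exists_bregman_le {E : Type*} [NormedAddCommGroup E] [NormedSpace ℝ E] [CompleteSpace E]
    {f : E → ℝ} (hf : ContDiff ℝ 3 f) {w₁ w₂ : ℝ → E} (h₁ : Integrable w₁ μT)
    (h₂ : Integrable w₂ μT) (c : E) : ∃ C : ℝ, 0 ≤ C ∧ ∀ t ∈ IT,
    f (prim c w₁ t) - f (prim c w₂ t) - fderiv ℝ f (prim c w₂ t) (prim c w₁ t - prim c w₂ t)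
      ≤ (∫ s in 0..t, (fderiv ℝ f (prim c w₁ s) - fderiv ℝ f (prim c w₂ s)) (w₁ s - w₂ s))
        + C * ∫ s in 0..t, ‖prim c w₁ s - prim c w₂ s‖ ^ 2 * ‖w₂ s‖ := by
  have c₁ := continuousOn_prim h₁ c
  have c₂ := continuousOn_prim h₂ c
  obtain ⟨C, hC, hR⟩ := exists_taylor_bound hf
    ((isCompact_Icc.image_of_continuousOn c₁).union (isCompact_Icc.image_of_continuousOn c₂))
  refine ⟨C, hC, fun t ht => ?_⟩
  have i : Integrable (fun s => ‖prim c w₁ s - prim c w₂ s‖ ^ 2 * ‖w₂ s‖) μT :=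
    memLp_one_iff_integrable.1 (MemLp.mul (r := 1) (memLp_one_iff_integrable.2 h₂.norm)
      (memLp_of_continuousOn ((c₁.sub c₂).norm.pow 2) ∞))
  rw [bregman_chain_rule hf h₁ h₂ c ht, ← intervalIntegral.integral_const_mul]
  gcongr
  refine (Real.le_norm_self _).trans (intervalIntegral.norm_integral_le_of_norm_le ht.1
    (.of_forall fun s hs => ?_) ((intervalIntegrable_left i ht).const_mul _))
  have hs' : s ∈ IT := ⟨hs.1.le, hs.2.trans ht.2⟩
  rw [← mul_assoc]
  exact (le_opNorm _ _).trans (mul_le_mul_of_nonneg_right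
    (hR _ (.inr ⟨s, hs', rfl⟩) _ (.inl ⟨s, hs', rfl⟩)).1 (norm_nonneg _))

namespace Problem

section Uniqueness

include hP

variable {u₁ u₂ : ℝ → U} {v₁ v₂ : ℝ → H} {z₁ z₂ : ℝ → Z} {du₁ du₂ : ℝ → U} {dz₁ dz₂ : ℝ → Z}
  {ξ₁ ξ₂ : ℝ → U⋆}

/-- Monotonicity of the dissipative forces. -/
lemma IsDissipative.monotone (h₁ : P.IsFlow K f₁ f₂ u₁ v₁ z₁ du₁ dz₁ ξ₁)
    (hd₁ : P.IsDissipative u₁ z₁ du₁ dz₁ ξ₁) (h₂ : P.IsFlow K f₁ f₂ u₂ v₂ z₂ du₂ dz₂ ξ₂)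
    (hd₂ : P.IsDissipative u₂ z₂ du₂ dz₂ ξ₂) (ht : t ∈ IP) :
    0 ≤ (∫ s in 0..t, (ξ₁ s - ξ₂ s) (du₁ s - du₂ s))
      + ∫ s in 0..t, (P.dΦz (u₂ s) (z₂ s) - P.dΦz (u₁ s) (z₁ s)) (dz₁ s - dz₂ s) := by
  classical
  have := holderTriple_conjExp hP.one_lt_p₁
  have := holderTriple_conjExp hP.one_lt_p₂
  obtain ⟨S, hSt⟩ : ∃ S, S = Iic t := ⟨_, rfl⟩
  have hS : MeasurableSet S := hSt ▸ measurableSet_Iic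
  have e1 := lintegral_swap_add hP.Ψ₁_lsc hS h₁.du_mem.1 h₂.du_mem.1
  have e2 := lintegral_swap_add hP.Ψ₂_lsc hS h₁.dz_mem.1 h₂.dz_mem.1
  have n1 : ∫Ψ₁ du₁ + ∫Ψ₁ du₂ ≠ ∞ := add_ne_top.2 ⟨hd₁.fin₁, hd₂.fin₁⟩
  have n2 : ∫Ψ₂ dz₁ + ∫Ψ₂ dz₂ ≠ ∞ := add_ne_top.2 ⟨hd₁.fin₂, hd₂.fin₂⟩
  obtain ⟨a1, b1⟩ := add_ne_top.1 (e1 ▸ n1)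
  obtain ⟨a2, b2⟩ := add_ne_top.1 (e2 ▸ n2)
  have t1 := congrArg ENNReal.toReal e1
  have t2 := congrArg ENNReal.toReal e2
  rw [toReal_add a1 b1, toReal_add hd₁.fin₁ hd₂.fin₁] at t1
  rw [toReal_add a2 b2, toReal_add hd₁.fin₂ hd₂.fin₂] at t2
  have x1 := hd₁.vi_of_memLp hP h₁ (MemLp.piecewise hS (h₂.du_mem.restrict S) (h₁.du_mem.restrict Sᶜ))
    (MemLp.piecewise hS (h₂.dz_mem.restrict S) (h₁.dz_mem.restrict Sᶜ)) a1 a2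
  have x2 := hd₂.vi_of_memLp hP h₂ (MemLp.piecewise hS (h₁.du_mem.restrict S) (h₂.du_mem.restrict Sᶜ))
    (MemLp.piecewise hS (h₁.dz_mem.restrict S) (h₂.dz_mem.restrict Sᶜ)) b1 b2
  have y1 := integral_swap_add hS h₁.ξ_mem h₂.ξ_mem h₁.du_mem h₂.du_mem
  have y2 := integral_swap_add hS (h₁.memLp_η hP) (h₂.memLp_η hP) h₁.dz_mem h₂.dz_mem
  have hr : (μP).restrict S = volume.restrict (Ioc 0 t) := by
    rw [μI_eq_Ioc, Measure.restrict_restrict hS, hSt, inter_comm, Ioc_inter_Iic, min_eq_right ht.2]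
  simp only [sub_sub_sub_cancel_left] at y2
  rw [hr, ← integral_of_le ht.1] at y1 y2
  linarith

lemma IsFlow.kin_sub_balance (hK : P.IsKinForm K) (hf : P.IsLoad f₁ f₂)
    (h₁ : P.IsFlow K f₁ f₂ u₁ v₁ z₁ du₁ dz₁ ξ₁) (h₂ : P.IsFlow K f₁ f₂ u₂ v₂ z₂ du₂ dz₂ ξ₂)
    (ht : t ∈ IP) :
    (1 / 2) * K (v₁ t - v₂ t) (v₁ t - v₂ t) =
      -(∫ s in 0..t, (P.dΦu (u₁ s) (z₁ s) - P.dΦu (u₂ s) (z₂ s)) (du₁ s - du₂ s))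
      - ∫ s in 0..t, (ξ₁ s - ξ₂ s) (du₁ s - du₂ s) := by
  have := holderTriple_conjExp hP.one_lt_p₁
  rcases ht.1.eq_or_lt with h0 | h0
  · rw [← h0, h₁.v_zero, h₂.v_zero]; simp
  have hle := μI_mono ht.2
  have hsub : Icc 0 t ⊆ IP := Icc_subset_Icc_right ht.2
  have m1 := h₁.memLp_force hP hf
  have m2 := h₂.memLp_force hP hf
  have ha : MemLp (fun s => (f₁ s - P.dΦu (u₁ s) (z₁ s) - ξ₁ s) - (f₁ s - P.dΦu (u₂ s) (z₂ s) - ξ₂ s))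
    ℓ₁' μP := m1.sub m2
  have key := gelfand_chain_rule (emb := P.emb) (v := fun s => v₁ s - v₂ s)
    (du := fun s => du₁ s - du₂ s) (β := fun _ => 0) hK.symm hP.one_lt_p₁ h0
    (fun x => by
      simp only [inner_sub_right]
      exact ((h₁.v_cont x).sub (h₂.v_cont x)).mono hsub)
    ((h₁.du_mem.sub h₂.du_mem).mono_measure hle) (ae_mono hle (by
      filter_upwards [h₁.emb_du, h₂.emb_du] with s e1 e2
      rw [map_sub, e1, e2]))
    (ha.mono_measure hle) (memLp_const 0)
    (fun s hs x => by
      have i1 := intervalIntegrable_left (m1.integrable hP.one_le_p₁') (hsub hs)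
      have i2 := intervalIntegrable_left (m2.integrable hP.one_le_p₁') (hsub hs)
      rw [intervalIntegral.integral_sub i1 i2, h₁.v_zero, h₂.v_zero]
      simp only [map_sub, sub_apply, h₁.momentum s (hsub hs) x, h₂.momentum s (hsub hs) x]
      simp)
  simp only [h₁.v_zero, h₂.v_zero, sub_self, map_zero, sub_zero, zero_apply, add_zero] at key
  have d1 : MemLp (fun s => P.dΦu (u₁ s) (z₁ s) - P.dΦu (u₂ s) (z₂ s))
    ℓ₁' μP := (h₁.memLp_dΦu hP _).sub (h₂.memLp_dΦu hP _)
  have d2 : MemLp (fun s => ξ₁ s - ξ₂ s) ℓ₁' μP := h₁.ξ_mem.sub h₂.ξ_mem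
  have i1 := intervalIntegrable_left (integrable_pairing d1 (h₁.du_mem.sub h₂.du_mem)) ht
  have i2 := intervalIntegrable_left (integrable_pairing d2 (h₁.du_mem.sub h₂.du_mem)) ht
  have i3 : IntervalIntegrable (fun s => -(P.dΦu (u₁ s) (z₁ s) - P.dΦu (u₂ s) (z₂ s))
    (du₁ s - du₂ s)) volume 0 t := i1.neg
  rw [key, ← intervalIntegral.integral_neg]
  have e := intervalIntegral.integral_sub i3 i2
  simp only [Pi.sub_apply] at e
  rw [← e]
  ring_nf
  refine intervalIntegral.integral_congr fun s _ => ?_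
  simp only [sub_apply, map_sub]
  ring

lemma IsFlow.norm_emb_sub_sq_le
    (h₁ : P.IsFlow K f₁ f₂ u₁ v₁ z₁ du₁ dz₁ ξ₁) (h₂ : P.IsFlow K f₁ f₂ u₂ v₂ z₂ du₂ dz₂ ξ₂)
    (ht : t ∈ IP) :
    ‖P.emb (u₁ t - u₂ t)‖ ^ 2 ≤ P.T * ∫ s in 0..t, ‖v₁ s - v₂ s‖ ^ 2 := by
  have m : MemLp (fun s => v₁ s - v₂ s) ∞ μP := h₁.memLp_v.sub h₂.memLp_v
  have i1 := intervalIntegrable_left (h₁.du_mem.integrable hP.one_le_p₁) ht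
  have i2 := intervalIntegrable_left (h₂.du_mem.integrable hP.one_le_p₁) ht
  have i3 : IntervalIntegrable (fun s => du₁ s - du₂ s) volume 0 t := i1.sub i2
  have e1 : P.emb (u₁ t - u₂ t) = ∫ s in 0..t, (v₁ s - v₂ s) := by
    rw [h₁.u_eq t ht, h₂.u_eq t ht, prim, prim, add_sub_add_left_eq_sub,
      ← intervalIntegral.integral_sub i1 i2, ← P.emb.intervalIntegral_comp_comm i3,
      integral_of_le ht.1, integral_of_le ht.1]
    refine integral_congr_ae ?_
    have a1 := h₁.emb_du
    have a2 := h₂.emb_du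
    rw [μI_eq_Ioc] at a1 a2
    filter_upwards [ae_restrict_of_ae_restrict_of_subset (Ioc_subset_Ioc_right ht.2) a1,
      ae_restrict_of_ae_restrict_of_subset (Ioc_subset_Ioc_right ht.2) a2] with s s1 s2
    rw [map_sub, s1, s2]
  have m2 : Integrable (fun s => ‖v₁ s - v₂ s‖ ^ 2) μP := by
    have := (m.mono_exponent (p := 2) le_top).integrable_norm_pow (by norm_num)
    simpa using this
  have j1 := intervalIntegrable_left (m.norm.integrable le_top) ht
  have j2 := intervalIntegrable_left m2 ht
  rw [e1]
  have n1 := intervalIntegral.norm_integral_le_integral_norm (μ := volume)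
    (f := fun s => v₁ s - v₂ s) ht.1
  set A := ∫ s in 0..t, ‖v₁ s - v₂ s‖
  set B := ∫ s in 0..t, ‖v₁ s - v₂ s‖ ^ 2
  have hB : 0 ≤ B := intervalIntegral.integral_nonneg ht.1 fun s _ => by positivity
  have hA : 0 ≤ A := intervalIntegral.integral_nonneg ht.1 fun s _ => by positivity
  have hq : ∀ r : ℝ, 2 * r * A ≤ B + r ^ 2 * t := by
    intro r
    have : ∫ s in 0..t, 2 * r * ‖v₁ s - v₂ s‖ ≤ ∫ s in 0..t, (‖v₁ s - v₂ s‖ ^ 2 + r ^ 2) :=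
      intervalIntegral.integral_mono_on ht.1 (j1.const_mul _)
        (j2.add intervalIntegrable_const) fun s _ => by nlinarith [sq_nonneg (‖v₁ s - v₂ s‖ - r)]
    rw [intervalIntegral.integral_const_mul, intervalIntegral.integral_add j2
      intervalIntegrable_const, intervalIntegral.integral_const, smul_eq_mul, sub_zero] at this
    linarith
  have hAB : A ^ 2 ≤ t * B := by
    rcases ht.1.eq_or_lt with h0 | h0
    · have : A = 0 := by simp only [A, ← h0, intervalIntegral.integral_same]
      rw [this, ← h0]; simp
    · have := hq (A / t)
      have e : 2 * (A / t) * A - (A / t) ^ 2 * t = A ^ 2 / t := by field_simp; ring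
      have : A ^ 2 / t ≤ B := by linarith
      rw [div_le_iff₀ h0] at this
      linarith
  calc _ ≤ A ^ 2 := by gcongr
    _ ≤ t * B := hAB
    _ ≤ _ := by gcongr; exact ht.2

set_option maxHeartbeats 400000 in
/-- Uniqueness of dissipative flows. -/
lemma IsFlow.unique (hK : P.IsKinForm K) (hf : P.IsLoad f₁ f₂)
    (h₁ : P.IsFlow K f₁ f₂ u₁ v₁ z₁ du₁ dz₁ ξ₁) (hd₁ : P.IsDissipative u₁ z₁ du₁ dz₁ ξ₁)
    (h₂ : P.IsFlow K f₁ f₂ u₂ v₂ z₂ du₂ dz₂ ξ₂) (hd₂ : P.IsDissipative u₂ z₂ du₂ dz₂ ξ₂) :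
    EqOn u₁ u₂ IP ∧ EqOn v₁ v₂ IP ∧ EqOn z₁ z₂ IP := by
  have := holderTriple_conjExp hP.one_lt_p₁
  have := holderTriple_conjExp hP.one_lt_p₂
  obtain ⟨κ, hκ, hKc⟩ := hK.coercive
  let w₁ : ℝ → U × Z := fun t => (du₁ t, dz₁ t)
  let w₂ : ℝ → U × Z := fun t => (du₂ t, dz₂ t)
  let q₁ := prim (P.u₀, P.z₀) w₁
  let q₂ := prim (P.u₀, P.z₀) w₂
  have iu₁ := h₁.du_mem.integrable hP.one_le_p₁
  have iu₂ := h₂.du_mem.integrable hP.one_le_p₁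
  have iz₁ := h₁.dz_mem.integrable hP.one_le_p₂
  have iz₂ := h₂.dz_mem.integrable hP.one_le_p₂
  have iw₁ : Integrable w₁ μP := iu₁.prodMk iz₁
  have iw₂ : Integrable w₂ μP := iu₂.prodMk iz₂
  have p₁ : ∀ s ∈ IP, q₁ s = (u₁ s, z₁ s) := fun s hs => by
    rw [h₁.u_eq s hs, h₁.z_eq s hs]; exact prim_prodMk iu₁ iz₁ _ _ hs
  have p₂ : ∀ s ∈ IP, q₂ s = (u₂ s, z₂ s) := fun s hs => by
    rw [h₂.u_eq s hs, h₂.z_eq s hs]; exact prim_prodMk iu₂ iz₂ _ _ hs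
  have hq₁ : ContinuousOn q₁ IP := continuousOn_prim iw₁ _
  have hq₂ : ContinuousOn q₂ IP := continuousOn_prim iw₂ _
  obtain ⟨c, C, hc, hC, hB⟩ :=
    hP.exists_bregman_bound (isCompact_Icc.image_of_continuousOn (hq₁.prodMk hq₂))
  obtain ⟨C', hC', hR⟩ := exists_bregman_le hP.contDiff_energy iw₁ iw₂ (P.u₀, P.z₀)
  have mv : MemLp (fun s => v₁ s - v₂ s) ∞ μP := h₁.memLp_v.sub h₂.memLp_v
  have iv : Integrable (fun s => ‖v₁ s - v₂ s‖ ^ 2) μP := by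
    simpa using (mv.mono_exponent (p := 2) le_top).integrable_norm_pow (by norm_num)
  have cq : ContinuousOn (fun s => ‖q₁ s - q₂ s‖ ^ 2) IP := (hq₁.sub hq₂).norm.pow 2
  have iqw : Integrable (fun s => ‖q₁ s - q₂ s‖ ^ 2 * ‖w₂ s‖) μP := memLp_one_iff_integrable.1
      (MemLp.mul (r := 1) (memLp_one_iff_integrable.2 iw₂.norm) (memLp_of_continuousOn cq ∞))
  have main : ∀ t ∈ IP, (1 / 2) * K (v₁ t - v₂ t) (v₁ t - v₂ t) + c * ‖q₁ t - q₂ t‖ ^ 2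
      ≤ C * (P.T * ∫ s in 0..t, ‖v₁ s - v₂ s‖ ^ 2)
        + C' * ∫ s in 0..t, ‖q₁ s - q₂ s‖ ^ 2 * ‖w₂ s‖ := by
    intro t ht
    have hsub : Icc 0 t ⊆ IP := Icc_subset_Icc_right ht.2
    have b1 : _ ≤ P.energy (q₁ t) - P.energy (q₂ t) - P.dE (q₂ t) (q₁ t - q₂ t)
      + C * ‖P.emb ((q₁ t).1 - (q₂ t).1)‖ ^ 2 := hB _ ⟨t, ht, rfl⟩
    rw [congrArg Prod.fst (p₁ t ht), congrArg Prod.fst (p₂ t ht)] at b1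
    have b2 := h₁.norm_emb_sub_sq_le hP h₂ ht
    have b3 := h₁.kin_sub_balance hP hK hf h₂ ht
    have b4 := hd₁.monotone hP h₁ h₂ hd₂ ht
    have b5 := hR t ht
    have b6 : ∫ s in 0..t, (P.dE (q₁ s) - P.dE (q₂ s)) (w₁ s - w₂ s)
        = (∫ s in 0..t, (P.dΦu (u₁ s) (z₁ s) - P.dΦu (u₂ s) (z₂ s)) (du₁ s - du₂ s))
          - ∫ s in 0..t, (P.dΦz (u₂ s) (z₂ s) - P.dΦz (u₁ s) (z₁ s)) (dz₁ s - dz₂ s) := by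
      have d1 : MemLp (fun s => P.dΦu (u₁ s) (z₁ s) - P.dΦu (u₂ s) (z₂ s))
        ℓ₁' μP := (h₁.memLp_dΦu hP _).sub (h₂.memLp_dΦu hP _)
      have d2 : MemLp (fun s => P.dΦz (u₂ s) (z₂ s) - P.dΦz (u₁ s) (z₁ s))
        ℓ₂' μP := (h₂.memLp_dΦz hP _).sub (h₁.memLp_dΦz hP _)
      have i1 := intervalIntegrable_left (integrable_pairing d1 (h₁.du_mem.sub h₂.du_mem)) ht
      have i2 := intervalIntegrable_left (integrable_pairing d2 (h₁.dz_mem.sub h₂.dz_mem)) ht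
      have e := intervalIntegral.integral_sub i1 i2
      simp only [Pi.sub_apply] at e
      rw [← e]
      refine intervalIntegral.integral_congr fun s hs => ?_
      rw [uIcc_of_le ht.1] at hs
      rw [p₁ s (hsub hs), p₂ s (hsub hs), sub_apply, hP.dE_apply, hP.dE_apply]
      simp only [w₁, w₂, Prod.fst_sub, Prod.snd_sub, sub_apply, map_sub]
      ring
    linarith [mul_le_mul_of_nonneg_left b2 hC]
  let m := min (κ / 2) c
  have hm : 0 < m := lt_min (by positivity) hc
  let y : ℝ → ℝ := fun t => ‖v₁ t - v₂ t‖ ^ 2 + ‖q₁ t - q₂ t‖ ^ 2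
  let k : ℝ → ℝ := fun t => m⁻¹ * (C * P.T + C' * ‖w₂ t‖)
  have hk0 : ∀ t, 0 ≤ k t := fun t => by
    have := hP.T_pos
    positivity
  have ik : Integrable k μP := ((integrable_const _).add (iw₂.norm.const_mul _)).const_mul _
  obtain ⟨M₁, hM₁0, hM₁⟩ := exists_bound_of_weakly_continuous h₁.v_cont
  obtain ⟨M₂, hM₂0, hM₂⟩ := exists_bound_of_weakly_continuous h₂.v_cont
  obtain ⟨M₃, hM₃⟩ := isCompact_Icc.exists_bound_of_continuousOn cq
  have hyM : ∀ t ∈ IP, y t ≤ (M₁ + M₂) ^ 2 + M₃ := fun t ht => by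
    have a1 : ‖v₁ t - v₂ t‖ ≤ M₁ + M₂ := (norm_sub_le _ _).trans (add_le_add (hM₁ t ht) (hM₂ t ht))
    have a2 := (le_abs_self _).trans (hM₃ t ht)
    have a3 : ‖v₁ t - v₂ t‖ ^ 2 ≤ (M₁ + M₂) ^ 2 := by gcongr
    exact add_le_add a3 a2
  have my : AEStronglyMeasurable y μP := iv.1.add (integrable_of_continuousOn cq).1
  have hy0 : ∀ t, 0 ≤ y t := fun t => by positivity
  have iky : Integrable (fun t => k t * y t) μP := by
    have : MemLp y ∞ μP := memLp_top_of_bound my ((M₁ + M₂) ^ 2 + M₃)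
      (ae_restrict_of_forall_mem measurableSet_Icc fun t ht => by
        rw [norm_of_nonneg (hy0 t)]; exact hyM t ht)
    exact memLp_one_iff_integrable.1 (MemLp.mul (r := 1) this (memLp_one_iff_integrable.2 ik))
  have hy : ∀ t ∈ IP, y t = 0 := by
    refine eq_zero_of_le_integral ik hk0 (fun t _ => hy0 t) hyM iky fun t ht => ?_
    have b := main t ht
    have b1 : m * y t ≤ (1 / 2) * K (v₁ t - v₂ t) (v₁ t - v₂ t) + c * ‖q₁ t - q₂ t‖ ^ 2 := by
      have l1 : m * ‖v₁ t - v₂ t‖ ^ 2 ≤ κ / 2 * ‖v₁ t - v₂ t‖ ^ 2 := by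
        gcongr; exact min_le_left _ _
      have l2 : m * ‖q₁ t - q₂ t‖ ^ 2 ≤ c * ‖q₁ t - q₂ t‖ ^ 2 := by
        gcongr; exact min_le_right _ _
      have l3 := hKc (v₁ t - v₂ t)
      simp only [y]
      linarith
    have j1 := intervalIntegrable_left iv ht
    have j2 := intervalIntegrable_left iqw ht
    have j3 := intervalIntegrable_left iky ht
    have b2 : C * (P.T * ∫ s in 0..t, ‖v₁ s - v₂ s‖ ^ 2)
        + C' * ∫ s in 0..t, ‖q₁ s - q₂ s‖ ^ 2 * ‖w₂ s‖
        ≤ m * ∫ s in 0..t, k s * y s := by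
      rw [← mul_assoc, ← intervalIntegral.integral_const_mul, ← intervalIntegral.integral_const_mul,
        ← intervalIntegral.integral_const_mul,
        ← intervalIntegral.integral_add (j1.const_mul _) (j2.const_mul _)]
      refine intervalIntegral.integral_mono_on ht.1 ((j1.const_mul _).add (j2.const_mul _))
        (j3.const_mul _) fun s _ => ?_
      have e : m * (k s * y s) = (C * P.T + C' * ‖w₂ s‖) * y s := by
        simp only [k]; field_simp
      rw [e]
      simp only [y]
      have := hP.T_pos
      have z1 : 0 ≤ C * P.T * ‖q₁ s - q₂ s‖ ^ 2 := by positivity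
      have z2 : 0 ≤ C' * ‖w₂ s‖ * ‖v₁ s - v₂ s‖ ^ 2 := by positivity
      linarith
    exact le_of_mul_le_mul_left (b1.trans (b.trans b2)) hm
  have hz : ∀ t ∈ IP, v₁ t = v₂ t ∧ q₁ t = q₂ t := fun t ht => by
    have e1 : ‖v₁ t - v₂ t‖ ^ 2 = 0 := le_antisymm (by linarith [hy t ht, sq_nonneg ‖q₁ t - q₂ t‖])
      (sq_nonneg _)
    have e2 : ‖q₁ t - q₂ t‖ ^ 2 = 0 := by linarith [hy t ht]
    simpa [sub_eq_zero] using And.intro e1 e2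
  have hz' : ∀ t ∈ IP, u₁ t = u₂ t ∧ z₁ t = z₂ t := fun t ht =>
    Prod.ext_iff.1 ((p₁ t ht).symm.trans ((hz t ht).2.trans (p₂ t ht)))
  exact ⟨fun t ht => (hz' t ht).1, fun t ht => (hz t ht).1, fun t ht => (hz' t ht).2⟩

end Uniqueness


include hP

/-- Solvability of one step for the velocity. -/
lemma Admissible.exists_velocity {τ : ℝ} (hτ : 0 < τ) (u : U) (v : H) (z : Z)
    (f : U⋆) : ∃ (u' : U) (v' : H) (ξ : U⋆),
      P.emb (τ⁻¹ • (u' - u)) = (1 / 2 : ℝ) • (v' + v) ∧ ξ ∈ subdiff P.Ψ₁ (τ⁻¹ • (u' - u)) ∧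
      P.kin' (τ⁻¹ • (v' - v)) + ξ + P.dΦu ((1 / 2 : ℝ) • (u' + u)) z = f := by
  obtain ⟨K, hK⟩ := hP.exists_kinForm
  obtain ⟨κ, hκ, hKc⟩ := hK.coercive
  obtain ⟨B, l, c, hB, hq⟩ := hP.exists_form_u z
  obtain ⟨c₀, hc₀, hBc⟩ := hP.coercive_u z hq
  let KU : U →L[ℝ] U⋆ := (((compL ℝ U H ℝ).flip P.emb).comp K).comp P.emb
  have hKU : ∀ x y, KU x y = K (P.emb x) (P.emb y) := fun x y => rfl
  have hd : ∀ x, P.dΦu x z = B x + l := fun x => (hasFDerivAt_quadratic hB hq x).fderiv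
  obtain ⟨w, hw⟩ := exists_sub_mem_subdiff ((2 / τ) • KU + (τ / 2) • B)
    (fun x y => by simp [hKU, hK.symm (P.emb x), hB x]) (c := τ / 2 * c₀) (by positivity)
    (fun x => by
      have h1 := hKc (P.emb x)
      have h2 : 0 ≤ K (P.emb x) (P.emb x) := le_trans (by positivity) h1
      have h3 : 0 ≤ 2 / τ * K (P.emb x) (P.emb x) := by positivity
      have h4 := mul_le_mul_of_nonneg_left (hBc x) (half_pos hτ).le
      simp only [add_apply, smul_apply, smul_eq_mul, hKU]
      linarith)
    (f + (2 / τ) • (K v).comp P.emb - B u - l) hP.Ψ₁_convex hP.Ψ₁_lsc hP.Ψ₁_zero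
  refine ⟨u + τ • w, (2 : ℝ) • P.emb w - v,
    f + (2 / τ) • (K v).comp P.emb - B u - l - ((2 / τ) • KU + (τ / 2) • B) w, ?_, ?_, ?_⟩
  · rw [add_sub_cancel_left, smul_smul, inv_mul_cancel₀ hτ.ne', one_smul, sub_add_cancel, smul_smul]
    norm_num
  · rwa [add_sub_cancel_left, smul_smul, inv_mul_cancel₀ hτ.ne', one_smul]
  · rw [hK.kin'_eq, hd]
    ext x
    simp only [add_apply, sub_apply, smul_apply, comp_apply, smul_eq_mul, map_add,
      map_sub, map_smul, hKU]
    field_simp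
    ring

/-- Solvability of one step for the internal variable. -/
lemma Admissible.exists_internal {τ : ℝ} (hτ : 0 < τ) (u : U) (z : Z)
    (g : Z⋆) : ∃ (z' : Z) (η : Z⋆), η ∈ subdiff P.Ψ₂ (τ⁻¹ • (z' - z)) ∧
      η + P.dΦz u ((1 / 2 : ℝ) • (z' + z)) = g := by
  obtain ⟨B, l, c, hB, hq⟩ := hP.exists_form_z u
  obtain ⟨c₀, hc₀, hBc⟩ := hP.coercive_z u hq
  have hd : ∀ x, P.dΦz u x = B x + l := fun x => (hasFDerivAt_quadratic hB hq x).fderiv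
  obtain ⟨w, hw⟩ := exists_sub_mem_subdiff ((τ / 2) • B)
    (fun x y => by simp [hB x]) (c := τ / 2 * c₀) (by positivity)
    (fun x => by
      have h4 := mul_le_mul_of_nonneg_left (hBc x) (half_pos hτ).le
      simp only [smul_apply, smul_eq_mul]
      linarith)
    (g - B z - l) hP.Ψ₂_convex hP.Ψ₂_lsc hP.Ψ₂_zero
  refine ⟨z + τ • w, g - B z - l - ((τ / 2) • B) w, ?_, ?_⟩
  · rwa [add_sub_cancel_left, smul_smul, inv_mul_cancel₀ hτ.ne', one_smul]
  · rw [hd]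
    ext x
    simp only [add_apply, sub_apply, smul_apply, smul_eq_mul, map_add, map_smul]
    ring

lemma Admissible.exists_discreteSolution (rf rg : LoadingRule)
    (hN : 1 ≤ N) : ∃ u v z, P.IsDiscreteSolution rf rg N u v z := by
  have hτ : 0 < P.T / N := div_pos hP.T_pos (by exact_mod_cast hN)
  choose U' V' ξ h1 h2 h3 using fun (x : U × H × Z) (k : ℕ) =>
    hP.exists_velocity hτ x.1 x.2.1 x.2.2 (rf.sample (P.T / N) P.f (k + 1))
  choose Z' η h4 h5 using fun (x : U × H × Z) (k : ℕ) =>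
    hP.exists_internal hτ (U' x k) x.2.2 (rg.sample (P.T / N) P.g (k + 1))
  let q : ℕ → U × H × Z := fun k =>
    Nat.rec (P.u₀, P.v₀, P.z₀) (fun k x => (U' x k, V' x k, Z' x k)) k
  exact ⟨fun k => (q k).1, fun k => (q k).2.1, fun k => (q k).2.2, rfl, rfl, rfl, fun k _ =>
    ⟨ξ (q k) k, η (q k) k, h1 _ _, h2 _ _, h3 _ _, h4 _ _, h5 _ _⟩⟩

/-- The exact energy balance of one step. -/
lemma Admissible.step_energy_balance {τ : ℝ} (hτ : 0 < τ) {u u' : U} {v v' : H}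
    {z z' : Z} {ξ f : U⋆} {η g : Z⋆}
    (h1 : P.emb (τ⁻¹ • (u' - u)) = (1 / 2 : ℝ) • (v' + v))
    (h2 : P.kin' (τ⁻¹ • (v' - v)) + ξ + P.dΦu ((1 / 2 : ℝ) • (u' + u)) z = f)
    (h3 : η + P.dΦz u' ((1 / 2 : ℝ) • (z' + z)) = g) :
    (P.kin v' - P.kin v) / τ + ξ (τ⁻¹ • (u' - u)) + η (τ⁻¹ • (z' - z)) + (P.Φ u' z' - P.Φ u z) / τ
      = f (τ⁻¹ • (u' - u)) + g (τ⁻¹ • (z' - z)) := by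
  obtain ⟨K, hK⟩ := hP.exists_kinForm
  have e1 : P.kin' (τ⁻¹ • (v' - v)) (τ⁻¹ • (u' - u)) = (P.kin v' - P.kin v) / τ := by
    rw [hK.kin'_eq, comp_apply, h1, hK.kin_eq, hK.kin_eq]
    simp only [map_smul, map_sub, map_add, smul_apply, sub_apply, smul_eq_mul, hK.symm v v']
    field_simp
    ring
  have e2 := hP.sub_eq_dΦu u' u z
  have e3 := hP.sub_eq_dΦz u' z' z
  have e4 : P.Φ u' z' - P.Φ u z = P.dΦz u' ((1 / 2 : ℝ) • (z' + z)) (z' - z)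
      + P.dΦu ((1 / 2 : ℝ) • (u' + u)) z (u' - u) := by linarith
  rw [← h2, ← h3, ← e1, e4]
  simp only [add_apply, map_smul, smul_eq_mul]
  field_simp
  ring

end Problem

/-! ### Piecewise constant functions -/

section PiecewiseConstant

lemma norm_midpoint_le {x y : X} {M : ℝ} (hx : ‖x‖ ≤ M) (hy : ‖y‖ ≤ M) :
    ‖(1 / 2 : ℝ) • (x + y)‖ ≤ M := by
  rw [norm_smul, norm_of_nonneg (by norm_num)]
  linarith [norm_add_le x y]

/-- The piecewise constant function with value `x k` on `((k - 1) τ, k τ]`. -/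
def pc {Y : Type*} (τ : ℝ) (x : ℕ → Y) (t : ℝ) : Y := x ⌈t / τ⌉₊

/-- Difference quotients. -/
def rate (τ : ℝ) (x : ℕ → X) (k : ℕ) : X := τ⁻¹ • (x k - x (k - 1))

/-- The piecewise constant interpolant of the difference quotients. -/
notation:max "Δ" τ:max x:max => pc τ (rate τ x)

lemma stronglyMeasurable_pc (τ : ℝ) (x : ℕ → X) : StronglyMeasurable (pc τ x) :=
  StronglyMeasurable.of_discrete.comp_measurable (f := x)
    (Nat.measurable_ceil.comp (measurable_id.div_const τ))

lemma pc_eq {Y : Type*} {τ : ℝ} (hτ : 0 < τ) (x : ℕ → Y) {k : ℕ}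
    (ht : t ∈ Ioc (k * τ) ((k + 1) * τ)) : pc τ x t = x (k + 1) := by
  have : ⌈t / τ⌉₊ = k + 1 := by
    rw [Nat.ceil_eq_iff (by omega), lt_div_iff₀ hτ, div_le_iff₀ hτ]
    push_cast
    exact ht
  rw [pc, this]

/-- The index of the cell that contains `t`. -/
lemma exists_cell (hT : 0 < T) (hN : 1 ≤ N) (ht : t ∈ Ioc 0 T) :
    ∃ k < N, t ∈ Ioc (k * (T / N)) ((k + 1) * (T / N)) ∧ ⌈t / (T / N)⌉₊ = k + 1 := by
  have hN0 : (0 : ℝ) < N := by exact_mod_cast hN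
  have hτ : 0 < T / N := by positivity
  have h0 : ⌈t / (T / N)⌉₊ ≠ 0 := by
    rw [Ne, Nat.ceil_eq_zero, not_le]; exact div_pos ht.1 hτ
  obtain ⟨k, hk⟩ := Nat.exists_eq_succ_of_ne_zero h0
  have h1 := (Nat.ceil_eq_iff (by omega)).1 hk
  rw [lt_div_iff₀ hτ, div_le_iff₀ hτ] at h1
  push_cast at h1
  refine ⟨k, ?_, h1, hk⟩
  have : (k : ℝ) * (T / N) < T := h1.1.trans_le ht.2
  rw [← mul_div_assoc, div_lt_iff₀ hN0, mul_comm] at this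
  exact_mod_cast lt_of_mul_lt_mul_left this hT.le

lemma forall_pc {Y : Type*} (hT : 0 < T) (hN : 1 ≤ N) {x : ℕ → Y} {p : Y → Prop}
    (h : ∀ k < N, p (x (k + 1))) (ht : t ∈ Ioc 0 T) : p (pc δT x t) := by
  obtain ⟨k, hk, -, hk'⟩ := exists_cell hT hN ht
  rw [pc, hk']
  exact h k hk

lemma ae_μI_of_Ioc {p : ℝ → Prop} (h : ∀ t ∈ Ioc 0 T, p t) : ∀ᵐ t ∂μT, p t := by
  rw [μI_eq_Ioc]; exact ae_restrict_of_forall_mem measurableSet_Ioc h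

lemma memLp_pc (hT : 0 < T) (hN : 1 ≤ N) (x : ℕ → X) (p : ℝ≥0∞) :
    MemLp (pc δT x) p μT := by
  refine MemLp.of_bound (stronglyMeasurable_pc _ _).aestronglyMeasurable
    (∑ k ∈ Finset.range N, ‖x (k + 1)‖) (ae_μI_of_Ioc fun t ht => ?_)
  exact forall_pc hT hN (p := fun y => ‖y‖ ≤ ∑ k ∈ Finset.range N, ‖x (k + 1)‖) (fun k hk =>
    Finset.single_le_sum (f := fun k => ‖x (k + 1)‖) (fun _ _ => norm_nonneg _)
      (Finset.mem_range.2 hk)) ht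

lemma integrable_pc (hT : 0 < T) (hN : 1 ≤ N) (x : ℕ → X) : Integrable (pc δT x) μT :=
  memLp_one_iff_integrable.1 (memLp_pc hT hN x 1)

lemma intervalIntegral_pc_cell {τ : ℝ} (hτ : 0 < τ) (x : ℕ → X) (k : ℕ)
    (ht : t ∈ Icc (k * τ) ((k + 1) * τ)) :
    IntervalIntegrable (pc τ x) volume (k * τ) t ∧
    ∫ s in (k * τ)..t, pc τ x s = (t - k * τ) • x (k + 1) := by
  have h : EqOn (fun _ => x (k + 1)) (pc τ x) (uIoc (k * τ) t) := fun s hs => by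
    rw [uIoc_of_le ht.1] at hs
    exact (pc_eq hτ x ⟨hs.1, hs.2.trans ht.2⟩).symm
  refine ⟨(intervalIntegrable_const (c := x (k + 1))).congr h, ?_⟩
  rw [← intervalIntegral.integral_congr_ae (.of_forall fun s hs => h hs),
    intervalIntegral.integral_const]

lemma intervalIntegral_pc {τ : ℝ} (hτ : 0 < τ) (x : ℕ → X) (m : ℕ) :
    IntervalIntegrable (pc τ x) volume 0 (m * τ) ∧
    ∫ s in 0..(m * τ), pc τ x s = τ • ∑ k ∈ Finset.range m, x (k + 1) := by
  induction m with
  | zero => simp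
  | succ m ih =>
    obtain ⟨h1, h2⟩ := intervalIntegral_pc_cell hτ x m (t := (m + 1) * τ) ⟨by nlinarith, le_rfl⟩
    push_cast
    refine ⟨ih.1.trans h1, ?_⟩
    rw [← integral_add_adjacent_intervals ih.1 h1, ih.2, h2, Finset.sum_range_succ, smul_add]
    congr 2
    ring

lemma integral_pc (hT : 0 < T) (hN : 1 ≤ N) (x : ℕ → X) :
    ∫ t, pc (T / N) x t ∂μT = (T / N) • ∑ k ∈ Finset.range N, x (k + 1) := by
  have hN0 : (0 : ℝ) < N := by exact_mod_cast hN
  rw [integral_μI hT.le, ← (intervalIntegral_pc (by positivity) x N).2]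
  congr 1
  field_simp

lemma eLpNorm_pc (hT : 0 < T) (hN : 1 ≤ N) {x : ℕ → X} {p : ℝ} (hp : 0 < p) :
    eLpNorm (pc δT x) (ofReal p) μT
      = ofReal (∑ k ∈ Finset.range N, T / N * ‖x (k + 1)‖ ^ p) ^ p⁻¹ := by
  have i := integrable_pc hT hN (fun k => ‖x k‖ ^ p)
  rw [eLpNorm_eq_lintegral_rpow_enorm_toReal (by simpa using hp) ofReal_ne_top,
    toReal_ofReal hp.le, one_div, ← Finset.mul_sum, ← smul_eq_mul, ← integral_pc hT hN (fun k => ‖x k‖ ^ p),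
    ofReal_integral_eq_lintegral_ofReal i (.of_forall fun t => rpow_nonneg (norm_nonneg _) p)]
  congr 1
  refine lintegral_congr fun t => ?_
  rw [← ofReal_norm, ofReal_rpow_of_nonneg (norm_nonneg _) hp.le]
  rfl

lemma eLpNorm_pc_le (hT : 0 < T) (hN : 1 ≤ N) {x : ℕ → X} {p C : ℝ} (hp : 1 < p)
    (h : ∑ k ∈ Finset.range N, T / N * ‖x (k + 1)‖ ^ p ≤ C) :
    eLpNorm (pc δT x) (ofReal p) μT ≤ ofReal (C ^ (1 / p)) := by
  have hp0 : 0 < p := by linarith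
  have hC : 0 ≤ C := le_trans (Finset.sum_nonneg fun k _ => by positivity) h
  rw [eLpNorm_pc hT hN hp0, ← ofReal_rpow_of_nonneg hC (by positivity), one_div]
  exact rpow_le_rpow (ofReal_le_ofReal h) (by positivity)

lemma sum_pc_le (hT : 0 < T) (hN : 1 ≤ N) {x : ℕ → X} {p : ℝ} (hp : 1 ≤ p) {C : ℝ} (hC : 0 ≤ C)
    (h : eLpNorm (pc δT x) (ofReal p) μT ≤ ofReal C) :
    ∑ k ∈ Finset.range N, T / N * ‖x (k + 1)‖ ^ p ≤ C ^ p := by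
  have hp0 : 0 < p := by linarith
  have h0 : 0 ≤ ∑ k ∈ Finset.range N, T / N * ‖x (k + 1)‖ ^ p :=
    Finset.sum_nonneg fun k _ => by positivity
  rwa [eLpNorm_pc hT hN hp0, ofReal_rpow_of_nonneg h0 (by positivity),
    ENNReal.ofReal_le_ofReal_iff hC, Real.rpow_inv_le_iff_of_pos h0 hC hp0] at h

/-- The affine interpolant is the primitive of its difference quotients. -/
lemma affineInterp_eq_prim (hT : 0 < T) (hN : 1 ≤ N) (x : ℕ → X) (ht : t ∈ IT) :
    affineInterp (T / N) x t = prim (x 0) (pc (T / N) (rate (T / N) x)) t := by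
  have hN0 : (0 : ℝ) < N := by exact_mod_cast hN
  have hτ : 0 < T / N := by positivity
  set τ := T / N
  rcases ht.1.eq_or_lt with h0 | h0
  · simp [← h0, affineInterp, prim, hτ.ne']
  · obtain ⟨k, hk, hkt, hc⟩ := exists_cell hT hN ⟨h0, ht.2⟩
    obtain ⟨h1, h2⟩ := intervalIntegral_pc hτ (rate τ x) k
    obtain ⟨h3, h4⟩ := intervalIntegral_pc_cell hτ (rate τ x) k (Ioc_subset_Icc_self hkt)
    have h5 : τ • ∑ j ∈ Finset.range k, rate τ x (j + 1) = x k - x 0 := by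
      rw [← Finset.sum_range_sub, Finset.smul_sum]
      refine Finset.sum_congr rfl fun j _ => ?_
      rw [rate, smul_smul, mul_inv_cancel₀ hτ.ne', one_smul, Nat.add_sub_cancel]
    rw [affineInterp, hc, prim, ← integral_add_adjacent_intervals h1 h3, h2, h4, h5,
      rate, Nat.add_sub_cancel]
    have e1 : (((k + 1 : ℕ) : ℝ) * τ - t) / τ = 1 - (t - k * τ) / τ := by
      push_cast; field_simp; ring
    have e2 : (t - (((k + 1 : ℕ) : ℝ) - 1) * τ) / τ = (t - k * τ) / τ := by
      push_cast; ring
    rw [e1, e2, smul_smul, ← div_eq_mul_inv]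
    module

end PiecewiseConstant

section Sampling

lemma LoadingRule.norm_sample_sub_le (r : LoadingRule) (hr : r ≠ .mean) {h : ℝ → X} {τ ε : ℝ}
    {k : ℕ} (hτ : 0 < τ) (hk : (k + 1) * τ ≤ T) (ht : t ∈ Ioc (k * τ) ((k + 1) * τ))
    (hh : ∀ s ∈ IT, |s - t| ≤ τ → ‖h s - h t‖ ≤ ε) :
    ‖r.sample τ h (k + 1) - h t‖ ≤ ε := by
  have hk0 : (0 : ℝ) ≤ k * τ := by positivity
  obtain ⟨h1, h2⟩ := ht
  have key : ∀ θ : ℝ, 0 ≤ θ → θ ≤ 1 → ‖h ((k + θ) * τ) - h t‖ ≤ ε := fun θ h0 h0' => by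
    refine hh _ ⟨by positivity, le_trans (by gcongr) hk⟩ ?_
    rw [abs_le]
    constructor <;> nlinarith
  cases r with
  | rightEnd => simpa [sample] using key 1 (by norm_num) le_rfl
  | midpoint =>
    have := key (1 / 2) (by norm_num) (by norm_num)
    have e : ((k : ℝ) + 1 - 1 / 2) = k + 1 / 2 := by ring
    simpa only [sample, Nat.cast_add, Nat.cast_one, e] using this
  | trapezoid =>
    have a := key 1 (by norm_num) le_rfl
    have b := key 0 le_rfl (by norm_num)
    have e : sample .trapezoid τ h (k + 1) - h t
        = (1 / 2 : ℝ) • ((h ((k + 1) * τ) - h t) + (h ((k + 0) * τ) - h t)) := by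
      simp only [sample, Nat.cast_add, Nat.cast_one, add_sub_cancel_right, add_zero]
      module
    exact e ▸ norm_midpoint_le a b
  | mean => exact absurd rfl hr

lemma LoadingRule.tendsto_sample (r : LoadingRule) (hT : 0 < T)
    {h : ℝ → X} (hr : r.AppliesTo T h) {q : ℝ≥0∞} (hq : 1 ≤ q) (hq' : q ≠ ∞)
    (hh : MemLp h q μT) :
    Tendsto (fun N : ℕ => eLpNorm (pc (T / N) (r.sample (T / N) h) - h) q μT) atTop (𝓝 0) := by
  by_cases hm : r = .mean
  · subst hm
    rw [← tendsto_add_atTop_iff_nat 1]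
    have hτ : ∀ n : ℕ, 0 < T / (n + 1 : ℕ) := fun n => by positivity
    have h0 : Tendsto (fun n : ℕ => T / (n + 1 : ℕ)) atTop (𝓝 0) :=
      (tendsto_add_atTop_iff_nat 1).2 (tendsto_const_div_atTop_nhds_zero_nat T)
    refine (tendsto_avg_sub_μI hq hq' hh (fun n => isWindow_cell (hτ n)) h0).congr fun n => ?_
    refine eLpNorm_congr_ae (ae_μI_of_Ioc fun t ht => ?_)
    obtain ⟨k, hk, hkt, hc⟩ := exists_cell hT (Nat.succ_le_succ (Nat.zero_le n)) ht
    have hm := cellLeft_mem hT (Nat.succ_pos n) ht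
    have hz : ⌈t / (T / (n + 1 : ℕ))⌉ = (k : ℤ) + 1 := by
      rw [← Int.natCast_ceil_eq_ceil (div_nonneg ht.1.le (hτ n).le), hc]; simp
    have hcl : cellLeft (T / (n + 1 : ℕ)) t = k * (T / (n + 1 : ℕ)) := by
      rw [cellLeft, hz]; push_cast; ring
    simp only [Pi.sub_apply]
    congr 1
    rw [avg, pc, hc, sample, integral_indicator_μI ⟨hm.1, by linarith [hτ n]⟩
      ⟨by linarith [hτ n], hm.2⟩ (by linarith [hτ n]), hcl]
    congr 2 <;> (push_cast; ring)
  · have hc : ContinuousOn h IT := hr.resolve_left hm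
    have hu := isCompact_Icc.uniformContinuousOn_of_continuous hc
    rw [Metric.uniformContinuousOn_iff_le] at hu
    rw [ENNReal.tendsto_atTop_zero]
    intro ε hε
    obtain ⟨ε', hle, hε'⟩ : ∃ ε' : ℝ, μT univ ^ q.toReal⁻¹ * ofReal ε' < ε ∧ 0 < ε' := by
      have := (ENNReal.Tendsto.const_mul (ENNReal.tendsto_ofReal tendsto_id) (Or.inr
        (rpow_ne_top_of_nonneg (by positivity) (measure_ne_top μT univ) (y := q.toReal⁻¹)))).mono_left
          (nhdsWithin_le_nhds (a := (0 : ℝ)) (s := Ioi 0))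
      rw [ENNReal.ofReal_zero, mul_zero] at this
      exact ((this.eventually_lt_const hε).and self_mem_nhdsWithin).exists
    obtain ⟨δ, hδ, hδ'⟩ := hu ε' hε'
    obtain ⟨N₀, hN₀⟩ := eventually_atTop.1
      ((tendsto_const_div_atTop_nhds_zero_nat T).eventually_lt_const hδ)
    refine ⟨max N₀ 1, fun N hN => ?_⟩
    have hN1 : 1 ≤ N := (le_max_right _ _).trans hN
    have hN0 : (0 : ℝ) < N := by exact_mod_cast hN1
    have hτ : 0 < T / N := by positivity
    have hNδ := hN₀ N ((le_max_left _ _).trans hN)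
    refine (eLpNorm_le_of_ae_bound (C := ε') (ae_μI_of_Ioc fun t ht => ?_)).trans hle.le
    obtain ⟨k, hk, hkt, hc⟩ := exists_cell hT hN1 ht
    rw [Pi.sub_apply, pc, hc]
    refine r.norm_sample_sub_le hm hτ (T := T) ?_ hkt fun s hs hst => ?_
    · have : ((k : ℝ) + 1) ≤ N := by exact_mod_cast hk
      calc ((k : ℝ) + 1) * (T / N) ≤ N * (T / N) := by gcongr
        _ = T := by field_simp
    · have := hδ' s hs t (Ioc_subset_Icc_self ht) (by rw [Real.dist_eq]; linarith)
      rwa [dist_eq_norm] at this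

end Sampling

lemma exists_young {p : ℝ} (hp : 1 < p) {δ : ℝ} (hδ : 0 < δ) : ∃ C : ℝ, 0 ≤ C ∧ ∀ a b : ℝ,
    0 ≤ a → 0 ≤ b → a * b ≤ C * a ^ conjExp p + δ * b ^ p := by
  have hpq := (holderConjugate_conjExp hp).symm
  have hp0 : 0 < p := by linarith
  have hq1 := one_lt_conjExp hp
  set q := conjExp p
  let s := δ ^ (1 / p)
  have hs : 0 < s := by positivity
  refine ⟨s⁻¹ ^ q, by positivity, fun a b ha hb => ?_⟩
  have h := Real.young_inequality_of_nonneg (a := s⁻¹ * a) (b := s * b) (by positivity)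
    (by positivity) hpq
  have e : s⁻¹ * a * (s * b) = a * b := by field_simp
  have e2 : s ^ p = δ := by
    simp only [s]; rw [← Real.rpow_mul hδ.le, one_div, inv_mul_cancel₀ hp0.ne', Real.rpow_one]
  rw [e, mul_rpow (by positivity) ha, mul_rpow hs.le hb, e2] at h
  have h1 : s⁻¹ ^ q * a ^ q / q ≤ s⁻¹ ^ q * a ^ q := div_le_self (by positivity) hq1.le
  have h2 : δ * b ^ p / p ≤ δ * b ^ p := div_le_self (by positivity) hp.le
  linarith

lemma le_apply_of_mem_subdiff
    {Ψ : X → ℝ≥0∞} (h0 : Ψ 0 ≠ ∞) {p ε : ℝ} (hε : ∀ x, ofReal (ε * ‖x‖ ^ p) ≤ Ψ x)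
    {x : X} {ξ : X⋆} (h : ξ ∈ subdiff Ψ x) : ε * ‖x‖ ^ p - (Ψ 0).toReal ≤ ξ x := by
  obtain ⟨h1, h2⟩ := mem_subdiff_iff.1 h
  have h3 := h2 0 h0
  rw [zero_sub, map_neg] at h3
  linarith [(ENNReal.ofReal_le_iff_le_toReal h1).1 (hε x)]

namespace Problem

variable (P) in
/-- The scheme with a decomposed loading. -/
structure IsDiscreteFlow (N : ℕ) (a : ℕ → U⋆) (b : ℕ → H)
    (c : ℕ → Z⋆) (u : ℕ → U) (v : ℕ → H) (z : ℕ → Z) (ξ : ℕ → U⋆)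
    (η : ℕ → Z⋆) : Prop where
  one_le : 1 ≤ N
  u_zero : u 0 = P.u₀
  v_zero : v 0 = P.v₀
  z_zero : z 0 = P.z₀
  emb_rate : ∀ k < N, P.emb (rate (P.T / N) u (k + 1)) = (1 / 2 : ℝ) • (v (k + 1) + v k)
  ξ_mem : ∀ k < N, ξ (k + 1) ∈ subdiff P.Ψ₁ (rate (P.T / N) u (k + 1))
  momentum : ∀ k < N, P.kin' (rate (P.T / N) v (k + 1)) + ξ (k + 1)
    + P.dΦu ((1 / 2 : ℝ) • (u (k + 1) + u k)) (z k) = a (k + 1) + P.toDual (b (k + 1))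
  η_mem : ∀ k < N, η (k + 1) ∈ subdiff P.Ψ₂ (rate (P.T / N) z (k + 1))
  internal : ∀ k < N, η (k + 1) + P.dΦz (u (k + 1)) ((1 / 2 : ℝ) • (z (k + 1) + z k)) = c (k + 1)

lemma IsDiscreteSolution.exists_discreteFlow {rf rg : LoadingRule} (hN : 1 ≤ N)
    {u : ℕ → U} {v : ℕ → H} {z : ℕ → Z} (h : P.IsDiscreteSolution rf rg N u v z)
    {a : ℕ → U⋆} {b : ℕ → H}
    (hab : ∀ k < N, rf.sample δP P.f (k + 1) = a (k + 1) + P.toDual (b (k + 1))) :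
    ∃ ξ η, P.IsDiscreteFlow N a b (rg.sample δP P.g) u v z ξ η := by
  obtain ⟨hu, hv, hz, hs⟩ := h
  have : ∀ k, ∃ ξ₁ ξ₂, k < N → P.IsStep rf rg δP u v z k ξ₁ ξ₂ := fun k => by
    by_cases hk : k < N
    · obtain ⟨x, y, h⟩ := hs k hk; exact ⟨x, y, fun _ => h⟩
    · exact ⟨0, 0, fun h => absurd h hk⟩
  choose ξ η hξη using this
  refine ⟨fun k => ξ (k - 1), fun k => η (k - 1), hN, hu, hv, hz, fun k hk => (hξη k hk).1,
    fun k hk => (hξη k hk).2.1, fun k hk => ?_, fun k hk => (hξη k hk).2.2.2.1,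
    fun k hk => (hξη k hk).2.2.2.2⟩
  rw [← hab k hk]; exact (hξη k hk).2.2.1

include hP

/-- The sampled loading converges, for a suitable decomposition. -/
lemma Admissible.exists_load {rf : LoadingRule} (hrf : rf.AppliesTo P.T P.f) :
    ∃ f₁ f₂, P.IsLoad f₁ f₂ ∧ ∃ (a : ℕ → ℕ → U⋆) (b : ℕ → ℕ → H), (∀ N : ℕ, 1 ≤ N → ∀ k < N,
        rf.sample (P.T / N) P.f (k + 1) = a N (k + 1) + P.toDual (b N (k + 1))) ∧
      Tendsto (fun N : ℕ => eLpNorm (pc (P.T / N) (a N) - f₁) ℓ₁' μP) atTop (𝓝 0) ∧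
      Tendsto (fun N : ℕ => eLpNorm (pc (P.T / N) (b N) - f₂) 1 μP) atTop (𝓝 0) := by
  have hT := hP.T_pos
  rcases hrf with hr | hr
  · subst hr
    obtain ⟨f₁, f₂, h1, h2, h3⟩ := hP.f_mem
    refine ⟨f₁, f₂, ⟨h1, h2, h3⟩, fun N => LoadingRule.mean.sample (P.T / N) f₁,
      fun N => LoadingRule.mean.sample (P.T / N) f₂, fun N hN k hk => ?_,
      LoadingRule.tendsto_sample _ hT (Or.inl rfl) hP.one_le_p₁' ofReal_ne_top h1,
      LoadingRule.tendsto_sample _ hT (Or.inl rfl) le_rfl (by simp) h2⟩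
    have hN0 : (0 : ℝ) < N := by exact_mod_cast hN
    have hτ : 0 < P.T / N := by positivity
    have hkN : ((k : ℝ) + 1) ≤ N := by exact_mod_cast hk
    have hr : ((k : ℝ) + 1) * (P.T / N) ≤ P.T := by
      calc ((k : ℝ) + 1) * (P.T / N) ≤ N * (P.T / N) := by gcongr
        _ = P.T := by field_simp
    have hl : (0 : ℝ) ≤ k * (P.T / N) := by positivity
    have hlr : k * (P.T / N) ≤ (k + 1) * (P.T / N) := by gcongr; linarith
    have hmem1 : k * (P.T / N) ∈ IP := ⟨hl, hlr.trans hr⟩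
    have hmem2 : ((k : ℝ) + 1) * (P.T / N) ∈ IP := ⟨hl.trans hlr, hr⟩
    simp only [LoadingRule.sample, Nat.cast_add, Nat.cast_one, add_sub_cancel_right]
    have i1 := intervalIntegrable_of_μI (h1.integrable hP.one_le_p₁') hmem1 hmem2
    have i2 := intervalIntegrable_of_μI (memLp_one_iff_integrable.1 h2) hmem1 hmem2
    have i3 : IntervalIntegrable (fun t => P.toDualL (f₂ t)) volume (k * (P.T / N))
        ((k + 1) * (P.T / N)) :=
      intervalIntegrable_of_μI (P.toDualL.integrable_comp (memLp_one_iff_integrable.1 h2)) hmem1 hmem2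
    rw [← toDualL_apply, map_smul, ← smul_add, ← P.toDualL.intervalIntegral_comp_comm i2,
      ← intervalIntegral.integral_add i1 i3]
    congr 1
    rw [integral_of_le hlr, integral_of_le hlr]
    refine integral_congr_ae ?_
    rw [μI_eq_Ioc] at h3
    filter_upwards [ae_restrict_of_ae_restrict_of_subset (Ioc_subset_Ioc hl hr) h3] with t ht
    rw [ht]; rfl
  · have h1 := memLp_of_continuousOn hr ℓ₁'
    refine ⟨P.f, 0, ⟨h1, MemLp.zero, .of_forall fun t => ?_⟩,
      fun N => rf.sample (P.T / N) P.f, fun N _ => 0, fun N hN k hk => ?_,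
      LoadingRule.tendsto_sample _ hT (Or.inr hr) hP.one_le_p₁' ofReal_ne_top h1, ?_⟩
    · simp [← toDualL_apply]
    · simp [← toDualL_apply]
    · have : ∀ N : ℕ, pc (P.T / N) (fun _ : ℕ => (0 : H)) - 0 = 0 := fun N => by
        ext t; simp [pc]
      simp [this]

lemma Admissible.exists_lower_bound :
    ∃ L : ℝ, 0 ≤ L ∧ ∀ u z, ‖u‖ + ‖z‖ - L ≤ P.Φ u z := by
  obtain ⟨R, hR⟩ := hP.superlinear 1
  obtain ⟨C, hC, hΦ⟩ := hP.exists_bound_Φ R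
  refine ⟨C + |R|, by positivity, fun u z => ?_⟩
  rcases le_or_gt R (‖u‖ + ‖z‖) with h | h
  · have := hR u z h
    linarith [abs_nonneg R]
  · have := hΦ u z (by linarith [norm_nonneg z]) (by linarith [norm_nonneg u])
    linarith [(abs_le.1 this).1, le_abs_self R]

namespace IsDiscreteFlow

variable {a : ℕ → U⋆} {b : ℕ → H} {c : ℕ → Z⋆} {u : ℕ → U} {v : ℕ → H} {z : ℕ → Z} {ξ : ℕ → U⋆}
  {η : ℕ → Z⋆}

lemma τ_pos (h : P.IsDiscreteFlow N a b c u v z ξ η) : 0 < P.T / N :=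
  div_pos hP.T_pos (by exact_mod_cast h.one_le)

lemma energy_step (h : P.IsDiscreteFlow N a b c u v z ξ η) {k : ℕ} (hk : k < N) :
    P.kin (v (k + 1)) + P.Φ (u (k + 1)) (z (k + 1))
      + P.T / N * (ξ (k + 1) (rate δP u (k + 1)) + η (k + 1) (rate δP z (k + 1)))
      = P.kin (v k) + P.Φ (u k) (z k) + P.T / N * (a (k + 1) (rate δP u (k + 1))
        + ⟪b (k + 1), (1 / 2 : ℝ) • (v (k + 1) + v k)⟫ + c (k + 1) (rate δP z (k + 1))) := by
  have hτ := h.τ_pos hP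
  have e := hP.step_energy_balance hτ (h.emb_rate k hk) (h.momentum k hk) (h.internal k hk)
  have e2 : P.toDual (b (k + 1)) (rate δP u (k + 1))
      = ⟪b (k + 1), (1 / 2 : ℝ) • (v (k + 1) + v k)⟫ := by
    rw [← h.emb_rate k hk]; rfl
  rw [← e2]
  simp only [rate, Nat.add_sub_cancel] at e ⊢
  rw [add_apply] at e
  set τ := P.T / N
  have e5 := congrArg (· * τ) e
  simp only [add_mul, div_mul_cancel₀ _ hτ.ne'] at e5
  linarith

end IsDiscreteFlow

/-- The a-priori estimates. -/
lemma Admissible.exists_apriori_bound {A B C : ℝ} (hA : 0 ≤ A) (hB : 0 ≤ B)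
    (hC : 0 ≤ C) : ∃ M : ℝ, 0 ≤ M ∧ ∀ {N a b c u v z ξ η}, P.IsDiscreteFlow N a b c u v z ξ η →
      ∑ k ∈ Finset.range N, P.T / N * ‖a (k + 1)‖ ^ conjExp P.p₁ ≤ A →
      ∑ k ∈ Finset.range N, P.T / N * ‖b (k + 1)‖ ≤ B →
      ∑ k ∈ Finset.range N, P.T / N * ‖c (k + 1)‖ ^ conjExp P.p₂ ≤ C →
      (∀ k ≤ N, ‖u k‖ ≤ M ∧ ‖v k‖ ≤ M ∧ ‖z k‖ ≤ M) ∧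
      ∑ k ∈ Finset.range N, P.T / N * ‖rate (P.T / N) u (k + 1)‖ ^ P.p₁ ≤ M ∧
      ∑ k ∈ Finset.range N, P.T / N * ‖rate (P.T / N) z (k + 1)‖ ^ P.p₂ ≤ M ∧
      ∑ k ∈ Finset.range N, P.T / N * ‖ξ (k + 1)‖ ^ conjExp P.p₁ ≤ M := by
  obtain ⟨K, hK⟩ := hP.exists_kinForm
  obtain ⟨κ, hκ, hKc⟩ := hK.coercive
  obtain ⟨L, hL0, hL⟩ := hP.exists_lower_bound
  obtain ⟨ε₁, hε₁, hΨ₁⟩ := hP.Ψ₁_coercive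
  obtain ⟨ε₂, hε₂, hΨ₂⟩ := hP.Ψ₂_coercive
  obtain ⟨Ca, hCa, hya⟩ := exists_young hP.one_lt_p₁ (half_pos hε₁)
  obtain ⟨Cc, hCc, hyc⟩ := exists_young hP.one_lt_p₂ (half_pos hε₂)
  obtain ⟨G, hG⟩ := hP.Ψ₁_growth
  have hT := hP.T_pos
  set q₁ := conjExp P.p₁
  have hq₁ : 1 < q₁ := one_lt_conjExp hP.one_lt_p₁
  have hpq : (P.p₁ - 1) * q₁ = P.p₁ := by
    linarith [(holderConjugate_conjExp hP.one_lt_p₁).mul_eq_add]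
  obtain ⟨ψ, hψ⟩ : ∃ ψ, ψ = (P.Ψ₁ 0).toReal + (P.Ψ₂ 0).toReal := ⟨_, rfl⟩
  have hψ0 : 0 ≤ ψ := hψ ▸ add_nonneg toReal_nonneg toReal_nonneg
  let C₁ := |P.kin P.v₀ + P.Φ P.u₀ P.z₀| + P.T * ψ + Ca * A + Cc * C + L
  let C₂ := 1 + 2 * (C₁ + B) / κ
  let M₀ := C₁ + B * C₂
  let M₁ := 2 * M₀ / ε₁
  let W := (max G 0) ^ q₁ * 2 ^ q₁
  have hC₁ : 0 ≤ C₁ := by positivity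
  have hC₂ : 0 ≤ C₂ := by positivity
  have hM₀ : 0 ≤ M₀ := by positivity
  have hM₁ : 0 ≤ M₁ := by positivity
  have hM₂ : 0 ≤ 2 * M₀ / ε₂ := by positivity
  have hW : 0 ≤ W * (P.T + M₁) := by positivity
  refine ⟨M₀ + C₂ + M₁ + 2 * M₀ / ε₂ + W * (P.T + M₁), by positivity, ?_⟩
  intro N a b c u v z ξ η h ha hb hc
  have hτ := h.τ_pos hP
  have hN0 : (0 : ℝ) < N := by exact_mod_cast h.one_le
  have hNτ : (N : ℝ) * (P.T / N) = P.T := by field_simp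
  have hstep := fun k (hk : k < N) => h.energy_step hP hk
  set τ := P.T / N
  obtain ⟨j, hj, hjmax⟩ := (Finset.range (N + 1)).exists_max_image (fun k => ‖v k‖) ⟨0, by simp⟩
  set V := ‖v j‖
  have hV : ∀ k ≤ N, ‖v k‖ ≤ V := fun k hk => hjmax k (Finset.mem_range.2 (by omega))
  let S (f : ℕ → ℝ) (m : ℕ) := ∑ k ∈ Finset.range m, τ * f (k + 1)
  have hS (f : ℕ → ℝ) (m : ℕ) : S f (m + 1) = S f m + τ * f (m + 1) := Finset.sum_range_succ _ _
  have hS0 (f : ℕ → ℝ) : S f 0 = 0 := rfl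
  have hSm {f : ℕ → ℝ} (hf : ∀ k, 0 ≤ f k) {m n : ℕ} (hm : m ≤ n) : S f m ≤ S f n :=
    Finset.sum_le_sum_of_subset_of_nonneg (Finset.range_mono hm) fun k _ _ => mul_nonneg hτ.le (hf _)
  obtain ⟨X, hX⟩ : ∃ X : ℕ → ℝ, X = fun k => ‖rate τ u k‖ ^ P.p₁ := ⟨_, rfl⟩
  obtain ⟨Y, hY⟩ : ∃ Y : ℕ → ℝ, Y = fun k => ‖rate τ z k‖ ^ P.p₂ := ⟨_, rfl⟩
  have hX0 (m) : 0 ≤ ε₁ / 2 * S X m :=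
    mul_nonneg (half_pos hε₁).le (hSm (fun k => by rw [hX]; positivity) (Nat.zero_le m))
  have hY0 (m) : 0 ≤ ε₂ / 2 * S Y m :=
    mul_nonneg (half_pos hε₂).le (hSm (fun k => by rw [hY]; positivity) (Nat.zero_le m))
  have hsum : ∀ m ≤ N, P.kin (v m) + P.Φ (u m) (z m) + ε₁ / 2 * S X m + ε₂ / 2 * S Y m
      ≤ P.kin P.v₀ + P.Φ P.u₀ P.z₀ + m * τ * ψ + Ca * S (fun k => ‖a k‖ ^ q₁) m
        + S (fun k => ‖b k‖) m * V + Cc * S (fun k => ‖c k‖ ^ conjExp P.p₂) m := by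
    intro m hm
    induction m with
    | zero => simp [h.u_zero, h.v_zero, h.z_zero, hS0]
    | succ k ih =>
      have hk : k < N := by omega
      have e1 := le_apply_of_mem_subdiff hP.Ψ₁_zero hΨ₁ (h.ξ_mem k hk)
      have e2 := le_apply_of_mem_subdiff hP.Ψ₂_zero hΨ₂ (h.η_mem k hk)
      have e3 := ((le_abs_self _).trans ((a (k + 1)).le_opNorm (rate τ u (k + 1)))).trans
        (hya _ _ (norm_nonneg _) (norm_nonneg _))
      have e4 := ((le_abs_self _).trans ((c (k + 1)).le_opNorm (rate τ z (k + 1)))).trans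
        (hyc _ _ (norm_nonneg _) (norm_nonneg _))
      have e5 : ⟪b (k + 1), (1 / 2 : ℝ) • (v (k + 1) + v k)⟫ ≤ ‖b (k + 1)‖ * V := by
        refine (real_inner_le_norm _ _).trans ?_
        exact mul_le_mul_of_nonneg_left (norm_midpoint_le (hV _ hm) (hV _ hk.le)) (norm_nonneg _)
      have e6 := mul_le_mul_of_nonneg_left
        (add_le_add (add_le_add (add_le_add e1 e2) (add_le_add e3 e4)) e5) hτ.le
      have e7 := ih hk.le
      have e8 := hstep k hk
      simp only [hS, hX, hY, hψ] at e7 ⊢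
      push_cast
      linarith
  have hall : ∀ m ≤ N, κ / 2 * ‖v m‖ ^ 2 + (‖u m‖ + ‖z m‖) + ε₁ / 2 * S X m + ε₂ / 2 * S Y m
      ≤ C₁ + B * V := fun m hm => by
    have e1 := hsum m hm
    rw [hK.kin_eq] at e1
    have a1 := (hSm (f := fun k => ‖a k‖ ^ q₁) (fun k => by positivity) hm).trans ha
    have b1 := (hSm (f := fun k => ‖b k‖) (fun k => by positivity) hm).trans hb
    have c1 := (hSm (f := fun k => ‖c k‖ ^ conjExp P.p₂) (fun k => by positivity) hm).trans hc
    have t1 : m * τ * ψ ≤ N * τ * ψ := by gcongr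
    rw [hNτ] at t1
    have := mul_le_mul_of_nonneg_left a1 hCa
    have := mul_le_mul_of_nonneg_right b1 (norm_nonneg (v j))
    have := mul_le_mul_of_nonneg_left c1 hCc
    linarith [hL (u m) (z m), hKc (v m), le_abs_self (P.kin P.v₀ + P.Φ P.u₀ P.z₀)]
  have hkin (m) : 0 ≤ κ / 2 * ‖v m‖ ^ 2 := by positivity
  have hVC : V ≤ C₂ := by
    have e := hall j (Nat.lt_succ_iff.1 (Finset.mem_range.1 hj))
    have e1 : κ / 2 * V ^ 2 ≤ C₁ + B * V := by
      linarith [hX0 j, hY0 j, norm_nonneg (u j), norm_nonneg (z j)]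
    rcases le_or_gt V 1 with h1 | h1
    · exact h1.trans (le_add_of_nonneg_right (by positivity))
    · have e2 : κ / 2 * V * V ≤ (C₁ + B) * V := by nlinarith
      have e3 := le_of_mul_le_mul_right e2 (by linarith)
      have e4 : V ≤ 2 * (C₁ + B) / κ := by rw [le_div_iff₀ hκ]; linarith
      exact e4.trans (le_add_of_nonneg_left zero_le_one)
  have hBV : C₁ + B * V ≤ M₀ := add_le_add_right (mul_le_mul_of_nonneg_left hVC hB) _
  have hN := hall N le_rfl
  have hSX : S X N ≤ M₁ := by
    rw [le_div_iff₀ hε₁]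
    linarith [hY0 N, norm_nonneg (u N), norm_nonneg (z N), hkin N]
  have hSY : S Y N ≤ 2 * M₀ / ε₂ := by
    rw [le_div_iff₀ hε₂]
    linarith [hX0 N, norm_nonneg (u N), norm_nonneg (z N), hkin N]
  have hSξ : S (fun k => ‖ξ k‖ ^ q₁) N ≤ W * (P.T + M₁) := by
    have key : ∀ m ≤ N, S (fun k => ‖ξ k‖ ^ q₁) m ≤ W * (m * τ + S X m) := by
      intro m hm
      induction m with
      | zero => simp [hS0]
      | succ k ih =>
        have g1 := (hG _ _ (h.ξ_mem k hm)).trans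
          (mul_le_mul_of_nonneg_right (le_max_left G 0) (by positivity))
        have g2 := Real.rpow_le_rpow (norm_nonneg _) g1 (by linarith : 0 ≤ q₁)
        rw [mul_rpow (le_max_right _ _) (by positivity)] at g2
        have g3 := one_add_rpow_le (p := q₁) (by linarith) (a := ‖rate τ u (k + 1)‖ ^ (P.p₁ - 1)) (by positivity)
        rw [← Real.rpow_mul (norm_nonneg _), hpq] at g3
        have g4 := mul_le_mul_of_nonneg_left (g2.trans (mul_le_mul_of_nonneg_left g3
          (by positivity))) hτ.le
        have g5 := ih (by omega)
        simp only [hS, hX, W] at g5 ⊢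
        push_cast
        linarith
    refine (key N le_rfl).trans ?_
    rw [hNτ]
    gcongr
  subst hX hY
  refine ⟨fun k hk => ?_, hSX.trans (by linarith), hSY.trans (by linarith), hSξ.trans (by linarith)⟩
  have e := hall k hk
  have i3 := norm_nonneg (u k)
  have i4 := norm_nonneg (z k)
  have i6 := hV k hk
  refine ⟨?_, ?_, ?_⟩ <;> linarith [hX0 k, hY0 k, hkin k]

end Problem

section Primitives

lemma exists_bound_of_tendsto (hT : 0 < T) {x : ℕ → ℕ → X} {h : ℝ → X} {q : ℝ≥0∞}
    (hq : 1 ≤ q) (hh : MemLp h q μT)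
    (hx : Tendsto (fun N : ℕ => eLpNorm (pc (T / N) (x N) - h) q μT) atTop (𝓝 0)) :
    ∃ C : ℝ, 0 ≤ C ∧ ∀ N : ℕ, 1 ≤ N → eLpNorm (pc (T / N) (x N)) q μT ≤ ofReal C := by
  have hm : ∀ n : ℕ, MemLp (pc (T / (n + 1 : ℕ)) (x (n + 1)) - h) q μT := fun n =>
    (memLp_pc hT (Nat.succ_le_succ (Nat.zero_le n)) _ q).sub hh
  have h1 := (tendsto_toReal zero_ne_top).comp ((tendsto_add_atTop_iff_nat 1).2 hx)
  obtain ⟨B, hB⟩ := h1.bddAbove_range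
  have hB' : ∀ n : ℕ, (eLpNorm (pc (T / (n + 1 : ℕ)) (x (n + 1)) - h) q μT).toReal ≤ B :=
    fun n => hB ⟨n, rfl⟩
  have hB0 : 0 ≤ B := toReal_nonneg.trans (hB' 0)
  refine ⟨B + (eLpNorm h q μT).toReal, by positivity, fun N hN => ?_⟩
  obtain ⟨n, rfl⟩ := Nat.exists_eq_add_of_le' hN
  rw [ofReal_add hB0 toReal_nonneg, ofReal_toReal hh.2.ne]
  calc eLpNorm (pc (T / (n + 1 : ℕ)) (x (n + 1))) q μT
      = eLpNorm ((pc (T / (n + 1 : ℕ)) (x (n + 1)) - h) + h) q μT := by rw [sub_add_cancel]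
    _ ≤ eLpNorm (pc (T / (n + 1 : ℕ)) (x (n + 1)) - h) q μT + eLpNorm h q μT :=
        eLpNorm_add_le (hm n).1 hh.1 hq
    _ ≤ _ := by
        gcongr
        exact (ENNReal.le_ofReal_iff_toReal_le (hm n).2.ne hB0).2 (hB' n)

lemma norm_prim_le {w : ℝ → X} (hw : Integrable w μT) (c : X)
    (ht : t ∈ IT) : ‖prim c w t‖ ≤ ‖c‖ + (eLpNorm w 1 μT).toReal := by
  refine (norm_add_le _ _).trans (add_le_add_right ?_ _)
  have h1 : (eLpNorm w 1 μT).toReal = ∫ s, ‖w s‖ ∂μT := by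
    rw [eLpNorm_one_eq_lintegral_enorm, integral_norm_eq_lintegral_enorm hw.1]
  rw [h1, integral_μI (ht.1.trans ht.2)]
  exact norm_integral_le_of_subset (ht.1.trans ht.2)
    (by rw [uIoc_of_le ht.1]; exact Ioc_subset_Ioc_right ht.2)
    (intervalIntegrable_left hw ⟨ht.1.trans ht.2, le_rfl⟩)

lemma eLpNorm_one_le {w : ℝ → X} {p : ℝ≥0∞} (hp : 1 ≤ p)
    (hw : MemLp w p μT) {C : ℝ} (hC : 0 ≤ C) (hwC : eLpNorm w p μT ≤ ofReal C) :
    (eLpNorm w 1 μT).toReal ≤ C * ((μT univ) ^ (1 - 1 / p.toReal)).toReal := by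
  have h := eLpNorm_le_eLpNorm_mul_rpow_measure_univ hp hw.1
  rw [toReal_one, div_one] at h
  have hexp : (0 : ℝ) ≤ 1 - 1 / p.toReal := by
    rcases eq_or_ne p ∞ with rfl | hp'
    · simp
    · have := toReal_mono hp' hp
      rw [toReal_one] at this
      exact sub_nonneg.2 ((div_le_one (by linarith)).2 this)
  have hfin : (μT univ) ^ (1 - 1 / p.toReal) ≠ ∞ := rpow_ne_top_of_nonneg hexp (measure_ne_top _ _)
  have h2 := toReal_mono (mul_ne_top ofReal_ne_top hfin) (h.trans (mul_le_mul_left hwC _))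
  rwa [toReal_mul, toReal_ofReal hC] at h2

/-- Primitives of functions that are bounded in `L^p` are bounded in `W^{1,p}` and in `L^∞`. -/
lemma exists_sobolevBound_prim (hT : 0 < T) {p : ℝ≥0∞} (hp : 1 ≤ p)
    {C C₀ : ℝ} (hC : 0 ≤ C) (hC₀ : 0 ≤ C₀) : ∃ C' : ℝ≥0, ∀ {w : ℝ → X} {c : X} {u : ℝ → X},
      MemLp w p μT → eLpNorm w p μT ≤ ofReal C → ‖c‖ ≤ C₀ →
      (∀ t ∈ IT, u t = prim c w t) → SobolevBound T p u C' ∧ LpBound T ∞ u C' := by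
  let D := C₀ + C * ((μT univ) ^ (1 - 1 / p.toReal)).toReal
  have hD : 0 ≤ D := by positivity
  let E : ℝ≥0∞ := (μT univ) ^ p.toReal⁻¹ * ofReal D
  have hE : E ≠ ∞ := mul_ne_top
    (rpow_ne_top_of_nonneg (by positivity) (measure_ne_top _ _)) ofReal_ne_top
  refine ⟨(E + ofReal C).toNNReal + D.toNNReal, fun {w c u} hw hwC hc hu => ?_⟩
  have hwi := hw.integrable hp
  have hae := ae_μI_of_forall hu
  have hcont : ContinuousOn u IT := (continuousOn_prim hwi c).congr hu
  have hb : ∀ᵐ t ∂μT, ‖u t‖ ≤ D := ae_restrict_of_forall_mem measurableSet_Icc fun t ht => by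
    rw [hu t ht]
    refine (norm_prim_le hwi c ht).trans ?_
    simp only [D]
    have := eLpNorm_one_le hp hw hC hwC
    linarith
  refine ⟨⟨w, ⟨memLp_of_continuousOn hcont p, hw, (hasWeakDeriv_prim hT hwi c).congr hae ae_eq_rfl⟩, ?_⟩,
    memLp_of_continuousOn hcont ∞, ?_⟩
  · have h1 : eLpNorm u p μT ≤ E := eLpNorm_le_of_ae_bound hb
    rw [ENNReal.coe_add, ENNReal.coe_toNNReal (add_ne_top.2 ⟨hE, ofReal_ne_top⟩)]
    exact (add_le_add h1 hwC).trans le_self_add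
  · rw [eLpNorm_exponent_top, ENNReal.coe_add]
    exact (eLpNormEssSup_le_of_ae_bound hb).trans le_add_self

lemma clm_prim [CompleteSpace Y] (L : X →L[ℝ] Y) {w : ℝ → X} (hw : Integrable w μT) (c : X)
    (ht : t ∈ IT) : L (prim c w t) = prim (L c) (fun s => L (w s)) t := by
  rw [prim, map_add, prim, L.intervalIntegral_comp_comm (intervalIntegrable_left hw ht)]

lemma eLpNorm_clm_le (L : X →L[ℝ] Y)
    {w : ℝ → X} {p : ℝ≥0∞} {C : ℝ} (h : eLpNorm w p μT ≤ ofReal C) :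
    eLpNorm (fun t => L (w t)) p μT ≤ ofReal (‖L‖ * C) := by
  refine (eLpNorm_le_mul_eLpNorm_of_ae_le_mul (.of_forall fun t => L.le_opNorm _) p).trans ?_
  rw [ofReal_mul (norm_nonneg L)]
  exact mul_le_mul_right h _

lemma prim_congr {w w' : ℝ → X} (h : ∀ t ∈ Ioc 0 T, w t = w' t) (c : X)
    (ht : t ∈ IT) : prim c w t = prim c w' t := by
  rw [prim, prim]
  congr 1
  refine intervalIntegral.integral_congr_ae (.of_forall fun s hs => h s ?_)
  rw [uIoc_of_le ht.1] at hs
  exact ⟨hs.1, hs.2.trans ht.2⟩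

lemma LpBound.mono {p : ℝ≥0∞} {u : ℝ → X} {C C' : ℝ≥0} (h : LpBound T p u C)
    (hC : C ≤ C') : LpBound T p u C' := ⟨h.1, h.2.trans (by exact_mod_cast hC)⟩

lemma SobolevBound.mono {p : ℝ≥0∞} {u : ℝ → X} {C C' : ℝ≥0} (h : SobolevBound T p u C)
    (hC : C ≤ C') : SobolevBound T p u C' := by
  obtain ⟨w, h1, h2⟩ := h
  exact ⟨w, h1, h2.trans (by exact_mod_cast hC)⟩

end Primitives

namespace Problem

lemma SumBound.mono {ζ : ℝ → U⋆} {C C' : ℝ≥0} (h : P.SumBound ζ C) (hC : C ≤ C') :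
    P.SumBound ζ C' := by
  obtain ⟨a, b, Ca, Cb, h1, h2⟩ := h
  exact ⟨a, b, Ca, Cb, h1.trans hC, h2⟩

variable (P) in
/-- The conservative force at the midpoint of a time step. -/
def midForce (u : ℕ → U) (z : ℕ → Z) (k : ℕ) : U⋆ :=
  P.dΦu ((1 / 2 : ℝ) • (u k + u (k - 1))) (z (k - 1))

variable (P) in
/-- The internal force at the midpoint of a time step. -/
def midForceZ (u : ℕ → U) (z : ℕ → Z) (k : ℕ) : Z⋆ := P.dΦz (u k) ((1 / 2 : ℝ) • (z k + z (k - 1)))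

variable (P) in
/-- Bounds for the solutions of the scheme. -/
structure DiscreteBounds (M : ℝ) (N : ℕ) (a : ℕ → U⋆) (b : ℕ → H)
    (u : ℕ → U) (v : ℕ → H) (z : ℕ → Z) (ξ : ℕ → U⋆) : Prop where
  u_le : ∀ k ≤ N, ‖u k‖ ≤ M
  v_le : ∀ k ≤ N, ‖v k‖ ≤ M
  z_le : ∀ k ≤ N, ‖z k‖ ≤ M
  du_le : eLpNorm (Δ (P.T / N) u) ℓ₁ μP ≤ ofReal M
  dz_le : eLpNorm (Δ (P.T / N) z) ℓ₂ μP ≤ ofReal M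
  ξ_le : eLpNorm (pc (P.T / N) ξ) ℓ₁' μP ≤ ofReal M
  a_le : eLpNorm (pc (P.T / N) a) ℓ₁' μP ≤ ofReal M
  b_le : eLpNorm (pc (P.T / N) b) 1 μP ≤ ofReal M
  force_le : ∀ k < N, ‖P.midForce u z (k + 1)‖ ≤ M
  forceZ_le : ∀ k < N, ‖P.midForceZ u z (k + 1)‖ ≤ M

variable (P) in
/-- A sampled and decomposed loading, with uniform bounds for the scheme. -/
structure IsSetup (f₁ : ℝ → U⋆) (f₂ : ℝ → H) (a : ℕ → ℕ → U⋆)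
    (b : ℕ → ℕ → H) (c : ℕ → ℕ → Z⋆) (M : ℝ) : Prop where
  load : P.IsLoad f₁ f₂
  a_tendsto : Tendsto (fun N : ℕ => eLpNorm (pc (P.T / N) (a N) - f₁) ℓ₁' μP) atTop (𝓝 0)
  b_tendsto : Tendsto (fun N : ℕ => eLpNorm (pc (P.T / N) (b N) - f₂) 1 μP) atTop (𝓝 0)
  c_tendsto : Tendsto (fun N : ℕ => eLpNorm (pc (P.T / N) (c N) - P.g) ℓ₂' μP) atTop (𝓝 0)
  nonneg : 0 ≤ M
  bounds : ∀ {N u v z ξ η}, P.IsDiscreteFlow N (a N) (b N) (c N) u v z ξ η →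
      P.DiscreteBounds M N (a N) (b N) u v z ξ

include hP in
lemma Admissible.exists_setup {rf rg : LoadingRule}
    (hrf : rf.AppliesTo P.T P.f) (hrg : rg.AppliesTo P.T P.g) :
    ∃ f₁ f₂ a b M, P.IsSetup f₁ f₂ a b (fun N => rg.sample (P.T / N) P.g) M ∧
      ∀ N : ℕ, 1 ≤ N → ∀ k < N,
        rf.sample (P.T / N) P.f (k + 1) = a N (k + 1) + P.toDual (b N (k + 1)) := by
  have hT := hP.T_pos
  obtain ⟨f₁, f₂, hf, a, b, hab, ha, hb⟩ := hP.exists_load hrf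
  have hc := rg.tendsto_sample hT hrg hP.one_le_p₂' ofReal_ne_top hP.g_mem
  obtain ⟨A, hA, hA'⟩ := exists_bound_of_tendsto hT hP.one_le_p₁' hf.mem₁ ha
  obtain ⟨B, hB, hB'⟩ := exists_bound_of_tendsto hT le_rfl hf.mem₂ hb
  obtain ⟨C, hC, hC'⟩ := exists_bound_of_tendsto hT hP.one_le_p₂' hP.g_mem hc
  have hq₁ := one_lt_conjExp hP.one_lt_p₁
  have hq₂ := one_lt_conjExp hP.one_lt_p₂
  obtain ⟨M, hM, hbd⟩ := hP.exists_apriori_bound (A := A ^ conjExp P.p₁) (B := B ^ (1 : ℝ))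
    (C := C ^ conjExp P.p₂) (by positivity) (by positivity) (by positivity)
  obtain ⟨D, hD, hD'⟩ := hP.exists_bound_dΦ M
  let M₁ := M + M ^ (1 / P.p₁) + M ^ (1 / P.p₂) + M ^ (1 / conjExp P.p₁) + A + B + D
  have e1 : 0 ≤ M ^ (1 / P.p₁) := by positivity
  have e2 : 0 ≤ M ^ (1 / P.p₂) := by positivity
  have e3 : 0 ≤ M ^ (1 / conjExp P.p₁) := by positivity
  refine ⟨f₁, f₂, a, b, M₁, ⟨hf, ha, hb, hc, by positivity, fun {N u v z ξ η} h => ?_⟩, hab⟩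
  obtain ⟨h1, h2, h3, h4⟩ := hbd h (sum_pc_le hT h.one_le hq₁.le hA (hA' N h.one_le))
    (by simpa using sum_pc_le hT h.one_le (p := 1) le_rfl hB (by simpa using hB' N h.one_le))
    (sum_pc_le hT h.one_le hq₂.le hC (hC' N h.one_le))
  have hle {y A : ℝ} (hy : y ≤ A) (hA : A ≤ M₁) : y ≤ M₁ := hy.trans hA
  have hle' {y : ℝ≥0∞} {A : ℝ} (hy : y ≤ ofReal A) (hA : A ≤ M₁) : y ≤ ofReal M₁ :=
    hy.trans (ofReal_le_ofReal hA)
  have h0 := fun k (hk : k < N) => h1 k hk.le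
  constructor
  · exact fun k hk => hle (h1 k hk).1 (by simp only [M₁]; linarith)
  · exact fun k hk => hle (h1 k hk).2.1 (by simp only [M₁]; linarith)
  · exact fun k hk => hle (h1 k hk).2.2 (by simp only [M₁]; linarith)
  · exact hle' (eLpNorm_pc_le hT h.one_le hP.one_lt_p₁ h2) (by simp only [M₁]; linarith)
  · exact hle' (eLpNorm_pc_le hT h.one_le hP.one_lt_p₂ h3) (by simp only [M₁]; linarith)
  · exact hle' (eLpNorm_pc_le hT h.one_le hq₁ h4) (by simp only [M₁]; linarith)
  · exact hle' (hA' N h.one_le) (by simp only [M₁]; linarith)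
  · exact hle' (hB' N h.one_le) (by simp only [M₁]; linarith)
  · exact fun k hk => hle (hD' _ _ (norm_midpoint_le (h1 _ hk).1 (h0 k hk).1) (h0 k hk).2.2).1
      (by simp only [M₁]; linarith)
  · exact fun k hk => hle (hD' _ _ (h1 _ hk).1 (norm_midpoint_le (h1 _ hk).2.2 (h0 k hk).2.2)).2
      (by simp only [M₁]; linarith)

section Estimates

variable {a : ℕ → U⋆} {b : ℕ → H} {c : ℕ → Z⋆} {u : ℕ → U} {v : ℕ → H} {z : ℕ → Z} {ξ : ℕ → U⋆}
  {η : ℕ → Z⋆}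

variable (P) in
/-- `𝒯'` as a continuous linear map from `H` to `U*`. -/
def kinL (K : H →L[ℝ] H⋆) : H →L[ℝ] U⋆ := ((compL ℝ U H ℝ).flip P.emb).comp K

lemma IsKinForm.kinL_apply (hK : P.IsKinForm K) (h : H) : P.kinL K h = P.kin' h :=
  (hK.kin'_eq h).symm

lemma IsKinForm.exists_equiv (hK : P.IsKinForm K) :
    ∃ J : H ≃L[ℝ] H, ∀ x y, ⟪J x, y⟫ = K x y := by
  obtain ⟨κ, hκ, hKc⟩ := hK.coercive
  have hc : IsCoercive K := ⟨κ, hκ, fun x => by rw [mul_assoc, ← sq]; exact hKc x⟩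
  exact ⟨hc.continuousLinearEquivOfBilin, fun x y => hc.continuousLinearEquivOfBilin_apply x y⟩

variable (h : P.IsDiscreteFlow N a b c u v z ξ η)

include hP h

lemma IsDiscreteFlow.emb_pc_rate (ht : t ∈ Ioc 0 P.T) :
    P.emb (Δ δP u t) = midInterp δP v t := by
  obtain ⟨k, hk, -, hc⟩ := exists_cell hP.T_pos h.one_le ht
  rw [pc, midInterp, hc]
  exact h.emb_rate k hk

lemma DiscreteBounds.norm_midInterp_le {M : ℝ} (hb : P.DiscreteBounds M N a b u v z ξ)
    (ht : t ∈ Ioc 0 P.T) : ‖midInterp δP v t‖ ≤ M := by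
  obtain ⟨k, hk, -, hc⟩ := exists_cell hP.T_pos h.one_le ht
  rw [midInterp, hc]
  exact norm_midpoint_le (hb.v_le (k + 1) hk) (hb.v_le k hk.le)

/-- The momentum balance of the scheme, in integrated form. -/
lemma IsDiscreteFlow.kin'_affineInterp (hK : P.IsKinForm K) (ht : t ∈ IP) :
    P.kin' (affineInterp δP v t) = prim 0 (pc δP (fun k => a k - P.midForce u z k - ξ k)) t
        + P.toDual (prim (H♯ (K P.v₀)) (pc δP b) t) := by
  have hT := hP.T_pos
  have i2 := integrable_pc hT h.one_le b
  rw [affineInterp_eq_prim hT h.one_le v ht, ← hK.kinL_apply, clm_prim _ (integrable_pc hT h.one_le _) _ ht, ← toDualL_apply,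
    clm_prim _ i2 _ ht, h.v_zero]
  have e0 : P.toDualL (H♯ (K P.v₀)) = P.kinL K P.v₀ :=
    ContinuousLinearMap.ext fun x => InnerProductSpace.toDual_symm_apply
  have e1 : ∀ s ∈ Ioc 0 P.T, P.kinL K (Δ δP v s)
      = pc δP (fun k => a k - P.midForce u z k - ξ k) s + P.toDualL (pc δP b s) := by
    intro s hs
    obtain ⟨k, hk, -, hc⟩ := exists_cell hT h.one_le hs
    simp only [pc, hc]
    have := h.momentum k hk
    rw [hK.kinL_apply, toDualL_apply, midForce, Nat.add_sub_cancel, eq_comm, ← sub_eq_zero]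
    rw [← sub_eq_zero] at this
    rw [← neg_eq_zero, ← this]
    abel
  rw [prim_congr e1 _ ht, e0, prim, prim, prim, zero_add,
    intervalIntegral.integral_add (intervalIntegrable_left (integrable_pc hT h.one_le _) ht)
      (intervalIntegrable_left (P.toDualL.integrable_comp i2) ht)]
  abel

/-- The energy balance of the scheme over the whole time interval. -/
lemma IsDiscreteFlow.energy_integral :
    ∫⟨pc δP ξ, Δ δP u⟩ + ∫⟨pc δP η, Δ δP z⟩
    = P.kin P.v₀ + P.Φ P.u₀ P.z₀ + (∫⟨pc δP a, Δ δP u⟩ + (∫ t, ⟪pc δP b t, midInterp δP v t⟫ ∂μP)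
      + ∫⟨pc δP c, Δ δP z⟩)
      - (P.kin (v N) + P.Φ (u N) (z N)) := by
  have I {x : ℕ → ℝ} := integral_pc hP.T_pos h.one_le x
  have e1 := @I fun k => ξ k (rate δP u k)
  have e2 := @I fun k => η k (rate δP z k)
  have e3 := @I fun k => a k (rate δP u k)
  have e4 := @I fun k => ⟪b k, (1 / 2 : ℝ) • (v k + v (k - 1))⟫
  have e5 := @I fun k => c k (rate δP z k)
  have h1 := Finset.sum_range_sub (fun k => P.kin (v k) + P.Φ (u k) (z k)) N
  have h2 := Finset.sum_congr rfl fun k hk => h.energy_step hP (Finset.mem_range.1 hk)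
  rw [h.u_zero, h.v_zero, h.z_zero] at h1
  simp only [pc, midInterp, Nat.add_sub_cancel, smul_eq_mul, mul_add, Finset.sum_add_distrib,
    Finset.sum_sub_distrib, Finset.mul_sum] at *
  linarith

lemma IsDiscreteFlow.ae_ξ_mem :
    ∀ᵐ t ∂μP, pc δP ξ t ∈ subdiff P.Ψ₁ (Δ δP u t) :=
  ae_μI_of_Ioc fun t ht => by
    obtain ⟨k, hk, -, hc⟩ := exists_cell hP.T_pos h.one_le ht
    simp only [pc, hc]
    exact h.ξ_mem k hk

lemma IsDiscreteFlow.ae_η_mem :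
    ∀ᵐ t ∂μP, pc δP η t ∈ subdiff P.Ψ₂ (Δ δP z t) :=
  ae_μI_of_Ioc fun t ht => by
    obtain ⟨k, hk, -, hc⟩ := exists_cell hP.T_pos h.one_le ht
    simp only [pc, hc]
    exact h.η_mem k hk

lemma IsDiscreteFlow.pc_η :
    ∀ᵐ t ∂μP, pc δP η t = pc δP c t - pc δP (P.midForceZ u z) t :=
  ae_μI_of_Ioc fun t ht => by
    obtain ⟨k, hk, -, hc⟩ := exists_cell hP.T_pos h.one_le ht
    simp only [pc, hc, midForceZ, Nat.add_sub_cancel]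
    exact eq_sub_of_add_eq (h.internal k hk)

end Estimates

include hP in
/-- The a-priori estimates for the interpolants. -/
lemma IsSetup.exists_estimates {a : ℕ → ℕ → U⋆} {b : ℕ → ℕ → H} {c : ℕ → ℕ → Z⋆} {M : ℝ}
    (hs : P.IsSetup f₁ f₂ a b c M) : ∃ C : ℝ≥0, ∀ {N u v z ξ η},
      P.IsDiscreteFlow N (a N) (b N) (c N) u v z ξ η →
      LpBound P.T ∞ (affineInterp (P.T / N) u) C ∧
      SobolevBound P.T ∞ (fun t => P.emb (affineInterp (P.T / N) u t)) C ∧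
      SobolevBound P.T ℓ₁ (affineInterp (P.T / N) u) C ∧
      SobolevBound P.T ℓ₂ (affineInterp (P.T / N) z) C ∧
      P.VelocityBound (midInterp (P.T / N) v) C ∧
      P.SumBound (fun t => P.kin' (affineInterp (P.T / N) v t)) C ∧
      (P.KinPreserves → P.SumBound (fun t => P.toDual (affineInterp (P.T / N) v t)) C) := by
  have hT := hP.T_pos
  have hM := hs.nonneg
  obtain ⟨K, hK⟩ := hP.exists_kinForm
  obtain ⟨J, hJ⟩ := hK.exists_equiv
  obtain ⟨C₁, hC₁⟩ := exists_sobolevBound_prim (X := U) hT hP.one_le_p₁ hM (norm_nonneg P.u₀)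
  obtain ⟨C₂, hC₂⟩ := exists_sobolevBound_prim (X := H) hT (p := ∞) le_top hM (norm_nonneg (P.emb P.u₀))
  obtain ⟨C₃, hC₃⟩ := exists_sobolevBound_prim (X := Z) hT hP.one_le_p₂ hM (norm_nonneg P.z₀)
  obtain ⟨S, hS⟩ : ∃ S : U ≃L[ℝ] U, P.KinPreserves →
      ∀ x : U, fderiv ℝ P.kin (P.emb x) = innerSL ℝ (P.emb (S x)) := by
    by_cases h : P.KinPreserves
    · obtain ⟨S, hS⟩ := h; exact ⟨S, fun _ => hS⟩
    · exact ⟨ContinuousLinearEquiv.refl ℝ U, fun h' => absurd h' h⟩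
  let w₀ := H♯ (K P.v₀)
  let L : U⋆ →L[ℝ] U⋆ := (compL ℝ U U ℝ).flip (S.symm : U →L[ℝ] U)
  let q := ℓ₁'
  let D : ℝ≥0∞ := μP univ ^ q.toReal⁻¹ * ofReal M
  have hD : D ≠ ∞ := mul_ne_top
    (rpow_ne_top_of_nonneg (by positivity) (measure_ne_top _ _)) ofReal_ne_top
  let M₄ := M + D.toReal + M
  have hM₄ : 0 ≤ M₄ := by have := toReal_nonneg (a := D); positivity
  have hforce : ∀ {N u v z ξ η}, P.IsDiscreteFlow N (a N) (b N) (c N) u v z ξ η →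
      eLpNorm (pc (P.T / N) (fun k => a N k - P.midForce u z k - ξ k)) q μP ≤ ofReal M₄ := by
    intro N u v z ξ η h
    have hb := hs.bounds h
    have m1 := memLp_pc hT h.one_le (a N) q
    have m2 := memLp_pc hT h.one_le (P.midForce u z) q
    have m3 := memLp_pc hT h.one_le ξ q
    have b2 : eLpNorm (pc (P.T / N) (P.midForce u z)) q μP ≤ D :=
      eLpNorm_le_of_ae_bound (ae_μI_of_Ioc fun t ht =>
        forall_pc hT h.one_le (p := fun y => ‖y‖ ≤ M) hb.force_le ht)
    refine (eLpNorm_sub_le (m1.sub m2).1 m3.1 hP.one_le_p₁').trans ?_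
    refine (add_le_add_left (eLpNorm_sub_le m1.1 m2.1 hP.one_le_p₁') _).trans ?_
    rw [ofReal_add (by have := toReal_nonneg (a := D); positivity) hM,
      ofReal_add hM toReal_nonneg, ofReal_toReal hD]
    exact add_le_add (add_le_add hb.a_le b2) hb.ξ_le
  obtain ⟨C₄, hC₄⟩ := exists_sobolevBound_prim (X := U⋆) hT hP.one_le_p₁' hM₄ (le_refl (0 : ℝ))
  obtain ⟨C₅, hC₅⟩ := exists_sobolevBound_prim (X := H) hT (p := 1) le_rfl hM (norm_nonneg w₀)
  obtain ⟨C₆, hC₆⟩ := exists_sobolevBound_prim (X := U⋆) hT hP.one_le_p₁'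
    (by positivity : 0 ≤ ‖L‖ * M₄) (le_refl (0 : ℝ))
  obtain ⟨C₇, hC₇⟩ := exists_sobolevBound_prim (X := H) hT (p := 1) le_rfl
    (by positivity : 0 ≤ ‖(J.symm : H →L[ℝ] H)‖ * M) (norm_nonneg (J.symm w₀))
  let C := C₁ + C₂ + C₃ + (C₄ + C₅) + (C₆ + C₇) + M.toNNReal
  refine ⟨C, fun {N u v z ξ η} h => ?_⟩
  have hb := hs.bounds h
  have hu := fun t ht => affineInterp_eq_prim hT h.one_le u (t := t) ht
  have hz := fun t ht => affineInterp_eq_prim hT h.one_le z (t := t) ht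
  rw [h.u_zero] at hu
  rw [h.z_zero] at hz
  have mu := memLp_pc hT h.one_le (rate (P.T / N) u) ℓ₁
  have mz := memLp_pc hT h.one_le (rate (P.T / N) z) ℓ₂
  obtain ⟨r3, r1⟩ := hC₁ mu hb.du_le le_rfl hu
  obtain ⟨r4, -⟩ := hC₃ mz hb.dz_le le_rfl hz
  have hemb : ∀ᵐ t ∂μP, ‖P.emb (Δ (P.T / N) u t)‖ ≤ M := ae_μI_of_Ioc fun t ht => by
      rw [h.emb_pc_rate hP ht]; exact hb.norm_midInterp_le hP h ht
  have memb := memLp_top_of_bound (P.emb.continuous.comp_aestronglyMeasurable mu.1) M hemb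
  have nemb := eLpNormEssSup_le_of_ae_bound hemb
  rw [← eLpNorm_exponent_top] at nemb
  obtain ⟨r2, -⟩ := hC₂ memb nemb le_rfl (u := fun t => P.emb (affineInterp (P.T / N) u t))
    fun t ht => hu t ht ▸ clm_prim P.emb (mu.integrable hP.one_le_p₁) _ ht
  have hmid : (fun t => P.emb (Δ (P.T / N) u t)) =ᵐ[μP]
      midInterp (P.T / N) v := ae_μI_of_Ioc fun t ht => h.emb_pc_rate hP ht
  have mf := memLp_pc hT h.one_le (fun k => a N k - P.midForce u z k - ξ k) q
  have mb := memLp_pc hT h.one_le (b N) 1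
  have r6 : P.SumBound (fun t => P.kin' (affineInterp (P.T / N) v t)) (C₄ + C₅) := by
    refine ⟨_, _, C₄, C₅, le_rfl, ?_, (hC₄ mf (hforce h) (c := 0) (by simp) fun t ht => rfl).1,
      (hC₅ mb hb.b_le (c := w₀) le_rfl fun t ht => rfl).1⟩
    exact ae_restrict_of_forall_mem measurableSet_Icc fun t ht => h.kin'_affineInterp hP hK ht
  have r7 : P.KinPreserves → P.SumBound (fun t => P.toDual (affineInterp (P.T / N) v t)) (C₆ + C₇) := by
    intro hkp
    have hSx := hS hkp
    have key : ∀ w : H, P.toDual w = L (P.kin' w) := fun w => by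
      ext x
      have e := congrArg (fun φ : H⋆ => φ w) (hSx (S.symm x))
      simp only [ContinuousLinearEquiv.apply_symm_apply] at e
      change ⟪w, P.emb x⟫ = P.kin' w (S.symm x)
      rw [hK.kin'_eq, comp_apply, hK.symm, ← hK.fderiv_eq, e, real_inner_comm]
      rfl
    have key2 : ∀ w : H, L (P.toDual w) = P.toDual (J.symm w) := fun w => by
      rw [key (J.symm w)]
      congr 1
      ext x
      change ⟪w, P.emb x⟫ = _
      rw [hK.kin'_eq, comp_apply, ← hJ, ContinuousLinearEquiv.apply_symm_apply]
    refine ⟨_, _, C₆, C₇, le_rfl, ?_, (hC₆ (L.comp_memLp' mf) (eLpNorm_clm_le L (hforce h)) (c := 0)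
      (by simp) fun t ht => rfl).1, (hC₇ ((J.symm : H →L[ℝ] H).comp_memLp' mb)
      (eLpNorm_clm_le (J.symm : H →L[ℝ] H) hb.b_le) (c := J.symm w₀) le_rfl fun t ht => rfl).1⟩
    refine ae_restrict_of_forall_mem measurableSet_Icc fun t ht => ?_
    change P.toDual (affineInterp (P.T / N) v t) = _
    rw [key (affineInterp (P.T / N) v t), h.kin'_affineInterp hP hK ht, map_add, key2,
      clm_prim L (mf.integrable hP.one_le_p₁') _ ht, map_zero]
    congr 2
    exact clm_prim (J.symm : H →L[ℝ] H) (mb.integrable le_rfl) _ ht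
  have h5 : ofReal M ≤ C := ENNReal.coe_le_coe.2 le_add_self
  refine ⟨r1.mono ?_, r2.mono ?_, r3.mono ?_, r4.mono ?_, ⟨⟨memb.ae_eq hmid, ?_⟩, _, hmid, mu,
    hb.du_le.trans h5⟩, r6.mono ?_, fun hk => (r7 hk).mono ?_⟩
  case refine_5 => exact eLpNorm_congr_ae hmid ▸ nemb.trans h5
  all_goals
    rw [← NNReal.coe_le_coe]
    push_cast [C]
    linarith [C₁.2, C₂.2, C₃.2, C₄.2, C₅.2, C₆.2, C₇.2, M.toNNReal.2]

end Problem

section WeakLimits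

lemma WeakStarTendsto.of_pointwise {C : ℝ} {x : ℕ → ℝ → X} {a : ℝ → X}
    (hx : ∀ n, AEStronglyMeasurable (x n) μT) (hC : ∀ n, ∀ t ∈ Ioc 0 T, ‖x n t‖ ≤ C)
    (h : ∀ t ∈ Ioc 0 T, WeaklyTendsto (fun n => x n t) (a t)) : WeakStarTendsto T 1 x a := by
  intro φ hφ
  have hi := (hφ.integrable le_rfl).norm.mul_const C
  refine tendsto_integral_of_dominated_convergence _ (fun n => ?_) hi (fun n => ?_) ?_
  · exact (ContinuousLinearMap.apply ℝ ℝ : X →L[ℝ] X⋆ →L[ℝ] ℝ).aestronglyMeasurable_comp₂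
      (hx n) hφ.1
  · exact ae_μI_of_Ioc fun t ht => ((φ t).le_opNorm _).trans
      (mul_le_mul_of_nonneg_left (hC n t ht) (norm_nonneg _))
  · exact ae_μI_of_Ioc fun t ht => h t ht (φ t)

lemma WeakStarTendsto.comp_clm 
    {q : ℝ≥0∞} {y : ℕ → ℝ → Y} {b : ℝ → Y} (h : WeakStarTendsto T q y b) (L : X →L[ℝ] Y⋆)
    {d : ℝ → X} (hd : MemLp d q μT) :
    Tendsto (fun n => ∫ t, L (d t) (y n t) ∂μT) atTop (𝓝 (∫ t, L (d t) (b t) ∂μT)) :=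
  h _ (L.comp_memLp' hd)

lemma WeakStarTendsto.eval {q : ℝ≥0∞} {x : ℕ → ℝ → X⋆} {a : ℝ → X⋆}
    (h : WeakStarTendsto T q x a) {d : ℝ → X} (hd : MemLp d q μT) :
    Tendsto (fun n => ∫ t, x n t (d t) ∂μT) atTop (𝓝 (∫ t, a t (d t) ∂μT)) :=
  h.comp_clm (ContinuousLinearMap.apply ℝ ℝ : X →L[ℝ] X⋆ →L[ℝ] ℝ) hd

lemma tendsto_eLpNorm_one {q : ℝ≥0∞} (hq : 1 ≤ q) {f : ℕ → ℝ → X}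
    (hf : ∀ n, AEStronglyMeasurable (f n) μT)
    (h : Tendsto (fun n => eLpNorm (f n) q μT) atTop (𝓝 0)) :
    Tendsto (fun n => eLpNorm (f n) 1 μT) atTop (𝓝 0) := by
  have hfin : (μT univ) ^ (1 / (1 : ℝ≥0∞).toReal - 1 / q.toReal) ≠ ∞ := by
    refine rpow_ne_top_of_nonneg ?_ (measure_ne_top _ _)
    rw [toReal_one, div_one]
    rcases eq_or_ne q ∞ with rfl | hp'
    · simp
    · have : 1 ≤ q.toReal := by
        rw [← toReal_one]; exact toReal_mono hp' hq
      have : 1 / q.toReal ≤ 1 := by rw [div_le_one (by linarith)]; exact this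
      linarith
  have h1 := ENNReal.Tendsto.mul_const h (Or.inr hfin)
  rw [zero_mul] at h1
  exact tendsto_of_tendsto_of_tendsto_of_le_of_le tendsto_const_nhds h1 (fun _ => zero_le)
    fun n => eLpNorm_le_eLpNorm_mul_rpow_measure_univ hq (hf n)

/-- Primitives of a strongly convergent sequence converge. -/
lemma tendsto_prim {q : ℝ≥0∞} (hq : 1 ≤ q) {f : ℕ → ℝ → X} {a : ℝ → X}
    (hf : ∀ n, MemLp (f n) q μT) (ha : MemLp a q μT)
    (h : Tendsto (fun n => eLpNorm (f n - a) q μT) atTop (𝓝 0)) (c : X)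
    (ht : t ∈ IT) : Tendsto (fun n => prim c (f n) t) atTop (𝓝 (prim c a t)) := by
  have h1 := tendsto_eLpNorm_one hq (fun n => ((hf n).sub ha).1) h
  have h2 := (tendsto_toReal zero_ne_top).comp h1
  rw [tendsto_iff_norm_sub_tendsto_zero]
  refine squeeze_zero (fun _ => norm_nonneg _) (fun n => ?_) h2
  have hi := (hf n).integrable hq
  have hia := ha.integrable hq
  have e : prim c (f n) t - prim c a t = prim 0 (f n - a) t := by
    rw [prim, prim, prim, add_sub_add_left_eq_sub, zero_add]
    exact (intervalIntegral.integral_sub (intervalIntegrable_left hi ht)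
      (intervalIntegrable_left hia ht)).symm
  rw [e]
  simpa using norm_prim_le (hi.sub hia) (0 : X) ht

/-- Pairings of a strongly and a weakly convergent sequence converge. -/
lemma tendsto_integral_pairing_of_weakStar {p q : ℝ≥0∞} [HolderTriple q p 1]
    {f : ℕ → ℝ → X⋆} {a : ℝ → X⋆} (hf : ∀ n, MemLp (f n) q μT)
    (ha : MemLp a q μT) (h : Tendsto (fun n => eLpNorm (f n - a) q μT) atTop (𝓝 0))
    {w : ℕ → ℝ → X} {d : ℝ → X} (hw : ∀ n, MemLp (w n) p μT) {C : ℝ≥0}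
    (hC : ∀ n, eLpNorm (w n) p μT ≤ C) (hd : WeakStarTendsto T q w d) :
    Tendsto (fun n => ∫ t, f n t (w n t) ∂μT) atTop (𝓝 (∫ t, a t (d t) ∂μT)) := by
  have h2 := ((tendsto_toReal zero_ne_top).comp h).mul_const (C : ℝ)
  rw [ENNReal.toReal_zero, zero_mul] at h2
  have h3 : Tendsto (fun n => ∫ t, (f n - a) t (w n t) ∂μT) atTop (𝓝 0) := by
    refine squeeze_zero_norm (fun n => ?_) h2
    refine (abs_integral_pairing_le (p := p) ((hf n).sub ha) (hw n)).trans
      (mul_le_mul_of_nonneg_left ?_ toReal_nonneg)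
    exact toReal_mono ENNReal.coe_ne_top (hC n)
  have h4 := h3.add (hd a ha)
  rw [zero_add] at h4
  refine h4.congr fun n => ?_
  rw [← integral_add (integrable_pairing (p := p) ((hf n).sub ha) (hw n))
    (integrable_pairing (p := p) ha (hw n))]
  refine integral_congr_ae (.of_forall fun t => ?_)
  simp only [Pi.sub_apply, sub_apply, sub_add_cancel]

lemma lintegral_add_integral_le_of_subdiff {Ψ : X → ℝ≥0∞} (hl : LowerSemicontinuous Ψ)
    {α : Type*} [MeasurableSpace α] {μ : Measure α} {w y : α → X} {ξ : α → X⋆}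
    (hw : AEStronglyMeasurable w μ) (hy : AEStronglyMeasurable y μ)
    (h : ∀ᵐ t ∂μ, ξ t ∈ subdiff Ψ (w t)) (iw : Integrable (fun t => ξ t (w t)) μ)
    (iy : Integrable (fun t => ξ t (y t)) μ) (hfin : ∫⁻ t, Ψ (y t) ∂μ ≠ ∞) :
    ∫⁻ t, Ψ (w t) ∂μ ≠ ∞ ∧ (∫⁻ t, Ψ (w t) ∂μ).toReal
      ≤ (∫⁻ t, Ψ (y t) ∂μ).toReal + ∫ t, ξ t (w t) ∂μ - ∫ t, ξ t (y t) ∂μ := by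
  have my := aemeasurable_comp_lsc hl hy
  have mw := aemeasurable_comp_lsc hl hw
  have iwy : Integrable (fun t => ξ t (w t) - ξ t (y t)) μ := iw.sub iy
  have hyt := ae_lt_top' my hfin
  have hle : ∀ᵐ t ∂μ, (Ψ (w t)).toReal ≤ (Ψ (y t)).toReal + (ξ t (w t) - ξ t (y t)) := by
    filter_upwards [h, hyt] with t ht hty
    have := (mem_subdiff_iff.1 ht).2 (y t) hty.ne
    rw [map_sub] at this
    linarith
  have hwt : ∀ᵐ t ∂μ, Ψ (w t) < ∞ := by
    filter_upwards [h] with t ht using (mem_subdiff_iff.1 ht).1.lt_top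
  have iΨy := integrable_toReal_of_lintegral_ne_top my hfin
  have hb : ∫⁻ t, Ψ (w t) ∂μ ≠ ∞ := by
    have h1 : ∫⁻ t, Ψ (w t) ∂μ ≤ ∫⁻ t, ofReal ((Ψ (y t)).toReal + (ξ t (w t) - ξ t (y t))) ∂μ := by
      refine lintegral_mono_ae ?_
      filter_upwards [hle, hwt] with t ht hw'
      rw [← ofReal_toReal hw'.ne]
      exact ofReal_le_ofReal ht
    have h2 := (iΨy.add iwy).lintegral_lt_top
    exact (h1.trans_lt h2).ne
  refine ⟨hb, ?_⟩
  rw [← integral_toReal mw hwt, ← integral_toReal my hyt]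
  have := integral_mono_ae (integrable_toReal_of_lintegral_ne_top mw hb) (iΨy.add iwy) hle
  refine this.trans (le_of_eq ?_)
  rw [integral_add' iΨy iwy, integral_sub iw iy]
  ring

lemma toReal_le_of_le_liminf {S : ℝ≥0∞} {s : ℕ → ℝ≥0∞} (hS : S ≤ liminf s atTop) {r : ℕ → ℝ}
    {R : ℝ} (hs : ∀ n, s n ≠ ∞) (hr : ∀ n, (s n).toReal ≤ r n)
    (hR : ∀ ε : ℝ, 0 < ε → ∀ᶠ n in atTop, r n ≤ R + ε) : S ≠ ∞ ∧ S.toReal ≤ R := by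
  have key : ∀ ε : ℝ, 0 < ε → 0 ≤ R + ε ∧ S ≤ ofReal (R + ε) := by
    intro ε hε
    have h1 := hR ε hε
    obtain ⟨n, hn⟩ := h1.exists
    refine ⟨toReal_nonneg.trans ((hr n).trans hn), hS.trans ?_⟩
    refine liminf_le_of_frequently_le' (Eventually.frequently ?_)
    filter_upwards [h1] with n hn
    rw [← ofReal_toReal (hs n)]
    exact ofReal_le_ofReal ((hr n).trans hn)
  refine ⟨ne_top_of_le_ne_top ofReal_ne_top (key 1 one_pos).2, ?_⟩
  refine le_of_forall_pos_le_add fun ε hε => ?_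
  obtain ⟨h1, h2⟩ := key ε hε
  exact (ENNReal.toReal_le_toReal (ne_top_of_le_ne_top ofReal_ne_top h2)
    ofReal_ne_top).2 h2 |>.trans (toReal_ofReal h1).le

end WeakLimits

section Interpolants

lemma affineInterp_eq {τ : ℝ} (hτ : 0 < τ) (x : ℕ → X) {k : ℕ}
    (ht : t ∈ Ioc (k * τ) ((k + 1) * τ)) (hc : ⌈t / τ⌉₊ = k + 1) :
    ∃ θ : ℝ, 0 ≤ θ ∧ θ ≤ 1 ∧ θ = (t - k * τ) / τ ∧
      affineInterp τ x t = x k + θ • (x (k + 1) - x k) := by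
  refine ⟨(t - k * τ) / τ, div_nonneg (by linarith [ht.1]) hτ.le, ?_, rfl, ?_⟩
  · rw [div_le_one hτ]; linarith [ht.2]
  · rw [affineInterp, hc, Nat.add_sub_cancel]
    have e : (((k + 1 : ℕ) : ℝ) * τ - t) / τ = 1 - (t - k * τ) / τ := by
      push_cast; field_simp; ring
    have e2 : (t - (((k + 1 : ℕ) : ℝ) - 1) * τ) / τ = (t - k * τ) / τ := by push_cast; ring
    rw [e, e2]
    module

lemma norm_affineInterp_le (hT : 0 < T) (hN : 1 ≤ N) {x : ℕ → X} {M : ℝ}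
    (hM : ∀ k ≤ N, ‖x k‖ ≤ M) (ht : t ∈ Ioc 0 T) : ‖affineInterp (T / N) x t‖ ≤ M := by
  have hτ : 0 < T / N := div_pos hT (by exact_mod_cast hN)
  obtain ⟨k, hk, hkt, hc⟩ := exists_cell hT hN ht
  obtain ⟨θ, h0, h1, -, he⟩ := affineInterp_eq hτ x hkt hc
  have e : x k + θ • (x (k + 1) - x k) = (1 - θ) • x k + θ • x (k + 1) := by module
  rw [he, e]
  refine (norm_add_le _ _).trans ?_
  rw [norm_smul, norm_smul, norm_of_nonneg h0, norm_of_nonneg (by linarith)]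
  have h2 := mul_le_mul_of_nonneg_left (hM k (by omega)) (by linarith : 0 ≤ 1 - θ)
  have h3 := mul_le_mul_of_nonneg_left (hM (k + 1) (by omega)) h0
  linarith

lemma norm_increment_le (hT : 0 < T) (hN : 1 ≤ N) {x : ℕ → X} {p M : ℝ} (hp : 1 < p) (hM : 0 ≤ M)
    (h : eLpNorm (Δ (T / N) x) (ofReal p) μT ≤ ofReal M)
    {k : ℕ} (hk : k < N) : ‖x (k + 1) - x k‖ ≤ M * (T / N) ^ (1 - 1 / p) := by
  have hτ : 0 < T / N := div_pos hT (by exact_mod_cast hN)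
  have hp0 : 0 < p := by linarith
  have h1 := sum_pc_le hT hN hp.le hM h
  have h2 : T / N * ‖rate (T / N) x (k + 1)‖ ^ p ≤ M ^ p :=
    (Finset.single_le_sum (f := fun k : ℕ => T / N * ‖rate (T / N) x (k + 1)‖ ^ p)
      (fun i _ => by positivity) (Finset.mem_range.2 hk)).trans h1
  have e : ‖x (k + 1) - x k‖ = T / N * ‖rate (T / N) x (k + 1)‖ := by
    rw [rate, Nat.add_sub_cancel, norm_smul, norm_inv, norm_of_nonneg hτ.le]
    field_simp
  have h3 : ((T / N) ^ (1 / p) * ‖rate (T / N) x (k + 1)‖) ≤ M := by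
    refine (Real.rpow_le_rpow_iff (by positivity) hM hp0).1 ?_
    rw [mul_rpow (by positivity) (norm_nonneg _), ← Real.rpow_mul hτ.le,
      one_div_mul_cancel hp0.ne', Real.rpow_one]
    exact h2
  have e2 : T / N = (T / N) ^ (1 - 1 / p) * (T / N) ^ (1 / p) := by
    rw [← Real.rpow_add hτ]; simp
  rw [e]
  calc T / N * ‖rate (T / N) x (k + 1)‖
      = (T / N) ^ (1 - 1 / p) * ((T / N) ^ (1 / p) * ‖rate (T / N) x (k + 1)‖) := by
        rw [← mul_assoc, ← e2]
    _ ≤ (T / N) ^ (1 - 1 / p) * M := mul_le_mul_of_nonneg_left h3 (by positivity)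
    _ = _ := mul_comm _ _

lemma tendsto_step {N : ℕ → ℕ} (hN : Tendsto N atTop atTop) :
    Tendsto (fun j => T / N j) atTop (𝓝 0) :=
  tendsto_const_nhds.div_atTop (tendsto_natCast_atTop_atTop.comp hN)

/-- The piecewise constant interpolants share the pointwise weak limits of the affine ones. -/
lemma weaklyTendsto_pc (hT : 0 < T) {N : ℕ → ℕ} (hN1 : ∀ j, 1 ≤ N j)
    (hN : Tendsto N atTop atTop) {x : ℕ → ℕ → X} {p M : ℝ} (hp : 1 < p) (hM : 0 ≤ M)
    (h : ∀ j, eLpNorm (Δ (T / N j) (x j)) (ofReal p) μT ≤ ofReal M) {a : X} (ht : t ∈ Ioc 0 T)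
    (ha : WeaklyTendsto (fun j => affineInterp (T / N j) (x j) t) a) :
    WeaklyTendsto (fun j => x j ⌈t / (T / N j)⌉₊) a ∧
    WeaklyTendsto (fun j => x j (⌈t / (T / N j)⌉₊ - 1)) a ∧
    WeaklyTendsto (fun j => midInterp (T / N j) (x j) t) a := by
  have hexp : (0 : ℝ) < 1 - 1 / p := by
    have : 1 / p < 1 := by rw [div_lt_one (by linarith)]; exact hp
    linarith
  have hlim : Tendsto (fun j => M * (T / N j) ^ (1 - 1 / p)) atTop (𝓝 0) := by
    have := ((Real.continuousAt_rpow_const 0 (1 - 1 / p) (Or.inr hexp.le)).tendsto.comp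
      (tendsto_step (T := T) hN)).const_mul M
    rwa [Real.zero_rpow hexp.ne', mul_zero] at this
  have key : ∀ j, ‖x j ⌈t / (T / N j)⌉₊ - affineInterp (T / N j) (x j) t‖ ≤ M * (T / N j) ^ (1 - 1 / p) ∧
      ‖x j (⌈t / (T / N j)⌉₊ - 1) - affineInterp (T / N j) (x j) t‖ ≤ M * (T / N j) ^ (1 - 1 / p) := by
    intro j
    have hτ : 0 < T / N j := div_pos hT (by exact_mod_cast hN1 j)
    obtain ⟨k, hk, hkt, hc⟩ := exists_cell hT (hN1 j) ht
    obtain ⟨θ, h0, h1, -, he⟩ := affineInterp_eq hτ (x j) hkt hc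
    have hi := norm_increment_le hT (hN1 j) hp hM (h j) hk
    rw [hc, Nat.add_sub_cancel, he]
    have e1 : x j (k + 1) - (x j k + θ • (x j (k + 1) - x j k))
      = (1 - θ) • (x j (k + 1) - x j k) := by module
    have e2 : x j k - (x j k + θ • (x j (k + 1) - x j k)) = (-θ) • (x j (k + 1) - x j k) := by module
    rw [e1, e2, norm_smul, norm_smul, norm_neg, norm_of_nonneg h0, norm_of_nonneg (by linarith)]
    have hn := norm_nonneg (x j (k + 1) - x j k)
    constructor <;> nlinarith
  have w1 := ha.of_sub (squeeze_zero (fun _ => norm_nonneg _) (fun j => (key j).1) hlim)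
  have w2 := ha.of_sub (squeeze_zero (fun _ => norm_nonneg _) (fun j => (key j).2) hlim)
  refine ⟨w1, w2, ?_⟩
  have w3 := (w1.add w2).smul (1 / 2 : ℝ)
  have e : (1 / 2 : ℝ) • (a + a) = a := by module
  rwa [e] at w3

/-- The midpoint and the affine interpolants have the same integral over every time step. -/
lemma integral_midInterp_sub_cell {τ : ℝ} (hτ : 0 < τ) (x : ℕ → X) (k : ℕ)
    (ht : t ∈ Icc (k * τ) ((k + 1) * τ)) :
    IntervalIntegrable (fun s => midInterp τ x s - affineInterp τ x s) volume (k * τ) t ∧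
    ∫ s in (k * τ)..t, (midInterp τ x s - affineInterp τ x s)
      = ((t - k * τ) * ((k + 1) * τ - t) / 2) • rate τ x (k + 1) := by
  have e : ∀ s ∈ Ioc (k * τ) t, ((k + 1 / 2) * τ - s) • rate τ x (k + 1)
      = midInterp τ x s - affineInterp τ x s := by
    intro s hs
    have hs' : s ∈ Ioc (k * τ) ((k + 1) * τ) := ⟨hs.1, hs.2.trans ht.2⟩
    have hc : ⌈s / τ⌉₊ = k + 1 := by
      rw [Nat.ceil_eq_iff (by omega)]
      push_cast
      rw [lt_div_iff₀ hτ, div_le_iff₀ hτ]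
      exact hs'
    obtain ⟨θ, -, -, hθ, he⟩ := affineInterp_eq hτ x hs' hc
    rw [he, midInterp, hc, Nat.add_sub_cancel, rate, Nat.add_sub_cancel, hθ, smul_smul]
    have : ((k + 1 / 2) * τ - s) * τ⁻¹ = 1 / 2 - (s - k * τ) / τ := by field_simp; ring
    rw [this]
    module
  have hi : IntervalIntegrable (fun s => ((k + 1 / 2) * τ - s) • rate τ x (k + 1)) volume (k * τ) t :=
    Continuous.intervalIntegrable (by fun_prop) _ _
  refine ⟨hi.congr fun s hs => e s (by rwa [uIoc_of_le ht.1] at hs), ?_⟩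
  rw [← intervalIntegral.integral_congr_ae (.of_forall fun s hs => e s
      (by rwa [uIoc_of_le ht.1] at hs)), intervalIntegral.integral_smul_const]
  congr 1
  rw [intervalIntegral.integral_sub (by simp) (by simp), intervalIntegral.integral_const, integral_id,
    smul_eq_mul]
  ring

lemma norm_integral_midInterp_sub_le (hT : 0 < T) (hN : 1 ≤ N)
    {x : ℕ → X} {M : ℝ} (hM : ∀ k ≤ N, ‖x k‖ ≤ M) (ht : t ∈ Ioc 0 T) :
    ‖∫ s in 0..t, (midInterp (T / N) x s - affineInterp (T / N) x s)‖ ≤ M * (T / N) := by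
  have hτ : 0 < T / N := div_pos hT (by exact_mod_cast hN)
  set τ := T / N
  have hsum : ∀ m : ℕ,
      IntervalIntegrable (fun s => midInterp τ x s - affineInterp τ x s) volume 0 (m * τ) ∧
      ∫ s in 0..(m * τ), (midInterp τ x s - affineInterp τ x s) = 0 := by
    intro m
    induction m with
    | zero => simp
    | succ m ih =>
      have hle : (m : ℝ) * τ ≤ (m + 1) * τ := by nlinarith
      obtain ⟨h1, h2⟩ := integral_midInterp_sub_cell hτ x m (right_mem_Icc.2 hle)
      push_cast
      refine ⟨ih.1.trans h1, ?_⟩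
      rw [← integral_add_adjacent_intervals ih.1 h1, ih.2, h2]
      simp
  obtain ⟨k, hk, hkt, -⟩ := exists_cell hT hN ht
  obtain ⟨h1, h2⟩ := integral_midInterp_sub_cell hτ x k ⟨hkt.1.le, hkt.2⟩
  rw [← integral_add_adjacent_intervals (hsum k).1 h1, (hsum k).2, h2, zero_add,
    rate, Nat.add_sub_cancel, smul_smul, norm_smul]
  have h3 : ‖x (k + 1) - x k‖ ≤ 2 * M := by
    linarith [norm_sub_le (x (k + 1)) (x k), hM (k + 1) (by omega), hM k (by omega)]
  have h4 : 0 ≤ (t - k * τ) := by linarith [hkt.1]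
  have h5 : 0 ≤ ((k + 1) * τ - t) := by linarith [hkt.2]
  have h6 : (t - k * τ) * ((k + 1) * τ - t) / 2 * τ⁻¹ ≤ τ / 2 := by
    rw [← div_eq_mul_inv, div_le_iff₀ hτ]
    nlinarith
  rw [norm_of_nonneg (by positivity)]
  calc _ ≤ τ / 2 * (2 * M) := mul_le_mul h6 h3 (norm_nonneg _) (by positivity)
    _ = M * τ := by ring

end Interpolants

lemma conjExp_conjExp {p : ℝ} (hp : 1 < p) : conjExp (conjExp p) = p := by
  have : p - 1 ≠ 0 := by linarith
  unfold conjExp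
  have e : p / (p - 1) - 1 = 1 / (p - 1) := by field_simp; ring
  rw [e]
  field_simp

lemma weaklyTendsto_affineInterp (hT : 0 < T) {N : ℕ → ℕ} (hN1 : ∀ j, 1 ≤ N j) {q : ℝ≥0∞}
    {x : ℕ → ℕ → X} {w : ℝ → X}
    (h : WeakStarTendsto T q (fun j => Δ (T / N j) (x j)) w)
    (hw : Integrable w μT) {c : X} (h0 : ∀ j, x j 0 = c) (ht : t ∈ IT) :
    WeaklyTendsto (fun j => affineInterp (T / N j) (x j) t) (prim c w t) := by
  have h1 := (weaklyTendsto_const c).add ((h.mono le_top).weakly_primitive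
    (fun j => integrable_pc hT (hN1 j) _) hw ht)
  have e : (fun j => affineInterp (T / N j) (x j) t)
      = fun j => c + ∫ s in 0..t, Δ (T / N j) (x j) s := by
    ext j
    rw [affineInterp_eq_prim hT (hN1 j) (x j) ht, h0, prim]
  rw [e]
  exact h1

/-- If the primitive of an integrable function is weakly the primitive of a weakly continuous one,
then the two functions agree almost everywhere. -/
lemma ae_eq_of_integral_inner_eq {e w : ℝ → H} (he : Integrable e μT)
    (hw : ∀ h : H, ContinuousOn (fun t => ⟪h, w t⟫) IT)
    (heq : ∀ t ∈ IT, ∀ h : H, ⟪h, ∫ s in 0..t, e s⟫ = ∫ s in 0..t, ⟪h, w s⟫) :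
    ∀ᵐ t ∂μT, e t = w t := by
  rcases lt_or_ge T 0 with hT | hT
  · rw [μI, Icc_eq_empty (not_le.2 hT), Measure.restrict_empty]; exact ae_zero ▸ trivial
  rw [ae_μI_iff]
  filter_upwards [(intervalIntegrable_left he ⟨hT, le_rfl⟩).ae_hasDerivAt_integral] with t ht h0
  have hIcc := Ioo_subset_Icc_self h0
  have h1 := ht (by rwa [uIcc_of_le hT]) 0 left_mem_uIcc
  refine ext_inner_left ℝ fun h => ?_
  have h2 : HasDerivAt (fun t => ⟪h, ∫ s in 0..t, e s⟫) ⟪h, e t⟫ t := by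
    have := (innerSL ℝ h : H⋆).hasFDerivAt.comp_hasDerivAt t h1
    exact this
  have hc := hw h
  have h3 : HasDerivAt (fun t => ∫ s in 0..t, ⟪h, w s⟫) ⟪h, w t⟫ t :=
    intervalIntegral.integral_hasDerivAt_right
      (intervalIntegrable_left (integrable_of_continuousOn hc) hIcc)
      ((hc.mono Ioo_subset_Icc_self).stronglyMeasurableAtFilter isOpen_Ioo t h0)
      (hc.continuousAt (Icc_mem_nhds h0.1 h0.2))
  refine h2.unique (h3.congr_of_eventuallyEq ?_)
  filter_upwards [isOpen_Ioo.mem_nhds h0] with s hs using heq s (Ioo_subset_Icc_self hs) h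

lemma liminf_add_liminf_le (α β : ℕ → ℝ≥0∞) :
    liminf α atTop + liminf β atTop ≤ liminf (fun n => α n + β n) atTop := by
  rw [liminf_eq_iSup_iInf_of_nat, liminf_eq_iSup_iInf_of_nat, liminf_eq_iSup_iInf_of_nat,
    ENNReal.iSup_add_iSup_of_monotone]
  · exact iSup_mono fun n => le_iInf₂ fun i hi => add_le_add (iInf₂_le i hi) (iInf₂_le i hi)
  · exact fun m n hmn => le_iInf₂ fun i hi => iInf₂_le i (hmn.trans hi)
  · exact fun m n hmn => le_iInf₂ fun i hi => iInf₂_le i (hmn.trans hi)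

lemma add_toReal_le_of_le_liminf {A B : ℝ≥0∞} {α β : ℕ → ℝ≥0∞} (hA : A ≤ liminf α atTop)
    (hB : B ≤ liminf β atTop) (hα : ∀ n, α n ≠ ∞) (hβ : ∀ n, β n ≠ ∞) {r : ℕ → ℝ} {R : ℝ}
    (hr : ∀ n, (α n).toReal + (β n).toReal ≤ r n)
    (hR : ∀ ε : ℝ, 0 < ε → ∀ᶠ n in atTop, r n ≤ R + ε) :
    A ≠ ∞ ∧ B ≠ ∞ ∧ A.toReal + B.toReal ≤ R := by
  have h1 : A + B ≤ liminf (fun n => α n + β n) atTop := (add_le_add hA hB).trans (liminf_add_liminf_le α β)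
  obtain ⟨h2, h3⟩ := toReal_le_of_le_liminf h1 (fun n => add_ne_top.2 ⟨hα n, hβ n⟩)
    (fun n => by rw [toReal_add (hα n) (hβ n)]; exact hr n) hR
  obtain ⟨h4, h5⟩ := add_ne_top.1 h2
  exact ⟨h4, h5, by rwa [toReal_add h4 h5] at h3⟩

lemma limsup_le_of_add_toReal_le {A B : ℝ≥0∞} {α β : ℕ → ℝ≥0∞} (hA : A ≠ ∞) (hB' : B ≠ ∞)
    (hB : B ≤ liminf β atTop) (hα : ∀ n, α n ≠ ∞) (hβ : ∀ n, β n ≠ ∞) {r : ℕ → ℝ}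
    (hr : ∀ n, (α n).toReal + (β n).toReal ≤ r n)
    (hR : ∀ ε : ℝ, 0 < ε → ∀ᶠ n in atTop, r n ≤ A.toReal + B.toReal + ε) :
    limsup α atTop ≤ A := by
  refine ENNReal.le_of_forall_pos_le_add fun ε hε _ => ?_
  have hε' : (0 : ℝ) < ε / 2 := by positivity
  have hBev : ∀ᶠ n in atTop, B.toReal - ε / 2 ≤ (β n).toReal := by
    rcases eq_or_ne B 0 with rfl | h0
    · exact .of_forall fun n => by
        rw [ENNReal.toReal_zero]; linarith [toReal_nonneg (a := β n)]
    · have hlt : B - ofReal (ε / 2) < B := ENNReal.sub_lt_self hB' h0 (by simpa using hε')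
      filter_upwards [eventually_lt_of_lt_liminf (hlt.trans_le hB)] with n hn
      have h1 := tsub_le_iff_right.1 hn.le
      have h2 := toReal_mono (add_ne_top.2 ⟨hβ n, ofReal_ne_top⟩) h1
      rw [toReal_add (hβ n) ofReal_ne_top, toReal_ofReal hε'.le] at h2
      linarith
  refine limsup_le_of_le (by isBoundedDefault) ?_
  filter_upwards [hBev, hR (ε / 2) hε'] with n h1 h2
  have h3 : (α n).toReal ≤ A.toReal + ε := by linarith [hr n]
  rw [← ofReal_toReal (hα n)]
  refine (ofReal_le_ofReal h3).trans ?_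
  rw [ofReal_add toReal_nonneg ε.coe_nonneg, ofReal_toReal hA, ENNReal.ofReal_coe_nnreal]

lemma WeakStarTendsto.congr
    {q : ℝ≥0∞} {x x' : ℕ → ℝ → X} {a a' : ℝ → X} (h : WeakStarTendsto T q x a)
    (hx : ∀ n, x n =ᵐ[μT] x' n) (ha : a =ᵐ[μT] a') : WeakStarTendsto T q x' a' := by
  intro φ hφ
  have h1 := h φ hφ
  rw [integral_congr_ae (ha.mono fun t ht => by simp only [ht] :
    (fun t => φ t (a t)) =ᵐ[μT] fun t => φ t (a' t))] at h1
  exact h1.congr fun n => integral_congr_ae ((hx n).mono fun t ht => by simp only [ht])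

lemma affineInterp_right
    (hT : 0 < T) (hN : 1 ≤ N) (x : ℕ → X) : affineInterp (T / N) x T = x N := by
  have hN0 : (N : ℝ) ≠ 0 := by positivity
  have e : T / (T / N) = N := by field_simp
  rw [affineInterp, e, Nat.ceil_natCast]
  have e1 : (T - ((N : ℝ) - 1) * (T / N)) / (T / N) = 1 := by field_simp; ring
  have e2 : ((N : ℝ) * (T / N) - T) / (T / N) = 0 := by field_simp; ring
  rw [e1, e2, one_smul, zero_smul, add_zero]

namespace Problem

variable (P) in
/-- A sequence of discrete flows with time steps tending to zero. -/
structure IsApprox (a : ℕ → ℕ → U⋆) (b : ℕ → ℕ → H)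
    (c : ℕ → ℕ → Z⋆) (N : ℕ → ℕ) (u : ℕ → ℕ → U) (v : ℕ → ℕ → H) (z : ℕ → ℕ → Z)
    (ξ : ℕ → ℕ → U⋆) (η : ℕ → ℕ → Z⋆) : Prop where
  tendsto : Tendsto N atTop atTop
  flow : ∀ j, P.IsDiscreteFlow (N j) (a (N j)) (b (N j)) (c (N j)) (u j) (v j) (z j) (ξ j) (η j)

variable (P) in
/-- Weak limits of the rates and of the viscous forces of a sequence of discrete flows. -/
structure IsWeakLimit (N : ℕ → ℕ) (u : ℕ → ℕ → U) (z : ℕ → ℕ → Z)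
    (ξ : ℕ → ℕ → U⋆) (du : ℝ → U) (dz : ℝ → Z) (ξ' : ℝ → U⋆) : Prop where
  du_mem : MemLp du ℓ₁ μP
  dz_mem : MemLp dz ℓ₂ μP
  ξ_mem : MemLp ξ' ℓ₁' μP
  du_tendsto : WeakStarTendsto P.T ℓ₁' (fun j => Δ (P.T / N j) (u j)) du
  dz_tendsto : WeakStarTendsto P.T ℓ₂' (fun j => Δ (P.T / N j) (z j)) dz
  ξ_tendsto : WeakStarTendsto P.T ℓ₁ (fun j => pc (P.T / N j) (ξ j)) ξ'

include hP

/-- Convergence of the momenta against `U` entails weak convergence of the velocities. -/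
lemma IsKinForm.tendsto_inner (hK : P.IsKinForm K)
    {ι : Type*} {l : Filter ι} {w : ι → H} {w₀ : H} {M : ℝ} (hM : ∀ᶠ i in l, ‖w i‖ ≤ M)
    (h : ∀ x : U, Tendsto (fun i => K (w i) (P.emb x)) l (𝓝 (K w₀ (P.emb x)))) (y : H) :
    Tendsto (fun i => ⟪y, w i⟫) l (𝓝 ⟪y, w₀⟫) := by
  obtain ⟨J, hJ⟩ := hK.exists_equiv
  have e : ∀ x : H, ⟪y, x⟫ = K x (J.symm y) := fun x => by
    rw [hK.symm, ← hJ, ContinuousLinearEquiv.apply_symm_apply]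
  simp only [e]
  generalize J.symm y = y'
  rw [Metric.tendsto_nhds]
  intro ε hε
  set B := ‖K‖ * (|M| + ‖w₀‖) + 1 with hB
  have hB0 : 0 < B := by positivity
  obtain ⟨x, hx⟩ := hP.emb_dense.exists_dist_lt y' (show 0 < ε / (3 * B) by positivity)
  rw [dist_eq_norm] at hx
  have hop : ∀ x' : H, ‖x'‖ ≤ |M| + ‖w₀‖ → |K x' (y' - P.emb x)| ≤ ε / 3 := fun x' hx' => by
    have h1 := K.le_opNorm₂ x' (y' - P.emb x)
    have h2 : ‖K‖ * ‖x'‖ ≤ B := by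
      have := mul_le_mul_of_nonneg_left hx' (norm_nonneg K); linarith
    rw [Real.norm_eq_abs] at h1
    calc _ ≤ B * (ε / (3 * B)) := h1.trans (mul_le_mul h2 hx.le (norm_nonneg _) hB0.le)
      _ = ε / 3 := by field_simp
  filter_upwards [hM, (Metric.tendsto_nhds.1 (h x)) (ε / 3) (by positivity)] with i h1 h2
  have h3 := hop (w i) (by linarith [le_abs_self M, norm_nonneg w₀])
  have h4 := hop w₀ (by linarith [abs_nonneg M])
  rw [Real.dist_eq] at h2 ⊢
  have e : K (w i) y' - K w₀ y' = K (w i) (y' - P.emb x) + (K (w i) (P.emb x) - K w₀ (P.emb x))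
      - K w₀ (y' - P.emb x) := by rw [map_sub, map_sub]; ring
  rw [e]
  have h6 : |K (w i) (P.emb x) - K w₀ (P.emb x)| < ε / 3 := h2
  have h7 := abs_lt.1 h6
  have h8 := abs_le.1 h3
  have h9 := abs_le.1 h4
  rw [abs_lt]
  constructor <;> linarith

section Limit

variable {a : ℕ → ℕ → U⋆} {b : ℕ → ℕ → H} {c : ℕ → ℕ → Z⋆} {M : ℝ} {N : ℕ → ℕ} {u : ℕ → ℕ → U}
  {v : ℕ → ℕ → H} {z : ℕ → ℕ → Z} {ξ : ℕ → ℕ → U⋆} {η : ℕ → ℕ → Z⋆} {du : ℝ → U} {dz : ℝ → Z}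
  {ξ' : ℝ → U⋆} {w : ℝ → H}

local notation:max "δ" j:max => P.T / (N j : ℝ)
local notation "û" => prim P.u₀ du
local notation "ẑ" => prim P.z₀ dz

omit hP in
lemma IsApprox.comp (h : P.IsApprox a b c N u v z ξ η) {φ : ℕ → ℕ} (hφ : Tendsto φ atTop atTop) :
    P.IsApprox a b c (N ∘ φ) (u ∘ φ) (v ∘ φ) (z ∘ φ) (ξ ∘ φ) (η ∘ φ) :=
  ⟨h.tendsto.comp hφ, fun j => h.flow (φ j)⟩

lemma IsApprox.exists_weakLimit (hs : P.IsSetup f₁ f₂ a b c M)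
    (h : P.IsApprox a b c N u v z ξ η) : ∃ φ : ℕ → ℕ, StrictMono φ ∧ ∃ du dz ξ',
      P.IsWeakLimit (N ∘ φ) (u ∘ φ) (z ∘ φ) (ξ ∘ φ) du dz ξ' := by
  have hT := hP.T_pos
  obtain ⟨φ₁, m₁, du, hdu, cdu⟩ := hP.hilbertizable_U.exists_subseq_weakStar hP.one_lt_p₁ hT
    (w := fun j => Δ δ j (u j)) (C := M.toNNReal)
    (fun j => memLp_pc hT (h.flow j).one_le _ _) (fun j => (hs.bounds (h.flow j)).du_le)
  obtain ⟨φ₂, m₂, dz, hdz, cdz⟩ := hP.hilbertizable_Z.exists_subseq_weakStar hP.one_lt_p₂ hT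
    (w := fun j => pc (P.T / N (φ₁ j)) (rate (P.T / N (φ₁ j)) (z (φ₁ j)))) (C := M.toNNReal)
    (fun j => memLp_pc hT (h.flow (φ₁ j)).one_le _ _) (fun j => (hs.bounds (h.flow (φ₁ j))).dz_le)
  obtain ⟨φ₃, m₃, ξ', hξ, cξ⟩ := hP.hilbertizable_U.dual.exists_subseq_weakStar
    (one_lt_conjExp hP.one_lt_p₁) hT
    (w := fun j => pc (P.T / N (φ₁ (φ₂ j))) (ξ (φ₁ (φ₂ j)))) (C := M.toNNReal)
    (fun j => memLp_pc hT (h.flow (φ₁ (φ₂ j))).one_le _ _)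
    (fun j => (hs.bounds (h.flow (φ₁ (φ₂ j)))).ξ_le)
  rw [conjExp_conjExp hP.one_lt_p₁] at cξ
  exact ⟨φ₁ ∘ φ₂ ∘ φ₃, m₁.comp (m₂.comp m₃), du, dz, ξ', hdu, hdz, hξ,
    cdu.comp (m₂.comp m₃).tendsto_atTop, cdz.comp m₃.tendsto_atTop, cξ⟩

lemma IsApprox.midInterp_weakStar (hs : P.IsSetup f₁ f₂ a b c M)
    (h : P.IsApprox a b c N u v z ξ η) (hdu : WeakStarTendsto P.T ℓ₁'
      (fun j => Δ δ j (u j)) du) (hw : MemLp w ∞ μP)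
    (he : ∀ᵐ t ∂μP, P.emb (du t) = w t) :
    WeakStarTendsto P.T 1 (fun j => midInterp δ j (v j)) w := by
  have hT := hP.T_pos
  have hmid : ∀ j, (fun t => P.emb (Δ δ j (u j) t)) =ᵐ[μP]
      midInterp δ j (v j) := fun j =>
    ae_μI_of_Ioc fun t ht => (h.flow j).emb_pc_rate hP ht
  have hb : ∀ j, ∀ᵐ t ∂μP, ‖midInterp δ j (v j) t‖ ≤ M := fun j =>
    ae_μI_of_Ioc fun t ht => (hs.bounds (h.flow j)).norm_midInterp_le hP (h.flow j) ht
  have hm : ∀ j, AEStronglyMeasurable (midInterp δ j (v j)) μP := fun j =>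
    (P.emb.continuous.comp_aestronglyMeasurable (memLp_pc hT (h.flow j).one_le _ 1).1).congr (hmid j)
  refine WeakStarTendsto.of_bounded (p := ∞) one_ne_top (C := M.toNNReal)
    (fun j => memLp_top_of_bound (hm j) M (hb j)) (fun j => ?_) hw
    (((hdu.mono le_top).clm P.emb).congr hmid he)
  rw [eLpNorm_exponent_top]
  exact eLpNormEssSup_le_of_ae_bound (hb j)

namespace IsWeakLimit

variable (hK : P.IsKinForm K) (hs : P.IsSetup f₁ f₂ a b c M)
  (h : P.IsApprox a b c N u v z ξ η) (hl : P.IsWeakLimit N u z ξ du dz ξ')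

include hs h hl

lemma u_tendsto (ht : t ∈ IP) :
    WeaklyTendsto (fun j => affineInterp δ j (u j) t) (û t) :=
  weaklyTendsto_affineInterp hP.T_pos (fun j => (h.flow j).one_le) hl.du_tendsto
    (hl.du_mem.integrable hP.one_le_p₁) (fun j => (h.flow j).u_zero) ht

lemma z_tendsto (ht : t ∈ IP) :
    WeaklyTendsto (fun j => affineInterp δ j (z j) t) (ẑ t) :=
  weaklyTendsto_affineInterp hP.T_pos (fun j => (h.flow j).one_le) hl.dz_tendsto
    (hl.dz_mem.integrable hP.one_le_p₂) (fun j => (h.flow j).z_zero) ht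

lemma u_pc (ht : t ∈ Ioc 0 P.T) :
    WeaklyTendsto (fun j => u j ⌈t / δ j⌉₊) (û t) ∧
    WeaklyTendsto (fun j => u j (⌈t / δ j⌉₊ - 1)) (û t) ∧
    WeaklyTendsto (fun j => midInterp δ j (u j) t) (û t) :=
  weaklyTendsto_pc hP.T_pos (fun j => (h.flow j).one_le) h.tendsto hP.one_lt_p₁ hs.nonneg
    (fun j => (hs.bounds (h.flow j)).du_le) ht (u_tendsto hP hs h hl (Ioc_subset_Icc_self ht))

lemma z_pc (ht : t ∈ Ioc 0 P.T) :
    WeaklyTendsto (fun j => z j ⌈t / δ j⌉₊) (ẑ t) ∧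
    WeaklyTendsto (fun j => z j (⌈t / δ j⌉₊ - 1)) (ẑ t) ∧
    WeaklyTendsto (fun j => midInterp δ j (z j) t) (ẑ t) :=
  weaklyTendsto_pc hP.T_pos (fun j => (h.flow j).one_le) h.tendsto hP.one_lt_p₂ hs.nonneg
    (fun j => (hs.bounds (h.flow j)).dz_le) ht (z_tendsto hP hs h hl (Ioc_subset_Icc_self ht))

lemma midForce_tendsto (ht : t ∈ Ioc 0 P.T) :
    WeaklyTendsto (fun j => pc δ j (P.midForce (u j) (z j)) t) (P.dΦu (û t) (ẑ t)) :=
  hP.dΦu_weakly_cont _ _ _ _ (u_pc hP hs h hl ht).2.2 (z_pc hP hs h hl ht).2.1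

lemma midForceZ_tendsto (ht : t ∈ Ioc 0 P.T) :
    WeaklyTendsto (fun j => pc δ j (P.midForceZ (u j) (z j)) t) (P.dΦz (û t) (ẑ t)) :=
  hP.dΦz_weakly_cont _ _ _ _ (u_pc hP hs h hl ht).1 (z_pc hP hs h hl ht).2.2

lemma midForce_weakStar : WeakStarTendsto P.T 1 (fun j => pc δ j (P.midForce (u j) (z j)))
    (fun t => P.dΦu (û t) (ẑ t)) :=
  WeakStarTendsto.of_pointwise (C := M) (fun j => (memLp_pc hP.T_pos (h.flow j).one_le _ 1).1)
    (fun j _ ht => forall_pc (p := fun y => ‖y‖ ≤ M) hP.T_pos (h.flow j).one_le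
      (hs.bounds (h.flow j)).force_le ht)
    (fun _ ht => midForce_tendsto hP hs h hl ht)

lemma midForceZ_weakStar : WeakStarTendsto P.T 1 (fun j => pc δ j (P.midForceZ (u j) (z j)))
    (fun t => P.dΦz (û t) (ẑ t)) :=
  WeakStarTendsto.of_pointwise (C := M) (fun j => (memLp_pc hP.T_pos (h.flow j).one_le _ 1).1)
    (fun j _ ht => forall_pc (p := fun y => ‖y‖ ≤ M) hP.T_pos (h.flow j).one_le
      (hs.bounds (h.flow j)).forceZ_le ht)
    (fun _ ht => midForceZ_tendsto hP hs h hl ht)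

/-- Continuity of the conservative forces along the limit. -/
lemma continuousOn_force :
    ContinuousOn (fun t => P.dΦu (û t) (ẑ t)) IP :=
  Admissible.continuousOn_dΦu hP (continuousOn_prim (hl.du_mem.integrable hP.one_le_p₁) _)
    (continuousOn_prim (hl.dz_mem.integrable hP.one_le_p₂) _)

lemma integral_inner_eq (hw : ∀ t ∈ IP, WeaklyTendsto (fun j => affineInterp δ j (v j) t) (w t))
    (ht : t ∈ IP) (y : H) :
    ⟪y, ∫ s in 0..t, P.emb (du s)⟫ = ∫ s in 0..t, ⟪y, w s⟫ := by
  have hT := hP.T_pos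
  rcases ht.1.eq_or_lt with rfl | h0
  · simp
  have ht' : t ∈ Ioc 0 P.T := ⟨h0, ht.2⟩
  have hsub : uIoc 0 t ⊆ Ioc 0 P.T := by
    rw [uIoc_of_le ht.1]; exact Ioc_subset_Ioc_right ht.2
  have hmeas : ∀ j, Integrable (affineInterp δ j (v j)) μP := fun j =>
    integrable_of_continuousOn ((continuousOn_prim (memLp_one_iff_integrable.1
      (memLp_pc hT (h.flow j).one_le _ 1)) _).congr
        fun s hs => affineInterp_eq_prim hT (h.flow j).one_le (v j) hs)
  have hres : volume.restrict (uIoc 0 t) ≤ μP := by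
    rw [μI_eq_Ioc]; exact Measure.restrict_mono hsub le_rfl
  have l1 : Tendsto (fun j => ∫ s in 0..t, ⟪y, affineInterp δ j (v j) s⟫) atTop
      (𝓝 (∫ s in 0..t, ⟪y, w s⟫)) := by
    refine intervalIntegral.tendsto_integral_filter_of_dominated_convergence (fun _ => ‖y‖ * M)
      (.of_forall fun j => ?_) (.of_forall fun j => ?_) (by simp) ?_
    · exact ((innerSL ℝ y : H⋆).integrable_comp (hmeas j)).1.mono_measure hres
    · refine .of_forall fun s hs' => ?_
      exact (norm_inner_le_norm _ _).trans (mul_le_mul_of_nonneg_left (norm_affineInterp_le hT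
        (h.flow j).one_le (hs.bounds (h.flow j)).v_le (hsub hs')) (norm_nonneg _))
    · exact .of_forall fun s hs' =>
        hw s (Ioc_subset_Icc_self (hsub hs')) (innerSL ℝ y)
  have iW : ∀ j, Integrable (Δ δ j (u j)) μP := fun j =>
    integrable_pc hT (h.flow j).one_le _
  have l2 := (((hl.du_tendsto.mono le_top).weakly_primitive iW
    (hl.du_mem.integrable hP.one_le_p₁) ht).map P.emb) (innerSL ℝ y)
  rw [← P.emb.intervalIntegral_comp_comm (intervalIntegrable_left
    (hl.du_mem.integrable hP.one_le_p₁) ht)] at l2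
  have l3 : Tendsto (fun j => M * δ j) atTop (𝓝 0) := by
    simpa using (tendsto_step (T := P.T) h.tendsto).const_mul M
  have l4 : Tendsto (fun j => ⟪y, ∫ s in 0..t,
      (midInterp δ j (v j) s - affineInterp δ j (v j) s)⟫) atTop (𝓝 0) := by
    have l5 := l3.const_mul ‖y‖
    rw [mul_zero] at l5
    refine squeeze_zero_norm (fun j => ?_) l5
    exact (norm_inner_le_norm _ _).trans (mul_le_mul_of_nonneg_left (norm_integral_midInterp_sub_le hT
      (h.flow j).one_le (hs.bounds (h.flow j)).v_le ht') (norm_nonneg _))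
  have e : ∀ j, innerSL ℝ y (P.emb (∫ s in 0..t, Δ δ j (u j) s)) = ⟪y, ∫ s in 0..t,
        (midInterp δ j (v j) s - affineInterp δ j (v j) s)⟫
        + ∫ s in 0..t, ⟪y, affineInterp δ j (v j) s⟫ := by
    intro j
    have jW := intervalIntegrable_left (iW j) ht
    have jA := intervalIntegrable_left (hmeas j) ht
    have jE : IntervalIntegrable (fun s => P.emb (Δ δ j (u j) s))
        volume 0 t := intervalIntegrable_left (P.emb.integrable_comp (iW j)) ht
    have hc : ∫ s in 0..t, (midInterp δ j (v j) s - affineInterp δ j (v j) s)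
        = ∫ s in 0..t, (P.emb (Δ δ j (u j) s) - affineInterp δ j (v j) s) := by
      refine intervalIntegral.integral_congr_ae (.of_forall fun s hs' => ?_)
      rw [(h.flow j).emb_pc_rate hP (hsub hs')]
    have hA := (innerSL ℝ y : H⋆).intervalIntegral_comp_comm jA
    rw [hc, intervalIntegral.integral_sub jE jA, P.emb.intervalIntegral_comp_comm jW]
    have hA' : ∫ s in 0..t, ⟪y, affineInterp δ j (v j) s⟫
      = ⟪y, ∫ s in 0..t, affineInterp δ j (v j) s⟫ := hA
    rw [hA', inner_sub_right, sub_add_cancel, innerSL_apply_apply]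
  simp only [e] at l2
  have l6 := l4.add l1
  rw [zero_add] at l6
  exact tendsto_nhds_unique l2 l6

lemma tendsto_η_pairing {z' : ℝ → Z} (hz' : MemLp z' ℓ₂ μP) :
    Tendsto (fun j => ∫⟨pc δ j (η j), z'⟩) atTop (𝓝 ∫Γ û ẑ z') := by
  have hT := hP.T_pos
  have := holderTriple_conjExp hP.one_lt_p₂
  have mg := fun j => memLp_pc hT (h.flow j).one_le (c (N j)) ℓ₂'
  have mF := fun j => memLp_pc hT (h.flow j).one_le (P.midForceZ (u j) (z j)) ℓ₂'
  have mD : MemLp (fun t => P.dΦz (û t) (ẑ t)) ℓ₂' μP :=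
    memLp_of_continuousOn (hP.continuousOn_dΦz (continuousOn_prim (hl.du_mem.integrable hP.one_le_p₁) _)
      (continuousOn_prim (hl.dz_mem.integrable hP.one_le_p₂) _)) _
  have c1 := tendsto_integral_pairing_of_weakStar (p := ℓ₂) mg hP.g_mem
    (hs.c_tendsto.comp h.tendsto) (fun _ => hz') (C := (eLpNorm z' ℓ₂ μP).toNNReal)
    (fun _ => (ENNReal.coe_toNNReal hz'.2.ne).ge) (d := z') (fun φ _ => tendsto_const_nhds)
  have c2 := ((midForceZ_weakStar hP hs h hl).mono hP.one_le_p₂).eval hz'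
  have c3 := c1.sub c2
  simp only [sub_apply]
  rw [integral_sub (integrable_pairing hP.g_mem hz') (integrable_pairing mD hz')]
  refine c3.congr fun j => ?_
  rw [← integral_sub (integrable_pairing (mg j) hz') (integrable_pairing (mF j) hz')]
  refine integral_congr_ae (((h.flow j).pc_η hP).mono fun t ht => ?_)
  simp only [ht, sub_apply]

lemma tendsto_load_pairing (hw : MemLp w ∞ μP) (he : ∀ᵐ t ∂μP, P.emb (du t) = w t) :
    Tendsto (fun j =>
      ∫⟨pc δ j (a (N j)), Δ δ j (u j)⟩
      + (∫ t, ⟪pc δ j (b (N j)) t, midInterp δ j (v j) t⟫ ∂μP)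
      + ∫⟨pc δ j (c (N j)), Δ δ j (z j)⟩) atTop
    (𝓝 (∫⟨P.f, du⟩ + ∫⟨P.g, dz⟩)) := by
  have hT := hP.T_pos
  have := holderTriple_conjExp hP.one_lt_p₁
  have := holderTriple_conjExp hP.one_lt_p₂
  rw [(hs.load.integrable_pairing hP hl.du_mem hw he).2]
  have c1 := tendsto_integral_pairing_of_weakStar (p := ℓ₁)
    (fun j => memLp_pc hT (h.flow j).one_le (a (N j)) ℓ₁') hs.load.mem₁
    (hs.a_tendsto.comp h.tendsto) (fun j => memLp_pc hT (h.flow j).one_le _ _) (C := M.toNNReal)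
    (fun j => (hs.bounds (h.flow j)).du_le) hl.du_tendsto
  have c3 := tendsto_integral_pairing_of_weakStar (p := ℓ₂)
    (fun j => memLp_pc hT (h.flow j).one_le (c (N j)) ℓ₂') hP.g_mem
    (hs.c_tendsto.comp h.tendsto) (fun j => memLp_pc hT (h.flow j).one_le _ _) (C := M.toNNReal)
    (fun j => (hs.bounds (h.flow j)).dz_le) hl.dz_tendsto
  have hb : ∀ j, ∀ᵐ t ∂μP, ‖midInterp δ j (v j) t‖ ≤ M := fun j =>
    ae_μI_of_Ioc fun t ht => (hs.bounds (h.flow j)).norm_midInterp_le hP (h.flow j) ht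
  have hm : ∀ j, AEStronglyMeasurable (midInterp δ j (v j)) μP := fun j =>
    (P.emb.continuous.comp_aestronglyMeasurable (memLp_pc hT (h.flow j).one_le _ 1).1).congr
      (ae_μI_of_Ioc fun t ht => (h.flow j).emb_pc_rate hP ht)
  have mb := fun j => memLp_pc hT (h.flow j).one_le (b (N j)) 1
  have c2 := tendsto_integral_pairing_of_weakStar (p := ∞) (q := 1)
    (f := fun j t => (innerSL ℝ (pc δ j (b (N j)) t) : H⋆))
    (a := fun t => (innerSL ℝ (f₂ t) : H⋆))
    (fun j => memLp_innerSL (mb j)) (memLp_innerSL hs.load.mem₂)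
    (by
      refine (hs.b_tendsto.comp h.tendsto).congr fun j => eLpNorm_congr_norm_ae
        (.of_forall fun t => ?_)
      rw [Pi.sub_apply, Pi.sub_apply, ← map_sub, innerSL_apply_norm])
    (fun j => memLp_top_of_bound (hm j) M (hb j)) (C := M.toNNReal)
    (fun j => by rw [eLpNorm_exponent_top]; exact eLpNormEssSup_le_of_ae_bound (hb j))
    (h.midInterp_weakStar hP hs hl.du_tendsto hw he)
  simp only [innerSL_apply_apply] at c2
  exact (c1.add c2).add c3

lemma primitive_tendsto : (∀ s ∈ IP, WeaklyTendsto
      (fun j => ∫ t in 0..s, Δ δ j (u j) t) (∫ t in 0..s, du t)) ∧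
    ∀ s ∈ IP, WeaklyTendsto (fun j => ∫ t in 0..s, Δ δ j (z j) t) (∫ t in 0..s, dz t) :=
  ⟨fun _ hs' => (hl.du_tendsto.mono le_top).weakly_primitive (fun j => memLp_one_iff_integrable.1
    (memLp_pc hP.T_pos (h.flow j).one_le _ 1)) (hl.du_mem.integrable hP.one_le_p₁) hs',
  fun _ hs' => (hl.dz_tendsto.mono le_top).weakly_primitive (fun j => memLp_one_iff_integrable.1
    (memLp_pc hP.T_pos (h.flow j).one_le _ 1)) (hl.dz_mem.integrable hP.one_le_p₂) hs'⟩

lemma lintegral_le_liminf :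
    ∫Ψ₁ du ≤ liminf (fun j =>
      ∫Ψ₁ (Δ δ j (u j))) atTop ∧
    ∫Ψ₂ dz ≤ liminf (fun j =>
      ∫Ψ₂ (Δ δ j (z j))) atTop :=
  ⟨lintegral_le_liminf_of_weak_primitives hP.Ψ₁_convex hP.Ψ₁_lsc hP.Ψ₁_weakly_lsc hP.T_pos
    (fun j => integrable_pc hP.T_pos (h.flow j).one_le _)
    (hl.du_mem.integrable hP.one_le_p₁) (primitive_tendsto hP hs h hl).1,
  lintegral_le_liminf_of_weak_primitives hP.Ψ₂_convex hP.Ψ₂_lsc hP.Ψ₂_weakly_lsc hP.T_pos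
    (fun j => integrable_pc hP.T_pos (h.flow j).one_le _)
    (hl.dz_mem.integrable hP.one_le_p₂) (primitive_tendsto hP hs h hl).2⟩

include hK

lemma momentum_tendsto (ht : t ∈ IP) :
    WeaklyTendsto (fun j => P.kin' (affineInterp δ j (v j) t))
      (prim 0 (fun s => f₁ s - P.dΦu (û s) (ẑ s) - ξ' s) t
        + P.toDual (prim (H♯ (K P.v₀)) f₂ t)) := by
  have hT := hP.T_pos
  have i0 : ∀ j (x : ℕ → U⋆), Integrable (pc δ j x) μP := fun j x =>
    integrable_pc hT (h.flow j).one_le x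
  have iF : Integrable (fun t => P.dΦu (û t) (ẑ t)) μP :=
    integrable_of_continuousOn (continuousOn_force hP hs h hl)
  have if₁ := hs.load.mem₁.integrable hP.one_le_p₁'
  have iξ := hl.ξ_mem.integrable hP.one_le_p₁'
  have c1 := (tendsto_prim hP.one_le_p₁' (fun j => memLp_pc hT (h.flow j).one_le (a (N j)) _)
    hs.load.mem₁ (hs.a_tendsto.comp h.tendsto) 0 ht).weaklyTendsto
  have c2 := ((midForce_weakStar hP hs h hl).mono le_top).weakly_primitive (fun j => i0 j _) iF ht
  have c3 := (hl.ξ_tendsto.mono le_top).weakly_primitive (fun j => i0 j _) iξ ht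
  have c4 := (((P.toDualL.continuous.tendsto _).comp (tendsto_prim le_rfl
    (fun j => memLp_pc hT (h.flow j).one_le (b (N j)) 1) hs.load.mem₂
    (hs.b_tendsto.comp h.tendsto) (H♯ (K P.v₀)) ht))).weaklyTendsto
  have c5 := ((c1.add c2.neg).add c3.neg).add c4
  have e : ∀ {A F X : ℝ → U⋆}, Integrable A μP → Integrable F μP →
      Integrable X μP → prim 0 (fun s => A s - F s - X s) t
        = prim 0 A t + -(∫ s in 0..t, F s) + -(∫ s in 0..t, X s) := by
    intro A F X hA hF hX
    have jA := intervalIntegrable_left hA ht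
    have jF := intervalIntegrable_left hF ht
    have jX := intervalIntegrable_left hX ht
    rw [prim, prim, intervalIntegral.integral_sub (jA.sub jF) jX, intervalIntegral.integral_sub jA jF]
    abel
  have e1 := e if₁ iF iξ
  have e2 : ∀ j, P.kin' (affineInterp δ j (v j) t) = _ := fun j => by
    have := (h.flow j).kin'_affineInterp hP hK ht
    have e3 := e (i0 j (a (N j))) (i0 j (P.midForce (u j) (z j))) (i0 j (ξ j))
    exact this.trans (congrArg (· + P.toDual (prim (H♯ (K P.v₀)) (pc δ j (b (N j))) t)) e3)
  simp only [e2]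
  rw [e1]
  exact c5

lemma exists_velocity : ∃ w : ℝ → H, (∀ t ∈ IP,
      WeaklyTendsto (fun j => affineInterp δ j (v j) t) (w t)) ∧
    (∀ t ∈ IP, ‖w t‖ ≤ M) ∧ w 0 = P.v₀ ∧ ∀ t ∈ IP, ∀ x : U, K (w t) (P.emb x) = K P.v₀ (P.emb x)
        + (∫ s in 0..t, (f₁ s - P.dΦu (û s) (ẑ s) - ξ' s)) x
        + (∫ s in 0..t, innerSL ℝ (f₂ s)) (P.emb x) := by
  have hT := hP.T_pos
  have hzero : ∀ j, affineInterp δ j (v j) 0 = P.v₀ := fun j => by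
    rw [affineInterp_eq_prim hT (h.flow j).one_le _ ⟨le_rfl, hT.le⟩, prim,
      intervalIntegral.integral_same, add_zero, (h.flow j).v_zero]
  have hbd : ∀ j, ∀ t ∈ IP, ‖affineInterp δ j (v j) t‖ ≤ M := by
    intro j t ht
    rcases ht.1.eq_or_lt with rfl | h0
    · rw [hzero, ← (h.flow j).v_zero]; exact (hs.bounds (h.flow j)).v_le 0 (Nat.zero_le _)
    · exact norm_affineInterp_le hT (h.flow j).one_le (hs.bounds (h.flow j)).v_le ⟨h0, ht.2⟩
  have if₂ := hs.load.mem₂.integrable le_rfl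
  have key : ∀ t ∈ IP, ∃ y : H, WeaklyTendsto (fun j => affineInterp δ j (v j) t) y ∧ ∀ x : U,
      K y (P.emb x) = K P.v₀ (P.emb x) + (∫ s in 0..t, (f₁ s - P.dΦu (û s) (ẑ s) - ξ' s)) x
        + (∫ s in 0..t, innerSL ℝ (f₂ s)) (P.emb x) := by
    intro t ht
    have hm := momentum_tendsto hP hK hs h hl ht
    obtain ⟨φ, hφ, y, hy⟩ := (Hilbertizable.of_hilbert H).exists_subseq
      (fun j => affineInterp δ j (v j) t) (fun j => hbd j t ht)
    have hy2 := hy.map (P.kinL K)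
    simp only [hK.kinL_apply] at hy2
    have heq := hy2.unique (hm.comp hφ.tendsto_atTop)
    refine ⟨y, fun ψ => ?_, fun x => ?_⟩
    · have hx : ∀ x : U, Tendsto (fun j => K (affineInterp δ j (v j) t) (P.emb x)) atTop
          (𝓝 (K y (P.emb x))) := fun x => by
        have h1 := hm ((ContinuousLinearMap.apply ℝ ℝ : U →L[ℝ] U⋆ →L[ℝ] ℝ) x)
        rw [← heq] at h1
        simpa only [ContinuousLinearMap.apply_apply, hK.kin'_eq, comp_apply] using h1
      have h2 := hK.tendsto_inner hP (.of_forall fun j => hbd j t ht) hx (H♯ ψ)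
      simpa only [InnerProductSpace.toDual_symm_apply] using h2
    · have h1 := congrArg (fun ℓ : U⋆ => ℓ x) heq
      simp only [hK.kin'_eq, comp_apply, add_apply] at h1
      have h3 : prim 0 (fun s => f₁ s - P.dΦu (û s) (ẑ s) - ξ' s) t
          = ∫ s in 0..t, (f₁ s - P.dΦu (û s) (ẑ s) - ξ' s) := zero_add _
      have h2 : P.toDual (prim (H♯ (K P.v₀)) f₂ t) x
          = K P.v₀ (P.emb x) + (∫ s in 0..t, innerSL ℝ (f₂ s)) (P.emb x) := by
        have e1 := (innerSL ℝ : H →L[ℝ] H⋆).intervalIntegral_comp_comm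
          (intervalIntegrable_left if₂ ht)
        change ⟪H♯ (K P.v₀) + ∫ s in 0..t, f₂ s, P.emb x⟫ = _
        rw [inner_add_left, InnerProductSpace.toDual_symm_apply]
        congr 1
        exact (congrArg (fun ℓ : H⋆ => ℓ (P.emb x)) e1).symm
      rw [h1, h2, h3]
      ring
  choose! w hw1 hw2 using key
  refine ⟨w, hw1, fun t ht => (hw1 t ht).norm_le (.of_forall fun j => hbd j t ht), ?_, hw2⟩
  have h0 := hw1 0 ⟨le_rfl, hT.le⟩
  simp only [hzero] at h0
  exact h0.unique (weaklyTendsto_const _)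

/-- The weak limits form a flow. -/
lemma exists_flow : ∃ w : ℝ → H, P.IsFlow K f₁ f₂ û w ẑ du dz ξ' ∧
      ∀ t ∈ IP, WeaklyTendsto (fun j => affineInterp δ j (v j) t) (w t) := by
  obtain ⟨w, hw, hwM, hw0, hmom⟩ := hl.exists_velocity hP hK hs h
  have hcont : ∀ y : H, ContinuousOn (fun t => ⟪y, w t⟫) IP := by
    intro y t ht
    refine hK.tendsto_inner hP (M := M) (eventually_nhdsWithin_of_forall hwM) (fun x => ?_) y
    have iF : Integrable (fun s => P.dΦu (û s) (ẑ s)) μP :=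
      integrable_of_continuousOn (hl.continuousOn_force hP hs h)
    have i1 : Integrable (fun s => f₁ s - P.dΦu (û s) (ẑ s) - ξ' s) μP :=
      ((hs.load.mem₁.integrable hP.one_le_p₁').sub iF).sub (hl.ξ_mem.integrable hP.one_le_p₁')
    have i2 : Integrable (fun s => (innerSL ℝ (f₂ s) : H⋆)) μP :=
      memLp_one_iff_integrable.1 (memLp_innerSL hs.load.mem₂)
    have c1 := ((continuousOn_prim i1 0).clm_apply (continuousOn_const (c := x)))
    have c2 := ((continuousOn_prim i2 0).clm_apply (continuousOn_const (c := P.emb x)))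
    have c3 : ContinuousOn (fun t => K (w t) (P.emb x)) IP := by
      refine ((continuousOn_const (c := K P.v₀ (P.emb x))).add c1 |>.add c2).congr fun s hs' => ?_
      rw [hmom s hs' x]
      simp only [Pi.add_apply]
      rw [show prim 0 (fun s => f₁ s - P.dΦu (û s) (ẑ s) - ξ' s) s = _ from
        zero_add _, show prim 0 (fun s => (innerSL ℝ (f₂ s) : H⋆)) s = _ from zero_add _]
    exact c3 t ht
  refine ⟨w, ⟨hcont, hw0, hl.du_mem, hl.dz_mem, hl.ξ_mem, ?_, fun t _ => rfl, fun t _ => rfl, hmom⟩, hw⟩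
  exact ae_eq_of_integral_inner_eq (P.emb.integrable_comp (hl.du_mem.integrable hP.one_le_p₁)) hcont
    fun t ht y => hl.integral_inner_eq hP hs h hw ht y

variable (hf : P.IsFlow K f₁ f₂ (prim P.u₀ du) w (prim P.z₀ dz) du dz ξ')
  (hw : ∀ t ∈ Icc 0 P.T, WeaklyTendsto (fun j => affineInterp (P.T / N j) (v j) t) (w t))

include hf hw

/-- The dissipated energy is asymptotically at most that of the limit. -/
lemma eventually_dissipation_le {ε : ℝ} (hε : 0 < ε) : ∀ᶠ j in atTop, ∫⟨pc δ j (ξ j), Δ δ j (u j)⟩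
      + ∫⟨pc δ j (η j), Δ δ j (z j)⟩
    ≤ ∫⟨ξ', du⟩ + ∫Γ û ẑ dz + ε := by
  have hT := hP.T_pos
  have hT1 : P.T ∈ IP := ⟨hT.le, le_rfl⟩
  have hbal := hf.energy_balance hP hK hs.load
  have hload := tendsto_load_pairing hP hs h hl hf.memLp_v hf.emb_du
  have hvT := hw P.T hT1
  have huT := u_tendsto hP hs h hl hT1
  have hzT := z_tendsto hP hs h hl hT1
  simp only [affineInterp_right hT (h.flow _).one_le] at hvT huT hzT
  have hkin : ∀ᶠ j in atTop, P.kin (w P.T) - ε / 3 ≤ P.kin (v j (N j)) := by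
    have h1 := (Metric.tendsto_nhds.1 (hvT (K (w P.T)))) (ε / 3) (by positivity)
    filter_upwards [h1] with j hj
    obtain ⟨κ, hκ, hKc⟩ := hK.coercive
    have h2 := hKc (v j (N j) - w P.T)
    have h3 : 0 ≤ κ * ‖v j (N j) - w P.T‖ ^ 2 := by positivity
    simp only [map_sub, sub_apply] at h2
    rw [hK.symm (v j (N j)) (w P.T)] at h2
    rw [Real.dist_eq] at hj
    have h4 := abs_lt.1 hj
    rw [hK.kin_eq, hK.kin_eq]
    linarith [h4.1]
  have hΦ : ∀ᶠ j in atTop, P.Φ (û P.T) (ẑ P.T) - ε / 3 ≤ P.Φ (u j (N j)) (z j (N j)) := by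
    have h1 := hP.Φ_weakly_lsc _ _ _ _ huT hzT
    have h2 : ((P.Φ (û P.T) (ẑ P.T) - ε / 3 : ℝ) : EReal)
        < liminf (fun n => (P.Φ (u n (N n)) (z n (N n)) : EReal)) atTop :=
      lt_of_lt_of_le (EReal.coe_lt_coe_iff.2 (by linarith)) h1
    filter_upwards [eventually_lt_of_lt_liminf h2] with j hj
    exact (EReal.coe_lt_coe_iff.1 hj).le
  filter_upwards [hkin, hΦ, (Metric.tendsto_nhds.1 hload) (ε / 3) (by positivity)] with j h1 h2 h3
  rw [Real.dist_eq] at h3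
  have h4 := (abs_lt.1 h3).2
  rw [(h.flow j).energy_integral hP]
  linarith

lemma exists_vi {y : ℝ → U} {z' : ℝ → Z} (hy : MemLp y ℓ₁ μP)
    (hz' : MemLp z' ℓ₂ μP) (h1 : ∫Ψ₁ y ≠ ∞)
    (h2 : ∫Ψ₂ z' ≠ ∞) : ∃ r : ℕ → ℝ,
    (∀ j, ∫Ψ₁ (Δ δ j (u j)) ≠ ∞) ∧
    (∀ j, ∫Ψ₂ (Δ δ j (z j)) ≠ ∞) ∧
    (∀ j, (∫Ψ₁ (Δ δ j (u j))).toReal + (∫Ψ₂ (Δ δ j (z j))).toReal ≤ r j) ∧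
    ∀ ε : ℝ, 0 < ε → ∀ᶠ j in atTop, r j ≤ (∫Ψ₁ y).toReal + (∫Ψ₂ z').toReal + (∫⟨ξ', du⟩ - ∫⟨ξ', y⟩)
      + (∫Γ û ẑ dz - ∫Γ û ẑ z') + ε := by
  have hT := hP.T_pos
  have := holderTriple_conjExp hP.one_lt_p₁
  have := holderTriple_conjExp hP.one_lt_p₂
  have mW := fun j => memLp_pc hT (h.flow j).one_le (rate δ j (u j)) ℓ₁
  have mY := fun j => memLp_pc hT (h.flow j).one_le (rate δ j (z j)) ℓ₂
  have mX := fun j => memLp_pc hT (h.flow j).one_le (ξ j) ℓ₁'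
  have mη := fun j => memLp_pc hT (h.flow j).one_le (η j) ℓ₂'
  have v1 := fun j => lintegral_add_integral_le_of_subdiff hP.Ψ₁_lsc (mW j).1 hy.1
    ((h.flow j).ae_ξ_mem hP) (integrable_pairing (mX j) (mW j)) (integrable_pairing (mX j) hy) h1
  have v2 := fun j => lintegral_add_integral_le_of_subdiff hP.Ψ₂_lsc (mY j).1 hz'.1
    ((h.flow j).ae_η_mem hP) (integrable_pairing (mη j) (mY j)) (integrable_pairing (mη j) hz') h2
  refine ⟨_, fun j => (v1 j).1, fun j => (v2 j).1, fun j => add_le_add (v1 j).2 (v2 j).2,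
    fun ε hε => ?_⟩
  have l1 := (Metric.tendsto_nhds.1 (hl.ξ_tendsto.eval hy)) (ε / 3) (by positivity)
  have l2 := (Metric.tendsto_nhds.1 (tendsto_η_pairing hP hs h hl hz')) (ε / 3) (by positivity)
  filter_upwards [l1, l2, eventually_dissipation_le hP hK hs h hl hf hw (show 0 < ε / 3 by positivity)]
    with j h3 h4 h5
  rw [Real.dist_eq] at h3 h4
  have h6 := (abs_lt.1 h3).1
  have h7 := (abs_lt.1 h4).1
  linarith

lemma isDissipative :
    P.IsDissipative û ẑ du dz ξ' := by
  obtain ⟨g1, g2⟩ := lintegral_le_liminf hP hs h hl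
  have key : ∀ {y : ℝ → U} {z' : ℝ → Z}, MemLp y ∞ μP → MemLp z' ∞ μP → ∫Ψ₁ y ≠ ∞ → ∫Ψ₂ z' ≠ ∞ →
      ∫Ψ₁ du ≠ ∞ ∧ ∫Ψ₂ dz ≠ ∞ ∧
      (∫Ψ₁ du).toReal + (∫Ψ₂ dz).toReal ≤ (∫Ψ₁ y).toReal + (∫Ψ₂ z').toReal
      + (∫⟨ξ', du⟩ - ∫⟨ξ', y⟩)
      + (∫Γ û ẑ dz - ∫Γ û ẑ z') := by
    intro y z' hy hz' h1 h2
    obtain ⟨r, r1, r2, r3, r4⟩ := exists_vi hP hK hs h hl hf hw (hy.mono_exponent le_top)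
      (hz'.mono_exponent le_top) h1 h2
    exact add_toReal_le_of_le_liminf g1 g2 r1 r2 r3 r4
  have z1 : ∫⁻ t, P.Ψ₁ ((fun _ : ℝ => (0 : U)) t) ∂μP ≠ ∞ := by
    rw [lintegral_const]; exact mul_ne_top hP.Ψ₁_zero (measure_ne_top _ _)
  have z2 : ∫⁻ t, P.Ψ₂ ((fun _ : ℝ => (0 : Z)) t) ∂μP ≠ ∞ := by
    rw [lintegral_const]; exact mul_ne_top hP.Ψ₂_zero (measure_ne_top _ _)
  have k0 := key (memLp_const 0) (memLp_const 0) z1 z2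
  refine ⟨k0.1, k0.2.1, fun v' z' hv' hz' h1 h2 => ?_⟩
  have := (key hv' hz' h1 h2).2.2
  linarith

lemma strong_convergence : (IsUniformlyConvex P.Ψ₁ → Tendsto (fun j => eLpNorm
      (Δ δ j (u j) - du) ℓ₁ μP) atTop (𝓝 0)) ∧
    (IsUniformlyConvex P.Ψ₂ → Tendsto (fun j => eLpNorm (Δ δ j (z j) - dz) ℓ₂ μP) atTop (𝓝 0)) := by
  have hd := isDissipative hP hK hs h hl hf hw
  obtain ⟨g1, g2⟩ := lintegral_le_liminf hP hs h hl
  obtain ⟨w1, w2⟩ := primitive_tendsto hP hs h hl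
  obtain ⟨r, r1, r2, r3, r4⟩ := exists_vi hP hK hs h hl hf hw hl.du_mem hl.dz_mem hd.fin₁ hd.fin₂
  simp only [sub_self, add_zero] at r4
  refine ⟨fun hu => ?_, fun hu => ?_⟩
  · exact tendsto_eLpNorm_of_uniformlyConvex hP.Ψ₁_convex hP.Ψ₁_lsc hP.Ψ₁_weakly_lsc hu hP.one_lt_p₁
      hP.Ψ₁_coercive hP.T_pos
      (fun j => integrable_pc hP.T_pos (h.flow j).one_le _)
      (hl.du_mem.integrable hP.one_le_p₁) w1 hd.fin₁
      (limsup_le_of_add_toReal_le hd.fin₁ hd.fin₂ g2 r1 r2 r3 r4)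
  · exact tendsto_eLpNorm_of_uniformlyConvex hP.Ψ₂_convex hP.Ψ₂_lsc hP.Ψ₂_weakly_lsc hu hP.one_lt_p₂
      hP.Ψ₂_coercive hP.T_pos
      (fun j => integrable_pc hP.T_pos (h.flow j).one_le _)
      (hl.dz_mem.integrable hP.one_le_p₂) w2 hd.fin₂
      (limsup_le_of_add_toReal_le (r := r) hd.fin₂ hd.fin₁ g1 r2 r1
        (fun j => by linarith [r3 j]) (fun ε hε => (r4 ε hε).mono fun j hj => by linarith))

end IsWeakLimit

end Limit

end Problem

section Primitives


lemma isSobolev_prim (hT : 0 < T) {p : ℝ≥0∞} (hp : 1 ≤ p) {w u : ℝ → X} {c : X}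
    (hw : MemLp w p μT) (hu : ∀ t ∈ IT, u t = prim c w t) : IsSobolev T p u w :=
  ⟨memLp_of_continuousOn ((continuousOn_prim (hw.integrable hp) c).congr hu) p, hw,
    (hasWeakDeriv_prim hT (hw.integrable hp) c).congr (ae_μI_of_forall hu) ae_eq_rfl⟩

lemma ae_eq_of_prim_eq (hT : 0 < T) {w w' : ℝ → X} {c : X} (hw : Integrable w μT)
    (hw' : Integrable w' μT) (h : ∀ t ∈ IT, prim c w t = prim c w' t) : w =ᵐ[μT] w' :=
  (hasWeakDeriv_prim hT hw c).unique
    ((hasWeakDeriv_prim hT hw' c).congr (ae_μI_of_forall h) ae_eq_rfl) hw hw'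

lemma tendsto_eLpNorm_prim {p : ℝ≥0∞} (hp : 1 ≤ p) {w : ℕ → ℝ → X} {a : ℝ → X} {c : X}
    (hw : ∀ n, MemLp (w n) p μT) (ha : MemLp a p μT)
    (h : Tendsto (fun n => eLpNorm (w n - a) p μT) atTop (𝓝 0)) {x : ℕ → ℝ → X} {b : ℝ → X}
    (hx : ∀ n, ∀ t ∈ IT, x n t = prim c (w n) t) (hb : ∀ t ∈ IT, b t = prim c a t) :
    Tendsto (fun n => eLpNorm (x n - b) p μT) atTop (𝓝 0) := by
  have h1 := tendsto_eLpNorm_one hp (fun n => ((hw n).sub ha).1) h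
  have hfin : (μT univ) ^ p.toReal⁻¹ ≠ ∞ :=
    rpow_ne_top_of_nonneg (by positivity) (measure_ne_top _ _)
  have h2 := ENNReal.Tendsto.const_mul h1 (Or.inr hfin)
  rw [mul_zero] at h2
  refine tendsto_of_tendsto_of_tendsto_of_le_of_le tendsto_const_nhds h2 (fun _ => zero_le)
    fun n => ?_
  have hi := (hw n).integrable hp
  have hia := ha.integrable hp
  have hfin1 : eLpNorm (w n - a) 1 μT ≠ ∞ := (memLp_one_iff_integrable.2 (hi.sub hia)).2.ne
  have hle : ∀ᵐ t ∂μT, ‖(x n - b) t‖ ≤ (eLpNorm (w n - a) 1 μT).toReal :=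
    ae_restrict_of_forall_mem measurableSet_Icc fun t ht => by
      have e : (x n - b) t = prim 0 (w n - a) t := by
        rw [Pi.sub_apply, hx n t ht, hb t ht, prim, prim, prim, add_sub_add_left_eq_sub, zero_add]
        exact (intervalIntegral.integral_sub (intervalIntegrable_left hi ht)
          (intervalIntegrable_left hia ht)).symm
      rw [e]
      simpa using norm_prim_le (hi.sub hia) (0 : X) ht
  have := eLpNorm_le_of_ae_bound (p := p) hle
  rwa [ofReal_toReal hfin1] at this

end Primitives

namespace Problem

variable {a : ℕ → ℕ → U⋆} {b : ℕ → ℕ → H} {c : ℕ → ℕ → Z⋆} {M : ℝ} {N : ℕ → ℕ} {ud : ℕ → ℕ → U}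
  {vd : ℕ → ℕ → H} {zd : ℕ → ℕ → Z} {ξd : ℕ → ℕ → U⋆} {ηd : ℕ → ℕ → Z⋆} {u : ℝ → U} {v : ℝ → H}
  {z : ℝ → Z} {du : ℝ → U} {dz : ℝ → Z} {ξ : ℝ → U⋆}

local notation:max "δ" j:max => P.T / (N j : ℝ)

include hP

variable (P) in
/-- Convergence of the rates of a sequence of discrete flows. -/
structure RatesTendsto (N : ℕ → ℕ) (ud : ℕ → ℕ → U) (zd : ℕ → ℕ → Z)
    (du : ℝ → U) (dz : ℝ → Z) : Prop where
  u_weak : WeakStarTendsto P.T ℓ₁' (fun j => Δ (P.T / N j) (ud j)) du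
  z_weak : WeakStarTendsto P.T ℓ₂' (fun j => Δ (P.T / N j) (zd j)) dz
  u_strong : IsUniformlyConvex P.Ψ₁ → Tendsto (fun j => eLpNorm
    (Δ (P.T / N j) (ud j) - du) ℓ₁ μP) atTop (𝓝 0)
  z_strong : IsUniformlyConvex P.Ψ₂ → Tendsto (fun j => eLpNorm
    (Δ (P.T / N j) (zd j) - dz) ℓ₂ μP) atTop (𝓝 0)

omit hP in
lemma RatesTendsto.congr {du' : ℝ → U} {dz' : ℝ → Z} (h : P.RatesTendsto N ud zd du dz)
    (hu : du =ᵐ[μP] du') (hz : dz =ᵐ[μP] dz') : P.RatesTendsto N ud zd du' dz' :=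
  ⟨h.u_weak.congr (fun _ => ae_eq_rfl) hu, h.z_weak.congr (fun _ => ae_eq_rfl) hz,
    fun hc => (h.u_strong hc).congr fun _ => eLpNorm_congr_ae (ae_eq_rfl.sub hu),
    fun hc => (h.z_strong hc).congr fun _ => eLpNorm_congr_ae (ae_eq_rfl.sub hz)⟩

lemma IsApprox.exists_limit (hK : P.IsKinForm K)
    (hs : P.IsSetup f₁ f₂ a b c M) (h : P.IsApprox a b c N ud vd zd ξd ηd) :
    ∃ φ : ℕ → ℕ, StrictMono φ ∧ ∃ u v z du dz ξ, P.IsFlow K f₁ f₂ u v z du dz ξ ∧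
      P.IsDissipative u z du dz ξ ∧ P.RatesTendsto (N ∘ φ) (ud ∘ φ) (zd ∘ φ) du dz := by
  obtain ⟨φ, hφ, du, dz, ξ, hl⟩ := h.exists_weakLimit hP hs
  have h' := h.comp hφ.tendsto_atTop
  obtain ⟨w, hf, hw⟩ := hl.exists_flow hP hK hs h'
  obtain ⟨s1, s2⟩ := hl.strong_convergence hP hK hs h' hf hw
  exact ⟨φ, hφ, _, w, _, du, dz, ξ, hf, hl.isDissipative hP hK hs h' hf hw,
    hl.du_tendsto, hl.dz_tendsto, s1, s2⟩

lemma IsApprox.ratesTendsto (hK : P.IsKinForm K)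
    (hs : P.IsSetup f₁ f₂ a b c M) (h : P.IsApprox a b c N ud vd zd ξd ηd)
    (hf : P.IsFlow K f₁ f₂ u v z du dz ξ) (hd : P.IsDissipative u z du dz ξ) :
    P.RatesTendsto N ud zd du dz := by
  have hT := hP.T_pos
  have key : ∀ ns : ℕ → ℕ, Tendsto ns atTop atTop → ∃ ms : ℕ → ℕ,
      P.RatesTendsto (N ∘ ns ∘ ms) (ud ∘ ns ∘ ms) (zd ∘ ns ∘ ms) du dz := by
    intro ns hns
    obtain ⟨φ, -, u', v', z', du', dz', ξ', hf', hd', hr⟩ := (h.comp hns).exists_limit hP hK hs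
    obtain ⟨e1, -, e3⟩ := IsFlow.unique hP hK hs.load hf' hd' hf hd
    refine ⟨φ, hr.congr ?_ ?_⟩
    · exact ae_eq_of_prim_eq hT (hf'.du_mem.integrable hP.one_le_p₁) (hf.du_mem.integrable hP.one_le_p₁)
        fun t ht => by rw [← hf'.u_eq t ht, ← hf.u_eq t ht]; exact e1 ht
    · exact ae_eq_of_prim_eq hT (hf'.dz_mem.integrable hP.one_le_p₂) (hf.dz_mem.integrable hP.one_le_p₂)
        fun t ht => by rw [← hf'.z_eq t ht, ← hf.z_eq t ht]; exact e3 ht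
  refine ⟨fun ψ hψ => ?_, fun ψ hψ => ?_, fun hc => ?_, fun hc => ?_⟩ <;>
    refine tendsto_of_subseq_tendsto fun ns hns => ?_ <;>
    obtain ⟨ms, hms⟩ := key ns hns
  · exact ⟨ms, hms.u_weak ψ hψ⟩
  · exact ⟨ms, hms.z_weak ψ hψ⟩
  · exact ⟨ms, hms.u_strong hc⟩
  · exact ⟨ms, hms.z_strong hc⟩

omit hP in
lemma weakStar_affineInterp
    (hT : 0 < T) (hN : ∀ j, 1 ≤ N j) {p q : ℝ≥0∞} (hp : 1 ≤ p) {x : ℕ → ℕ → X}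
    (hM : ∀ j, ∀ k ≤ N j, ‖x j k‖ ≤ M) {c : X} (h0 : ∀ j, x j 0 = c) {w y : ℝ → X}
    (hw : MemLp w p μT) (hy : ∀ t ∈ IT, y t = prim c w t)
    (h : WeakStarTendsto T q (fun j => Δ (T / N j) (x j)) w) :
    WeakStarTendsto T 1 (fun j => affineInterp (T / N j) (x j)) y := by
  refine WeakStarTendsto.of_pointwise (C := M) (fun j => ?_)
    (fun j t ht => norm_affineInterp_le hT (hN j) (hM j) ht) fun t ht => ?_
  · exact (isSobolev_prim hT le_rfl (memLp_pc hT (hN j) _ 1)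
      fun t ht => affineInterp_eq_prim hT (hN j) (x j) ht).1.1
  · rw [hy t (Ioc_subset_Icc_self ht)]
    exact weaklyTendsto_affineInterp hT hN h (hw.integrable hp) h0 (Ioc_subset_Icc_self ht)

/-- All the convergences of the interpolants follow from those of the rates. -/
lemma IsApprox.convergence (hs : P.IsSetup f₁ f₂ a b c M)
    (h : P.IsApprox a b c N ud vd zd ξd ηd) (hf : P.IsFlow K f₁ f₂ u v z du dz ξ)
    (hr : P.RatesTendsto N ud zd du dz) :
    WeakStarTendsto P.T 1 (fun n => affineInterp (P.T / N n) (ud n)) u ∧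
    SobolevWeakStarTendsto P.T ∞ 1
      (fun n t => P.emb (affineInterp (P.T / N n) (ud n) t)) (fun t => P.emb (u t)) ∧
    SobolevWeakStarTendsto P.T ℓ₁ ℓ₁' (fun n => affineInterp (P.T / N n) (ud n)) u ∧
    SobolevWeakStarTendsto P.T ℓ₂ ℓ₂' (fun n => affineInterp (P.T / N n) (zd n)) z ∧
    P.VelocityTendsto (fun n => midInterp (P.T / N n) (vd n)) v ∧
    (IsUniformlyConvex P.Ψ₁ → SobolevTendsto P.T ℓ₁ (fun n => affineInterp (P.T / N n) (ud n)) u) ∧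
    (IsUniformlyConvex P.Ψ₂ → SobolevTendsto P.T ℓ₂
      (fun n => affineInterp (P.T / N n) (zd n)) z) := by
  have hT := hP.T_pos
  have hN : ∀ j, 1 ≤ N j := fun j => (h.flow j).one_le
  have hb := fun j => hs.bounds (h.flow j)
  have eu := fun j t ht => affineInterp_eq_prim hT (hN j) (ud j) (t := t) ht
  have ez := fun j t ht => affineInterp_eq_prim hT (hN j) (zd j) (t := t) ht
  simp only [(h.flow _).u_zero] at eu
  simp only [(h.flow _).z_zero] at ez
  have mu := fun j => memLp_pc hT (hN j) (rate δ j (ud j)) ℓ₁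
  have mz := fun j => memLp_pc hT (hN j) (rate δ j (zd j)) ℓ₂
  have su := fun j => isSobolev_prim hT hP.one_le_p₁ (mu j) (eu j)
  have sz := fun j => isSobolev_prim hT hP.one_le_p₂ (mz j) (ez j)
  have su' := isSobolev_prim hT hP.one_le_p₁ hf.du_mem hf.u_eq
  have sz' := isSobolev_prim hT hP.one_le_p₂ hf.dz_mem hf.z_eq
  have wu := weakStar_affineInterp hT hN hP.one_le_p₁ (fun j => (hb j).u_le)
    (fun j => (h.flow j).u_zero) hf.du_mem hf.u_eq hr.u_weak
  have wz := weakStar_affineInterp hT hN hP.one_le_p₂ (fun j => (hb j).z_le)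
    (fun j => (h.flow j).z_zero) hf.dz_mem hf.z_eq hr.z_weak
  have wm := h.midInterp_weakStar hP hs hr.u_weak hf.memLp_v hf.emb_du
  have hmid : ∀ j, (fun t => P.emb (Δ δ j (ud j) t)) =ᵐ[μP]
      midInterp δ j (vd j) := fun j =>
    ae_μI_of_Ioc fun t ht => (h.flow j).emb_pc_rate hP ht
  have memb : ∀ j, MemLp (fun t => P.emb (Δ δ j (ud j) t)) ∞ μP :=
    fun j => P.emb.comp_memLp' (memLp_pc hT (hN j) _ ∞)
  have memb' : MemLp (fun t => P.emb (du t)) ∞ μP := hf.memLp_v.ae_eq (hf.emb_du.mono fun t ht => ht.symm)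
  refine ⟨wu, ⟨_, _, fun j => isSobolev_prim hT le_top (memb j) (c := P.emb P.u₀) fun t ht => ?_,
      isSobolev_prim hT le_top memb' (c := P.emb P.u₀) fun t ht => ?_, wu.clm P.emb,
      wm.congr (fun j => (hmid j).symm) (hf.emb_du.mono fun t ht => ht.symm)⟩,
    ⟨_, du, su, su', wu.mono hP.one_le_p₁', hr.u_weak⟩,
    ⟨_, dz, sz, sz', wz.mono hP.one_le_p₂', hr.z_weak⟩,
    ⟨wm, _, du, fun j => ⟨mu j, hmid j⟩, ⟨hf.du_mem, hf.emb_du⟩, hr.u_weak⟩,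
    fun hc => ⟨_, du, su, su', tendsto_eLpNorm_prim hP.one_le_p₁ mu hf.du_mem (hr.u_strong hc) eu hf.u_eq,
      hr.u_strong hc⟩,
    fun hc => ⟨_, dz, sz, sz', tendsto_eLpNorm_prim hP.one_le_p₂ mz hf.dz_mem (hr.z_strong hc) ez hf.z_eq,
      hr.z_strong hc⟩⟩
  · change P.emb (affineInterp δ j (ud j) t) = _
    rw [eu j t ht]
    exact clm_prim P.emb ((mu j).integrable hP.one_le_p₁) _ ht
  · rw [hf.u_eq t ht]
    exact clm_prim P.emb (hf.du_mem.integrable hP.one_le_p₁) _ ht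

omit hP in
lemma exists_approx {rf rg : LoadingRule} (hc : ∀ N, c N = rg.sample (P.T / N) P.g)
    (hab : ∀ N : ℕ, 1 ≤ N → ∀ k < N,
      rf.sample (P.T / N) P.f (k + 1) = a N (k + 1) + P.toDual (b N (k + 1)))
    (h : ∀ n, P.IsDiscreteSolution rf rg (n + 1) (ud n) (vd n) (zd n)) :
    ∃ ξd ηd, P.IsApprox a b c (fun n => n + 1) ud vd zd ξd ηd := by
  choose ξd ηd hfl using fun n => (h n).exists_discreteFlow (Nat.succ_le_succ (Nat.zero_le n))
    (hab (n + 1) (Nat.succ_le_succ (Nat.zero_le n)))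
  exact ⟨ξd, ηd, tendsto_add_atTop_nat 1, fun n => by rw [hc]; exact hfl n⟩

end Problem

end FractionalStep

end

theorem proposition2 {U H Z : Type*}
    [NormedAddCommGroup U] [NormedSpace ℝ U] [CompleteSpace U]
    [NormedAddCommGroup H] [InnerProductSpace ℝ H] [CompleteSpace H]
    [NormedAddCommGroup Z] [NormedSpace ℝ Z] [CompleteSpace Z]
    (P : Problem U H Z) (hP : P.Admissible)
    (rf rg : LoadingRule) (hrf : rf.AppliesTo P.T P.f) (hrg : rg.AppliesTo P.T P.g) :
    -- the scheme is solvable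
    (∀ N : ℕ, 1 ≤ N → ∃ u v z, P.IsDiscreteSolution rf rg N u v z) ∧
    -- exact discrete energy balance
    (∀ N : ℕ, 1 ≤ N → ∀ u v z, P.IsDiscreteSolution rf rg N u v z →
      ∀ k < N, ∀ ξ₁ ξ₂, P.IsStep rf rg (P.T / N) u v z k ξ₁ ξ₂ →
        (P.kin (v (k + 1)) - P.kin (v k)) / (P.T / N)
            + ξ₁ ((P.T / N)⁻¹ • (u (k + 1) - u k)) + ξ₂ ((P.T / N)⁻¹ • (z (k + 1) - z k))
            + (P.Φ (u (k + 1)) (z (k + 1)) - P.Φ (u k) (z k)) / (P.T / N)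
          = rf.sample (P.T / N) P.f (k + 1) ((P.T / N)⁻¹ • (u (k + 1) - u k))
            + rg.sample (P.T / N) P.g (k + 1) ((P.T / N)⁻¹ • (z (k + 1) - z k))) ∧
    -- a-priori estimates, uniform with respect to the time step
    (∃ C : ℝ≥0, ∀ N : ℕ, 1 ≤ N → ∀ u v z, P.IsDiscreteSolution rf rg N u v z →
      LpBound P.T ∞ (affineInterp (P.T / N) u) C ∧
      SobolevBound P.T ∞ (fun t => P.emb (affineInterp (P.T / N) u t)) C ∧
      SobolevBound P.T (ENNReal.ofReal P.p₁) (affineInterp (P.T / N) u) C ∧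
      SobolevBound P.T (ENNReal.ofReal P.p₂) (affineInterp (P.T / N) z) C ∧
      P.VelocityBound (midInterp (P.T / N) v) C ∧
      P.SumBound (fun t => P.kin' (affineInterp (P.T / N) v t)) C ∧
      (P.KinPreserves → P.SumBound (fun t => P.toDual (affineInterp (P.T / N) v t)) C)) ∧
    -- convergence to the unique weak solution
    (∃ u v z, P.IsWeakSolution u v z ∧
      (∀ u' v' z', P.IsWeakSolution u' v' z' →
        EqOn u' u (Icc 0 P.T) ∧ EqOn v' v (Icc 0 P.T) ∧ EqOn z' z (Icc 0 P.T)) ∧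
      ∀ (ud : ℕ → ℕ → U) (vd : ℕ → ℕ → H) (zd : ℕ → ℕ → Z),
        (∀ n, P.IsDiscreteSolution rf rg (n + 1) (ud n) (vd n) (zd n)) →
        -- weak* convergence
        WeakStarTendsto P.T 1 (fun n => affineInterp (P.T / (n + 1 : ℕ)) (ud n)) u ∧
        SobolevWeakStarTendsto P.T ∞ 1
          (fun n t => P.emb (affineInterp (P.T / (n + 1 : ℕ)) (ud n) t)) (fun t => P.emb (u t)) ∧
        SobolevWeakStarTendsto P.T (ENNReal.ofReal P.p₁) (ENNReal.ofReal (conjExp P.p₁))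
          (fun n => affineInterp (P.T / (n + 1 : ℕ)) (ud n)) u ∧
        SobolevWeakStarTendsto P.T (ENNReal.ofReal P.p₂) (ENNReal.ofReal (conjExp P.p₂))
          (fun n => affineInterp (P.T / (n + 1 : ℕ)) (zd n)) z ∧
        P.VelocityTendsto (fun n => midInterp (P.T / (n + 1 : ℕ)) (vd n)) v ∧
        -- strong convergence
        (P.p₁ ≤ 2 → UniformConvexSpace U → IsUniformlyConvex P.Ψ₁ →
          SobolevTendsto P.T (ENNReal.ofReal P.p₁)
            (fun n => affineInterp (P.T / (n + 1 : ℕ)) (ud n)) u) ∧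
        (P.p₁ ≤ 2 → UniformConvexSpace Z → IsUniformlyConvex P.Ψ₂ →
          SobolevTendsto P.T (ENNReal.ofReal P.p₂)
            (fun n => affineInterp (P.T / (n + 1 : ℕ)) (zd n)) z)) := by
  have hT := hP.T_pos
  obtain ⟨K, hK⟩ := hP.exists_kinForm
  obtain ⟨f₁, f₂, a, b, M, hs, hab⟩ := hP.exists_setup hrf hrg
  refine ⟨fun N hN => hP.exists_discreteSolution rf rg hN,
    fun N hN u v z _ k _ ξ₁ ξ₂ hst => hP.step_energy_balance (div_pos hT (by exact_mod_cast hN))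
      hst.1 hst.2.2.1 hst.2.2.2.2, ?_, ?_⟩
  · obtain ⟨C, hC⟩ := hs.exists_estimates hP
    refine ⟨C, fun N hN u v z h => ?_⟩
    obtain ⟨ξ, η, hfl⟩ := h.exists_discreteFlow hN (hab N hN)
    exact hC hfl
  · choose ud₀ vd₀ zd₀ hd₀ using fun n : ℕ =>
      hP.exists_discreteSolution rf rg (Nat.succ_le_succ (Nat.zero_le n))
    obtain ⟨ξd₀, ηd₀, happ₀⟩ := Problem.exists_approx (fun _ => rfl) hab hd₀
    obtain ⟨-, -, u, v, z, du, dz, ξ, hf, hd, -⟩ := happ₀.exists_limit hP hK hs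
    refine ⟨u, v, z, hf.isWeakSolution hP hK hs.load hd, fun u' v' z' h' => ?_,
      fun ud vd zd hdisc => ?_⟩
    · obtain ⟨du', dz', ξ', hf', hd'⟩ := h'.exists_flow hP hK hs.load
      exact hf'.unique hP hK hs.load hd' hf hd
    · obtain ⟨ξd, ηd, happ⟩ := Problem.exists_approx (fun _ => rfl) hab hdisc
      obtain ⟨c1, c2, c3, c4, c5, c6, c7⟩ :=
        happ.convergence hP hs hf (happ.ratesTendsto hP hK hs hf hd)
      exact ⟨c1, c2, c3, c4, c5, fun _ _ hc => c6 hc, fun _ _ hc => c7 hc⟩
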